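/- For positive integers $a_0,a_1,a_2$ let $\Sigma(a_0,a_1,a_2)\subset\mathbb C^3$ be the Brieskorn link $\{x_0^{a_0}+x_1^{a_1}+x_2^{a_2}=0\}\cap S^5$, oriented as the boundary of the part of the complex surface $x_0^{a_0}+x_1^{a_1}+x_2^{a_2}=0$ inside the unit ball. For a plumbing tree $\Gamma$ (an integer-weighted finite tree, all of whose vertices have genus $0$) let $\partial P(\Gamma)$ be the oriented boundary of the associated plumbed $4$-manifold, $\sigma(\Gamma)$ the signature of its intersection form, and, if the determinant of the form is odd (so that $\partial P(\Gamma)$ is a $\mathbb Z_2$-homology sphere), let $w=\sum_v\varepsilon_v[S_v]$, $\varepsilon_v\in\{0,1\}$, be its spherical Wu class, that is, the unique such class with $w\cdot[S_v]\equiv[S_v]\cdot[S_v]\pmod 2$ for every vertex $v$. The Neumann–Siebenmann invariant of an oriented $\mathbb Z_2$-homology sphere $Y$ that is orientation-preservingly diffeomorphic to such a $\partial P(\Gamma)$ is $\bar\mu(Y)=\frac{\sigma(\Gamma)-w^2}{8}$ (which does not depend on the choice of $\Gamma$, by a theorem of Neumann that is not part of the present claim). Let $k\ge 1$ be an integer and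 $m$ a positive odd integer. Then $$\bar\mu\bigl(\Sigma(2^k,\,2^k m,\,2^k\cdot 10m-1)\bigr)=-2^k-\frac14 .$$ More explicitly, let $\Gamma_{k,m}$ be the star-shaped graph that consists of a central vertex of weight $-2^k$, one vertex of weight $-m$ adjacent to the centre, and $2^k$ arms, each a chain attached to the centre with weights, from the centre outwards, $$\underbrace{-2,\dots,-2}_{2^k m-2},\,-3,\,\underbrace{-2,\dots,-2}_{8}.$$ Then $\Gamma_{k,m}$ is a tree of odd determinant, $\partial P(\Gamma_{k,m})$ is orientation-preservingly diffeomorphic to $\Sigma(2^k,2^km,2^k\cdot10m-1)$, $\Gamma_{k,m}$ has exactly one spherical Wu class $w$, and $$\sigma(\Gamma_{k,m})=-\bigl(2+2^k(2^km+7)\bigr),\qquad w^2=2^k-2^{2k}m,\qquad \frac{\sigma(\Gamma_{k,m})-w^2}{8}=-2^k-\frac14 .$$ -/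

import Mathlib

open scoped ContDiff

noncomputable section

/-! ## Brieskorn links -/

/-- The Brieskorn link `Σ(a₀, a₁, a₂)`: the unit sphere of `ℂ³` intersected with the hypersurface
`x₀ ^ a₀ + x₁ ^ a₁ + x₂ ^ a₂ = 0`. -/
def brieskornLink (a : Fin 3 → ℕ) : Set (Fin 3 → ℂ) :=
  {x | ∑ j, x j ^ a j = 0 ∧ ∑ j, ‖x j‖ ^ 2 = 1}

/-- The six real coordinates `(Re x₀, Im x₀, Re x₁, Im x₁, Re x₂, Im x₂)`, which define the standard
orientation of `ℂ³`. -/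
def realCoords (x : Fin 3 → ℂ) : Fin 6 → ℝ :=
  ![(x 0).re, (x 0).im, (x 1).re, (x 1).im, (x 2).re, (x 2).im]

/-- The complex gradient `conj (∂f/∂xⱼ)` of `f = x₀ ^ a₀ + x₁ ^ a₁ + x₂ ^ a₂`. At a smooth point of
`f = 0` it spans the complex orthogonal complement of the complex tangent plane. -/
def brieskornNormal (a : Fin 3 → ℕ) (x : Fin 3 → ℂ) : Fin 3 → ℂ :=
  fun j => starRingEnd ℂ ((a j : ℂ) * x j ^ (a j - 1))

/-- `(u₁, u₂, u₃)` is a positively oriented frame of the tangent space of `Σ(a₀, a₁, a₂)` at `x`,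
for vectors `u₁, u₂, u₃` that are tangent to the link. The link is oriented as the boundary of
the part of the complex surface `f = 0` in the unit ball, with the outward normal first: the frame
`(n, u₁, u₂, u₃)` has to be positive for the complex orientation of `ker df`, where `n` is the
orthogonal projection of `x` to `ker df`. Completing by the complex normal direction `ν` of `ker df`,
this says that `(x, u₁, u₂, u₃, ν, iν)` is positive in `ℂ³` (replacing `n` by `x` only adds a
combination of `ν` and `iν`). -/
def IsPositiveFrame (a : Fin 3 → ℕ) (x u₁ u₂ u₃ : Fin 3 → ℂ) : Prop :=
  0 < (Matrix.of ![realCoords x, realCoords u₁, realCoords u₂, realCoords u₃,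
    realCoords (brieskornNormal a x), realCoords (Complex.I • brieskornNormal a x)]).det

/-! ## Plumbing graphs and plumbed 3-manifolds -/

/-- A plumbing graph all of whose vertices have genus zero: a simple graph with integer weights. -/
structure PlumbingGraph (V : Type) where
  graph : SimpleGraph V
  weight : V → ℤ

namespace PlumbingGraph

variable {V : Type}

/-- The auxiliary choices in the plumbing construction: for each vertex `v`, disjoint open discs in
the unit disc of `ℂ`, the finite part of the base sphere of `v`, one for each neighbour of `v`. The
plumbed manifold does not depend on them up to orientation-preserving diffeomorphism. -/
structure DiscSystem (Γ : PlumbingGraph V) where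
  center : V → V → ℂ
  radius : V → V → ℝ
  radius_pos : ∀ v w, Γ.graph.Adj v w → 0 < radius v w
  inside : ∀ v w, Γ.graph.Adj v w → ‖center v w‖ + radius v w ≤ 1
  disjoint : ∀ v w w', Γ.graph.Adj v w → Γ.graph.Adj v w' → w ≠ w' →
    Disjoint (Metric.ball (center v w) (radius v w)) (Metric.ball (center v w') (radius v w'))

namespace DiscSystem

variable {Γ : PlumbingGraph V} (D : DiscSystem Γ)

/-- The bases of the two charts at `v`: `Sum.inl v` is the finite part of the base sphere, punctured
at the centers of the discs; `Sum.inr v` is a disc about the point at infinity. -/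
def base : V ⊕ V → Set ℂ
  | Sum.inl v => {z | ∀ w, Γ.graph.Adj v w → z ≠ D.center v w}
  | Sum.inr _ => Metric.ball 0 1

/-- The disjoint union of the charts `base × S¹`, with coordinates (base point, fibre). -/
abbrev Pieces : Type :=
  Σ c : V ⊕ V, (D.base c) × Circle

/-- The gluing of the charts.

`infinity`: the circle bundle of `v` is the unit circle bundle of the line bundle `O(e)` over the
Riemann sphere, `e` being the weight of `v`: in terms of the coordinates `(z, s)` near `0`, the
coordinates near infinity are `z' = 1 / z` and `s' = (z / |z|) ^ (-e) * s`.

`edge`: over the discs that belong to an edge `vw`, base and fibre are exchanged: the punctured disc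
of `v` times the circle is `(0, 1) × S¹ × S¹`, with the radius `t`, the direction in the base and the
fibre as its coordinates, and `(t, s', s)` is glued to `(1 - t, s, s')`. -/
inductive Glue : D.Pieces → D.Pieces → Prop
  | infinity (v : V) (z : D.base (Sum.inl v)) (z' : D.base (Sum.inr v)) (s s' : Circle)
      (hz : (z : ℂ) * (z' : ℂ) = 1)
      (hs : (s' : ℂ) = ((z : ℂ) / (‖(z : ℂ)‖ : ℂ)) ^ (-Γ.weight v) * (s : ℂ)) :
      Glue ⟨Sum.inl v, (z, s)⟩ ⟨Sum.inr v, (z', s')⟩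
  | edge (v w : V) (h : Γ.graph.Adj v w) (z : D.base (Sum.inl v)) (z' : D.base (Sum.inl w))
      (s s' : Circle) (t : ℝ) (h0 : 0 < t) (h1 : t < 1)
      (hz : (z : ℂ) = D.center v w + ((t * D.radius v w : ℝ) : ℂ) * (s' : ℂ))
      (hz' : (z' : ℂ) = D.center w v + (((1 - t) * D.radius w v : ℝ) : ℂ) * (s : ℂ)) :
      Glue ⟨Sum.inl v, (z, s)⟩ ⟨Sum.inl w, (z', s')⟩

/-- The plumbed 3-manifold `∂P(Γ)`, with the quotient topology (`V` carries the discrete topology).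
It is oriented by the frames `(∂/∂x, ∂/∂y, ∂/∂θ)` of the charts, where `z = x + iy` and
`s = exp (iθ)`: the boundary orientation of the complex line bundle. -/
def Boundary : Type :=
  Quot D.Glue

instance : TopologicalSpace D.Boundary :=
  inferInstanceAs (TopologicalSpace (Quot D.Glue))

/-- The charts of the plumbed 3-manifold. -/
def chart (c : V ⊕ V) (z : D.base c) (s : Circle) : D.Boundary :=
  Quot.mk D.Glue ⟨c, (z, s)⟩

/-- A homeomorphism onto a Brieskorn link is an orientation-preserving diffeomorphism: in each
chart, with coordinates `(z, θ)`, it is smooth as a map to `ℂ³`, and its differential sends the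
oriented coordinate frame to a positively oriented frame of the link. -/
def IsOrientedDiffeo (a : Fin 3 → ℕ) (h : D.Boundary ≃ₜ brieskornLink a) : Prop :=
  ∀ c : V ⊕ V, ∃ f : ℂ × ℝ → (Fin 3 → ℂ),
    ContDiffOn ℝ ∞ f (D.base c ×ˢ Set.univ) ∧
    ∀ (z : D.base c) (θ : ℝ),
      f ((z : ℂ), θ) = h (D.chart c z (Circle.exp θ)) ∧
      IsPositiveFrame a (f ((z : ℂ), θ))
        (fderiv ℝ f ((z : ℂ), θ) ((1 : ℂ), (0 : ℝ)))
        (fderiv ℝ f ((z : ℂ), θ) (Complex.I, (0 : ℝ)))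
        (fderiv ℝ f ((z : ℂ), θ) ((0 : ℂ), (1 : ℝ)))

end DiscSystem

/-- `∂P(Γ)` is orientation-preservingly diffeomorphic to the Brieskorn link `Σ(a₀, a₁, a₂)`. -/
def BoundaryIsBrieskorn (Γ : PlumbingGraph V) (a : Fin 3 → ℕ) : Prop :=
  ∃ (D : DiscSystem Γ) (h : D.Boundary ≃ₜ brieskornLink a), D.IsOrientedDiffeo a h

/-! ## The Neumann–Siebenmann invariant -/

open Classical in
/-- The intersection form of the plumbing in the basis of the base spheres. -/
def intersectionMatrix (Γ : PlumbingGraph V) : Matrix V V ℤ :=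
  fun v w => if v = w then Γ.weight v else if Γ.graph.Adj v w then 1 else 0

variable [Fintype V]

/-- The intersection number of `∑ x_v [S_v]` and `∑ y_v [S_v]`. -/
def inter (Γ : PlumbingGraph V) (x y : V → ℤ) : ℤ :=
  ∑ v, ∑ w, x v * Γ.intersectionMatrix v w * y w

open Classical in
/-- The determinant of the intersection form is odd; for a plumbing tree this says that `∂P(Γ)` is a
`ℤ/2`-homology sphere. -/
def HasOddDet (Γ : PlumbingGraph V) : Prop :=
  Odd Γ.intersectionMatrix.det

open Classical in
/-- The signature of the intersection form. -/
def signature (Γ : PlumbingGraph V) : ℤ :=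
  let Q : QuadraticForm ℝ (V → ℝ) :=
    (Γ.intersectionMatrix.map (Int.cast : ℤ → ℝ)).toQuadraticForm'
  (sigPos Q : ℤ) - (sigNeg Q : ℤ)

open Classical in
/-- `w` is a spherical Wu class: a sum of distinct base spheres with `w · [S_v] ≡ [S_v] · [S_v]`
modulo 2 for every vertex `v`. If the determinant is odd there is exactly one, which belongs to the
unique spin structure of `∂P(Γ)`. -/
def IsSphericalWuClass (Γ : PlumbingGraph V) (w : V → ℤ) : Prop :=
  (∀ v, w v = 0 ∨ w v = 1) ∧ ∀ v, Γ.inter w (Pi.single v 1) ≡ Γ.weight v [ZMOD 2]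

/-- `(σ(Γ) - w²) / 8`. -/
def muBar (Γ : PlumbingGraph V) (w : V → ℤ) : ℚ :=
  ((Γ.signature : ℚ) - (Γ.inter w w : ℚ)) / 8

end PlumbingGraph

/-- `x` is the Neumann–Siebenmann invariant of the Brieskorn link `Σ(a₀, a₁, a₂)`, as a
`ℤ/2`-homology sphere: the link is, with its orientation, the boundary of the plumbing along a tree
`Γ` of odd determinant, and `x = (σ(Γ) - w²) / 8` for the spherical Wu class `w` of `Γ`. -/
def IsNeumannSiebenmannInvariant (a : Fin 3 → ℕ) (x : ℚ) : Prop :=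
  ∃ (V : Type) (_ : Fintype V) (Γ : PlumbingGraph V),
    Γ.graph.IsTree ∧ Γ.HasOddDet ∧ Γ.BoundaryIsBrieskorn a ∧
      ∃ w, Γ.IsSphericalWuClass w ∧ x = Γ.muBar w

/-! ## The explicit graph -/

/-- A central vertex, one further vertex, and `r` arms with `l` vertices each. -/
abbrev StarVertex (r l : ℕ) : Type :=
  Unit ⊕ (Unit ⊕ (Fin r × Fin l))

/-- The first vertex of each edge is the one nearer to the centre. -/
def starEdge (r l : ℕ) : StarVertex r l → StarVertex r l → Prop
  | Sum.inl _, Sum.inr (Sum.inl _) => True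
  | Sum.inl _, Sum.inr (Sum.inr (_, j)) => (j : ℕ) = 0
  | Sum.inr (Sum.inr (i, j)), Sum.inr (Sum.inr (i', j')) => i = i' ∧ (j : ℕ) + 1 = (j' : ℕ)
  | _, _ => False

/-- The star-shaped graph with a central vertex of weight `-2 ^ k`, a vertex of weight `-m` attached
to it, and `2 ^ k` arms with weights `-2, …, -2, -3, -2, …, -2`, where the `-3` is preceded by
`2 ^ k * m - 2` and followed by `8` vertices. -/
def brieskornGraph (k m : ℕ) : PlumbingGraph (StarVertex (2 ^ k) (2 ^ k * m + 7)) where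
  graph := SimpleGraph.fromRel (starEdge (2 ^ k) (2 ^ k * m + 7))
  weight
    | Sum.inl _ => -(2 ^ k)
    | Sum.inr (Sum.inl _) => -(m : ℤ)
    | Sum.inr (Sum.inr (_, j)) => if (j : ℕ) = 2 ^ k * m - 2 then -3 else -2

end

/-! Write d = 2^k and N = 10dm - 1. The cone x₀^d + x₁^(dm) + x₂^N = 0 without its origin is
invariant under the dilations with weights (mN, N, dm), and each orbit of the real dilations meets
the unit sphere exactly once (`toSphere`). So maps to the link may be written as maps to the
punctured cone, where holomorphic charts are available. The orientation is tested there as well: a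
frame of the link is positive as soon as its lift to a chart, preceded by the Euler field, is
positive for the complex orientation (`isPositiveFrame_toSphere`).

The circle action makes the link a Seifert manifold over the sphere of y = x₀ / x₁^m. The function λ
= x₂^10 / x₁ has weight 10dm - N = 1, hence it is a fibre coordinate wherever x₁ and x₂ do not
vanish. The special orbits are the one over y = ∞ (x₁ = 0, multiplicity m) and the d orbits over y^d
= -1 (x₂ = 0, multiplicity N). Each has a solid torus neighbourhood with coordinates (u, v), |u| = 1
and |v| small. An arm of the graph cuts such a solid torus into overlapping shells according to |v|.
On a shell, u = a^p b^p' and v / |v| = a^q b^q' with p q' - p' q = 1, where a is the direction in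
the base and b the fibre coordinate. Passing an edge to the next vertex replaces (p, p') by (p', n
p' - p), and (q, q') likewise, where -n is the weight of the vertex that is left. Starting from (N,
N - 10) and (dm, dm - 1), this is the continued fraction of N / (N - 10), with entries 2, ..., 2, 3,
2, ..., 2 (`armP_rec`, `armQ_rec`, `armPQ_unimodular`). It ends with p = n and p' = 1, which is what
lets the last circle bundle close up over the core v = 0.

The Euler number of a vertex enters through a function without zeros on the punctured base whose
direction twists the fibre coordinate (`CentreData.phase`, `armPhase`); its winding number at
infinity produces the weight. The gluing of the plumbing requires exact formulas on the discs.
Therefore the holomorphic coordinates are made linear there by diffeomorphisms supported near the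
punctures (`nonempty_straightening`), and the punctures of the central base are opened radially to
discs (`blowUp`). The resulting maps of the charts are smooth, compatible, positive on frames and
jointly bijective. Since the plumbed manifold is compact, they give a homeomorphism onto the link
(`PlumbingGraph.DiscSystem.boundaryIsBrieskorn`, `StarData.boundaryIsBrieskorn_graph`).

The rest is arithmetic of the form. The positive vector `multiplicity` pairs to -1 with the centre
and to 0 with every other vertex, so the form is negative definite and the signature is minus the
number of vertices. Modulo 2 the recursion along the arms forces every kernel vector to vanish,
which gives the odd determinant and the uniqueness of the Wu class. The Wu class consists of the
centre and of every second vertex of each arm before the -3. Its square is -d - d(dm - 2), and σ -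
w² = -2 - 8d. -/

noncomputable section

open Filter Topology
open scoped ContDiff

/-! ## The weighted dilation flow of `ℂ³` and the retraction to the sphere -/

/-- The weighted dilation by `exp τ`. -/
def dilate (w : Fin 3 → ℕ) (τ : ℝ) (x : Fin 3 → ℂ) : Fin 3 → ℂ :=
  fun j => ((Real.exp (w j * τ) : ℝ) : ℂ) * x j

/-- The generating vector field of the weighted dilations. -/
def eulerField (w : Fin 3 → ℕ) (x : Fin 3 → ℂ) : Fin 3 → ℂ :=
  fun j => (w j : ℂ) * x j

/-- The squared norm of the weighted dilation of `x` by `exp τ`. -/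
def dilateNormSq (w : Fin 3 → ℕ) (x : Fin 3 → ℂ) (τ : ℝ) : ℝ :=
  ∑ j, Real.exp (2 * w j * τ) * Complex.normSq (x j)

section Dilate

variable {w : Fin 3 → ℕ}

lemma dilate_dilate (σ τ : ℝ) (x : Fin 3 → ℂ) :
    dilate w σ (dilate w τ x) = dilate w (σ + τ) x := by
  funext j
  simp only [dilate, mul_add, Real.exp_add]
  push_cast
  ring

@[simp] lemma dilate_zero (x : Fin 3 → ℂ) : dilate w 0 x = x := by
  funext j; simp [dilate]

lemma dilate_ne_zero {x : Fin 3 → ℂ} (hx : x ≠ 0) (τ : ℝ) : dilate w τ x ≠ 0 := by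
  intro h
  apply hx
  have : dilate w (-τ) (dilate w τ x) = 0 := by rw [h]; funext j; simp [dilate]
  simpa [dilate_dilate] using this

lemma sum_norm_sq_dilate (τ : ℝ) (x : Fin 3 → ℂ) :
    ∑ j, ‖dilate w τ x j‖ ^ 2 = dilateNormSq w x τ := by
  refine Finset.sum_congr rfl fun j _ => ?_
  rw [dilate, norm_mul, mul_pow, Complex.sq_norm, Complex.sq_norm, Complex.normSq_ofReal,
    ← Real.exp_add]
  ring_nf

lemma dilateNormSq_zero (x : Fin 3 → ℂ) : dilateNormSq w x 0 = ∑ j, ‖x j‖ ^ 2 := by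
  rw [← sum_norm_sq_dilate, dilate_zero]

lemma dilateNormSq_add (x : Fin 3 → ℂ) (σ τ : ℝ) :
    dilateNormSq w (dilate w τ x) σ = dilateNormSq w x (σ + τ) := by
  rw [← sum_norm_sq_dilate, ← sum_norm_sq_dilate, dilate_dilate]

lemma hasDerivAt_dilateNormSq (x : Fin 3 → ℂ) (τ : ℝ) :
    HasDerivAt (dilateNormSq w x)
      (∑ j, Real.exp (2 * w j * τ) * (2 * w j) * Complex.normSq (x j)) τ := by
  unfold dilateNormSq
  refine HasDerivAt.fun_sum fun j _ => ?_
  have : HasDerivAt (fun τ : ℝ => 2 * (w j : ℝ) * τ) (2 * w j) τ := by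
    simpa using (hasDerivAt_id τ).const_mul (2 * (w j : ℝ))
  exact this.exp.mul_const _

lemma deriv_dilateNormSq_pos (hw : ∀ j, 0 < w j) {x : Fin 3 → ℂ} (hx : x ≠ 0) (τ : ℝ) :
    0 < ∑ j, Real.exp (2 * w j * τ) * (2 * w j) * Complex.normSq (x j) := by
  obtain ⟨j, hj⟩ := Function.ne_iff.1 hx
  refine Finset.sum_pos' (fun i _ => ?_) ⟨j, Finset.mem_univ j, ?_⟩
  · have := Complex.normSq_nonneg (x i)
    positivity
  · have := Complex.normSq_pos.2 hj
    have := hw j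
    positivity

lemma strictMono_dilateNormSq (hw : ∀ j, 0 < w j) {x : Fin 3 → ℂ} (hx : x ≠ 0) :
    StrictMono (dilateNormSq w x) :=
  strictMono_of_deriv_pos fun τ => by
    rw [(hasDerivAt_dilateNormSq x τ).deriv]; exact deriv_dilateNormSq_pos hw hx τ

lemma exists_dilateNormSq_eq_one (hw : ∀ j, 0 < w j) {x : Fin 3 → ℂ} (hx : x ≠ 0) :
    ∃ τ, dilateNormSq w x τ = 1 := by
  have hc : Continuous (dilateNormSq w x) :=
    continuous_iff_continuousAt.2 fun τ => (hasDerivAt_dilateNormSq x τ).continuousAt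
  have hbot : Tendsto (dilateNormSq w x) atBot (𝓝 0) := by
    have : Tendsto (dilateNormSq w x) atBot (𝓝 (∑ j, 0 * Complex.normSq (x j))) := by
      refine tendsto_finsetSum _ fun j _ => Tendsto.mul_const _ ?_
      refine Real.tendsto_exp_atBot.comp ?_
      have := hw j
      exact tendsto_id.const_mul_atBot (by positivity)
    simpa using this
  have htop : Tendsto (dilateNormSq w x) atTop atTop := by
    obtain ⟨j, hj⟩ := Function.ne_iff.1 hx
    have h1 : Tendsto (fun τ : ℝ => Real.exp (2 * w j * τ) * Complex.normSq (x j)) atTop atTop := by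
      refine Tendsto.atTop_mul_const (Complex.normSq_pos.2 hj) ?_
      refine Real.tendsto_exp_atTop.comp ?_
      have := hw j
      exact tendsto_id.const_mul_atTop (by positivity)
    refine tendsto_atTop_mono (fun τ => ?_) h1
    refine Finset.single_le_sum (f := fun j => Real.exp (2 * w j * τ) * Complex.normSq (x j))
      (fun i _ => ?_) (Finset.mem_univ j)
    have := Complex.normSq_nonneg (x i)
    positivity
  obtain ⟨a, ha⟩ := (hbot.eventually (gt_mem_nhds (zero_lt_one' ℝ))).exists
  obtain ⟨b, hb⟩ := (htop.eventually (eventually_ge_atTop 1)).exists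
  obtain ⟨τ, hτ⟩ := mem_range_of_exists_le_of_exists_ge hc ⟨a, ha.le⟩ ⟨b, hb⟩
  exact ⟨τ, hτ⟩

open Classical in
/-- The parameter of the dilation that takes `x` to the unit sphere. -/
def sphereTime (w : Fin 3 → ℕ) (x : Fin 3 → ℂ) : ℝ :=
  if h : ∃ τ, dilateNormSq w x τ = 1 then h.choose else 0

/-- The point of the unit sphere on the dilation orbit of `x`. -/
def toSphere (w : Fin 3 → ℕ) (x : Fin 3 → ℂ) : Fin 3 → ℂ :=
  dilate w (sphereTime w x) x

lemma dilateNormSq_sphereTime (hw : ∀ j, 0 < w j) {x : Fin 3 → ℂ} (hx : x ≠ 0) :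
    dilateNormSq w x (sphereTime w x) = 1 := by
  have h := exists_dilateNormSq_eq_one hw hx
  rw [sphereTime, dif_pos h]
  exact h.choose_spec

lemma sum_norm_sq_toSphere (hw : ∀ j, 0 < w j) {x : Fin 3 → ℂ} (hx : x ≠ 0) :
    ∑ j, ‖toSphere w x j‖ ^ 2 = 1 := by
  rw [toSphere, sum_norm_sq_dilate, dilateNormSq_sphereTime hw hx]

lemma sphereTime_eq (hw : ∀ j, 0 < w j) {x : Fin 3 → ℂ} (hx : x ≠ 0) {τ : ℝ}
    (h : dilateNormSq w x τ = 1) : sphereTime w x = τ :=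
  (strictMono_dilateNormSq hw hx).injective ((dilateNormSq_sphereTime hw hx).trans h.symm)

lemma toSphere_dilate (hw : ∀ j, 0 < w j) {x : Fin 3 → ℂ} (hx : x ≠ 0) (τ : ℝ) :
    toSphere w (dilate w τ x) = toSphere w x := by
  have h : sphereTime w (dilate w τ x) = sphereTime w x - τ := by
    refine sphereTime_eq hw (dilate_ne_zero hx τ) ?_
    rw [dilateNormSq_add, sub_add_cancel, dilateNormSq_sphereTime hw hx]
  rw [toSphere, h, dilate_dilate, sub_add_cancel, toSphere]

lemma toSphere_eq_self (hw : ∀ j, 0 < w j) {x : Fin 3 → ℂ} (h : ∑ j, ‖x j‖ ^ 2 = 1) :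
    toSphere w x = x := by
  have hx : x ≠ 0 := by rintro rfl; simp at h
  rw [toSphere, sphereTime_eq hw hx (τ := 0) (by rw [dilateNormSq_zero, h]), dilate_zero]

/-- Whatever the value of `sphereTime`, a point and its image are on the same dilation orbit; hence
x and y need not be nonzero. -/
lemma exists_dilate_eq_of_toSphere_eq {x y : Fin 3 → ℂ} (h : toSphere w x = toSphere w y) :
    ∃ τ, x = dilate w τ y := by
  refine ⟨-sphereTime w x + sphereTime w y, ?_⟩
  rw [← dilate_dilate, ← toSphere, ← h, toSphere, dilate_dilate]
  simp

/-- The implicit function theorem applies to |exp(τ)·x|² = 1, because the derivative in τ is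
positive. The implicit function is `sphereTime` itself, since the equation has only one solution. -/
lemma contDiffAt_sphereTime (hw : ∀ j, 0 < w j) {x : Fin 3 → ℂ} (hx : x ≠ 0) :
    ContDiffAt ℝ ∞ (sphereTime w) x := by
  let F : (Fin 3 → ℂ) × ℝ → ℝ := fun p => dilateNormSq w p.1 p.2
  have hF : ContDiff ℝ ∞ F := by
    simp only [F, dilateNormSq, Complex.normSq_apply]
    have hre : ∀ j, ContDiff ℝ ∞ fun p : (Fin 3 → ℂ) × ℝ => (p.1 j).re := fun j =>
      Complex.reCLM.contDiff.comp
        ((ContinuousLinearMap.proj (R := ℝ) (φ := fun _ : Fin 3 => ℂ) j).contDiff.comp contDiff_fst)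
    have him : ∀ j, ContDiff ℝ ∞ fun p : (Fin 3 → ℂ) × ℝ => (p.1 j).im := fun j =>
      Complex.imCLM.contDiff.comp
        ((ContinuousLinearMap.proj (R := ℝ) (φ := fun _ : Fin 3 => ℂ) j).contDiff.comp contDiff_fst)
    refine ContDiff.sum fun j _ => ContDiff.mul ?_ ?_
    · exact Real.contDiff_exp.comp (contDiff_const.mul contDiff_snd)
    · exact ((hre j).mul (hre j)).add ((him j).mul (him j))
  let u : (Fin 3 → ℂ) × ℝ := (x, sphereTime w x)
  have hFu : ContDiffAt ℝ ∞ F u := hF.contDiffAt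
  have hn : (∞ : WithTop ℕ∞) ≠ 0 := by simp
  have hd : (fderiv ℝ F u ∘L .inr ℝ (Fin 3 → ℂ) ℝ) 1 =
      ∑ j, Real.exp (2 * w j * sphereTime w x) * (2 * w j) * Complex.normSq (x j) := by
    have h1 : HasFDerivAt F (fderiv ℝ F u) u := (hFu.differentiableAt hn).hasFDerivAt
    have h2 : HasDerivAt (fun τ : ℝ => (x, τ)) ((0 : Fin 3 → ℂ), (1 : ℝ)) (sphereTime w x) :=
      (hasDerivAt_const _ _).prodMk (hasDerivAt_id _)
    have h3 : HasDerivAt (fun τ : ℝ => F (x, τ)) (fderiv ℝ F u (0, 1)) (sphereTime w x) :=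
      h1.comp_hasDerivAt (sphereTime w x) h2
    exact h3.unique (hasDerivAt_dilateNormSq x (sphereTime w x))
  have hinv : (fderiv ℝ F u ∘L .inr ℝ (Fin 3 → ℂ) ℝ).IsInvertible := by
    have hne : (fderiv ℝ F u ∘L .inr ℝ (Fin 3 → ℂ) ℝ) 1 ≠ 0 := by
      rw [hd]; exact (deriv_dilateNormSq_pos hw hx _).ne'
    refine ⟨ContinuousLinearEquiv.unitsEquivAut ℝ (Units.mk0 _ hne), ?_⟩
    ext
    simp
  have h1 := hFu.contDiffAt_implicitFunction hn hinv
  have h2 := hFu.eventually_apply_implicitFunction hn hinv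
  refine h1.congr_of_eventuallyEq ?_
  filter_upwards [h2, isOpen_ne.mem_nhds hx] with y hy hy0
  exact sphereTime_eq hw hy0 (hy.trans (dilateNormSq_sphereTime hw hx))

/-- The weighted dilation as a complex linear map. -/
def dilateL (w : Fin 3 → ℕ) (τ : ℝ) : (Fin 3 → ℂ) →L[ℂ] (Fin 3 → ℂ) :=
  ContinuousLinearMap.pi fun j =>
    ((Real.exp (w j * τ) : ℝ) : ℂ) • ContinuousLinearMap.proj (R := ℂ) (φ := fun _ : Fin 3 => ℂ) j

lemma eulerField_dilate (τ : ℝ) (x : Fin 3 → ℂ) :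
    eulerField w (dilate w τ x) = dilate w τ (eulerField w x) := by
  funext j; simp only [eulerField, dilate]; ring

lemma contDiffAt_toSphere (hw : ∀ j, 0 < w j) {x : Fin 3 → ℂ} (hx : x ≠ 0) :
    ContDiffAt ℝ ∞ (toSphere w) x := by
  refine contDiffAt_pi.2 fun j => ?_
  have h1 : ContDiffAt ℝ ∞ (fun y => Real.exp (w j * sphereTime w y)) x :=
    Real.contDiff_exp.contDiffAt.comp x (contDiffAt_const.mul (contDiffAt_sphereTime hw hx))
  have h2 : ContDiffAt ℝ ∞ (fun y : Fin 3 → ℂ => y j) x :=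
    (ContinuousLinearMap.proj (R := ℝ) (φ := fun _ : Fin 3 => ℂ) j).contDiff.contDiffAt
  exact (Complex.ofRealCLM.contDiff.contDiffAt.comp x h1).mul h2

/-- By the product rule, the dependence of the time on x contributes only a multiple of the Euler
field. Up to that multiple the projection to the sphere has a complex linear derivative, namely the
dilation. -/
lemma hasFDerivAt_toSphere (hw : ∀ j, 0 < w j) {x : Fin 3 → ℂ} (hx : x ≠ 0) :
    ∃ L : (Fin 3 → ℂ) →L[ℝ] (Fin 3 → ℂ), HasFDerivAt (toSphere w) L x ∧
      ∃ l : (Fin 3 → ℂ) → ℝ, ∀ v, L v = dilate w (sphereTime w x) v +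
        l v • eulerField w (toSphere w x) := by
  have hn : (∞ : WithTop ℕ∞) ≠ 0 := by simp
  refine ⟨fderiv ℝ (toSphere w) x,
    ((contDiffAt_toSphere hw hx).differentiableAt hn).hasFDerivAt,
    fun v => fderiv ℝ (sphereTime w) x v, fun v => ?_⟩
  have hs := ((contDiffAt_sphereTime hw hx).differentiableAt hn).hasFDerivAt
  funext j
  have h1 : HasFDerivAt (fun y => ((Real.exp (w j * sphereTime w y) : ℝ) : ℂ)) _ x :=
    Complex.ofRealCLM.hasFDerivAt.comp x (hs.const_mul (w j : ℝ)).exp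
  have h2 : HasFDerivAt (fun y : Fin 3 → ℂ => y j)
      (ContinuousLinearMap.proj (R := ℝ) (φ := fun _ : Fin 3 => ℂ) j) x :=
    (ContinuousLinearMap.proj (R := ℝ) (φ := fun _ : Fin 3 => ℂ) j).hasFDerivAt
  have h3 := h1.mul h2
  have h4 := hasFDerivAt_pi'.1 ((contDiffAt_toSphere hw hx).differentiableAt hn).hasFDerivAt j
  have h5 := congrArg (fun L => L v) (h4.unique h3)
  simp at h5
  rw [h5]
  simp [dilate, eulerField, toSphere]
  ring

end Dilate

/-! ## Positivity of frames in holomorphic charts -/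

/-- The determinant of four vectors of `ℂ²`, for the complex orientation. -/
def det4 (a b c e : ℂ × ℂ) : ℝ :=
  (Matrix.of ![![a.1.re, a.1.im, a.2.re, a.2.im], ![b.1.re, b.1.im, b.2.re, b.2.im],
    ![c.1.re, c.1.im, c.2.re, c.2.im], ![e.1.re, e.1.im, e.2.re, e.2.im]]).det

lemma det4_eq (a b c e : ℂ × ℂ) : det4 a b c e =
    (a.1.re * b.1.im - a.1.im * b.1.re) * (c.2.re * e.2.im - c.2.im * e.2.re)
    - (a.1.re * b.2.re - a.2.re * b.1.re) * (c.1.im * e.2.im - c.2.im * e.1.im)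
    + (a.1.re * b.2.im - a.2.im * b.1.re) * (c.1.im * e.2.re - c.2.re * e.1.im)
    + (a.1.im * b.2.re - a.2.re * b.1.im) * (c.1.re * e.2.im - c.2.im * e.1.re)
    - (a.1.im * b.2.im - a.2.im * b.1.im) * (c.1.re * e.2.re - c.2.re * e.1.re)
    + (a.2.re * b.2.im - a.2.im * b.2.re) * (c.1.re * e.1.im - c.1.im * e.1.re) := by
  simp [det4, Matrix.det_succ_row_zero, Fin.sum_univ_succ, Fin.succAbove]
  ring

/-- Row operations: subtracting x, y and z times the other rows from the first leaves a multiple of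
E there, and this clears the multiples of E from the other rows. -/
lemma det4_combination (E a b c : ℂ × ℂ) (s x y z p q r : ℝ) :
    det4 (s • E + x • a + y • b + z • c) (a + p • E) (b + q • E) (c + r • E) =
      (s - x * p - y * q - z * r) * det4 E a b c := by
  simp only [det4_eq, Prod.fst_add, Prod.snd_add, Prod.smul_fst, Prod.smul_snd, Complex.add_re,
    Complex.add_im, Complex.smul_re, Complex.smul_im, smul_eq_mul]
  ring

lemma exists_combination_of_det4_ne_zero {E a b c : ℂ × ℂ} (h : det4 E a b c ≠ 0) (v : ℂ × ℂ) :
    ∃ s x y z : ℝ, v = s • E + x • a + y • b + z • c := by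
  rw [det4] at h
  set A := Matrix.of ![![E.1.re, E.1.im, E.2.re, E.2.im], ![a.1.re, a.1.im, a.2.re, a.2.im],
    ![b.1.re, b.1.im, b.2.re, b.2.im], ![c.1.re, c.1.im, c.2.re, c.2.im]] with hA
  let v' : Fin 4 → ℝ := ![v.1.re, v.1.im, v.2.re, v.2.im]
  let t := Matrix.vecMul v' A⁻¹
  have ht : Matrix.vecMul t A = v' := by
    rw [Matrix.vecMul_vecMul, Matrix.nonsing_inv_mul _ (isUnit_iff_ne_zero.2 h), Matrix.vecMul_one]
  refine ⟨t 0, t 1, t 2, t 3, ?_⟩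
  have h0 := congrFun ht 0
  have h1 := congrFun ht 1
  have h2 := congrFun ht 2
  have h3 := congrFun ht 3
  simp [Matrix.vecMul, dotProduct, Fin.sum_univ_four, hA, v'] at h0 h1 h2 h3
  refine Prod.ext (Complex.ext ?_ ?_) (Complex.ext ?_ ?_)
  · simp [← h0]
  · simp [← h1]
  · simp [← h2]
  · simp [← h3]

/-! ### Determinants in real coordinates and complex linear maps -/

/-- The real coordinates of `ℂ³` as a linear equivalence. -/
def realCoordsEquiv : (Fin 3 → ℂ) ≃ₗ[ℝ] (Fin 6 → ℝ) where
  toFun := realCoords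
  invFun v := ![⟨v 0, v 1⟩, ⟨v 2, v 3⟩, ⟨v 4, v 5⟩]
  map_add' x y := by funext j; fin_cases j <;> simp [realCoords]
  map_smul' c x := by funext j; fin_cases j <;> simp [realCoords]
  left_inv x := by funext j; fin_cases j <;> simp [realCoords]
  right_inv v := by funext j; fin_cases j <;> simp [realCoords]

/-- The standard real basis of `ℂ³`. -/
def realBasis : Module.Basis (Fin 6) ℝ (Fin 3 → ℂ) :=
  Module.Basis.ofEquivFun realCoordsEquiv

/-- The determinant of six vectors of `ℂ³` in real coordinates. -/
def det6 (y : Fin 6 → Fin 3 → ℂ) : ℝ :=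
  (Matrix.of fun i => realCoords (y i)).det

lemma det6_eq_basis_det (y : Fin 6 → Fin 3 → ℂ) : det6 y = realBasis.det y := by
  rw [Module.Basis.det_apply, det6, ← Matrix.det_transpose]
  rfl

/-- The real determinant of a complex linear map is the squared absolute value of its complex
determinant; this is why holomorphic charts preserve positivity. -/
lemma det6_map (L : (Fin 3 → ℂ) →ₗ[ℂ] (Fin 3 → ℂ)) (y : Fin 6 → Fin 3 → ℂ) :
    det6 (fun i => L (y i)) = Complex.normSq L.det * det6 y := by
  rw [det6_eq_basis_det, det6_eq_basis_det]
  have := Module.Basis.det_comp realBasis (L.restrictScalars ℝ) y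
  rw [LinearMap.det_restrictScalars, Algebra.norm_complex_eq] at this
  exact this

/-- Expansion along the last two rows, which are unit vectors, removes the third complex coordinate
and with it the entry t. -/
lemma det6_split (a b c e : ℂ × ℂ) (t : ℂ) :
    det6 ![![a.1, a.2, t], ![b.1, b.2, 0], ![c.1, c.2, 0], ![e.1, e.2, 0], ![0, 0, 1],
      ![0, 0, Complex.I]] = det4 a b c e := by
  rw [det6, Matrix.det_succ_row _ (Fin.last 5), Finset.sum_eq_single (Fin.last 5)]
  · rw [Matrix.det_succ_row _ (Fin.last 4), Finset.sum_eq_single (Fin.last 4)]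
    · rw [det4]
      have h1 : (Matrix.of fun i => realCoords ((![![a.1, a.2, t], ![b.1, b.2, 0], ![c.1, c.2, 0],
          ![e.1, e.2, 0], ![0, 0, 1], ![0, 0, Complex.I]] : Fin 6 → Fin 3 → ℂ) i))
          (Fin.last 5) (Fin.last 5) = 1 := by
        simp [realCoords, Fin.last]
      have h2 : ((Matrix.of fun i => realCoords ((![![a.1, a.2, t], ![b.1, b.2, 0], ![c.1, c.2, 0],
          ![e.1, e.2, 0], ![0, 0, 1], ![0, 0, Complex.I]] : Fin 6 → Fin 3 → ℂ) i)).submatrix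
          (Fin.last 5).succAbove (Fin.last 5).succAbove) (Fin.last 4) (Fin.last 4) = 1 := by
        simp [realCoords, Fin.last, Fin.succAbove]
      rw [h1, h2]
      have hs : ((-1 : ℝ)) ^ ((Fin.last 5 : ℕ) + (Fin.last 5 : ℕ)) * 1 = 1 := by norm_num [Fin.last]
      have hs' : ((-1 : ℝ)) ^ ((Fin.last 4 : ℕ) + (Fin.last 4 : ℕ)) * 1 = 1 := by
        norm_num [Fin.last]
      rw [hs, hs', one_mul, one_mul]
      congr 1
      ext i j
      fin_cases i <;> fin_cases j <;> simp [realCoords, Fin.last, Fin.succAbove]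
    · intro j _ hj
      fin_cases j <;> simp [realCoords, Fin.last, Fin.succAbove] at hj ⊢
    · simp
  · intro j _ hj
    fin_cases j <;> simp [realCoords, Fin.last] at hj ⊢
  · simp

/-- The Hermitian product of `ℂ³`, linear in the second variable. -/
def hermProd (x y : Fin 3 → ℂ) : ℂ := ∑ j, starRingEnd ℂ (x j) * y j

lemma hermProd_self (x : Fin 3 → ℂ) : hermProd x x = ((∑ j, ‖x j‖ ^ 2 : ℝ) : ℂ) := by
  rw [hermProd]
  push_cast
  refine Finset.sum_congr rfl fun j _ => ?_
  rw [mul_comm, Complex.mul_conj, Complex.normSq_eq_norm_sq]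
  push_cast; rfl

lemma hermProd_add_right (x y z : Fin 3 → ℂ) :
    hermProd x (y + z) = hermProd x y + hermProd x z := by
  simp [hermProd, mul_add, Finset.sum_add_distrib]

lemma hermProd_smul_right (x y : Fin 3 → ℂ) (c : ℂ) :
    hermProd x (c • y) = c * hermProd x y := by
  simp only [hermProd, Pi.smul_apply, smul_eq_mul, Finset.mul_sum]
  exact Finset.sum_congr rfl fun j _ => by ring

lemma hermProd_conj (x y : Fin 3 → ℂ) : starRingEnd ℂ (hermProd x y) = hermProd y x := by
  simp only [hermProd, map_sum, map_mul, Complex.conj_conj]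
  exact Finset.sum_congr rfl fun j _ => by ring

lemma hermProd_add_left (x y z : Fin 3 → ℂ) :
    hermProd (x + y) z = hermProd x z + hermProd y z := by
  simp [hermProd, add_mul, Finset.sum_add_distrib]

lemma hermProd_smul_left (x y : Fin 3 → ℂ) (c : ℂ) :
    hermProd (c • x) y = starRingEnd ℂ c * hermProd x y := by
  simp only [hermProd, Pi.smul_apply, smul_eq_mul, Finset.mul_sum, map_mul]
  exact Finset.sum_congr rfl fun j _ => by ring

lemma hermProd_self_re_pos {x : Fin 3 → ℂ} (hx : x ≠ 0) : 0 < (hermProd x x).re := by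
  rw [hermProd_self, Complex.ofReal_re]
  obtain ⟨j, hj⟩ := Function.ne_iff.1 hx
  refine Finset.sum_pos' (fun i _ => by positivity) ⟨j, Finset.mem_univ j, ?_⟩
  have : 0 < ‖x j‖ := norm_pos_iff.2 hj
  positivity

/-- If a frame of a complex plane with a positive vector `E` is positive and `x` is
orthogonal to the frame (up to multiples of `E`) and pairs positively with `E`, then one may
replace `E` by `x`. -/
lemma det6_pos_of_det4_pos (A : ℂ × ℂ →ₗ[ℂ] (Fin 3 → ℂ)) (hA : Function.Injective A)
    {ν x : Fin 3 → ℂ} (hν : ν ≠ 0) (hνA : ∀ v, hermProd ν (A v) = 0) {E a b c : ℂ × ℂ}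
    (p q r : ℝ) (hpos : 0 < det4 E a b c) (hxE : 0 < (hermProd x (A E)).re)
    (hxa : (hermProd x (A (a + p • E))).re = 0) (hxb : (hermProd x (A (b + q • E))).re = 0)
    (hxc : (hermProd x (A (c + r • E))).re = 0) :
    0 < det6 ![x, A (a + p • E), A (b + q • E), A (c + r • E), ν, Complex.I • ν] := by
  -- A is completed by the normal direction ν to a complex automorphism of ℂ³. Its determinant is
  -- nonzero because ν is orthogonal to the image of A.
  let L : (Fin 3 → ℂ) →ₗ[ℂ] (Fin 3 → ℂ) :=
    { toFun := fun s => A (s 0, s 1) + s 2 • ν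
      map_add' := fun s t => by
        have : ((s + t) 0, (s + t) 1) = (s 0, s 1) + (t 0, t 1) := rfl
        rw [this, map_add, Pi.add_apply, add_smul]; abel
      map_smul' := fun z s => by
        have : ((z • s) 0, (z • s) 1) = z • (s 0, s 1) := rfl
        rw [this, map_smul, Pi.smul_apply, smul_assoc, smul_add]; rfl }
  have hL : ∀ v : ℂ × ℂ, ∀ t : ℂ, L ![v.1, v.2, t] = A v + t • ν := fun v t => rfl
  have hAν : ∀ v, hermProd (A v) ν = 0 := fun v => by
    rw [← hermProd_conj, hνA, map_zero]
  have hνν : hermProd ν ν ≠ 0 := fun h => by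
    have := hermProd_self_re_pos hν
    rw [h] at this; simp at this
  have hLinj : Function.Injective L := by
    rw [injective_iff_map_eq_zero]
    intro s hs
    have hs' : A (s 0, s 1) + s 2 • ν = 0 := hs
    have h2 : s 2 = 0 := by
      have := congrArg (hermProd ν) hs'
      rw [hermProd_add_right, hνA, hermProd_smul_right, zero_add] at this
      have h0 : hermProd ν 0 = 0 := by simp [hermProd]
      rw [h0] at this
      exact (mul_eq_zero.1 this).resolve_right hνν
    rw [h2, zero_smul, add_zero] at hs'
    have h01 := (injective_iff_map_eq_zero A).1 hA _ hs'
    simp only [Prod.mk_eq_zero] at h01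
    funext j
    fin_cases j
    · exact h01.1
    · exact h01.2
    · exact h2
  have hLdet : L.det ≠ 0 := by
    intro h
    have := LinearMap.bot_lt_ker_of_det_eq_zero h
    rw [LinearMap.ker_eq_bot.2 hLinj] at this
    exact lt_irrefl _ this
  have hLsurj : Function.Surjective L := LinearMap.injective_iff_surjective.1 hLinj
  obtain ⟨s, hs⟩ := hLsurj x
  -- A v is the orthogonal projection of x to the plane spanned by A.
  set v : ℂ × ℂ := (s 0, s 1) with hv
  have hx : x = A v + s 2 • ν := hs.symm
  obtain ⟨σ, α, β, γ, hcomb⟩ := exists_combination_of_det4_ne_zero hpos.ne' v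
  have key : det6 ![x, A (a + p • E), A (b + q • E), A (c + r • E), ν, Complex.I • ν] =
      Complex.normSq L.det * ((σ - α * p - β * q - γ * r) * det4 E a b c) := by
    rw [← det4_combination E a b c σ α β γ p q r, ← hcomb, ← det6_split _ _ _ _ (s 2), ← det6_map]
    congr 1
    funext i
    fin_cases i
    · exact hx
    · exact ((hL (a + p • E) 0).trans (by simp)).symm
    · exact ((hL (b + q • E) 0).trans (by simp)).symm
    · exact ((hL (c + r • E) 0).trans (by simp)).symm
    · exact ((hL 0 1).trans (by simp)).symm
    · exact ((hL 0 Complex.I).trans (by simp)).symm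
  rw [key]
  refine mul_pos (Complex.normSq_pos.2 hLdet) (mul_pos ?_ hpos)
  -- This is the coefficient of E when v is expanded in E and the three corrected vectors. Those are
  -- real-orthogonal to x, so pairing with x gives |A v|² = c' Re⟨x, A E⟩, and both other factors
  -- are positive.
  set c' := σ - α * p - β * q - γ * r with hc'
  have hv' : A v = (c' : ℂ) • A E + (α : ℂ) • A (a + p • E) + (β : ℂ) • A (b + q • E)
      + (γ : ℂ) • A (c + r • E) := by
    rw [← map_smul, ← map_smul, ← map_smul, ← map_smul, ← map_add, ← map_add, ← map_add, hcomb]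
    congr 1
    have hr : ∀ (t : ℝ) (z : ℂ × ℂ), ((t : ℂ) • z) = t • z := fun t z => by
      ext <;> simp
    simp only [hr, hc']
    module
  have hpair : ∀ u, hermProd x (A u) = hermProd (A v) (A u) := fun u => by
    rw [hx, hermProd_add_left, hermProd_smul_left, hνA, mul_zero, add_zero]
  have hvne : A v ≠ 0 := by
    intro h
    rw [hpair, h] at hxE
    simp [hermProd] at hxE
  have h1 : (hermProd (A v) (A v)).re = c' * (hermProd x (A E)).re := by
    have h2 : hermProd (A v) (A v) = hermProd x (A v) := (hpair v).symm
    rw [h2, hv', hermProd_add_right, hermProd_add_right, hermProd_add_right, hermProd_smul_right,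
      hermProd_smul_right, hermProd_smul_right, hermProd_smul_right]
    simp only [Complex.add_re, Complex.re_ofReal_mul, hxa, hxb, hxc]
    ring
  have h3 := hermProd_self_re_pos hvne
  rw [h1] at h3
  exact pos_of_mul_pos_left h3 hxE.le

lemma hermProd_eulerField_re_pos {w : Fin 3 → ℕ} (hw : ∀ j, 0 < w j) {x : Fin 3 → ℂ} (hx : x ≠ 0) :
    0 < (hermProd x (eulerField w x)).re := by
  have : (hermProd x (eulerField w x)).re = ∑ j, (w j : ℝ) * Complex.normSq (x j) := by
    simp only [hermProd, eulerField, Complex.re_sum]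
    refine Finset.sum_congr rfl fun j _ => ?_
    rw [show starRingEnd ℂ (x j) * ((w j : ℂ) * x j) = (w j : ℂ) * (x j * starRingEnd ℂ (x j)) by ring,
      Complex.mul_conj]
    simp
  rw [this]
  obtain ⟨j, hj⟩ := Function.ne_iff.1 hx
  refine Finset.sum_pos' (fun i _ => mul_nonneg (Nat.cast_nonneg _) (Complex.normSq_nonneg _))
    ⟨j, Finset.mem_univ j, mul_pos (Nat.cast_pos.2 (hw j)) (Complex.normSq_pos.2 hj)⟩

/-- In a holomorphic chart of the cone over the link, positivity of a frame can be tested against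
the radial vector field. -/
theorem isPositiveFrame_toSphere {a w : Fin 3 → ℕ} (ha : ∀ j, 0 < a j) (hw : ∀ j, 0 < w j)
    {M : ℕ} (hM : ∀ j, w j * a j = M) {T : ℂ × ℂ → Fin 3 → ℂ} {P : ℂ × ℂ}
    {A : ℂ × ℂ →L[ℂ] (Fin 3 → ℂ)} (hA : HasFDerivAt T A P)
    (hT : ∀ᶠ Q in 𝓝 P, ∑ j, T Q j ^ a j = 0) (hne : T P ≠ 0) (hinj : Function.Injective A)
    {E : ℂ × ℂ} (hE : A E = eulerField w (T P)) {g : ℂ × ℝ → ℂ × ℂ} {g' : ℂ × ℝ →L[ℝ] ℂ × ℂ}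
    {o : ℂ × ℝ} (hg : HasFDerivAt g g' o) (hgo : g o = P)
    (hdet : 0 < det4 E (g' (1, 0)) (g' (Complex.I, 0)) (g' (0, 1))) :
    IsPositiveFrame a (toSphere w (T (g o)))
      (fderiv ℝ (fun z => toSphere w (T (g z))) o (1, 0))
      (fderiv ℝ (fun z => toSphere w (T (g z))) o (Complex.I, 0))
      (fderiv ℝ (fun z => toSphere w (T (g z))) o (0, 1)) := by
  obtain ⟨L, hL, l, hl⟩ := hasFDerivAt_toSphere hw hne
  set τ := sphereTime w (T P)
  set x := toSphere w (T P) with hx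
  have hx1 : ∑ j, ‖x j‖ ^ 2 = 1 := sum_norm_sq_toSphere hw hne
  have hx0 : x ≠ 0 := dilate_ne_zero hne _
  have hAg : HasFDerivAt (fun z => T (g z)) ((A.restrictScalars ℝ).comp g') o := by
    have h1 : HasFDerivAt T (A.restrictScalars ℝ) (g o) := by rw [hgo]; exact hA.restrictScalars ℝ
    exact h1.comp o hg
  have hf : HasFDerivAt (fun z => toSphere w (T (g z))) (L.comp ((A.restrictScalars ℝ).comp g')) o := by
    rw [← hgo] at hL
    exact hL.comp o hAg
  let A' : ℂ × ℂ →ₗ[ℂ] (Fin 3 → ℂ) := ((dilateL w τ).comp A : ℂ × ℂ →L[ℂ] (Fin 3 → ℂ))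
  have hA' : ∀ v, A' v = dilate w τ (A v) := fun v => rfl
  have hA'E : A' E = eulerField w x := by
    rw [hA', hE, ← eulerField_dilate]; rfl
  have hA'inj : Function.Injective A' := by
    rw [injective_iff_map_eq_zero]
    intro v hv
    have h1 : A v = 0 := by
      by_contra h
      exact dilate_ne_zero (w := w) h τ hv
    exact (injective_iff_map_eq_zero A).1 hinj v h1
  -- The multiples of the Euler field in the derivative of the projection are moved into the chart
  -- as multiples of E.
  have hfd : ∀ v, fderiv ℝ (fun z => toSphere w (T (g z))) o v = A' (g' v + l (A (g' v)) • E) := by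
    intro v
    rw [hf.fderiv]
    have hr : l (A (g' v)) • E = ((l (A (g' v)) : ℝ) : ℂ) • E := by ext <;> simp
    have hr' : ∀ z : Fin 3 → ℂ, l (A (g' v)) • z = ((l (A (g' v)) : ℝ) : ℂ) • z := fun z => by
      ext <;> simp
    rw [hr, map_add, map_smul, hA'E, hA']
    change L (A (g' v)) = _
    rw [hl, hr']
  -- The image stays in the unit sphere, so differentiating the squared norm gives orthogonality to
  -- x.
  have horth : ∀ v, (hermProd x (fderiv ℝ (fun z => toSphere w (T (g z))) o v)).re = 0 := by
    intro v
    have hev : ∀ᶠ z in 𝓝 o, ∑ j, Complex.normSq (toSphere w (T (g z)) j) = 1 := by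
      have hc : ContinuousAt (fun z => T (g z)) o := hAg.continuousAt
      have : ∀ᶠ z in 𝓝 o, T (g z) ≠ 0 := hc.eventually_ne (by rw [hgo]; exact hne)
      filter_upwards [this] with z hz
      simpa [Complex.sq_norm] using sum_norm_sq_toSphere hw hz
    have hj : ∀ j, ∃ D : ℂ × ℝ →L[ℝ] ℝ,
        HasFDerivAt (fun z => Complex.normSq (toSphere w (T (g z)) j)) D o ∧
        D v = 2 * ((x j).re * (fderiv ℝ (fun z => toSphere w (T (g z))) o v j).re +
          (x j).im * (fderiv ℝ (fun z => toSphere w (T (g z))) o v j).im) := by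
      intro j
      have h := hasFDerivAt_pi'.1 hf j
      simp only [Complex.normSq_apply]
      have hre := Complex.reCLM.hasFDerivAt.comp o h
      have him := Complex.imCLM.hasFDerivAt.comp o h
      refine ⟨_, (hre.mul hre).add (him.mul him), ?_⟩
      rw [hf.fderiv]
      simp [hgo, ← hx]
      ring
    choose D hD hDv using hj
    have hsum := HasFDerivAt.fun_sum (u := Finset.univ) fun j _ => hD j
    have h0 := hsum.unique ((hasFDerivAt_const (1 : ℝ) o).congr_of_eventuallyEq hev)
    have h1 := congrArg (fun L => L v) h0
    simp only [_root_.sum_apply, hDv, _root_.zero_apply,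
      ← Finset.mul_sum, mul_eq_zero, OfNat.ofNat_ne_zero, false_or] at h1
    simp only [hermProd, Complex.re_sum, Complex.mul_re, Complex.conj_re, Complex.conj_im]
    rw [← h1]
    exact Finset.sum_congr rfl fun j _ => by ring
  have hν : brieskornNormal a x ≠ 0 := by
    obtain ⟨j, hj⟩ := Function.ne_iff.1 hx0
    refine Function.ne_iff.2 ⟨j, ?_⟩
    have h1 : (a j : ℂ) ≠ 0 := Nat.cast_ne_zero.2 (ha j).ne'
    simpa [brieskornNormal, (ha j).ne'] using fun h => absurd h hj
  -- The differentiated cone equation at T P is transported to x by the dilation. All terms acquire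
  -- the same factor exp(Mτ) because every product of a weight and an exponent equals M.
  have hνA : ∀ v, hermProd (brieskornNormal a x) (A' v) = 0 := by
    intro v
    have hj := hasFDerivAt_pi'.1 hA
    have hsum : HasFDerivAt (fun Q => ∑ j, T Q j ^ a j) (∑ j, _) P :=
      HasFDerivAt.fun_sum (u := Finset.univ) fun j _ => (hj j).pow (a j)
    have h0 := hsum.unique ((hasFDerivAt_const (0 : ℂ) P).congr_of_eventuallyEq hT)
    have h1 := congrArg (fun L => L v) h0
    simp at h1
    have h2 : hermProd (brieskornNormal a x) (A' v) =
        ((Real.exp (M * τ) : ℝ) : ℂ) * ∑ j, (a j : ℂ) * T P j ^ (a j - 1) * (A v) j := by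
      rw [hermProd, Finset.mul_sum]
      refine Finset.sum_congr rfl fun j _ => ?_
      rw [brieskornNormal, Complex.conj_conj, hA']
      simp only [hx, toSphere, dilate]
      have h3 : ((Real.exp (M * τ) : ℝ) : ℂ) = ((Real.exp (w j * τ) : ℝ) : ℂ) ^ (a j - 1) *
          ((Real.exp (w j * τ) : ℝ) : ℂ) := by
        rw [← pow_succ, Nat.sub_add_cancel (ha j), ← Complex.ofReal_pow, ← Real.exp_nat_mul, ← hM j]
        push_cast
        ring_nf
      rw [h3, mul_pow]
      ring
    rw [h2]
    have h4 : ∑ j, (a j : ℂ) * T P j ^ (a j - 1) * (A v) j = 0 := by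
      rw [← h1]
    rw [h4, mul_zero]
  have hres := det6_pos_of_det4_pos A' hA'inj hν hνA (l (A (g' (1, 0))))
    (l (A (g' (Complex.I, 0)))) (l (A (g' (0, 1)))) hdet
    (by rw [hA'E]; exact hermProd_eulerField_re_pos hw hx0)
    (by rw [← hfd]; exact horth _) (by rw [← hfd]; exact horth _) (by rw [← hfd]; exact horth _)
  rw [← hfd, ← hfd, ← hfd] at hres
  rw [IsPositiveFrame, hgo]
  rw [det6] at hres
  convert hres using 3
  funext i
  fin_cases i <;> rfl

/-! ## Orientation-preserving maps of the plane -/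

/-- `G` is real differentiable at `z` with positive Jacobian determinant. -/
def PosJacAt (G : ℂ → ℂ) (z : ℂ) : Prop :=
  ∃ L : ℂ →L[ℝ] ℂ, HasFDerivAt G L z ∧ 0 < (L 1).re * (L Complex.I).im - (L 1).im * (L Complex.I).re

lemma realLinear_apply (L : ℂ →L[ℝ] ℂ) (v : ℂ) : L v = v.re • L 1 + v.im • L Complex.I := by
  rw [← map_smul, ← map_smul, ← map_add]
  congr 1
  apply Complex.ext <;> simp

lemma PosJacAt.comp {F G : ℂ → ℂ} {z : ℂ} (hF : PosJacAt F (G z)) (hG : PosJacAt G z) :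
    PosJacAt (fun x => F (G x)) z := by
  obtain ⟨L, hL, hL'⟩ := hF
  obtain ⟨K, hK, hK'⟩ := hG
  refine ⟨L.comp K, hL.comp z hK, ?_⟩
  simp only [ContinuousLinearMap.comp_apply]
  rw [realLinear_apply L (K 1), realLinear_apply L (K Complex.I)]
  refine (mul_pos hL' hK').trans_eq ?_
  simp
  ring

lemma PosJacAt.congr {F G : ℂ → ℂ} {z : ℂ} (hF : PosJacAt F z) (h : G =ᶠ[𝓝 z] F) :
    PosJacAt G z := by
  obtain ⟨L, hL, hL'⟩ := hF
  exact ⟨L, hL.congr_of_eventuallyEq h, hL'⟩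

lemma HasDerivAt.posJacAt {F : ℂ → ℂ} {F' z : ℂ} (hF : HasDerivAt F F' z) (h : F' ≠ 0) :
    PosJacAt F z := by
  refine ⟨_, hF.hasFDerivAt.restrictScalars ℝ, ?_⟩
  have := Complex.normSq_pos.2 h
  rw [Complex.normSq_apply] at this
  simpa using this

lemma posJacAt_id (z : ℂ) : PosJacAt (fun x => x) z :=
  (hasDerivAt_id z).posJacAt one_ne_zero

/-! ## The direction of a complex number -/

/-- The direction of a nonzero complex number. -/
def dir (z : ℂ) : ℂ := z / (‖z‖ : ℂ)

lemma norm_dir {z : ℂ} (hz : z ≠ 0) : ‖dir z‖ = 1 := by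
  rw [dir, norm_div, Complex.norm_real, norm_norm, div_self (norm_ne_zero_iff.2 hz)]

lemma dir_ne_zero {z : ℂ} (hz : z ≠ 0) : dir z ≠ 0 := by
  rw [← norm_ne_zero_iff, norm_dir hz]; exact one_ne_zero

lemma norm_mul_dir (z : ℂ) : (‖z‖ : ℂ) * dir z = z := by
  rcases eq_or_ne z 0 with rfl | hz
  · simp
  · rw [dir, mul_div_cancel₀]
    exact_mod_cast norm_ne_zero_iff.2 hz

lemma dir_mul (x y : ℂ) : dir (x * y) = dir x * dir y := by
  rw [dir, dir, dir, norm_mul, Complex.ofReal_mul, mul_div_mul_comm]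

lemma dir_inv (x : ℂ) : dir x⁻¹ = (dir x)⁻¹ := by
  rw [dir, dir, norm_inv, inv_div, Complex.ofReal_inv, div_eq_mul_inv, inv_inv, mul_comm,
    div_eq_mul_inv]

lemma dir_pow (x : ℂ) (n : ℕ) : dir (x ^ n) = dir x ^ n := by
  rw [dir, dir, norm_pow, Complex.ofReal_pow, div_pow]

lemma dir_ofReal {t : ℝ} (ht : 0 < t) : dir (t : ℂ) = 1 := by
  rw [dir, Complex.norm_real, Real.norm_of_nonneg ht.le, div_self]
  exact_mod_cast ht.ne'

lemma dir_of_norm_eq_one {z : ℂ} (hz : ‖z‖ = 1) : dir z = z := by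
  rw [dir, hz, Complex.ofReal_one, div_one]

lemma dir_ofReal_mul {t : ℝ} (ht : 0 < t) (z : ℂ) : dir ((t : ℂ) * z) = dir z := by
  rw [dir_mul, dir_ofReal ht, one_mul]

lemma contDiffAt_dir {z : ℂ} (hz : z ≠ 0) : ContDiffAt ℝ ∞ dir z := by
  have h1 : ContDiffAt ℝ ∞ (fun x : ℂ => (‖x‖ : ℂ)) z :=
    Complex.ofRealCLM.contDiff.contDiffAt.comp z (contDiffAt_norm ℝ hz)
  have h2 : ContDiffAt ℝ ∞ (fun x : ℂ => x * (‖x‖ : ℂ)⁻¹) z :=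
    contDiffAt_id.mul (h1.inv (by exact_mod_cast norm_ne_zero_iff.2 hz))
  exact h2

/-- The logarithmic derivative of ‖G‖ is the real part of that of G; it is read off from two
expressions for the derivative of ‖z‖². -/
lemma hasFDerivAt_norm_complex {X : Type*} [NormedAddCommGroup X] [NormedSpace ℝ X] {G : X → ℂ}
    {L : X →L[ℝ] ℂ} {x : X} (hG : HasFDerivAt G L x) (h0 : G x ≠ 0) :
    ∃ D : X →L[ℝ] ℝ, HasFDerivAt (fun y => ‖G y‖) D x ∧
      ∀ v, D v = ‖G x‖ * (L v / G x).re := by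
  have hd : DifferentiableAt ℝ (fun z : ℂ => ‖z‖) (G x) :=
    (contDiffAt_norm ℝ h0 (n := 1)).differentiableAt one_ne_zero
  refine ⟨_, hd.hasFDerivAt.comp x hG, fun v => ?_⟩
  set D := fderiv ℝ (fun z : ℂ => ‖z‖) (G x) with hD
  have hn := norm_pos_iff.2 h0
  have h1 : HasFDerivAt (fun z : ℂ => ‖z‖ ^ 2) _ (G x) := hd.hasFDerivAt.pow 2
  have h2 : HasFDerivAt (fun z : ℂ => z.re * z.re + z.im * z.im) _ (G x) :=
    (Complex.reCLM.hasFDerivAt.mul Complex.reCLM.hasFDerivAt).add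
      (Complex.imCLM.hasFDerivAt.mul Complex.imCLM.hasFDerivAt)
  have h3 : (fun z : ℂ => ‖z‖ ^ 2) = fun z : ℂ => z.re * z.re + z.im * z.im := by
    funext z; rw [Complex.sq_norm, Complex.normSq_apply]
  rw [h3] at h1
  have h4 := congrArg (fun K => K (L v)) (h1.unique h2)
  simp [← hD] at h4
  rw [ContinuousLinearMap.comp_apply, Complex.div_re, Complex.normSq_eq_norm_sq]
  field_simp
  linarith

/-- The logarithmic derivative of the direction is the imaginary part of that of G: differentiate
‖G‖ · dir G = G and take away the contribution of the norm. -/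
lemma hasFDerivAt_dir {X : Type*} [NormedAddCommGroup X] [NormedSpace ℝ X] {G : X → ℂ}
    {L : X →L[ℝ] ℂ} {x : X} (hG : HasFDerivAt G L x) (h0 : G x ≠ 0) :
    ∃ D : X →L[ℝ] ℂ, HasFDerivAt (fun y => dir (G y)) D x ∧
      ∀ v, D v = dir (G x) * ((L v / G x).im * Complex.I) := by
  have hd : DifferentiableAt ℝ dir (G x) := (contDiffAt_dir h0).differentiableAt (by simp)
  have hD := hd.hasFDerivAt.comp x hG
  refine ⟨_, hD, fun v => ?_⟩
  obtain ⟨N, hN, hNv⟩ := hasFDerivAt_norm_complex hG h0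
  have h1 : HasFDerivAt (fun y => (‖G y‖ : ℂ) * dir (G y)) _ x :=
    (Complex.ofRealCLM.hasFDerivAt.comp x hN).mul hD
  simp only [norm_mul_dir] at h1
  have h2 := congrArg (fun K => K v) (hG.unique h1)
  have hn : (‖G x‖ : ℂ) ≠ 0 := by exact_mod_cast norm_ne_zero_iff.2 h0
  simp [hNv] at h2
  rw [ContinuousLinearMap.comp_apply]
  have h3 : (‖G x‖ : ℂ) * dir (G x) * ((L v / G x).re + (L v / G x).im * Complex.I) = L v := by
    rw [Complex.re_add_im, norm_mul_dir, mul_div_cancel₀ _ h0]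
  apply mul_left_cancel₀ hn
  linear_combination -h2 - h3

/-! ## Blending of monotone functions -/

/-- A smooth nondecreasing function that is `0` up to `r` and `1` from `3 r / 2` on. -/
def ramp (r x : ℝ) : ℝ := Real.smoothTransition ((x - r) / (r / 2))

lemma ramp_of_le {r x : ℝ} (hr : 0 < r) (h : x ≤ r) : ramp r x = 0 :=
  Real.smoothTransition.zero_of_nonpos (div_nonpos_of_nonpos_of_nonneg (by linarith) (by linarith))

lemma ramp_of_ge {r x : ℝ} (hr : 0 < r) (h : 3 / 2 * r ≤ x) : ramp r x = 1 :=
  Real.smoothTransition.one_of_one_le (by rw [le_div_iff₀ (by linarith)]; linarith)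

lemma ramp_nonneg (r x : ℝ) : 0 ≤ ramp r x := Real.smoothTransition.nonneg _

lemma ramp_le_one (r x : ℝ) : ramp r x ≤ 1 := Real.smoothTransition.le_one _

lemma ramp_monotone {r : ℝ} (hr : 0 < r) : Monotone (ramp r) := fun x y h =>
  Real.smoothTransition.monotone (div_le_div_of_nonneg_right (by linarith) (by linarith))

lemma contDiff_ramp (r : ℝ) : ContDiff ℝ ∞ (ramp r) :=
  Real.smoothTransition.contDiff.comp ((contDiff_id.sub contDiff_const).div_const _)

/-- The function that is `f` up to `r` and `g` from `3 r / 2` on. -/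
def blend (r : ℝ) (f g : ℝ → ℝ) (x : ℝ) : ℝ := (1 - ramp r x) * f x + ramp r x * g x

lemma blend_of_le {r x : ℝ} (hr : 0 < r) (h : x ≤ r) (f g : ℝ → ℝ) : blend r f g x = f x := by
  simp [blend, ramp_of_le hr h]

lemma blend_of_ge {r x : ℝ} (hr : 0 < r) (h : 3 / 2 * r ≤ x) (f g : ℝ → ℝ) :
    blend r f g x = g x := by
  simp [blend, ramp_of_ge hr h]

lemma contDiffAt_blend {r x : ℝ} {f g : ℝ → ℝ} (hf : ContDiffAt ℝ ∞ f x)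
    (hg : ContDiffAt ℝ ∞ g x) : ContDiffAt ℝ ∞ (blend r f g) x :=
  ((contDiffAt_const.sub (contDiff_ramp r).contDiffAt).mul hf).add
    ((contDiff_ramp r).contDiffAt.mul hg)

/-- The derivative is (1 - ρ) f' + ρ g' + ρ' (g - f) with ρ the ramp. The last term is nonnegative
because ρ' vanishes outside the transition interval and f ≤ g on it. -/
lemma exists_hasDerivAt_blend_pos {r x f' g' : ℝ} {f g : ℝ → ℝ} (hr : 0 < r)
    (hf : HasDerivAt f f' x) (hg : HasDerivAt g g' x) (hf' : x ≤ 3 / 2 * r → 0 < f')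
    (hg' : r ≤ x → 0 < g') (hfg : r ≤ x → x ≤ 3 / 2 * r → f x ≤ g x) :
    ∃ d, 0 < d ∧ HasDerivAt (blend r f g) d x := by
  have hρ : HasDerivAt (ramp r) (deriv (ramp r) x) x :=
    ((contDiff_ramp r).contDiffAt.differentiableAt (by simp)).hasDerivAt
  have hρ0 : 0 ≤ deriv (ramp r) x := (ramp_monotone hr).deriv_nonneg
  have h1 : HasDerivAt (blend r f g) _ x := ((hρ.const_sub 1).mul hf).add (hρ.mul hg)
  refine ⟨_, ?_, h1⟩
  have e1 : x ≤ r → ramp r x = 0 := ramp_of_le hr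
  have e2 : 3 / 2 * r ≤ x → ramp r x = 1 := ramp_of_ge hr
  have hD : 0 ≤ deriv (ramp r) x * (g x - f x) := by
    rcases lt_or_ge x r with h | h
    · have : deriv (ramp r) x = 0 := by
        have : ramp r =ᶠ[𝓝 x] fun _ => 0 := by
          filter_upwards [gt_mem_nhds h] with y hy using ramp_of_le hr hy.le
        rw [this.deriv_eq, deriv_const]
      rw [this, zero_mul]
    rcases lt_or_ge (3 / 2 * r) x with h' | h'
    · have : deriv (ramp r) x = 0 := by
        have : ramp r =ᶠ[𝓝 x] fun _ => 1 := by
          filter_upwards [lt_mem_nhds h'] with y hy using ramp_of_ge hr hy.le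
        rw [this.deriv_eq, deriv_const]
      rw [this, zero_mul]
    exact mul_nonneg hρ0 (sub_nonneg.2 (hfg h h'))
  have h0 := ramp_nonneg r x
  have h1 := ramp_le_one r x
  have hs : 0 < (1 - ramp r x) * f' + ramp r x * g' := by
    rcases lt_or_ge x r with h | h
    · rw [e1 h.le]; linarith [hf' (by linarith)]
    rcases lt_or_ge (3 / 2 * r) x with h' | h'
    · rw [e2 h'.le]; linarith [hg' h]
    · rcases h0.eq_or_lt with h2 | h2
      · rw [← h2]; linarith [hf' h']
      · have := mul_pos h2 (hg' h)
        have := mul_nonneg (sub_nonneg.2 h1) (hf' h').le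
        linarith
  linarith

lemma strictMonoOn_of_hasDerivAt_pos {f : ℝ → ℝ} (h : ∀ x, 0 < x → ∃ d, 0 < d ∧ HasDerivAt f d x) :
    StrictMonoOn f (Set.Ioi 0) := by
  refine strictMonoOn_of_deriv_pos (convex_Ioi 0) (fun x hx => ?_) fun x hx => ?_
  · obtain ⟨d, _, hd⟩ := h x hx
    exact hd.continuousAt.continuousWithinAt
  · rw [interior_Ioi] at hx
    obtain ⟨d, hd0, hd⟩ := h x hx
    rwa [hd.deriv]

/-! ## Straightening local coordinates -/

/-- A smooth cutoff function: `1` on the unit disc, `0` outside the disc of radius `2`. -/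
def cutoff : ContDiffBump (0 : ℂ) := ⟨1, 2, one_pos, one_lt_two⟩

lemma cutoff_of_le {r : ℝ} (hr : 0 < r) {ζ : ℂ} (h : ‖ζ‖ ≤ r) : cutoff (ζ / r) = 1 := by
  refine cutoff.one_of_mem_closedBall ?_
  rw [mem_closedBall_zero_iff, norm_div, Complex.norm_real, Real.norm_of_nonneg hr.le]
  exact (div_le_one hr).2 h

lemma cutoff_of_ge {r : ℝ} (hr : 0 < r) {ζ : ℂ} (h : 2 * r ≤ ‖ζ‖) : cutoff (ζ / r) = 0 := by
  refine cutoff.zero_of_le_dist ?_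
  rw [dist_zero_right, norm_div, Complex.norm_real, Real.norm_of_nonneg hr.le]
  exact (le_div_iff₀ hr).2 h

lemma exists_lipschitz_cutoff : ∃ C : ℝ, 0 ≤ C ∧ ∀ r : ℝ, 0 < r → ∀ x y : ℂ,
    |cutoff (x / r) - cutoff (y / r)| ≤ C / r * ‖x - y‖ := by
  have h1 : ContDiff ℝ 1 (cutoff : ℂ → ℝ) := cutoff.contDiff
  obtain ⟨C, hC⟩ := h1.lipschitzWith_of_hasCompactSupport cutoff.hasCompactSupport (by simp)
  refine ⟨C, C.2, fun r hr x y => ?_⟩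
  have := hC.dist_le_mul (x / r) (y / r)
  rw [Real.dist_eq, dist_eq_norm, ← sub_div, norm_div, Complex.norm_real,
    Real.norm_of_nonneg hr.le] at this
  refine this.trans_eq ?_
  ring

/-- The scales cancel: the cutoff of radius r has Lipschitz constant C / r, while e is at most η ·
2r where the cutoff is nonzero, since e vanishes to second order. -/
lemma exists_cutoff_lipschitz {e : ℂ → ℂ} (he : HasStrictFDerivAt e (0 : ℂ →L[ℝ] ℂ) 0)
    (he0 : e 0 = 0) {ε : ℝ} (hε : 0 < ε) : ∃ δ : ℝ, 0 < δ ∧ ∀ r : ℝ, 0 < r → 2 * r < δ → ∀ x y : ℂ,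
      ‖cutoff (x / r) • e x - cutoff (y / r) • e y‖ ≤ ε * ‖x - y‖ := by
  obtain ⟨C, hC0, hC⟩ := exists_lipschitz_cutoff
  -- The product rule yields the constant η · 2C + η, which is ε.
  set η : ℝ := ε / (1 + 2 * C) with hη
  have hη0 : 0 < η := by positivity
  obtain ⟨s, hs, hl⟩ := he.exists_lipschitzOnWith_of_nnnorm_lt ⟨η, hη0.le⟩
    (by rw [nnnorm_zero]; exact hη0)
  obtain ⟨δ, hδ, hδs⟩ := Metric.mem_nhds_iff.1 hs
  have hlip : ∀ x y, ‖x‖ < δ → ‖y‖ < δ → ‖e x - e y‖ ≤ η * ‖x - y‖ := by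
    intro x y hx hy
    have := hl.dist_le_mul x (hδs (by simpa using hx)) y (hδs (by simpa using hy))
    rwa [dist_eq_norm, dist_eq_norm] at this
  have he1 : ∀ x, ‖x‖ < δ → ‖e x‖ ≤ η * ‖x‖ := fun x hx => by
    simpa [he0] using hlip x 0 hx (by simpa using hδ)
  refine ⟨δ, hδ, fun r hr hrδ => ?_⟩
  have key : ∀ x y : ℂ, ‖x‖ < 2 * r →
      ‖cutoff (x / r) • e x - cutoff (y / r) • e y‖ ≤ ε * ‖x - y‖ := by
    intro x y hx
    have hx' : ‖e x‖ * |cutoff (x / r) - cutoff (y / r)| ≤ η * (2 * r) * (C / r * ‖x - y‖) := by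
      refine mul_le_mul ((he1 x (by linarith)).trans ?_) (hC r hr x y) (abs_nonneg _) (by positivity)
      exact mul_le_mul_of_nonneg_left hx.le hη0.le
    have h2 : η * (2 * r) * (C / r * ‖x - y‖) = η * (2 * C) * ‖x - y‖ := by field_simp
    have h3 : ε * ‖x - y‖ = η * (2 * C) * ‖x - y‖ + η * ‖x - y‖ := by rw [hη]; field_simp; ring
    rw [h2] at hx'
    have hxy : ‖cutoff (x / r) • e x - cutoff (y / r) • e y‖ ≤
        ‖e x‖ * |cutoff (x / r) - cutoff (y / r)| + ‖cutoff (y / r) • (e x - e y)‖ := by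
      have : cutoff (x / r) • e x - cutoff (y / r) • e y =
          (cutoff (x / r) - cutoff (y / r)) • e x + cutoff (y / r) • (e x - e y) := by
        rw [sub_smul, smul_sub]; abel
      rw [this]
      refine (norm_add_le _ _).trans (add_le_add_left (le_of_eq ?_) _)
      rw [norm_smul, Real.norm_eq_abs, mul_comm]
    have hlast : ‖cutoff (y / r) • (e x - e y)‖ ≤ η * ‖x - y‖ := by
      rcases lt_or_ge ‖y‖ (2 * r) with hy | hy
      · rw [norm_smul, Real.norm_of_nonneg cutoff.nonneg]
        refine (mul_le_of_le_one_left (norm_nonneg _) cutoff.le_one).trans ?_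
        exact hlip x y (by linarith) (by linarith)
      · rw [cutoff_of_ge hr hy, zero_smul, norm_zero]; positivity
    linarith
  intro x y
  rcases lt_or_ge ‖x‖ (2 * r) with hx | hx
  · exact key x y hx
  rcases lt_or_ge ‖y‖ (2 * r) with hy | hy
  · rw [norm_sub_rev, norm_sub_rev x]; exact key y x hy
  · rw [cutoff_of_ge hr hx, cutoff_of_ge hr hy]
    simp only [zero_smul, sub_self, norm_zero]; positivity

lemma contDiff_cutoff_smul {e : ℂ → ℂ} {δ r : ℝ} (hr : 0 < r) (hrδ : 2 * r < δ)
    (he : ∀ ζ : ℂ, ‖ζ‖ < δ → ContDiffAt ℝ ∞ e ζ) :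
    ContDiff ℝ ∞ fun ζ : ℂ => cutoff (ζ / r) • e ζ := by
  rw [contDiff_iff_contDiffAt]
  intro ζ
  rcases lt_or_ge ‖ζ‖ δ with h | h
  · have h1 : ContDiffAt ℝ ∞ (fun ζ : ℂ => ζ / (r : ℂ)) ζ := contDiffAt_id.div_const _
    have h2 : ContDiffAt ℝ ∞ (fun ζ : ℂ => cutoff (ζ / r)) ζ :=
      ContDiffAt.comp ζ (f := fun ζ : ℂ => ζ / (r : ℂ)) cutoff.contDiffAt h1
    exact h2.smul (he ζ h)
  · have : (fun ζ : ℂ => cutoff (ζ / r) • e ζ) =ᶠ[𝓝 ζ] fun _ => 0 := by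
      have : ∀ᶠ x in 𝓝 ζ, 2 * r < ‖x‖ := continuous_norm.continuousAt.eventually
        (lt_mem_nhds (by linarith))
      filter_upwards [this] with x hx
      rw [cutoff_of_ge hr hx.le, zero_smul]
    exact contDiffAt_const.congr_of_eventuallyEq this

/-- A map that differs from the identity by a small Lipschitz map is a diffeomorphism. -/
lemma bijective_of_lipschitz_sub_id {p : ℂ → ℂ} (hp : ∀ x y, ‖p x - p y‖ ≤ 1 / 4 * ‖x - y‖) :
    Function.Bijective fun z => z + p z := by
  constructor
  · intro x y hxy
    have h1 : x - y = p y - p x := by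
      have : x + p x = y + p y := hxy
      linear_combination this
    have h2 := hp y x
    rw [← h1, norm_sub_rev y x] at h2
    have h3 : ‖x - y‖ ≤ 0 := by linarith [norm_nonneg (x - y)]
    exact sub_eq_zero.1 (norm_le_zero_iff.1 h3)
  · intro y
    -- A solution of z + p z = y is a fixed point of z ↦ y - p z.
    have hc : ContractingWith (1 / 4 : NNReal) fun x => y - p x := by
      refine ⟨by norm_num [← NNReal.coe_lt_coe], LipschitzWith.of_dist_le_mul fun a b => ?_⟩
      rw [dist_eq_norm, dist_eq_norm, sub_sub_sub_cancel_left, norm_sub_rev]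
      simpa using hp a b
    refine ⟨hc.fixedPoint, ?_⟩
    have := hc.fixedPoint_isFixedPt
    rw [Function.IsFixedPt] at this
    change hc.fixedPoint + p hc.fixedPoint = y
    nth_rw 1 [← this]
    ring

/-- The entries of the derivative of p are at most 1/4 in absolute value, so the Jacobian of the sum
is at least (3/4)² - (1/4)² > 0. -/
lemma posJacAt_of_lipschitz_sub_id {p : ℂ → ℂ} (hp : ∀ x y, ‖p x - p y‖ ≤ 1 / 4 * ‖x - y‖) {z : ℂ}
    (hd : DifferentiableAt ℝ p z) : PosJacAt (fun z => z + p z) z := by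
  refine ⟨_, (hasFDerivAt_id z).add hd.hasFDerivAt, ?_⟩
  have hL : ‖fderiv ℝ p z‖ ≤ 1 / 4 := by
    have : LipschitzWith (1 / 4 : NNReal) p := LipschitzWith.of_dist_le_mul fun a b => by
      rw [dist_eq_norm, dist_eq_norm]; simpa using hp a b
    simpa using norm_fderiv_le_of_lipschitz ℝ this (x₀ := z)
  have h1 := (fderiv ℝ p z).le_opNorm 1
  have h2 := (fderiv ℝ p z).le_opNorm Complex.I
  rw [norm_one, mul_one] at h1
  rw [Complex.norm_I, mul_one] at h2
  set m1 := fderiv ℝ p z 1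
  set m2 := fderiv ℝ p z Complex.I
  simp only [_root_.add_apply, ContinuousLinearMap.id_apply,
    Complex.add_re, Complex.add_im, Complex.one_re, Complex.one_im, Complex.I_re, Complex.I_im]
  have a1 := abs_le.1 ((Complex.abs_re_le_norm m1).trans (h1.trans hL))
  have a2 := abs_le.1 ((Complex.abs_im_le_norm m1).trans (h1.trans hL))
  have a3 := abs_le.1 ((Complex.abs_re_le_norm m2).trans (h2.trans hL))
  have a4 := abs_le.1 ((Complex.abs_im_le_norm m2).trans (h2.trans hL))
  nlinarith

/-- A diffeomorphism of the plane, supported near the points `c α`, that equals a prescribed map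
with derivative the identity near each of these points. -/
structure Straightening {ι : Type*} (c : ι → ℂ) (κ : ι → ℂ → ℂ) (ρ : ℝ) where
  toFun : ℂ → ℂ
  radius : ℝ
  radius_pos : 0 < radius
  radius_le : 2 * radius ≤ ρ
  contDiff : ContDiff ℝ ∞ toFun
  posJacAt : ∀ z, PosJacAt toFun z
  bijective : Function.Bijective toFun
  eq_near : ∀ α ζ, ‖ζ‖ ≤ radius → toFun (c α + ζ) = κ α ζ
  eq_self : ∀ z, (∀ α, ρ ≤ ‖z - c α‖) → toFun z = z

/-- The errors e = κ - c - ζ vanish to second order at the centres. Cut off on sufficiently small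
discs, they have disjoint supports and a small total Lipschitz constant, and the identity plus their
sum is the required diffeomorphism. -/
theorem nonempty_straightening {ι : Type*} [Fintype ι] {c : ι → ℂ} {κ : ι → ℂ → ℂ} {ρ : ℝ}
    (hρ : 0 < ρ) (hc : ∀ α β, α ≠ β → 2 * ρ ≤ ‖c α - c β‖) (hκ0 : ∀ α, κ α 0 = c α)
    (hκ : ∀ α, ∀ᶠ ζ in 𝓝 0, ContDiffAt ℝ ∞ (κ α) ζ) (hκ1 : ∀ α, HasDerivAt (κ α) 1 0) :
    Nonempty (Straightening c κ ρ) := by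
  classical
  let e : ι → ℂ → ℂ := fun α ζ => κ α ζ - c α - ζ
  have he0 : ∀ α, e α 0 = 0 := fun α => by simp [e, hκ0]
  have hes : ∀ α, ∀ᶠ ζ in 𝓝 0, ContDiffAt ℝ ∞ (e α) ζ := fun α => by
    filter_upwards [hκ α] with ζ hζ
    exact (hζ.sub contDiffAt_const).sub contDiffAt_id
  have hed : ∀ α, HasStrictFDerivAt (e α) (0 : ℂ →L[ℝ] ℂ) 0 := fun α => by
    have h1 : HasDerivAt (e α) (1 - 1) 0 := ((hκ1 α).sub_const (c α)).sub (hasDerivAt_id 0)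
    have h2 := h1.hasFDerivAt.restrictScalars ℝ
    refine ((hes α).self_of_nhds).hasStrictFDerivAt' (h2.congr_fderiv ?_) (by simp)
    ext <;> simp
  -- The sum of the constants over all centres then stays below 1/4.
  set ε : ℝ := 1 / (4 * (Fintype.card ι + 1)) with hε
  have hε0 : 0 < ε := by positivity
  choose δ hδ hlip using fun α => exists_cutoff_lipschitz (hed α) (he0 α) hε0
  choose δ' hδ' hsm using fun α => Metric.eventually_nhds_iff.1 (hes α)
  obtain ⟨r, hr, hrρ, hrδ⟩ : ∃ r : ℝ, 0 < r ∧ 2 * r ≤ ρ ∧ ∀ α, 2 * r < δ α ∧ 2 * r < δ' α := by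
    have : ∀ᶠ r : ℝ in 𝓝[>] 0, 0 < r ∧ 2 * r ≤ ρ ∧ ∀ α, 2 * r < δ α ∧ 2 * r < δ' α := by
      have ht : Tendsto (fun r : ℝ => 2 * r) (𝓝[>] 0) (𝓝 0) := by
        have : Tendsto (fun r : ℝ => 2 * r) (𝓝 0) (𝓝 (2 * 0)) := tendsto_id.const_mul 2
        rw [mul_zero] at this
        exact this.mono_left nhdsWithin_le_nhds
      have h0 : ∀ᶠ r : ℝ in 𝓝[>] 0, 0 < r := self_mem_nhdsWithin
      refine h0.and ((ht.eventually (ge_mem_nhds hρ)).and ?_)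
      refine eventually_all.2 fun α => ?_
      exact (ht.eventually (gt_mem_nhds (hδ α))).and (ht.eventually (gt_mem_nhds (hδ' α)))
    obtain ⟨r, h⟩ := this.exists
    exact ⟨r, h.1, h.2⟩
  let q : ι → ℂ → ℂ := fun α ζ => cutoff (ζ / r) • e α ζ
  let p : ℂ → ℂ := fun z => ∑ α, q α (z - c α)
  have hp : ∀ x y, ‖p x - p y‖ ≤ 1 / 4 * ‖x - y‖ := by
    intro x y
    have h1 : ‖p x - p y‖ ≤ ∑ α : ι, ε * ‖x - y‖ := by
      simp only [p]
      rw [← Finset.sum_sub_distrib]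
      refine norm_sum_le_of_le _ fun α _ => ?_
      have := hlip α r hr (hrδ α).1 (x - c α) (y - c α)
      rwa [sub_sub_sub_cancel_right] at this
    refine h1.trans ?_
    rw [Finset.sum_const, Finset.card_univ, nsmul_eq_mul, ← mul_assoc]
    refine mul_le_mul_of_nonneg_right ?_ (norm_nonneg _)
    rw [hε, mul_one_div, div_le_div_iff₀ (by positivity) (by norm_num)]
    linarith
  have hps : ContDiff ℝ ∞ p := by
    refine ContDiff.sum fun α _ => ?_
    have : ContDiff ℝ ∞ (q α) := contDiff_cutoff_smul hr (hrδ α).2 fun ζ hζ =>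
      hsm α (by simpa using hζ)
    exact this.comp (contDiff_id.sub contDiff_const)
  have hq0 : ∀ α z, 2 * r ≤ ‖z - c α‖ → q α (z - c α) = 0 := fun α z h => by
    simp only [q]; rw [cutoff_of_ge hr h, zero_smul]
  refine ⟨⟨fun z => z + p z, r, hr, hrρ, contDiff_id.add hps, fun z => ?_,
    bijective_of_lipschitz_sub_id hp, fun α ζ hζ => ?_, fun z hz => ?_⟩⟩
  · exact posJacAt_of_lipschitz_sub_id hp (hps.contDiffAt.differentiableAt (by simp))
  · have : p (c α + ζ) = e α ζ := by
      simp only [p]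
      rw [Finset.sum_eq_single α]
      · simp only [q, add_sub_cancel_left]
        rw [cutoff_of_le hr hζ, one_smul]
      · intro β _ hβ
        apply hq0
        have h1 := hc α β (Ne.symm hβ)
        have h2 : c α + ζ - c β = (c α - c β) - (-ζ) := by ring
        have h3 := norm_sub_norm_le (c α - c β) (-ζ)
        rw [h2]
        rw [norm_neg] at h3
        linarith
      · simp
    change c α + ζ + p (c α + ζ) = κ α ζ
    rw [this]
    simp only [e]; ring
  · have : p z = 0 := Finset.sum_eq_zero fun α _ => hq0 α z (hrρ.trans (hz α))
    change z + p z = z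
    rw [this, add_zero]

/-! ## Radial blow-up of punctures -/

/-- A radial profile: a diffeomorphism of `(0, ∞)` onto `(b, ∞)` that is the identity from `s`
on. -/
structure IsRadialProfile (a : ℝ → ℝ) (b s : ℝ) : Prop where
  s_pos : 0 < s
  contDiffAt : ∀ x, 0 < x → ContDiffAt ℝ ∞ a x
  deriv_pos : ∀ x, 0 < x → ∃ d, 0 < d ∧ HasDerivAt a d x
  eq_self : ∀ x, s ≤ x → a x = x
  b_nonneg : 0 ≤ b
  lt : ∀ x, 0 < x → b < a x
  exists_eq : ∀ y, b < y → ∃ x, 0 < x ∧ a x = y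

namespace IsRadialProfile

variable {a : ℝ → ℝ} {b s : ℝ}

lemma pos (h : IsRadialProfile a b s) {x : ℝ} (hx : 0 < x) : 0 < a x :=
  h.b_nonneg.trans_lt (h.lt x hx)

lemma strictMonoOn (h : IsRadialProfile a b s) : StrictMonoOn a (Set.Ioi 0) :=
  strictMonoOn_of_hasDerivAt_pos h.deriv_pos

lemma lt_iff (h : IsRadialProfile a b s) {x : ℝ} (hx : 0 < x) : a x < s ↔ x < s := by
  have := h.strictMonoOn.lt_iff_lt (Set.mem_Ioi.2 hx) (Set.mem_Ioi.2 h.s_pos)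
  rwa [h.eq_self s le_rfl] at this

end IsRadialProfile

/-- The profile `f` near `0`, blended into the identity. -/
lemma isRadialProfile_blend {r : ℝ} (hr : 0 < r) {f : ℝ → ℝ} (hf : ContDiff ℝ ∞ f)
    (hf' : ∀ x, 0 ≤ x → ∃ d, 0 < d ∧ HasDerivAt f d x) (hf0 : 0 ≤ f 0)
    (hfr : f (3 / 2 * r) ≤ r) :
    IsRadialProfile (blend r f fun x => x) (f 0) (3 / 2 * r) := by
  have hd : ∀ x, 0 < x → ∃ d, 0 < d ∧ HasDerivAt (blend r f fun x => x) d x := by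
    intro x hx
    obtain ⟨d, hd0, hd⟩ := hf' x hx.le
    refine exists_hasDerivAt_blend_pos hr hd (hasDerivAt_id x) (fun _ => hd0)
      (fun _ => one_pos) fun h1 h2 => ?_
    have hm : StrictMonoOn f (Set.Ioi 0) :=
      strictMonoOn_of_hasDerivAt_pos fun x hx => hf' x hx.le
    have := hm.monotoneOn (Set.mem_Ioi.2 hx) (Set.mem_Ioi.2 (by linarith : 0 < 3 / 2 * r)) h2
    linarith
  have hm := strictMonoOn_of_hasDerivAt_pos hd
  have hf0m : ∀ x, 0 < x → f 0 < f x := by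
    intro x hx
    have : StrictMonoOn f (Set.Ici 0) := by
      refine strictMonoOn_of_deriv_pos (convex_Ici 0) hf.continuous.continuousOn fun y hy => ?_
      rw [interior_Ici] at hy
      obtain ⟨d, hd0, hd⟩ := hf' y (le_of_lt hy)
      rwa [hd.deriv]
    exact this (Set.mem_Ici.2 le_rfl) (Set.mem_Ici.2 hx.le) hx
  have hlt : ∀ x, 0 < x → f 0 < blend r f (fun x => x) x := by
    intro x hx
    rcases le_or_gt x r with h | h
    · rw [blend_of_le hr h]; exact hf0m x hx
    · have h1 := hm (Set.mem_Ioi.2 hr) (Set.mem_Ioi.2 hx) h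
      rw [blend_of_le hr le_rfl] at h1
      exact (hf0m r hr).trans h1
  refine ⟨by positivity, fun x hx => contDiffAt_blend hf.contDiffAt contDiffAt_id, hd,
    fun x hx => blend_of_ge hr hx _ _, hf0, hlt, fun y hy => ?_⟩
  obtain ⟨x₀, hx₀, hx₀r, hx₀y⟩ : ∃ x, 0 < x ∧ x ≤ r ∧ f x < y := by
    have h1 : ∀ᶠ x in 𝓝[>] (0 : ℝ), f x < y :=
      nhdsWithin_le_nhds (hf.continuous.continuousAt.eventually (gt_mem_nhds hy))
    have h2 : ∀ᶠ x in 𝓝[>] (0 : ℝ), x ≤ r := nhdsWithin_le_nhds (ge_mem_nhds hr)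
    have h3 : ∀ᶠ x in 𝓝[>] (0 : ℝ), 0 < x := self_mem_nhdsWithin
    obtain ⟨x, hx⟩ := (h1.and (h2.and h3)).exists
    exact ⟨x, hx.2.2, hx.2.1, hx.1⟩
  set x₁ := max (3 / 2 * r) y with hx₁
  have h01 : x₀ ≤ x₁ := hx₀r.trans ((by linarith : r ≤ 3 / 2 * r).trans (le_max_left _ _))
  have hc : ContinuousOn (blend r f fun x => x) (Set.Icc x₀ x₁) := fun x hx => by
    obtain ⟨d, _, hd⟩ := hd x (hx₀.trans_le hx.1)
    exact hd.continuousAt.continuousWithinAt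
  have := intermediate_value_Icc h01 hc
  obtain ⟨x, hx, hxy⟩ := this (show y ∈ Set.Icc _ _ from ⟨by rw [blend_of_le hr hx₀r]; exact hx₀y.le,
    by rw [blend_of_ge hr (le_max_left _ _)]; exact le_max_right _ _⟩)
  exact ⟨x, hx₀.trans_le hx.1, hxy⟩

lemma contDiffAt_radial {a : ℝ → ℝ} {ζ : ℂ} (hζ : ζ ≠ 0) (ha : ContDiffAt ℝ ∞ a ‖ζ‖) :
    ContDiffAt ℝ ∞ (fun z : ℂ => (a ‖z‖ : ℂ) * dir z) ζ := by
  have h1 : ContDiffAt ℝ ∞ (fun z : ℂ => a ‖z‖) ζ := ha.comp ζ (contDiffAt_norm ℝ hζ)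
  exact (Complex.ofRealCLM.contDiff.contDiffAt.comp ζ h1).mul (contDiffAt_dir hζ)

/-- The logarithmic derivative of a radial rescaling. -/
lemma hasFDerivAt_radial {a : ℝ → ℝ} {d : ℝ} {ζ : ℂ} (hζ : ζ ≠ 0) (ha : HasDerivAt a d ‖ζ‖) :
    ∃ D : ℂ →L[ℝ] ℂ, HasFDerivAt (fun z : ℂ => (a ‖z‖ : ℂ) * dir z) D ζ ∧
      ∀ v, D v = dir ζ * (d * ‖ζ‖ * (v / ζ).re + a ‖ζ‖ * (v / ζ).im * Complex.I) := by
  obtain ⟨N, hN, hNv⟩ := hasFDerivAt_norm_complex (hasFDerivAt_id (𝕜 := ℝ) ζ) hζ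
  obtain ⟨K, hK, hKv⟩ := hasFDerivAt_dir (hasFDerivAt_id (𝕜 := ℝ) ζ) hζ
  have h1 : HasFDerivAt (fun z : ℂ => a ‖z‖) _ ζ := ha.comp_hasFDerivAt ζ hN
  refine ⟨_, (Complex.ofRealCLM.hasFDerivAt.comp ζ h1).mul hK, fun v => ?_⟩
  simp [hNv, hKv]
  ring

lemma posJacAt_radial {a : ℝ → ℝ} {d : ℝ} {ζ : ℂ} (hζ : ζ ≠ 0) (ha : HasDerivAt a d ‖ζ‖)
    (hd : 0 < d * a ‖ζ‖) : PosJacAt (fun z : ℂ => (a ‖z‖ : ℂ) * dir z) ζ := by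
  obtain ⟨D, hD, hDv⟩ := hasFDerivAt_radial hζ ha
  refine ⟨D, hD, ?_⟩
  have hn := norm_pos_iff.2 hζ
  have h1 : (D 1).re * (D Complex.I).im - (D 1).im * (D Complex.I).re =
      Complex.normSq (dir ζ) * (d * a ‖ζ‖ * ‖ζ‖ * (((1 : ℂ) / ζ).re * (Complex.I / ζ).im -
        ((1 : ℂ) / ζ).im * (Complex.I / ζ).re)) := by
    rw [hDv, hDv, Complex.normSq_apply]
    simp
    ring
  have h2 : ((1 : ℂ) / ζ).re * (Complex.I / ζ).im - ((1 : ℂ) / ζ).im * (Complex.I / ζ).re =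
      Complex.normSq ζ⁻¹ := by
    rw [one_div, div_eq_mul_inv, Complex.normSq_apply]
    simp
  rw [h1, h2]
  have h3 := Complex.normSq_pos.2 (dir_ne_zero hζ)
  have h4 := Complex.normSq_pos.2 (inv_ne_zero hζ)
  positivity

section BlowUp

variable {ι : Type*} [Fintype ι] {c : ι → ℂ} {a : ι → ℝ → ℝ} {b : ι → ℝ} {s ρ : ℝ}

/-- The radial map with profile `a α` about each of the points `c α`. -/
def blowUp (c : ι → ℂ) (a : ι → ℝ → ℝ) (z : ℂ) : ℂ :=
  z + ∑ α, ((a α ‖z - c α‖ - ‖z - c α‖ : ℝ) : ℂ) * dir (z - c α)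

lemma blowUp_of_forall_ge (ha : ∀ α, IsRadialProfile (a α) (b α) s) {z : ℂ}
    (hz : ∀ α, s ≤ ‖z - c α‖) : blowUp c a z = z := by
  rw [blowUp, Finset.sum_eq_zero, add_zero]
  intro α _
  rw [(ha α).eq_self _ (hz α), sub_self, Complex.ofReal_zero, zero_mul]

lemma blowUp_of_norm_le (ha : ∀ α, IsRadialProfile (a α) (b α) s)
    (hc : ∀ α β, α ≠ β → s + ρ ≤ ‖c α - c β‖) (α : ι) {ζ : ℂ} (hζ : ‖ζ‖ ≤ ρ) :
    blowUp c a (c α + ζ) = c α + a α ‖ζ‖ * dir ζ := by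
  classical
  rw [blowUp, Finset.sum_eq_single α]
  · rw [add_sub_cancel_left]
    push_cast
    rw [sub_mul, norm_mul_dir]
    ring
  · intro β _ hβ
    have h1 := hc α β (Ne.symm hβ)
    have h2 : c α + ζ - c β = (c α - c β) - (-ζ) := by ring
    have h3 := norm_sub_norm_le (c α - c β) (-ζ)
    rw [norm_neg] at h3
    rw [(ha β).eq_self _ (by rw [h2]; linarith), sub_self, Complex.ofReal_zero, zero_mul]
  · simp

lemma contDiffAt_blowUp (ha : ∀ α, IsRadialProfile (a α) (b α) s) {z : ℂ} (hz : ∀ α, z ≠ c α) :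
    ContDiffAt ℝ ∞ (blowUp c a) z := by
  refine contDiffAt_id.add (ContDiffAt.sum fun α _ => ?_)
  have h0 : z - c α ≠ 0 := sub_ne_zero.2 (hz α)
  have h1 : ContDiffAt ℝ ∞ (fun z : ℂ => z - c α) z := contDiffAt_id.sub contDiffAt_const
  have h2 := contDiffAt_radial (a := fun x => a α x - x) h0
    (((ha α).contDiffAt _ (norm_pos_iff.2 h0)).sub contDiffAt_id)
  exact ContDiffAt.comp z h2 h1

variable (ha : ∀ α, IsRadialProfile (a α) (b α) s) (hsρ : s < ρ)
  (hc : ∀ α β, α ≠ β → s + ρ ≤ ‖c α - c β‖)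

include ha hsρ hc

lemma posJacAt_blowUp {z : ℂ} (hz : ∀ α, z ≠ c α) : PosJacAt (blowUp c a) z := by
  by_cases h : ∃ α, ‖z - c α‖ < ρ
  · obtain ⟨α, hα⟩ := h
    have h0 : z - c α ≠ 0 := sub_ne_zero.2 (hz α)
    obtain ⟨d, hd0, hd⟩ := (ha α).deriv_pos _ (norm_pos_iff.2 h0)
    have h1 : PosJacAt (fun x => c α + x) ((a α ‖z - c α‖ : ℂ) * dir (z - c α)) :=
      ((hasDerivAt_id _).const_add _).posJacAt one_ne_zero
    have h2 : PosJacAt (fun x => x - c α) z := ((hasDerivAt_id _).sub_const _).posJacAt one_ne_zero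
    have h3 := posJacAt_radial h0 hd (mul_pos hd0 ((ha α).pos (norm_pos_iff.2 h0)))
    refine (PosJacAt.comp (F := fun x => c α + x)
      (G := fun x => (a α ‖x - c α‖ : ℂ) * dir (x - c α)) h1
      (PosJacAt.comp (F := fun z : ℂ => (a α ‖z‖ : ℂ) * dir z) (G := fun x => x - c α) h3 h2)).congr ?_
    have : ∀ᶠ x in 𝓝 z, ‖x - c α‖ < ρ :=
      (continuous_id.sub continuous_const).norm.continuousAt.eventually (gt_mem_nhds hα)
    filter_upwards [this] with x hx
    have := blowUp_of_norm_le ha hc α hx.le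
    rwa [add_sub_cancel] at this
  · push Not at h
    refine (posJacAt_id z).congr ?_
    have : ∀ᶠ x in 𝓝 z, ∀ α, s < ‖x - c α‖ := eventually_all.2 fun α =>
      (continuous_id.sub continuous_const).norm.continuousAt.eventually
        (lt_mem_nhds (hsρ.trans_le (h α)))
    filter_upwards [this] with x hx using blowUp_of_forall_ge ha fun α => (hx α).le

/-- The map preserves each disc of radius s about a centre, and also the complement of these discs,
on which it is the identity. Injectivity and surjectivity can therefore be checked on one disc at a
time. -/
lemma norm_blowUp_sub_lt_iff {z : ℂ} (hz : ∀ α, z ≠ c α) (α : ι) :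
    ‖blowUp c a z - c α‖ < s ↔ ‖z - c α‖ < s := by
  have key : ∀ β, ‖z - c β‖ < s → ‖blowUp c a z - c β‖ < s := by
    intro β hβ
    have h0 : 0 < ‖z - c β‖ := norm_pos_iff.2 (sub_ne_zero.2 (hz β))
    have h1 := blowUp_of_norm_le ha hc β (hβ.le.trans hsρ.le)
    rw [add_sub_cancel] at h1
    rw [h1, add_sub_cancel_left, norm_mul, norm_dir (norm_pos_iff.1 h0), Complex.norm_real,
      Real.norm_of_nonneg ((ha β).pos h0).le, mul_one]
    exact ((ha β).lt_iff h0).2 hβ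
  refine ⟨fun h => ?_, key α⟩
  by_contra hα
  by_cases hex : ∃ β, ‖z - c β‖ < s
  · obtain ⟨β, hβ⟩ := hex
    have hne : α ≠ β := by rintro rfl; exact hα hβ
    have h1 := hc α β hne
    have h2 := norm_sub_le_norm_sub_add_norm_sub (c α) (blowUp c a z) (c β)
    rw [norm_sub_rev (c α) (blowUp c a z)] at h2
    have := key β hβ
    linarith
  · push Not at hex
    rw [blowUp_of_forall_ge ha hex] at h
    exact hα h

lemma blowUp_injective {z z' : ℂ} (hz : ∀ α, z ≠ c α) (hz' : ∀ α, z' ≠ c α)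
    (h : blowUp c a z = blowUp c a z') : z = z' := by
  by_cases hex : ∃ α, ‖z - c α‖ < s
  · obtain ⟨α, hα⟩ := hex
    have hα' : ‖z' - c α‖ < s := by
      rw [← norm_blowUp_sub_lt_iff ha hsρ hc hz', ← h, norm_blowUp_sub_lt_iff ha hsρ hc hz]
      exact hα
    have h0 : 0 < ‖z - c α‖ := norm_pos_iff.2 (sub_ne_zero.2 (hz α))
    have h0' : 0 < ‖z' - c α‖ := norm_pos_iff.2 (sub_ne_zero.2 (hz' α))
    have h1 := blowUp_of_norm_le ha hc α (hα.le.trans hsρ.le)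
    have h1' := blowUp_of_norm_le ha hc α (hα'.le.trans hsρ.le)
    rw [add_sub_cancel] at h1 h1'
    rw [h1, h1', add_right_inj] at h
    have hn := congrArg norm h
    rw [norm_mul, norm_mul, norm_dir (norm_pos_iff.1 h0), norm_dir (norm_pos_iff.1 h0'),
      Complex.norm_real, Complex.norm_real, Real.norm_of_nonneg ((ha α).pos h0).le,
      Real.norm_of_nonneg ((ha α).pos h0').le, mul_one, mul_one] at hn
    have hn' := (ha α).strictMonoOn.injOn (Set.mem_Ioi.2 h0) (Set.mem_Ioi.2 h0') hn
    rw [hn'] at h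
    have hd := mul_left_cancel₀ (by exact_mod_cast ((ha α).pos h0').ne') h
    have := norm_mul_dir (z - c α)
    rw [hd, hn', norm_mul_dir] at this
    exact (sub_left_injective this).symm
  · have hex' : ∀ α, s ≤ ‖z' - c α‖ := fun α => by
      by_contra hα
      rw [not_le, ← norm_blowUp_sub_lt_iff ha hsρ hc hz', ← h,
        norm_blowUp_sub_lt_iff ha hsρ hc hz] at hα
      exact hex ⟨α, hα⟩
    push Not at hex
    rwa [blowUp_of_forall_ge ha hex, blowUp_of_forall_ge ha hex'] at h

lemma lt_norm_blowUp_sub {z : ℂ} (hz : ∀ α, z ≠ c α) (hb : ∀ α, b α < s) (α : ι) :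
    b α < ‖blowUp c a z - c α‖ := by
  by_cases hα : ‖z - c α‖ < s
  · have h0 : 0 < ‖z - c α‖ := norm_pos_iff.2 (sub_ne_zero.2 (hz α))
    have h1 := blowUp_of_norm_le ha hc α (hα.le.trans hsρ.le)
    rw [add_sub_cancel] at h1
    rw [h1, add_sub_cancel_left, norm_mul, norm_dir (norm_pos_iff.1 h0), Complex.norm_real,
      Real.norm_of_nonneg ((ha α).pos h0).le, mul_one]
    exact (ha α).lt _ h0
  · have := (norm_blowUp_sub_lt_iff ha hsρ hc hz α).not.2 hα
    exact (hb α).trans_le (not_lt.1 this)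

lemma exists_blowUp_eq {y : ℂ} (hy : ∀ α, b α < ‖y - c α‖) :
    ∃ z, (∀ α, z ≠ c α) ∧ blowUp c a z = y := by
  by_cases hex : ∃ α, ‖y - c α‖ < s
  · obtain ⟨α, hα⟩ := hex
    obtain ⟨x, hx0, hx⟩ := (ha α).exists_eq _ (hy α)
    have hys : 0 < ‖y - c α‖ := (ha α).b_nonneg.trans_lt (hy α)
    have hyd := norm_dir (norm_pos_iff.1 hys)
    have hxn : ‖(x : ℂ) * dir (y - c α)‖ = x := by
      rw [norm_mul, hyd, Complex.norm_real, Real.norm_of_nonneg hx0.le, mul_one]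
    have hxs : x < s := ((ha α).lt_iff hx0).1 (by rw [hx]; exact hα)
    refine ⟨c α + x * dir (y - c α), fun β hβ => ?_, ?_⟩
    · by_cases hαβ : α = β
      · subst hαβ
        rw [add_eq_left] at hβ
        rw [hβ, norm_zero] at hxn
        exact hx0.ne hxn
      · have h1 := hc α β hαβ
        rw [← hβ, sub_add_cancel_left, norm_neg, hxn] at h1
        have := (ha α).s_pos
        linarith
    · rw [blowUp_of_norm_le ha hc α (by rw [hxn]; linarith), hxn, hx, dir_ofReal_mul hx0,
        dir_of_norm_eq_one hyd, norm_mul_dir, add_sub_cancel]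
  · push Not at hex
    refine ⟨y, fun α hα => ?_, blowUp_of_forall_ge ha hex⟩
    have := hex α
    rw [hα, sub_self, norm_zero] at this
    exact absurd (ha α).s_pos (not_lt.2 this)

end BlowUp

/-! ## Holomorphic charts of the cone over the link -/

/-- `T` is a holomorphic chart, on `Ω`, of the cone `∑ x_j ^ a_j = 0` minus the origin, in which the
dilations act diagonally with weights `wt`; `S` is a holomorphic left inverse. -/
structure ConeChart (a w : Fin 3 → ℕ) (T : ℂ × ℂ → Fin 3 → ℂ) (S : (Fin 3 → ℂ) → ℂ × ℂ)
    (wt : ℕ × ℕ) (Ω : Set (ℂ × ℂ)) : Prop where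
  isOpen : IsOpen Ω
  contDiffAt : ∀ P ∈ Ω, ContDiffAt ℂ ∞ T P
  cone : ∀ P ∈ Ω, ∑ j, T P j ^ a j = 0
  left_inv : ∀ P ∈ Ω, S (T P) = P
  differentiableAt : ∀ P ∈ Ω, DifferentiableAt ℂ S (T P)
  dilate_eq : ∀ P ∈ Ω, ∀ τ : ℝ,
    T (((Real.exp (wt.1 * τ) : ℝ) : ℂ) * P.1, ((Real.exp (wt.2 * τ) : ℝ) : ℂ) * P.2) =
      dilate w τ (T P)
  ne_zero : ∀ P ∈ Ω, T P ≠ 0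

lemma hasDerivAt_exp_smul (n : ℕ) (z : ℂ) :
    HasDerivAt (fun τ : ℝ => ((Real.exp (n * τ) : ℝ) : ℂ) * z) (n * z) 0 := by
  have h1 : HasDerivAt (fun τ : ℝ => Real.exp (n * τ)) (n : ℝ) 0 := by
    have h2 : HasDerivAt (fun τ : ℝ => (n : ℝ) * τ) n 0 := by
      simpa using (hasDerivAt_id (0 : ℝ)).const_mul (n : ℝ)
    simpa using h2.exp
  have := h1.ofReal_comp.mul_const z
  simpa using this

namespace ConeChart

variable {a w : Fin 3 → ℕ} {T : ℂ × ℂ → Fin 3 → ℂ} {S : (Fin 3 → ℂ) → ℂ × ℂ} {wt : ℕ × ℕ}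
  {Ω : Set (ℂ × ℂ)}

/-- Both sides are the velocity at τ = 0 of the dilation orbit, once computed in the chart and once
in ℂ³. -/
lemma fderiv_euler (h : ConeChart a w T S wt Ω) {P : ℂ × ℂ} (hP : P ∈ Ω) :
    fderiv ℂ T P ((wt.1 : ℂ) * P.1, (wt.2 : ℂ) * P.2) = eulerField w (T P) := by
  have hT : HasFDerivAt T ((fderiv ℂ T P).restrictScalars ℝ) P :=
    (((h.contDiffAt P hP).differentiableAt (by simp)).hasFDerivAt).restrictScalars ℝ
  set c : ℝ → ℂ × ℂ := fun τ => (((Real.exp (wt.1 * τ) : ℝ) : ℂ) * P.1,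
    ((Real.exp (wt.2 * τ) : ℝ) : ℂ) * P.2) with hc
  have hc0 : c 0 = P := by simp [hc]
  have hcd : HasDerivAt c ((wt.1 : ℂ) * P.1, (wt.2 : ℂ) * P.2) 0 :=
    (hasDerivAt_exp_smul _ _).prodMk (hasDerivAt_exp_smul _ _)
  have h1 : HasDerivAt (fun τ => T (c τ)) (fderiv ℂ T P ((wt.1 : ℂ) * P.1, (wt.2 : ℂ) * P.2)) 0 := by
    rw [← hc0] at hT
    have := hT.comp_hasDerivAt 0 hcd
    rwa [hc0] at this
  have h2 : HasDerivAt (fun τ => T (c τ)) (eulerField w (T P)) 0 := by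
    have : (fun τ => T (c τ)) = fun τ => dilate w τ (T P) := by
      funext τ; exact h.dilate_eq P hP τ
    rw [this]
    exact hasDerivAt_pi.2 fun j => hasDerivAt_exp_smul _ _
  exact h1.unique h2

lemma fderiv_injective (h : ConeChart a w T S wt Ω) {P : ℂ × ℂ} (hP : P ∈ Ω) :
    Function.Injective (fderiv ℂ T P) := by
  have hT := ((h.contDiffAt P hP).differentiableAt (by simp)).hasFDerivAt
  have hS := (h.differentiableAt P hP).hasFDerivAt
  have h1 := hS.comp P hT
  have h2 : S ∘ T =ᶠ[𝓝 P] id := by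
    filter_upwards [h.isOpen.mem_nhds hP] with Q hQ using h.left_inv Q hQ
  have h3 := h1.unique ((hasFDerivAt_id P).congr_of_eventuallyEq h2)
  intro x y hxy
  have := congrArg (fderiv ℂ S (T P)) hxy
  rw [← ContinuousLinearMap.comp_apply, ← ContinuousLinearMap.comp_apply, h3] at this
  exact this

theorem isPositiveFrame (h : ConeChart a w T S wt Ω) (ha : ∀ j, 0 < a j) (hw : ∀ j, 0 < w j)
    {M : ℕ} (hM : ∀ j, w j * a j = M) {g : ℂ × ℝ → ℂ × ℂ} {g' : ℂ × ℝ →L[ℝ] ℂ × ℂ} {o : ℂ × ℝ}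
    (hg : HasFDerivAt g g' o) (hgo : g o ∈ Ω)
    (hdet : 0 < det4 ((wt.1 : ℂ) * (g o).1, (wt.2 : ℂ) * (g o).2) (g' (1, 0)) (g' (Complex.I, 0))
      (g' (0, 1))) :
    IsPositiveFrame a (toSphere w (T (g o)))
      (fderiv ℝ (fun z => toSphere w (T (g z))) o (1, 0))
      (fderiv ℝ (fun z => toSphere w (T (g z))) o (Complex.I, 0))
      (fderiv ℝ (fun z => toSphere w (T (g z))) o (0, 1)) := by
  refine isPositiveFrame_toSphere ha hw hM
    ((h.contDiffAt _ hgo).differentiableAt (by simp)).hasFDerivAt ?_ (h.ne_zero _ hgo)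
    (h.fderiv_injective hgo) (h.fderiv_euler hgo) hg rfl hdet
  filter_upwards [h.isOpen.mem_nhds hgo] with Q hQ using h.cone Q hQ

end ConeChart

/-! ## Logarithmic derivatives -/

/-- `l` is the logarithmic derivative of `f` at `x`. -/
def HasLogFDerivAt {X : Type*} [NormedAddCommGroup X] [NormedSpace ℝ X] (f l : X → ℂ) (x : X) :
    Prop :=
  ∃ D : X →L[ℝ] ℂ, HasFDerivAt f D x ∧ ∀ v, D v = f x * l v

section LogDeriv

variable {X : Type*} [NormedAddCommGroup X] [NormedSpace ℝ X] {f g l k : X → ℂ} {x : X}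

lemma HasLogFDerivAt.mul (hf : HasLogFDerivAt f l x) (hg : HasLogFDerivAt g k x) :
    HasLogFDerivAt (fun y => f y * g y) (fun v => l v + k v) x := by
  obtain ⟨D, hD, hDv⟩ := hf
  obtain ⟨K, hK, hKv⟩ := hg
  refine ⟨_, hD.mul hK, fun v => ?_⟩
  simp [hDv, hKv]
  ring

lemma HasLogFDerivAt.pow (hf : HasLogFDerivAt f l x) (n : ℕ) :
    HasLogFDerivAt (fun y => f y ^ n) (fun v => n * l v) x := by
  induction n with
  | zero => exact ⟨0, by simpa using hasFDerivAt_const (1 : ℂ) x, by simp⟩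
  | succ n ih =>
    have := ih.mul hf
    simp only [← pow_succ] at this
    convert this using 2 with v
    push_cast; ring

lemma hasLogFDerivAt_dir {L : X →L[ℝ] ℂ} (hf : HasFDerivAt f L x) (h0 : f x ≠ 0) :
    HasLogFDerivAt (fun y => dir (f y)) (fun v => (L v / f x).im * Complex.I) x :=
  hasFDerivAt_dir hf h0

lemma hasLogFDerivAt_norm {L : X →L[ℝ] ℂ} (hf : HasFDerivAt f L x) (h0 : f x ≠ 0) {R : ℝ → ℝ}
    {R' : ℝ} (hR : HasDerivAt R R' ‖f x‖) (hR0 : R ‖f x‖ ≠ 0) :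
    HasLogFDerivAt (fun y => (R ‖f y‖ : ℂ))
      (fun v => ((R' * ‖f x‖ / R ‖f x‖ * (L v / f x).re : ℝ) : ℂ)) x := by
  obtain ⟨D, hD, hDv⟩ := hasFDerivAt_norm_complex hf h0
  have h1 : HasFDerivAt (fun y => R ‖f y‖) _ x := hR.comp_hasFDerivAt x hD
  refine ⟨_, Complex.ofRealCLM.hasFDerivAt.comp x h1, fun v => ?_⟩
  have : ((R ‖f x‖ : ℝ) : ℂ) ≠ 0 := by exact_mod_cast hR0
  simp [hDv]
  field_simp

end LogDeriv

lemma hasLogFDerivAt_circle (o : ℂ × ℝ) :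
    HasLogFDerivAt (fun y : ℂ × ℝ => Complex.exp (y.2 * Complex.I)) (fun v => v.2 * Complex.I) o := by
  have h1 : HasFDerivAt (fun y : ℂ × ℝ => (y.2 : ℂ)) _ o :=
    Complex.ofRealCLM.hasFDerivAt.comp o (hasFDerivAt_snd (𝕜 := ℝ) (p := o))
  refine ⟨_, (h1.mul_const Complex.I).cexp, fun v => ?_⟩
  simp [mul_comm]

lemma det4_mul (u v : ℂ) (a b c e : ℂ × ℂ) :
    det4 (u * a.1, v * a.2) (u * b.1, v * b.2) (u * c.1, v * c.2) (u * e.1, v * e.2) =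
      Complex.normSq u * Complex.normSq v * det4 a b c e := by
  simp only [det4_eq, Complex.mul_re, Complex.mul_im, Complex.normSq_apply]
  ring

/-- Toric coordinates: the torus coordinates are the direction of `G` and `s * dir W ^ n`, and the
radial coordinate is a function of `‖G‖`. -/
def toricCoord (p p' q q' n : ℕ) (R : ℝ → ℝ) (G W s : ℂ) : ℂ × ℂ :=
  (dir G ^ p * (s * dir W ^ n) ^ p', R ‖G‖ * (dir G ^ q * (s * dir W ^ n) ^ q'))

/-- Dividing the two columns by the coordinates u and v only removes the factor |u|²|v|², so
everything may be computed with logarithmic derivatives. The terms from W are multiples of the last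
row and drop out. What remains is the weight of u, the logarithmic Jacobian of G, p q' - p' q = 1,
and the sign of -R': the radius has to decrease in ‖G‖. -/
lemma toricCoord_det4_pos {p p' q q' n : ℕ} (hpq : p * q' = p' * q + 1) {R : ℝ → ℝ} {R' : ℝ}
    {G W : ℂ → ℂ} {z : ℂ} (hG : PosJacAt G z) (hG0 : G z ≠ 0) (hW : DifferentiableAt ℝ W z)
    (hW0 : W z ≠ 0) (hR : HasDerivAt R R' ‖G z‖) (hR' : R' < 0) (hR0 : 0 < R ‖G z‖) (θ : ℝ)
    {wt : ℕ × ℕ} (hwt : 0 < wt.1) :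
    ∃ g' : ℂ × ℝ →L[ℝ] ℂ × ℂ, HasFDerivAt (fun x : ℂ × ℝ =>
        toricCoord p p' q q' n R (G x.1) (W x.1) (Complex.exp (x.2 * Complex.I))) g' (z, θ) ∧
      0 < det4
        ((wt.1 : ℂ) * (toricCoord p p' q q' n R (G z) (W z) (Complex.exp (θ * Complex.I))).1,
          (wt.2 : ℂ) * (toricCoord p p' q q' n R (G z) (W z) (Complex.exp (θ * Complex.I))).2)
        (g' (1, 0)) (g' (Complex.I, 0)) (g' (0, 1)) := by
  obtain ⟨L, hL, hLpos⟩ := hG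
  have hGx : HasFDerivAt (fun x : ℂ × ℝ => G x.1) (L.comp (ContinuousLinearMap.fst ℝ ℂ ℝ)) (z, θ) :=
    HasFDerivAt.comp (z, θ) hL hasFDerivAt_fst
  have hWx : HasFDerivAt (fun x : ℂ × ℝ => W x.1)
      ((fderiv ℝ W z).comp (ContinuousLinearMap.fst ℝ ℂ ℝ)) (z, θ) :=
    HasFDerivAt.comp (z, θ) hW.hasFDerivAt hasFDerivAt_fst
  have hA := hasLogFDerivAt_dir hGx hG0
  have hσ := (hasLogFDerivAt_circle (z, θ)).mul ((hasLogFDerivAt_dir hWx hW0).pow n)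
  have hN := hasLogFDerivAt_norm hGx hG0 hR hR0.ne'
  obtain ⟨D1, hD1, hD1v⟩ := (hA.pow p).mul (hσ.pow p')
  obtain ⟨D2, hD2, hD2v⟩ := hN.mul ((hA.pow q).mul (hσ.pow q'))
  refine ⟨D1.prod D2, hD1.prodMk hD2, ?_⟩
  set u := dir (G z) ^ p * (Complex.exp (θ * Complex.I) * dir (W z) ^ n) ^ p' with hu
  set v := (R ‖G z‖ : ℂ) * (dir (G z) ^ q * (Complex.exp (θ * Complex.I) * dir (W z) ^ n) ^ q')
    with hv
  have hs0 : Complex.exp (θ * Complex.I) * dir (W z) ^ n ≠ 0 :=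
    mul_ne_zero (Complex.exp_ne_zero _) (pow_ne_zero _ (dir_ne_zero hW0))
  have hu0 : u ≠ 0 := mul_ne_zero (pow_ne_zero _ (dir_ne_zero hG0)) (pow_ne_zero _ hs0)
  have hv0 : v ≠ 0 := mul_ne_zero (by exact_mod_cast hR0.ne')
    (mul_ne_zero (pow_ne_zero _ (dir_ne_zero hG0)) (pow_ne_zero _ hs0))
  simp only [ContinuousLinearMap.prod_apply, hD1v, hD2v, toricCoord]
  rw [← hu, ← hv, mul_comm (wt.1 : ℂ) u, mul_comm (wt.2 : ℂ) v,
    det4_mul u v ((wt.1 : ℂ), (wt.2 : ℂ)) (_, _) (_, _) (_, _)]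
  refine mul_pos (mul_pos (Complex.normSq_pos.2 hu0) (Complex.normSq_pos.2 hv0)) ?_
  simp only [ContinuousLinearMap.comp_apply, ContinuousLinearMap.coe_fst', map_zero, zero_div,
    Complex.zero_im, Complex.ofReal_zero, zero_mul, mul_zero, add_zero, zero_add, Complex.zero_re,
    Complex.ofReal_one, one_mul]
  set μ1 := (L 1 / G z).re
  set μ2 := (L Complex.I / G z).re
  set α1 := (L 1 / G z).im
  set α2 := (L Complex.I / G z).im
  set π1 := (fderiv ℝ W z 1 / W z).im
  set π2 := (fderiv ℝ W z Complex.I / W z).im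
  set t := R' * ‖G z‖ / R ‖G z‖
  have ht : t < 0 := div_neg_of_neg_of_pos (mul_neg_of_neg_of_pos hR' (norm_pos_iff.2 hG0)) hR0
  have hμα : 0 < μ1 * α2 - α1 * μ2 := by
    have h1 : μ1 * α2 - α1 * μ2 = Complex.normSq (G z)⁻¹ *
        ((L 1).re * (L Complex.I).im - (L 1).im * (L Complex.I).re) := by
      simp only [μ1, μ2, α1, α2, div_eq_mul_inv, Complex.mul_re, Complex.mul_im,
        Complex.normSq_apply]
      ring
    rw [h1]
    exact mul_pos (Complex.normSq_pos.2 (inv_ne_zero hG0)) hLpos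
  have hpq' : (p : ℝ) * q' = p' * q + 1 := by exact_mod_cast hpq
  have key : det4 ((wt.1 : ℂ), (wt.2 : ℂ))
      (p * (α1 * Complex.I) + p' * (n * (π1 * Complex.I)),
        ((t * μ1 : ℝ) : ℂ) + (q * (α1 * Complex.I) + q' * (n * (π1 * Complex.I))))
      (p * (α2 * Complex.I) + p' * (n * (π2 * Complex.I)),
        ((t * μ2 : ℝ) : ℂ) + (q * (α2 * Complex.I) + q' * (n * (π2 * Complex.I))))
      (p' * Complex.I, q' * Complex.I) =
      wt.1 * (-t) * (μ1 * α2 - α1 * μ2) * (p * q' - p' * q) := by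
    simp [det4_eq]
    ring
  rw [key, hpq']
  have : (0 : ℝ) < wt.1 := by exact_mod_cast hwt
  have : 0 < -t := by linarith
  have h2 : (p' : ℝ) * q + 1 - p' * q = 1 := by ring
  rw [h2]
  positivity

/-- In the fibre direction the Euler field is radial and ∂/∂θ is tangential, so together they are
positive. The direction of W changes only the fibre component, which is irrelevant next to them, and
the Jacobian of Y decides. -/
lemma fibre_det4_pos {Y W : ℂ → ℂ} {z : ℂ} (hY : PosJacAt Y z) (hW : DifferentiableAt ℝ W z)
    (hW0 : W z ≠ 0) (θ : ℝ) :
    ∃ g' : ℂ × ℝ →L[ℝ] ℂ × ℂ, HasFDerivAt (fun x : ℂ × ℝ =>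
        (Y x.1, Complex.exp (x.2 * Complex.I) * dir (W x.1))) g' (z, θ) ∧
      0 < det4 (((0 : ℕ) : ℂ) * Y z, ((1 : ℕ) : ℂ) * (Complex.exp (θ * Complex.I) * dir (W z)))
        (g' (1, 0)) (g' (Complex.I, 0)) (g' (0, 1)) := by
  obtain ⟨L, hL, hLpos⟩ := hY
  have hYx : HasFDerivAt (fun x : ℂ × ℝ => Y x.1) (L.comp (ContinuousLinearMap.fst ℝ ℂ ℝ)) (z, θ) :=
    HasFDerivAt.comp (z, θ) hL hasFDerivAt_fst
  have hWx : HasFDerivAt (fun x : ℂ × ℝ => W x.1)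
      ((fderiv ℝ W z).comp (ContinuousLinearMap.fst ℝ ℂ ℝ)) (z, θ) :=
    HasFDerivAt.comp (z, θ) hW.hasFDerivAt hasFDerivAt_fst
  obtain ⟨D, hD, hDv⟩ := (hasLogFDerivAt_circle (z, θ)).mul (hasLogFDerivAt_dir hWx hW0)
  refine ⟨_, hYx.prodMk hD, ?_⟩
  set l := Complex.exp (θ * Complex.I) * dir (W z) with hl
  have hl0 : l ≠ 0 := mul_ne_zero (Complex.exp_ne_zero _) (dir_ne_zero hW0)
  have h3 : D (0, 1) = l * Complex.I := by rw [hDv]; simp [hl]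
  simp only [ContinuousLinearMap.prod_apply, h3]
  have key : det4 (((0 : ℕ) : ℂ) * Y z, ((1 : ℕ) : ℂ) * l)
      ((L.comp (ContinuousLinearMap.fst ℝ ℂ ℝ)) (1, 0), D (1, 0))
      ((L.comp (ContinuousLinearMap.fst ℝ ℂ ℝ)) (Complex.I, 0), D (Complex.I, 0))
      ((L.comp (ContinuousLinearMap.fst ℝ ℂ ℝ)) (0, 1), l * Complex.I) =
      Complex.normSq l * ((L 1).re * (L Complex.I).im - (L 1).im * (L Complex.I).re) := by
    simp [det4_eq, Complex.normSq_apply]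
    ring
  rw [key]
  exact mul_pos (Complex.normSq_pos.2 hl0) hLpos

/-- This is the chart that covers the core of a solid torus. Here the Euler field and ∂/∂θ span the
plane of the first coordinate, and z is a coordinate transverse to the core. -/
lemma core_det4_pos {C : ℝ} (hC : 0 < C) (n : ℕ) (z : ℂ) (θ : ℝ) {wt : ℕ × ℕ} (hwt : 0 < wt.1) :
    ∃ g' : ℂ × ℝ →L[ℝ] ℂ × ℂ, HasFDerivAt (fun x : ℂ × ℝ =>
        (Complex.exp (x.2 * Complex.I), (C : ℂ) * x.1 * Complex.exp (x.2 * Complex.I) ^ n)) g' (z, θ) ∧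
      0 < det4 ((wt.1 : ℂ) * Complex.exp (θ * Complex.I),
          (wt.2 : ℂ) * ((C : ℂ) * z * Complex.exp (θ * Complex.I) ^ n))
        (g' (1, 0)) (g' (Complex.I, 0)) (g' (0, 1)) := by
  obtain ⟨D1, hD1, hD1v⟩ := hasLogFDerivAt_circle (z, θ)
  obtain ⟨D2, hD2, hD2v⟩ := (hasLogFDerivAt_circle (z, θ)).pow n
  have h1 : HasFDerivAt (fun x : ℂ × ℝ => (C : ℂ) * x.1) _ (z, θ) :=
    (hasFDerivAt_fst (𝕜 := ℝ) (p := (z, θ))).const_mul (C : ℂ)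
  refine ⟨_, hD1.prodMk (h1.mul hD2), ?_⟩
  simp only [ContinuousLinearMap.prod_apply, hD1v]
  set s := Complex.exp (θ * Complex.I) with hs
  have hs0 : s ≠ 0 := Complex.exp_ne_zero _
  simp [hD2v]
  rw [← hs]
  have key : ∀ x y : ℂ, det4 ((wt.1 : ℂ) * s, x) (0, s ^ n * C) (0, s ^ n * (C * Complex.I))
      (s * Complex.I, y) = wt.1 * C ^ 2 * Complex.normSq s * Complex.normSq (s ^ n) := by
    intro x y
    simp [det4_eq, Complex.normSq_apply]
    ring
  rw [key]
  have := Complex.normSq_pos.2 hs0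
  have := Complex.normSq_pos.2 (pow_ne_zero n hs0)
  have : (0 : ℝ) < wt.1 := by exact_mod_cast hwt
  positivity

/-! ## Charts of the Brieskorn cone -/

/-- The exponents of the link. -/
def linkExp (d m N : ℕ) : Fin 3 → ℕ := ![d, d * m, N]

/-- The weights of the dilations. -/
def linkWeight (d m N : ℕ) : Fin 3 → ℕ := ![m * N, N, d * m]

lemma cone_iff {d m N : ℕ} {x : Fin 3 → ℂ} :
    ∑ j, x j ^ linkExp d m N j = 0 ↔ x 0 ^ d + x 1 ^ (d * m) + x 2 ^ N = 0 := by
  simp [Fin.sum_univ_three, linkExp]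

lemma linkExp_pos {d m N : ℕ} (hd : 0 < d) (hm : 0 < m) (hN : 0 < N) (j : Fin 3) :
    0 < linkExp d m N j := by
  fin_cases j
  exacts [hd, Nat.mul_pos hd hm, hN]

lemma linkWeight_pos {d m N : ℕ} (hd : 0 < d) (hm : 0 < m) (hN : 0 < N) (j : Fin 3) :
    0 < linkWeight d m N j := by
  fin_cases j
  exacts [Nat.mul_pos hm hN, hN, Nat.mul_pos hd hm]

lemma linkWeight_mul_linkExp (d m N : ℕ) (j : Fin 3) :
    linkWeight d m N j * linkExp d m N j = d * m * N := by
  fin_cases j <;> simp [linkWeight, linkExp] <;> ring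

lemma dilate_link (d m N : ℕ) (τ : ℝ) (x : Fin 3 → ℂ) : dilate (linkWeight d m N) τ x =
    ![((Real.exp τ : ℝ) : ℂ) ^ (m * N) * x 0, ((Real.exp τ : ℝ) : ℂ) ^ N * x 1,
      ((Real.exp τ : ℝ) : ℂ) ^ (d * m) * x 2] := by
  funext j
  rw [dilate, Real.exp_nat_mul]
  fin_cases j <;> simp [linkWeight]

lemma contDiffAt_vec3 {X : Type*} [NormedAddCommGroup X] [NormedSpace ℂ X] {f g h : X → ℂ} {x : X}
    (hf : ContDiffAt ℂ ∞ f x) (hg : ContDiffAt ℂ ∞ g x) (hh : ContDiffAt ℂ ∞ h x) :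
    ContDiffAt ℂ ∞ (fun y => ![f y, g y, h y]) x := by
  refine contDiffAt_pi.2 fun j => ?_
  fin_cases j
  exacts [hf, hg, hh]

lemma differentiableAt_coord (j : Fin 3) (x : Fin 3 → ℂ) :
    DifferentiableAt ℂ (fun y : Fin 3 → ℂ => y j) x :=
  (ContinuousLinearMap.proj (R := ℂ) (φ := fun _ : Fin 3 => ℂ) j).differentiableAt

lemma DifferentiableAt.div_fun {X : Type*} [NormedAddCommGroup X] [NormedSpace ℂ X] {f g : X → ℂ}
    {x : X} (hf : DifferentiableAt ℂ f x) (hg : DifferentiableAt ℂ g x) (h0 : g x ≠ 0) :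
    DifferentiableAt ℂ (fun y => f y / g y) x := by
  simp only [div_eq_mul_inv]
  exact hf.mul (hg.inv h0)

lemma ContDiffAt.div_fun {X : Type*} [NormedAddCommGroup X] [NormedSpace ℂ X] {f g : X → ℂ}
    {x : X} (hf : ContDiffAt ℂ ∞ f x) (hg : ContDiffAt ℂ ∞ g x) (h0 : g x ≠ 0) :
    ContDiffAt ℂ ∞ (fun y => f y / g y) x :=
  ContDiffAt.div hf hg h0

/-- The chart of the cone over the regular part of the base, with coordinates `y = x₀ / x₁ ^ m` and
`λ = x₂ ^ 10 / x₁`. -/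
def baseChart (d m N : ℕ) (P : ℂ × ℂ) : Fin 3 → ℂ :=
  ![P.2 ^ (m * N) * P.1 / (-(1 + P.1 ^ d)) ^ (10 * m), P.2 ^ N / (-(1 + P.1 ^ d)) ^ 10,
    P.2 ^ (d * m) / (-(1 + P.1 ^ d))]

/-- The coordinates `(y, λ)`. -/
def baseCoord (m : ℕ) (x : Fin 3 → ℂ) : ℂ × ℂ := (x 0 / x 1 ^ m, x 2 ^ 10 / x 1)

/-- The chart of the cone about the exceptional orbit `x₁ = 0`. -/
def multChart (d m N : ℕ) (P : ℂ × ℂ) : Fin 3 → ℂ :=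
  ![P.1 ^ N / (-(1 + (P.2 ^ m / P.1 ^ N) ^ d)) ^ (10 * m),
    P.2 / (-(1 + (P.2 ^ m / P.1 ^ N) ^ d)) ^ 10,
    P.1 ^ d / (-(1 + (P.2 ^ m / P.1 ^ N) ^ d))]

/-- The inverse of `multChart`. -/
def multCoord (d m : ℕ) (x : Fin 3 → ℂ) : ℂ × ℂ :=
  (x 2 ^ (10 * m) / x 0, x 1 * ((x 2 ^ (10 * m) / x 0) ^ d / x 2) ^ 10)

/-- The principal branch of `(1 + Y) ^ (1 / d)`. -/
def rootBranch (d : ℕ) (Y : ℂ) : ℂ := Complex.exp (Complex.log (1 + Y) / d)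

/-- The value of `Y = -(1 + y ^ d)` in the chart about an exceptional orbit `x₂ = 0`. -/
def rootBase (d m N : ℕ) (D : ℂ) (P : ℂ × ℂ) : ℂ := D * P.2 ^ N / P.1 ^ (d * m)

/-- The chart of the cone about the exceptional orbit `x₂ = 0`, `x₀ = p x₁ ^ m`. -/
def rootChart (d m N : ℕ) (p D : ℂ) (P : ℂ × ℂ) : Fin 3 → ℂ :=
  ![p * rootBranch d (rootBase d m N D P) * (D ^ (N - 10) * P.1) ^ m, D ^ (N - 10) * P.1,
    D ^ (d * m - 1) * P.2]

/-- The inverse of `rootChart`. -/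
def rootCoord (d m N : ℕ) (D : ℂ) (x : Fin 3 → ℂ) : ℂ × ℂ :=
  (x 1 / D ^ (N - 10), x 2 / D ^ (d * m - 1))

/-! ### The part of the cone where x₁ and x₂ do not vanish -/

section BaseChart

variable {d m N : ℕ} (hN : N + 1 = 10 * (d * m))

include hN

/-- With Y = -(1 + y^d) and N + 1 = 10dm, the three powers are λ^(dmN) / Y^(N+1) times y^d, 1 and Y,
and these add up to zero. -/
lemma baseChart_cone {P : ℂ × ℂ} (h1 : 1 + P.1 ^ d ≠ 0) :
    baseChart d m N P 0 ^ d + baseChart d m N P 1 ^ (d * m) + baseChart d m N P 2 ^ N = 0 := by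
  simp only [baseChart, Matrix.cons_val_zero, Matrix.cons_val_one, Matrix.cons_val_two,
    Matrix.tail_cons, Matrix.head_cons]
  set Y := -(1 + P.1 ^ d) with hY
  have hY0 : Y ≠ 0 := neg_ne_zero.2 h1
  have e1 : (P.2 ^ (m * N) * P.1 / Y ^ (10 * m)) ^ d = P.2 ^ (d * m * N) * P.1 ^ d / (Y ^ N * Y) := by
    rw [div_pow, mul_pow, ← pow_mul, ← pow_mul, ← pow_succ, hN]; ring_nf
  have e2 : (P.2 ^ N / Y ^ 10) ^ (d * m) = P.2 ^ (d * m * N) / (Y ^ N * Y) := by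
    rw [div_pow, ← pow_mul, ← pow_mul, ← pow_succ, hN]; ring_nf
  have e3 : (P.2 ^ (d * m) / Y) ^ N = P.2 ^ (d * m * N) * Y / (Y ^ N * Y) := by
    rw [div_pow, ← pow_mul]; field_simp
  rw [e1, e2, e3, ← add_div, ← add_div]
  have : P.2 ^ (d * m * N) * P.1 ^ d + P.2 ^ (d * m * N) + P.2 ^ (d * m * N) * Y = 0 := by
    rw [hY]; ring
  rw [this, zero_div]

lemma baseCoord_baseChart {P : ℂ × ℂ} (h1 : 1 + P.1 ^ d ≠ 0) (h2 : P.2 ≠ 0) :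
    baseCoord m (baseChart d m N P) = P := by
  simp only [baseChart, baseCoord, Matrix.cons_val_zero, Matrix.cons_val_one, Matrix.cons_val_two,
    Matrix.tail_cons, Matrix.head_cons]
  set Y := -(1 + P.1 ^ d) with hY
  have hY0 : Y ≠ 0 := neg_ne_zero.2 h1
  refine Prod.ext ?_ ?_
  · simp only
    rw [div_pow, ← pow_mul, ← pow_mul, mul_comm N m]
    field_simp
  · simp only
    rw [div_pow, ← pow_mul]
    have : d * m * 10 = N + 1 := by rw [hN]; ring
    rw [this, pow_succ]
    field_simp

/-- The regular part of the cone is covered by `baseChart`. -/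
lemma baseChart_baseCoord {x : Fin 3 → ℂ} (hx : x 0 ^ d + x 1 ^ (d * m) + x 2 ^ N = 0)
    (h1 : x 1 ≠ 0) (h2 : x 2 ≠ 0) :
    -(1 + (x 0 / x 1 ^ m) ^ d) = x 2 ^ N / x 1 ^ (d * m) ∧
      baseChart d m N (baseCoord m x) = x := by
  have hY : -(1 + (x 0 / x 1 ^ m) ^ d) = x 2 ^ N / x 1 ^ (d * m) := by
    rw [div_pow, ← pow_mul, mul_comm m d]
    field_simp
    linear_combination -hx
  refine ⟨hY, ?_⟩
  simp only [baseChart, baseCoord, hY]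
  have e2 : (x 2 ^ 10 / x 1) ^ (d * m) / (x 2 ^ N / x 1 ^ (d * m)) = x 2 := by
    rw [div_pow, ← pow_mul, ← hN, pow_succ]
    field_simp
  have e1 : (x 2 ^ 10 / x 1) ^ N / (x 2 ^ N / x 1 ^ (d * m)) ^ 10 = x 1 := by
    rw [div_pow, div_pow, ← pow_mul, ← pow_mul, ← pow_mul, mul_comm (d * m) 10, ← hN, pow_succ,
      mul_comm 10 N]
    field_simp
  funext j
  fin_cases j
  · have : (x 2 ^ 10 / x 1) ^ (m * N) * (x 0 / x 1 ^ m) / (x 2 ^ N / x 1 ^ (d * m)) ^ (10 * m) =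
        ((x 2 ^ 10 / x 1) ^ N / (x 2 ^ N / x 1 ^ (d * m)) ^ 10) ^ m * (x 0 / x 1 ^ m) := by
      rw [div_pow _ ((x 2 ^ N / x 1 ^ (d * m)) ^ 10), ← pow_mul, ← pow_mul, mul_comm N m]
      ring
    simp only [Fin.zero_eta, Matrix.cons_val_zero]
    rw [this, e1]
    field_simp
  · exact e1
  · exact e2

omit hN in
lemma baseChart_dilate (P : ℂ × ℂ) (τ : ℝ) :
    baseChart d m N (P.1, ((Real.exp τ : ℝ) : ℂ) * P.2) =
      dilate (linkWeight d m N) τ (baseChart d m N P) := by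
  rw [dilate_link]
  funext j
  fin_cases j <;> simp only [baseChart, mul_pow, Fin.zero_eta, Fin.mk_one, Fin.reduceFinMk,
    Matrix.cons_val_zero, Matrix.cons_val_one, Matrix.cons_val] <;> ring

lemma coneChart_baseChart : ConeChart (linkExp d m N) (linkWeight d m N) (baseChart d m N)
    (baseCoord m) (0, 1) {P | 1 + P.1 ^ d ≠ 0 ∧ P.2 ≠ 0} where
  isOpen := by
    refine IsOpen.and (isOpen_ne_fun (by fun_prop) continuous_const)
      (isOpen_ne_fun (by fun_prop) continuous_const)
  contDiffAt P hP := by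
    have hY : -(1 + P.1 ^ d) ≠ 0 := neg_ne_zero.2 hP.1
    have h1 : ContDiffAt ℂ ∞ (fun P : ℂ × ℂ => -(1 + P.1 ^ d)) P :=
      (contDiffAt_const.add (contDiffAt_fst.pow d)).neg
    refine contDiffAt_vec3 ?_ ?_ ?_
    · exact ((contDiffAt_snd.pow _).mul contDiffAt_fst).div_fun (h1.pow _) (pow_ne_zero _ hY)
    · exact (contDiffAt_snd.pow _).div_fun (h1.pow _) (pow_ne_zero _ hY)
    · exact (contDiffAt_snd.pow _).div_fun h1 hY
  cone P hP := cone_iff.2 (baseChart_cone hN hP.1)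
  left_inv P hP := baseCoord_baseChart hN hP.1 hP.2
  differentiableAt P hP := by
    have h1 : baseChart d m N P 1 ≠ 0 :=
      div_ne_zero (pow_ne_zero _ hP.2) (pow_ne_zero _ (neg_ne_zero.2 hP.1))
    refine DifferentiableAt.prodMk ?_ ?_
    · exact (differentiableAt_coord 0 _).div_fun ((differentiableAt_coord 1 _).pow m) (pow_ne_zero _ h1)
    · exact ((differentiableAt_coord 2 _).pow 10).div_fun (differentiableAt_coord 1 _) h1
  dilate_eq P _ τ := by
    have := baseChart_dilate (d := d) (m := m) (N := N) P τ
    simpa using this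
  ne_zero P hP h := by
    have h1 : baseChart d m N P 1 ≠ 0 :=
      div_ne_zero (pow_ne_zero _ hP.2) (pow_ne_zero _ (neg_ne_zero.2 hP.1))
    exact h1 (congrFun h 1)

end BaseChart

/-! ### A neighbourhood of the orbit x₁ = 0 -/

section MultChart

variable {d m N : ℕ} (hN : N + 1 = 10 * (d * m))

lemma one_add_pow_ne_zero_of_norm_lt (hd : 0 < d) {η : ℂ} (h : ‖η‖ < 1) : 1 + η ^ d ≠ 0 := by
  intro h0
  have h1 : η ^ d = -1 := by linear_combination h0
  have h2 := congrArg norm h1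
  rw [norm_pow, norm_neg, norm_one] at h2
  exact (pow_lt_one₀ (norm_nonneg η) h hd.ne').ne h2

include hN

/-- The same computation as on the regular part, now with η = P.2^m / P.1^N = 1 / y: the three
powers are proportional to 1, η^d and Z = -(1 + η^d). -/
lemma multChart_cone {P : ℂ × ℂ} (h1 : P.1 ≠ 0) (hZ : 1 + (P.2 ^ m / P.1 ^ N) ^ d ≠ 0) :
    multChart d m N P 0 ^ d + multChart d m N P 1 ^ (d * m) + multChart d m N P 2 ^ N = 0 := by
  simp only [multChart, Matrix.cons_val_zero, Matrix.cons_val_one, Matrix.cons_val_two,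
    Matrix.tail_cons, Matrix.head_cons]
  set Z := -(1 + (P.2 ^ m / P.1 ^ N) ^ d) with hZd
  have hZ0 : Z ≠ 0 := neg_ne_zero.2 hZ
  have e1 : (P.1 ^ N / Z ^ (10 * m)) ^ d = P.1 ^ (N * d) / (Z ^ N * Z) := by
    rw [div_pow, ← pow_mul, ← pow_mul, ← pow_succ, hN]; ring_nf
  have e2 : (P.2 / Z ^ 10) ^ (d * m) = P.1 ^ (N * d) * (P.2 ^ m / P.1 ^ N) ^ d / (Z ^ N * Z) := by
    rw [div_pow, div_pow, ← pow_mul, ← pow_mul, ← pow_mul, ← pow_succ, hN, mul_comm d m]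
    field_simp
  have e3 : (P.1 ^ d / Z) ^ N = P.1 ^ (N * d) * Z / (Z ^ N * Z) := by
    rw [div_pow, ← pow_mul, mul_comm d N]; field_simp
  rw [e1, e2, e3, ← add_div, ← add_div]
  have : P.1 ^ (N * d) + P.1 ^ (N * d) * (P.2 ^ m / P.1 ^ N) ^ d + P.1 ^ (N * d) * Z = 0 := by
    rw [hZd]; ring
  rw [this, zero_div]

/-- The functions `x₂ ^ {10 m} / x₀`, `x₁ ^ m / x₀` and `x₂ ^ 10 / x₁` in `multChart`. -/
lemma multChart_functions {P : ℂ × ℂ} (h1 : P.1 ≠ 0) (hZ : 1 + (P.2 ^ m / P.1 ^ N) ^ d ≠ 0) :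
    multChart d m N P 2 ^ (10 * m) / multChart d m N P 0 = P.1 ∧
      multChart d m N P 1 ^ m / multChart d m N P 0 = P.2 ^ m / P.1 ^ N ∧
      multChart d m N P 2 ^ 10 / multChart d m N P 1 = P.1 ^ (10 * d) / P.2 := by
  simp only [multChart, Matrix.cons_val_zero, Matrix.cons_val_one, Matrix.cons_val_two,
    Matrix.tail_cons, Matrix.head_cons]
  set Z := -(1 + (P.2 ^ m / P.1 ^ N) ^ d) with hZd
  have hZ0 : Z ≠ 0 := neg_ne_zero.2 hZ
  refine ⟨?_, ?_, ?_⟩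
  · rw [div_pow, ← pow_mul]
    have : d * (10 * m) = N + 1 := by rw [hN]; ring
    rw [this, pow_succ]
    field_simp
  · rw [div_pow, ← pow_mul]
    field_simp
  · rw [div_pow, ← pow_mul, mul_comm d 10]
    rcases eq_or_ne P.2 0 with h | h
    · rw [h]; simp
    · field_simp

lemma multCoord_multChart {P : ℂ × ℂ} (h1 : P.1 ≠ 0) (hZ : 1 + (P.2 ^ m / P.1 ^ N) ^ d ≠ 0) :
    multCoord d m (multChart d m N P) = P := by
  rw [multCoord, (multChart_functions hN h1 hZ).1]
  refine Prod.ext rfl ?_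
  simp only [multChart, Matrix.cons_val_zero, Matrix.cons_val_one, Matrix.cons_val_two,
    Matrix.tail_cons, Matrix.head_cons]
  have hZ0 : -(1 + (P.2 ^ m / P.1 ^ N) ^ d) ≠ 0 := neg_ne_zero.2 hZ
  field_simp

omit hN in
lemma multChart_dilate (P : ℂ × ℂ) (τ : ℝ) :
    multChart d m N (((Real.exp (m * τ) : ℝ) : ℂ) * P.1, ((Real.exp (N * τ) : ℝ) : ℂ) * P.2) =
      dilate (linkWeight d m N) τ (multChart d m N P) := by
  rw [dilate_link, Real.exp_nat_mul, Real.exp_nat_mul]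
  have ht : ((Real.exp τ : ℝ) : ℂ) ≠ 0 := by exact_mod_cast (Real.exp_pos τ).ne'
  set t := ((Real.exp τ : ℝ) : ℂ) with htd
  simp only [Complex.ofReal_pow]
  rw [← htd]
  have hη : (t ^ N * P.2) ^ m / (t ^ m * P.1) ^ N = P.2 ^ m / P.1 ^ N := by
    rw [mul_pow, mul_pow, ← pow_mul, ← pow_mul, mul_comm m N, mul_div_mul_left]
    exact pow_ne_zero _ ht
  simp only [multChart, hη]
  generalize -(1 + (P.2 ^ m / P.1 ^ N) ^ d) = Z
  funext j
  fin_cases j <;> simp only [mul_pow, Fin.zero_eta, Fin.mk_one, Fin.reduceFinMk,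
    Matrix.cons_val_zero, Matrix.cons_val_one, Matrix.cons_val] <;> ring

lemma coneChart_multChart (hd : 0 < d) :
    ConeChart (linkExp d m N) (linkWeight d m N) (multChart d m N) (multCoord d m) (m, N)
      {P | P.1 ≠ 0 ∧ ‖P.2 ^ m / P.1 ^ N‖ < 1} where
  isOpen := by
    rw [isOpen_iff_mem_nhds]
    intro P hP
    have hc : ContinuousAt (fun P : ℂ × ℂ => ‖P.2 ^ m / P.1 ^ N‖) P :=
      ((continuous_snd.continuousAt.pow m).div (continuous_fst.continuousAt.pow N)
        (pow_ne_zero _ hP.1)).norm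
    exact (continuous_fst.continuousAt.eventually_ne hP.1).and (hc.eventually (gt_mem_nhds hP.2))
  contDiffAt P hP := by
    have hZ := one_add_pow_ne_zero_of_norm_lt hd hP.2
    have hZ' : -(1 + (P.2 ^ m / P.1 ^ N) ^ d) ≠ 0 := neg_ne_zero.2 hZ
    have h1 : ContDiffAt ℂ ∞ (fun P : ℂ × ℂ => -(1 + (P.2 ^ m / P.1 ^ N) ^ d)) P :=
      (contDiffAt_const.add
        (((contDiffAt_snd.pow m).div_fun (contDiffAt_fst.pow N) (pow_ne_zero _ hP.1)).pow d)).neg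
    refine contDiffAt_vec3 ?_ ?_ ?_
    · exact (contDiffAt_fst.pow _).div_fun (h1.pow _) (pow_ne_zero _ hZ')
    · exact contDiffAt_snd.div_fun (h1.pow _) (pow_ne_zero _ hZ')
    · exact (contDiffAt_fst.pow _).div_fun h1 hZ'
  cone P hP := cone_iff.2 (multChart_cone hN hP.1 (one_add_pow_ne_zero_of_norm_lt hd hP.2))
  left_inv P hP := multCoord_multChart hN hP.1 (one_add_pow_ne_zero_of_norm_lt hd hP.2)
  differentiableAt P hP := by
    have hZ' := neg_ne_zero.2 (one_add_pow_ne_zero_of_norm_lt hd hP.2)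
    have h0 : multChart d m N P 0 ≠ 0 := div_ne_zero (pow_ne_zero _ hP.1) (pow_ne_zero _ hZ')
    have h2 : multChart d m N P 2 ≠ 0 := div_ne_zero (pow_ne_zero _ hP.1) hZ'
    have h3 : DifferentiableAt ℂ (fun x : Fin 3 → ℂ => x 2 ^ (10 * m) / x 0) (multChart d m N P) :=
      ((differentiableAt_coord 2 _).pow _).div_fun (differentiableAt_coord 0 _) h0
    exact DifferentiableAt.prodMk h3
      ((differentiableAt_coord 1 _).mul (((h3.pow d).div_fun (differentiableAt_coord 2 _) h2).pow 10))
  dilate_eq P _ τ := multChart_dilate P τ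
  ne_zero P hP h := by
    have hZ' := neg_ne_zero.2 (one_add_pow_ne_zero_of_norm_lt hd hP.2)
    have h0 : multChart d m N P 0 ≠ 0 := div_ne_zero (pow_ne_zero _ hP.1) (pow_ne_zero _ hZ')
    exact h0 (congrFun h 0)

end MultChart

/-! ### Neighbourhoods of the orbits x₂ = 0 -/

section RootChart

lemma rootBranch_pow {d : ℕ} (hd : 0 < d) {Y : ℂ} (hY : 1 + Y ≠ 0) : rootBranch d Y ^ d = 1 + Y := by
  have : (d : ℂ) ≠ 0 := Nat.cast_ne_zero.2 hd.ne'
  rw [rootBranch, ← Complex.exp_nat_mul, mul_div_cancel₀ _ this, Complex.exp_log hY]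

lemma rootBranch_ne_zero (d : ℕ) (Y : ℂ) : rootBranch d Y ≠ 0 := Complex.exp_ne_zero _

lemma one_add_mem_slitPlane {Y : ℂ} (h : ‖Y‖ < 1) : 1 + Y ∈ Complex.slitPlane :=
  Complex.mem_slitPlane_of_norm_lt_one h

lemma contDiffAt_rootBranch (d : ℕ) {Y : ℂ} (h : ‖Y‖ < 1) : ContDiffAt ℂ ∞ (rootBranch d) Y :=
  ((ContDiffAt.comp Y (f := fun Y : ℂ => 1 + Y) (Complex.contDiffAt_log (one_add_mem_slitPlane h))
    (contDiffAt_const.add contDiffAt_id)).div_const _).cexp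

variable {d m N : ℕ} {p D : ℂ} (hN : N + 1 = 10 * (d * m)) (hd : 0 < d)
  (hp : p ^ d = -1) (hD : ‖D‖ = 1)

include hN hd hp hD

-- This is the reason for the powers of the unit D in the chart: (dm - 1) N = (N - 10) dm + 1, so
-- exactly one factor D survives in x₂^N / x₁^(dm). Likewise one factor D survives in x₂^10 / x₁,
-- where it matches the constant -p in the direction of `CentreData.phase` at this puncture.
omit hd hp in
lemma rootChart_base (hdm : 2 ≤ d * m) {P : ℂ × ℂ} (h1 : P.1 ≠ 0) :
    (D ^ (d * m - 1) * P.2) ^ N / (D ^ (N - 10) * P.1) ^ (d * m) = rootBase d m N D P := by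
  have hD0 : D ≠ 0 := by rw [← norm_ne_zero_iff, hD]; exact one_ne_zero
  have : (d * m - 1) * N = (N - 10) * (d * m) + 1 := by
    obtain ⟨e, he⟩ : ∃ e, d * m = e + 2 := ⟨d * m - 2, by omega⟩
    obtain rfl : N = 10 * e + 19 := by omega
    rw [he]
    have h1 : e + 2 - 1 = e + 1 := by omega
    have h2 : 10 * e + 19 - 10 = 10 * e + 9 := by omega
    rw [h1, h2]; ring
  rw [mul_pow, mul_pow, ← pow_mul, ← pow_mul, this, pow_succ, rootBase]
  field_simp

lemma rootChart_cone (hdm : 2 ≤ d * m) {P : ℂ × ℂ} (h1 : P.1 ≠ 0)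
    (hY : 1 + rootBase d m N D P ≠ 0) :
    rootChart d m N p D P 0 ^ d + rootChart d m N p D P 1 ^ (d * m) +
      rootChart d m N p D P 2 ^ N = 0 := by
  have hD0 : D ≠ 0 := by rw [← norm_ne_zero_iff, hD]; exact one_ne_zero
  have hb := rootChart_base hN hD hdm h1
  have hu : D ^ (N - 10) * P.1 ≠ 0 := mul_ne_zero (pow_ne_zero _ hD0) h1
  simp only [rootChart, Matrix.cons_val_zero, Matrix.cons_val_one, Matrix.cons_val_two,
    Matrix.tail_cons, Matrix.head_cons]
  rw [mul_pow, mul_pow, rootBranch_pow hd hY, hp, ← pow_mul, mul_comm m d, ← hb]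
  field_simp
  ring

lemma coneChart_rootChart (hdm : 2 ≤ d * m) :
    ConeChart (linkExp d m N) (linkWeight d m N) (rootChart d m N p D) (rootCoord d m N D)
      (N, d * m) {P | P.1 ≠ 0 ∧ ‖rootBase d m N D P‖ < 1} where
  isOpen := by
    rw [isOpen_iff_mem_nhds]
    intro P hP
    have hc : ContinuousAt (fun P : ℂ × ℂ => ‖rootBase d m N D P‖) P :=
      ((continuousAt_const.mul (continuous_snd.continuousAt.pow N)).div
        (continuous_fst.continuousAt.pow (d * m)) (pow_ne_zero _ hP.1)).norm
    exact (continuous_fst.continuousAt.eventually_ne hP.1).and (hc.eventually (gt_mem_nhds hP.2))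
  contDiffAt P hP := by
    have h1 : ContDiffAt ℂ ∞ (rootBase d m N D) P :=
      (contDiffAt_const.mul (contDiffAt_snd.pow N)).div_fun (contDiffAt_fst.pow (d * m))
        (pow_ne_zero _ hP.1)
    have h2 : ContDiffAt ℂ ∞ (fun P => rootBranch d (rootBase d m N D P)) P :=
      (contDiffAt_rootBranch d hP.2).comp P h1
    have h3 : ContDiffAt ℂ ∞ (fun P : ℂ × ℂ => D ^ (N - 10) * P.1) P :=
      contDiffAt_const.mul contDiffAt_fst
    exact contDiffAt_vec3 ((contDiffAt_const.mul h2).mul (h3.pow m)) h3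
      (contDiffAt_const.mul contDiffAt_snd)
  cone P hP := cone_iff.2 (rootChart_cone hN hd hp hD hdm hP.1
    (Complex.slitPlane_ne_zero (one_add_mem_slitPlane hP.2)))
  left_inv P _ := by
    have hD0 : D ≠ 0 := by rw [← norm_ne_zero_iff, hD]; exact one_ne_zero
    refine Prod.ext ?_ ?_
    · simp [rootCoord, rootChart, hD0]
    · simp [rootCoord, rootChart, hD0]
  differentiableAt P _ := by
    have hD0 : D ≠ 0 := by rw [← norm_ne_zero_iff, hD]; exact one_ne_zero
    exact DifferentiableAt.prodMk
      ((differentiableAt_coord 1 _).div_fun (differentiableAt_const _) (pow_ne_zero _ hD0))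
      ((differentiableAt_coord 2 _).div_fun (differentiableAt_const _) (pow_ne_zero _ hD0))
  dilate_eq P hP τ := by
    rw [dilate_link, Real.exp_nat_mul, Real.exp_nat_mul]
    have ht : ((Real.exp τ : ℝ) : ℂ) ≠ 0 := by exact_mod_cast (Real.exp_pos τ).ne'
    set t := ((Real.exp τ : ℝ) : ℂ) with htd
    simp only [Complex.ofReal_pow]
    rw [← htd]
    have hη : rootBase d m N D (t ^ N * P.1, t ^ (d * m) * P.2) = rootBase d m N D P := by
      simp only [rootBase]
      rw [mul_pow, mul_pow, ← pow_mul, ← pow_mul, mul_comm N (d * m), mul_left_comm,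
        mul_div_mul_left]
      exact pow_ne_zero _ ht
    funext j
    fin_cases j <;> simp only [rootChart, hη, mul_pow, Fin.zero_eta, Fin.mk_one, Fin.reduceFinMk,
      Matrix.cons_val_zero, Matrix.cons_val_one, Matrix.cons_val] <;> ring
  ne_zero P hP h := by
    have hD0 : D ≠ 0 := by rw [← norm_ne_zero_iff, hD]; exact one_ne_zero
    have h1 : rootChart d m N p D P 1 ≠ 0 := mul_ne_zero (pow_ne_zero _ hD0) hP.1
    exact h1 (congrFun h 1)

end RootChart

/-! ## The radial coordinate along an arm -/

/-- A decreasing function from `(0, ∞)` onto `(α, 1)`, linear up to `r` and `α + β / x` from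
`3 r / 2` on. -/
def radialProfile (r α β : ℝ) : ℝ → ℝ := blend r (fun x => 1 - x / (2 * r)) fun x => α + β / x

section RadialProfile

variable {r α β : ℝ}

lemma radialProfile_of_le (hr : 0 < r) {x : ℝ} (hx : x ≤ r) :
    radialProfile r α β x = 1 - x / (2 * r) := blend_of_le hr hx _ _

lemma radialProfile_of_ge (hr : 0 < r) {x : ℝ} (hx : 3 / 2 * r ≤ x) :
    radialProfile r α β x = α + β / x := blend_of_ge hr hx _ _

lemma contDiffAt_radialProfile {x : ℝ} (hx : 0 < x) : ContDiffAt ℝ ∞ (radialProfile r α β) x :=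
  contDiffAt_blend (contDiffAt_const.sub (contDiffAt_id.div_const _))
    (contDiffAt_const.add (contDiffAt_const.div contDiffAt_id hx.ne'))

variable (hr : 0 < r) (hα : 0 ≤ α) (hβ : 0 < β) (h : α + β / r ≤ 1 / 4)

include hr hβ h

/-- The monotonicity of blends is applied to the negatives. On [r, 3r/2] the linear function is at
least 1/4, and α + β / x is at most α + β / r ≤ 1/4. -/
lemma radialProfile_hasDerivAt {x : ℝ} (hx : 0 < x) :
    ∃ d, d < 0 ∧ HasDerivAt (radialProfile r α β) d x := by
  have h1 : HasDerivAt (fun x : ℝ => -(1 - x / (2 * r))) (1 / (2 * r)) x := by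
    have := (((hasDerivAt_id x).div_const (2 * r)).const_sub 1).neg
    exact this.congr_deriv (neg_neg _)
  have h2 : HasDerivAt (fun x : ℝ => -(α + β / x)) (β / x ^ 2) x := by
    have := (((hasDerivAt_inv hx.ne').const_mul β).const_add α).neg
    refine (this.congr_deriv ?_)
    rw [mul_neg, neg_neg, ← div_eq_mul_inv]
  obtain ⟨d, hd0, hd⟩ := exists_hasDerivAt_blend_pos hr h1 h2 (fun _ => by positivity)
    (fun _ => by positivity) fun hx1 hx2 => by
      have h3 : β / x ≤ β / r := div_le_div_of_nonneg_left hβ.le hr hx1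
      have h4 : x / (2 * r) ≤ 3 / 4 := by rw [div_le_iff₀ (by positivity)]; linarith
      linarith
  refine ⟨-d, by linarith, ?_⟩
  have := hd.neg
  refine this.congr_of_eventuallyEq (Eventually.of_forall fun y => ?_)
  simp only [radialProfile, blend, Pi.neg_apply]
  ring

lemma strictAntiOn_radialProfile : StrictAntiOn (radialProfile r α β) (Set.Ioi 0) := by
  have : StrictMonoOn (fun x => -radialProfile r α β x) (Set.Ioi 0) :=
    strictMonoOn_of_hasDerivAt_pos fun x hx => by
      obtain ⟨d, hd0, hd⟩ := radialProfile_hasDerivAt hr hβ h hx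
      exact ⟨-d, by linarith, hd.neg⟩
  intro x hx y hy hxy
  simpa using this hx hy hxy

omit hβ h in
lemma radialProfile_lt_one_of_le {x : ℝ} (hx : 0 < x) (hxr : x ≤ r) :
    radialProfile r α β x < 1 := by
  rw [radialProfile_of_le hr hxr]
  have : 0 < x / (2 * r) := by positivity
  linarith

lemma radialProfile_lt_one {x : ℝ} (hx : 0 < x) : radialProfile r α β x < 1 := by
  rcases le_or_gt x r with hxr | hxr
  · exact radialProfile_lt_one_of_le hr hx hxr
  · exact (strictAntiOn_radialProfile hr hβ h (Set.mem_Ioi.2 hr) (Set.mem_Ioi.2 hx) hxr).trans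
      (radialProfile_lt_one_of_le hr hr le_rfl)

lemma lt_radialProfile {x : ℝ} (hx : 0 < x) : α < radialProfile r α β x := by
  have key : ∀ y, 3 / 2 * r ≤ y → α < radialProfile r α β y := fun y hy => by
    rw [radialProfile_of_ge hr hy]
    have : 0 < β / y := div_pos hβ (by linarith)
    linarith
  rcases le_or_gt (3 / 2 * r) x with hxr | hxr
  · exact key x hxr
  · exact (key _ le_rfl).trans (strictAntiOn_radialProfile hr hβ h (Set.mem_Ioi.2 hx)
      (Set.mem_Ioi.2 (by linarith)) hxr)

lemma exists_radialProfile_eq {y : ℝ} (h1 : α < y) (h2 : y < 1) :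
    ∃ x, 0 < x ∧ radialProfile r α β x = y := by
  -- x₀ and x₁ are chosen in the ranges of the linear and of the hyperbolic formula, at points where
  -- the value is at least y and at most y.
  set x₀ := min r (2 * r * (1 - y)) with hx₀
  have hx₀0 : 0 < x₀ := lt_min hr (by have : 0 < 1 - y := by linarith
                                      positivity)
  have hx₀y : y ≤ radialProfile r α β x₀ := by
    rw [radialProfile_of_le hr (min_le_left _ _)]
    have : x₀ / (2 * r) ≤ 1 - y := by
      rw [div_le_iff₀ (by positivity)]
      calc x₀ ≤ 2 * r * (1 - y) := min_le_right _ _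
        _ = (1 - y) * (2 * r) := by ring
    linarith
  set x₁ := max (3 / 2 * r) (β / (y - α)) with hx₁
  have hx₁0 : 0 < x₁ := lt_max_of_lt_left (by linarith)
  have hx₁y : radialProfile r α β x₁ ≤ y := by
    rw [radialProfile_of_ge hr (le_max_left _ _)]
    have h3 : 0 < y - α := by linarith
    have : β / x₁ ≤ y - α := by
      rw [div_le_iff₀ hx₁0]
      calc β = (y - α) * (β / (y - α)) := by field_simp
        _ ≤ (y - α) * x₁ := mul_le_mul_of_nonneg_left (le_max_right _ _) h3.le
    linarith
  have h01 : x₀ ≤ x₁ := (min_le_left _ _).trans ((by linarith : r ≤ 3 / 2 * r).trans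
    (le_max_left _ _))
  have hc : ContinuousOn (radialProfile r α β) (Set.Icc x₀ x₁) := fun x hx => by
    obtain ⟨d, _, hd⟩ := radialProfile_hasDerivAt hr hβ h (hx₀0.trans_le hx.1)
    exact hd.continuousAt.continuousWithinAt
  obtain ⟨x, hx, hxy⟩ := intermediate_value_Icc' h01 hc ⟨hx₁y, hx₀y⟩
  exact ⟨x, hx₀0.trans_le hx.1, hxy⟩

end RadialProfile

/-! ## The base of an interior vertex of an arm -/

/-- The straightening of the coordinate `z / (1 + 2 i z)` near `0` and near `i / 2`. -/
def ArmStraightening : Type :=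
  Straightening (ι := Bool) (fun b => cond b (Complex.I / 2) 0)
    (fun b ζ => cond b (Complex.I / 2 / (1 + 2 * Complex.I * ζ)) (ζ / (1 - 2 * Complex.I * ζ)))
    (1 / 8)

lemma one_add_two_I_mul_ne_zero {ζ : ℂ} (h : ‖ζ‖ < 1 / 2) : 1 + 2 * Complex.I * ζ ≠ 0 := by
  intro h0
  have h1 : 2 * Complex.I * ζ = -1 := by linear_combination h0
  have h2 := congrArg norm h1
  rw [norm_mul, norm_mul, Complex.norm_I, norm_neg, norm_one, Complex.norm_ofNat] at h2
  linarith

lemma one_sub_two_I_mul_ne_zero {ζ : ℂ} (h : ‖ζ‖ < 1 / 2) : 1 - 2 * Complex.I * ζ ≠ 0 := by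
  have := one_add_two_I_mul_ne_zero (ζ := -ζ) (by rwa [norm_neg])
  rwa [mul_neg, ← sub_eq_add_neg] at this

/-- The Möbius map z / (1 + 2iz) sends the punctures 0 and i/2 to 0 and ∞. The prescribed germs are
its inverse applied to ζ and to 1 / (4ζ), so that the composite is exactly ζ, respectively 1 / (4ζ),
on the discs. Both germs have derivative 1. -/
lemma nonempty_armStraightening : Nonempty ArmStraightening := by
  refine nonempty_straightening (by norm_num) ?_ ?_ ?_ ?_
  · intro α β hαβ
    cases α <;> cases β <;> simp at hαβ ⊢ <;> norm_num
  · intro α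
    cases α <;> simp
  · intro α
    have : ∀ᶠ ζ : ℂ in 𝓝 0, ‖ζ‖ < 1 / 2 := by
      filter_upwards [Metric.ball_mem_nhds (0 : ℂ) (by norm_num : (0 : ℝ) < 1 / 2)] with ζ hζ
      simpa using hζ
    filter_upwards [this] with ζ hζ
    refine ContDiffAt.restrict_scalars ℝ (𝕜' := ℂ) ?_
    have hl : ∀ c : ℂ, ContDiffAt ℂ ∞ (fun ζ : ℂ => c * ζ) ζ := fun c =>
      contDiffAt_const.mul contDiffAt_id
    cases α
    · exact contDiffAt_id.div_fun (contDiffAt_const.sub (hl _)) (one_sub_two_I_mul_ne_zero hζ)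
    · exact contDiffAt_const.div_fun (contDiffAt_const.add (hl _)) (one_add_two_I_mul_ne_zero hζ)
  · intro α
    have hl : HasDerivAt (fun ζ : ℂ => 2 * Complex.I * ζ) (2 * Complex.I) 0 := by
      simpa using (hasDerivAt_id (0 : ℂ)).const_mul (2 * Complex.I)
    cases α
    · have := (hasDerivAt_id (0 : ℂ)).div (hl.const_sub 1) (by simp)
      refine this.congr_deriv ?_
      simp
    · have := (hasDerivAt_const (0 : ℂ) (Complex.I / 2)).div (hl.const_add 1) (by simp)
      refine this.congr_deriv ?_
      simp
      linear_combination -Complex.I_mul_I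

/-- A fixed choice of straightening for the interior vertices of the arms. -/
def armStraight : ArmStraightening := Classical.choice nonempty_armStraightening

/-- The radius of the discs of the vertices of an arm. -/
def armRadius : ℝ := Straightening.radius armStraight

lemma armRadius_pos : 0 < armRadius := Straightening.radius_pos armStraight

lemma armRadius_le : armRadius ≤ 1 / 16 := by
  have := Straightening.radius_le armStraight
  rw [armRadius]; linarith

/-- The diffeomorphism of the base of an interior vertex. -/
def armDiffeo : ℂ → ℂ := Straightening.toFun armStraight

lemma armDiffeo_near_zero {ζ : ℂ} (h : ‖ζ‖ ≤ armRadius) :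
    armDiffeo ζ = ζ / (1 - 2 * Complex.I * ζ) := by
  have : armDiffeo (0 + ζ) = ζ / (1 - 2 * Complex.I * ζ) :=
    Straightening.eq_near armStraight false ζ h
  rwa [zero_add] at this

lemma armDiffeo_near_center {ζ : ℂ} (h : ‖ζ‖ ≤ armRadius) :
    armDiffeo (Complex.I / 2 + ζ) = Complex.I / 2 / (1 + 2 * Complex.I * ζ) :=
  Straightening.eq_near armStraight true ζ h

lemma norm_I_div_two : ‖Complex.I / 2‖ = 1 / 2 := by simp

lemma armDiffeo_of_one_le {z : ℂ} (h : 1 ≤ ‖z‖) : armDiffeo z = z := by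
  refine Straightening.eq_self armStraight z fun b => ?_
  cases b
  · simp only [cond_false, sub_zero]; linarith
  · have := norm_sub_norm_le z (Complex.I / 2)
    rw [norm_I_div_two] at this
    simp only [cond_true]; linarith

lemma armDiffeo_injective : Function.Injective armDiffeo :=
  (Straightening.bijective armStraight).1

lemma armDiffeo_surjective : Function.Surjective armDiffeo :=
  (Straightening.bijective armStraight).2

lemma armDiffeo_zero : armDiffeo 0 = 0 := by
  have := armDiffeo_near_zero (ζ := 0) (by simpa using armRadius_pos.le)
  simpa using this

lemma armDiffeo_center : armDiffeo (Complex.I / 2) = Complex.I / 2 := by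
  have := armDiffeo_near_center (ζ := 0) (by simpa using armRadius_pos.le)
  simpa using this

/-- The base coordinate of an interior vertex, with values in the punctured plane. -/
def armBase (z : ℂ) : ℂ := armDiffeo z / (1 + 2 * Complex.I * armDiffeo z)

lemma one_add_two_I_mul_eq_zero_iff {z : ℂ} : 1 + 2 * Complex.I * z = 0 ↔ z = Complex.I / 2 := by
  constructor
  · intro h
    linear_combination (-Complex.I / 2) * h + z * Complex.I_mul_I
  · rintro rfl
    linear_combination Complex.I_mul_I

lemma armDiffeo_den_ne_zero {z : ℂ} (h : z ≠ Complex.I / 2) :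
    1 + 2 * Complex.I * armDiffeo z ≠ 0 := by
  intro h0
  rw [one_add_two_I_mul_eq_zero_iff] at h0
  rw [← armDiffeo_center] at h0
  exact h (armDiffeo_injective h0)

lemma armDiffeo_ne_zero {z : ℂ} (h : z ≠ 0) : armDiffeo z ≠ 0 := by
  rw [← armDiffeo_zero]
  exact fun h0 => h (armDiffeo_injective h0)

lemma armBase_ne_zero {z : ℂ} (h0 : z ≠ 0) (h1 : z ≠ Complex.I / 2) : armBase z ≠ 0 :=
  div_ne_zero (armDiffeo_ne_zero h0) (armDiffeo_den_ne_zero h1)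

lemma div_one_add_two_I_mul_div {ξ : ℂ} (h : 1 - 2 * Complex.I * ξ ≠ 0) :
    ξ / (1 - 2 * Complex.I * ξ) / (1 + 2 * Complex.I * (ξ / (1 - 2 * Complex.I * ξ))) = ξ := by
  have h1 : 1 + 2 * Complex.I * (ξ / (1 - 2 * Complex.I * ξ)) = (1 - 2 * Complex.I * ξ)⁻¹ := by
    refine eq_inv_of_mul_eq_one_left ?_
    rw [add_mul, mul_assoc (2 * Complex.I), div_mul_cancel₀ _ h]
    ring
  rw [h1, div_inv_eq_mul, div_mul_cancel₀ _ h]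

lemma armBase_near_zero {ζ : ℂ} (h : ‖ζ‖ ≤ armRadius) : armBase ζ = ζ := by
  have hr := armRadius_le
  have h1 := one_sub_two_I_mul_ne_zero (ζ := ζ) (by linarith)
  rw [armBase, armDiffeo_near_zero h, div_one_add_two_I_mul_div h1]

lemma armBase_near_center {ζ : ℂ} (h : ‖ζ‖ ≤ armRadius) (h0 : ζ ≠ 0) :
    armBase (Complex.I / 2 + ζ) = (4 * ζ)⁻¹ := by
  have hr := armRadius_le
  have h1 := one_add_two_I_mul_ne_zero (ζ := ζ) (by linarith)
  rw [armBase, armDiffeo_near_center h]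
  have h2 : 1 + 2 * Complex.I * (Complex.I / 2 / (1 + 2 * Complex.I * ζ)) =
      2 * Complex.I * ζ / (1 + 2 * Complex.I * ζ) := by
    field_simp
    linear_combination Complex.I_mul_I
  rw [h2, div_div_div_cancel_right₀ h1, mul_inv, div_eq_mul_inv, mul_inv, mul_inv]
  field_simp
  norm_num

lemma armBase_of_one_le {z z' : ℂ} (h : 1 ≤ ‖z‖) (hz : z * z' = 1) :
    armBase z = (z' + 2 * Complex.I)⁻¹ := by
  rw [armBase, armDiffeo_of_one_le h]
  have hz0 : z ≠ 0 := by rintro rfl; simp at hz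
  have h1 : 1 + 2 * Complex.I * z = z * (z' + 2 * Complex.I) := by linear_combination -hz
  rw [h1]
  by_cases h2 : z' + 2 * Complex.I = 0
  · simp [h2]
  · field_simp

lemma add_two_I_ne_zero {z' : ℂ} (h : ‖z'‖ < 1) : z' + 2 * Complex.I ≠ 0 := by
  intro h0
  have h1 : z' = -(2 * Complex.I) := by linear_combination h0
  rw [h1, norm_neg, norm_mul, Complex.norm_I, Complex.norm_ofNat] at h
  linarith

lemma contDiffAt_armBase {z : ℂ} (h1 : z ≠ Complex.I / 2) : ContDiffAt ℝ ∞ armBase z := by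
  have hd : ContDiffAt ℝ ∞ armDiffeo z := (Straightening.contDiff armStraight).contDiffAt
  have h2 : ContDiffAt ℝ ∞ (fun z => 1 + 2 * Complex.I * armDiffeo z) z :=
    contDiffAt_const.add (contDiffAt_const.mul hd)
  have h3 : ContDiffAt ℝ ∞ (fun z => armDiffeo z * (1 + 2 * Complex.I * armDiffeo z)⁻¹) z :=
    hd.mul (h2.inv (armDiffeo_den_ne_zero h1))
  exact h3

lemma posJacAt_armBase {z : ℂ} (h1 : z ≠ Complex.I / 2) : PosJacAt armBase z := by
  have h2 := armDiffeo_den_ne_zero h1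
  have hl : HasDerivAt (fun ζ : ℂ => 1 + 2 * Complex.I * ζ) (2 * Complex.I) (armDiffeo z) := by
    simpa using ((hasDerivAt_id (armDiffeo z)).const_mul (2 * Complex.I)).const_add 1
  have h3 : HasDerivAt (fun ζ : ℂ => ζ / (1 + 2 * Complex.I * ζ)) _ (armDiffeo z) :=
    (hasDerivAt_id (armDiffeo z)).div hl h2
  refine PosJacAt.comp (F := fun ζ : ℂ => ζ / (1 + 2 * Complex.I * ζ)) (h3.posJacAt ?_)
    (Straightening.posJacAt armStraight z)
  have : (1 * (1 + 2 * Complex.I * armDiffeo z) - armDiffeo z * (2 * Complex.I)) = 1 := by ring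
  simp only [id]
  rw [this]
  exact div_ne_zero one_ne_zero (pow_ne_zero _ h2)

lemma armBase_injective {z z' : ℂ} (h : z ≠ Complex.I / 2) (h' : z' ≠ Complex.I / 2)
    (he : armBase z = armBase z') : z = z' := by
  have h2 := armDiffeo_den_ne_zero h
  have h2' := armDiffeo_den_ne_zero h'
  rw [armBase, armBase, div_eq_div_iff h2 h2'] at he
  exact armDiffeo_injective (by linear_combination he)

/-- The base coordinate at infinity is `1 / (2 i)`. -/
lemma armBase_ne_inf {z : ℂ} (h : z ≠ Complex.I / 2) : armBase z ≠ (2 * Complex.I)⁻¹ := by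
  have h2 := armDiffeo_den_ne_zero h
  intro h0
  rw [armBase, div_eq_iff h2] at h0
  have h3 : (2 * Complex.I) ≠ 0 := by simp
  rw [eq_comm, inv_mul_eq_iff_eq_mul₀ h3] at h0
  exact one_ne_zero (by linear_combination h0 : (1 : ℂ) = 0)

lemma exists_armBase_eq {ξ : ℂ} (h0 : ξ ≠ 0) (h1 : ξ ≠ (2 * Complex.I)⁻¹) :
    ∃ z, z ≠ 0 ∧ z ≠ Complex.I / 2 ∧ armBase z = ξ := by
  have hne : 1 - 2 * Complex.I * ξ ≠ 0 := by
    intro h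
    apply h1
    refine eq_inv_of_mul_eq_one_left ?_
    linear_combination -h
  obtain ⟨z, hz⟩ := armDiffeo_surjective (ξ / (1 - 2 * Complex.I * ξ))
  have hz0 : z ≠ 0 := by
    rintro rfl
    rw [armDiffeo_zero, eq_comm, div_eq_zero_iff] at hz
    exact hz.elim h0 hne
  have hz1 : z ≠ Complex.I / 2 := by
    rintro rfl
    rw [armDiffeo_center, eq_div_iff hne] at hz
    have : Complex.I = 0 := by linear_combination 2 * hz + 2 * ξ * Complex.I_mul_I
    exact Complex.I_ne_zero this
  refine ⟨z, hz0, hz1, ?_⟩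
  rw [armBase, hz, div_one_add_two_I_mul_div hne]

/-- The function whose direction trivializes the bundle of an interior vertex. -/
def armPhase (z : ℂ) : ℂ :=
  cutoff (z / ((1 / 8 : ℝ) : ℂ)) + (1 - cutoff (z / ((1 / 8 : ℝ) : ℂ))) * (z - Complex.I / 2)

lemma armPhase_near_zero {z : ℂ} (h : ‖z‖ ≤ 1 / 8) : armPhase z = 1 := by
  rw [armPhase, cutoff_of_le (by norm_num) h]; simp

lemma armPhase_of_ge {z : ℂ} (h : 1 / 4 ≤ ‖z‖) : armPhase z = z - Complex.I / 2 := by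
  rw [armPhase, cutoff_of_ge (by norm_num) (by linarith)]; simp

lemma armPhase_near_center {ζ : ℂ} (h : ‖ζ‖ ≤ armRadius) :
    armPhase (Complex.I / 2 + ζ) = ζ := by
  have hr := armRadius_le
  rw [armPhase_of_ge, add_sub_cancel_left]
  have h2 : Complex.I / 2 + ζ = Complex.I / 2 - (-ζ) := by ring
  have h3 := norm_sub_norm_le (Complex.I / 2) (-ζ)
  rw [h2]
  rw [norm_neg, norm_I_div_two] at h3
  linarith

lemma contDiff_armPhase : ContDiff ℝ ∞ armPhase := by
  have h1 : ContDiff ℝ ∞ fun z : ℂ => z / ((1 / 8 : ℝ) : ℂ) := contDiff_id.div_const _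
  have h2 : ContDiff ℝ ∞ fun z : ℂ => ((cutoff (z / ((1 / 8 : ℝ) : ℂ)) : ℝ) : ℂ) :=
    Complex.ofRealCLM.contDiff.comp (cutoff.contDiff.comp h1)
  exact h2.add ((contDiff_const.sub h2).mul (contDiff_id.sub contDiff_const))

/-- In the transition zone ‖z‖ < 1/4 the function interpolates between 1 and a number with negative
imaginary part, and such a segment misses 0. -/
lemma armPhase_ne_zero {z : ℂ} (h : z ≠ Complex.I / 2) : armPhase z ≠ 0 := by
  rcases le_or_gt (1 / 4) ‖z‖ with h1 | h1
  · rw [armPhase_of_ge h1]; exact sub_ne_zero.2 h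
  · intro h0
    set β : ℝ := cutoff (z / ((1 / 8 : ℝ) : ℂ)) with hβ
    have him := congrArg Complex.im h0
    have hre := congrArg Complex.re h0
    simp [armPhase] at him hre
    have hz : z.im < 1 / 4 := (Complex.im_le_norm z).trans_lt h1
    rcases him with hb | hb
    · rw [hb] at hre; simp at hre; linarith
    · linarith

/-! ## The base of the central vertex -/

/-- The solutions of `p ^ d = -1`. -/
def rootPt (d : ℕ) (j : Fin d) : ℂ :=
  Complex.exp (Real.pi * Complex.I / d) * Complex.exp (2 * Real.pi * Complex.I / d) ^ (j : ℕ)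

section RootPt

variable {d : ℕ}

lemma exp_pi_div_pow (hd : 0 < d) : Complex.exp (Real.pi * Complex.I / d) ^ d = -1 := by
  have : (d : ℂ) ≠ 0 := Nat.cast_ne_zero.2 hd.ne'
  rw [← Complex.exp_nat_mul, mul_div_cancel₀ _ this, Complex.exp_pi_mul_I]

lemma rootPt_pow (j : Fin d) : rootPt d j ^ d = -1 := by
  have hd : 0 < d := j.pos
  rw [rootPt, mul_pow, exp_pi_div_pow hd, ← pow_mul, mul_comm (j : ℕ), pow_mul,
    (Complex.isPrimitiveRoot_exp d hd.ne').pow_eq_one, one_pow, mul_one]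

lemma rootPt_injective : Function.Injective (rootPt d) := by
  intro i j h
  have hd : 0 < d := i.pos
  exact Fin.ext ((Complex.isPrimitiveRoot_exp d hd.ne').pow_inj i.2 j.2
    (mul_left_cancel₀ (Complex.exp_ne_zero _) h))

lemma exists_rootPt_eq (hd : 0 < d) {y : ℂ} (hy : y ^ d = -1) : ∃ j, rootPt d j = y := by
  have he := Complex.exp_ne_zero (Real.pi * Complex.I / d)
  have h1 : (y / Complex.exp (Real.pi * Complex.I / d)) ^ d = 1 := by
    rw [div_pow, hy, exp_pi_div_pow hd, div_self (by norm_num)]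
  have : NeZero d := ⟨hd.ne'⟩
  obtain ⟨i, hi, h⟩ := (Complex.isPrimitiveRoot_exp d hd.ne').eq_pow_of_pow_eq_one h1
  refine ⟨⟨i, hi⟩, ?_⟩
  rw [rootPt]
  simp only
  rw [h, mul_div_cancel₀ _ he]

lemma norm_rootPt (j : Fin d) : ‖rootPt d j‖ = 1 := by
  have h := congrArg norm (rootPt_pow j)
  rw [norm_pow, norm_neg, norm_one] at h
  exact (pow_eq_one_iff_of_nonneg (norm_nonneg _) j.pos.ne').1 h

lemma rootPt_ne_zero (j : Fin d) : rootPt d j ≠ 0 := by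
  rw [← norm_ne_zero_iff, norm_rootPt]; exact one_ne_zero

end RootPt

/-- The punctures of the base of the central vertex. -/
def centrePt (d : ℕ) : Option (Fin d) → ℂ
  | none => 0
  | some j => (2 * rootPt d j)⁻¹

section CentrePt

variable {d : ℕ}

lemma norm_centrePt_some (j : Fin d) : ‖centrePt d (some j)‖ = 1 / 2 := by
  rw [centrePt, norm_inv, norm_mul, norm_rootPt, Complex.norm_ofNat]; norm_num

lemma centrePt_some_ne_zero (j : Fin d) : centrePt d (some j) ≠ 0 := by
  rw [← norm_ne_zero_iff, norm_centrePt_some]; norm_num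

lemma centrePt_injective : Function.Injective (centrePt d) := by
  intro α β h
  cases α <;> cases β
  · rfl
  · exact absurd h.symm (centrePt_some_ne_zero _)
  · exact absurd h (centrePt_some_ne_zero _)
  · have h1 := inv_injective h
    rw [rootPt_injective (mul_left_cancel₀ two_ne_zero h1)]

lemma norm_centrePt_le (α : Option (Fin d)) : ‖centrePt d α‖ ≤ 1 / 2 := by
  cases α
  · simp [centrePt]
  · exact (norm_centrePt_some _).le

/-- The bound 4dρ ≤ 1 keeps 2dζ, up to a unit the argument of the root branch, at most 1/4 on the
discs of the central vertex. -/
lemma exists_separation (d : ℕ) : ∃ ρ : ℝ, 0 < ρ ∧ ρ ≤ 1 / 16 ∧ 4 * (d * ρ) ≤ 1 ∧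
    ∀ α β, α ≠ β → 2 * ρ ≤ ‖centrePt d α - centrePt d β‖ := by
  have ht : ∀ c : ℝ, Tendsto (fun r : ℝ => c * r) (𝓝[>] 0) (𝓝 0) := fun c => by
    have : Tendsto (fun r : ℝ => c * r) (𝓝 0) (𝓝 (c * 0)) := tendsto_id.const_mul c
    rw [mul_zero] at this
    exact this.mono_left nhdsWithin_le_nhds
  have h0 : ∀ᶠ ρ : ℝ in 𝓝[>] 0, 0 < ρ := self_mem_nhdsWithin
  have h1 : ∀ᶠ ρ : ℝ in 𝓝[>] 0, ρ ≤ 1 / 16 :=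
    nhdsWithin_le_nhds (ge_mem_nhds (by norm_num))
  have h2 : ∀ᶠ ρ : ℝ in 𝓝[>] 0, (4 * d) * ρ ≤ 1 := (ht _).eventually (ge_mem_nhds one_pos)
  have h3 : ∀ᶠ ρ : ℝ in 𝓝[>] 0, ∀ α β, α ≠ β → 2 * ρ ≤ ‖centrePt d α - centrePt d β‖ := by
    refine eventually_all.2 fun α => eventually_all.2 fun β => ?_
    by_cases h : α = β
    · exact Eventually.of_forall fun _ hn => absurd h hn
    · filter_upwards [(ht 2).eventually (ge_mem_nhds
        (norm_pos_iff.2 (sub_ne_zero.2 (centrePt_injective.ne h))))] with ρ hρ _ using hρ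
  obtain ⟨ρ, hρ⟩ := (h0.and (h1.and (h2.and h3))).exists
  exact ⟨ρ, hρ.1, hρ.2.1, by linarith [hρ.2.2.1], hρ.2.2.2⟩

end CentrePt

/-- The choices in the construction of the base coordinate of the central vertex. -/
structure CentreData (d : ℕ) where
  ρ : ℝ
  ρ_le : ρ ≤ 1 / 16
  ρ_le' : 4 * (d * ρ) ≤ 1
  sep : ∀ α β, α ≠ β → 2 * ρ ≤ ‖centrePt d α - centrePt d β‖
  inner : Straightening (fun j : Fin d => centrePt d (some j))
    (fun j ζ => centrePt d (some j) / rootBranch d (2 * d * -rootPt d j * ζ)) ρ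
  outer : Straightening (fun j : Fin d => centrePt d (some j))
    (fun j ζ => centrePt d (some j) * rootBranch d (-(2 * d * -rootPt d j * ζ))) ρ

lemma hasDerivAt_rootBranch_mul {d : ℕ} (hd : 0 < d) (c : ℂ) :
    HasDerivAt (fun ζ : ℂ => rootBranch d (d * c * ζ)) c 0 := by
  have hd0 : (d : ℂ) ≠ 0 := Nat.cast_ne_zero.2 hd.ne'
  have h1 : HasDerivAt (fun ζ : ℂ => 1 + d * c * ζ) (d * c) 0 := by
    simpa using ((hasDerivAt_id (0 : ℂ)).const_mul (d * c)).const_add 1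
  have h2 := ((h1.clog (by simp)).div_const (d : ℂ)).cexp
  refine h2.congr_deriv ?_
  simp
  field_simp

lemma rootBranch_zero (d : ℕ) : rootBranch d 0 = 1 := by simp [rootBranch]

lemma eventually_contDiffAt_rootBranch_mul (d : ℕ) (c : ℂ) :
    ∀ᶠ ζ : ℂ in 𝓝 0, ContDiffAt ℝ ∞ (fun ζ : ℂ => rootBranch d (c * ζ)) ζ := by
  have h : Tendsto (fun ζ : ℂ => ‖c * ζ‖) (𝓝 0) (𝓝 0) := by
    have : Continuous fun ζ : ℂ => ‖c * ζ‖ := by fun_prop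
    simpa using this.tendsto 0
  filter_upwards [h.eventually (gt_mem_nhds one_pos)] with ζ hζ
  refine ContDiffAt.restrict_scalars ℝ (𝕜' := ℂ) ?_
  exact (contDiffAt_rootBranch d hζ).comp ζ (contDiffAt_const.mul contDiffAt_id)

/-- Apart from the straightening, y is 1 / (2z), with punctures at 0 and at c_j = 1 / (2p_j). The
inner germ turns y into p_j (1 - p_j η)^(1/d) with η = 2dζ, so that 1 + y^d becomes linear in ζ. The
outer germ makes 2^(-d) + x^d linear in ζ, which is needed for the phase. Both have derivative 1
because 2 p_j c_j = 1. -/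
lemma nonempty_centreData {d : ℕ} (hd : 0 < d) : Nonempty (CentreData d) := by
  obtain ⟨ρ, h0, h1, h2, h3⟩ := exists_separation d
  have hsep : ∀ i j : Fin d, i ≠ j → 2 * ρ ≤ ‖centrePt d (some i) - centrePt d (some j)‖ :=
    fun i j hij => h3 _ _ fun h => hij (Option.some_injective _ h)
  have hone : ∀ j : Fin d, centrePt d (some j) * (2 * rootPt d j) = 1 := fun j => by
    rw [centrePt, inv_mul_cancel₀]
    exact mul_ne_zero two_ne_zero (rootPt_ne_zero j)
  obtain ⟨ψ⟩ : Nonempty (Straightening (fun j : Fin d => centrePt d (some j))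
      (fun j ζ => centrePt d (some j) / rootBranch d (2 * d * -rootPt d j * ζ)) ρ) := by
    refine nonempty_straightening h0 hsep (fun j => ?_) (fun j => ?_) fun j => ?_
    · simp [rootBranch_zero]
    · filter_upwards [eventually_contDiffAt_rootBranch_mul d (2 * d * -rootPt d j)] with ζ hζ
      simp only [div_eq_mul_inv]
      exact contDiffAt_const.mul (hζ.inv (rootBranch_ne_zero _ _))
    · have := (hasDerivAt_const (0 : ℂ) (centrePt d (some j))).div
        (hasDerivAt_rootBranch_mul hd (2 * -rootPt d j)) (rootBranch_ne_zero _ _)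
      have he : (fun ζ : ℂ => rootBranch d (d * (2 * -rootPt d j) * ζ)) =
          fun ζ => rootBranch d (2 * d * -rootPt d j * ζ) := by
        funext ζ; congr 1; ring
      rw [he] at this
      refine this.congr_deriv ?_
      simp [rootBranch_zero]
      linear_combination hone j
  obtain ⟨ψ'⟩ : Nonempty (Straightening (fun j : Fin d => centrePt d (some j))
      (fun j ζ => centrePt d (some j) * rootBranch d (-(2 * d * -rootPt d j * ζ))) ρ) := by
    have he : ∀ j, (fun ζ : ℂ => rootBranch d (-(2 * d * -rootPt d j * ζ))) =
        fun ζ => rootBranch d (d * (2 * rootPt d j) * ζ) := fun j => by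
      funext ζ; congr 1; ring
    refine nonempty_straightening h0 hsep (fun j => ?_) (fun j => ?_) fun j => ?_
    · simp [rootBranch_zero]
    · filter_upwards [eventually_contDiffAt_rootBranch_mul d (d * (2 * rootPt d j))] with ζ hζ
      rw [← he] at hζ
      exact contDiffAt_const.mul hζ
    · have := (hasDerivAt_rootBranch_mul hd (2 * rootPt d j)).const_mul (centrePt d (some j))
      have hj := this.congr_deriv (hone j)
      have hf : (fun ζ : ℂ => centrePt d (some j) * rootBranch d (-(2 * d * -rootPt d j * ζ))) =
          fun ζ => centrePt d (some j) * rootBranch d (d * (2 * rootPt d j) * ζ) := by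
        funext ζ; rw [congrFun (he j) ζ]
      rwa [hf]
  exact ⟨⟨ρ, h1, h2, h3, ψ, ψ'⟩⟩

/-- The multiplicity of the fibre over a puncture. -/
def endMult (m N : ℕ) {d : ℕ} : Option (Fin d) → ℕ
  | none => m
  | some _ => N

/-- The scale of the base coordinate near a puncture. -/
def endScale (d : ℕ) : Option (Fin d) → ℝ
  | none => 2
  | some _ => 2 * d

/-- The value of `y` at a parameter near a puncture. -/
def endVal (d : ℕ) : Option (Fin d) → ℂ → ℂ
  | none, η => η⁻¹
  | some j, η => rootPt d j * rootBranch d (-rootPt d j * η)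

/-! ### The base coordinate and the phase of the central vertex -/

namespace CentreData

variable {d : ℕ} (C : CentreData d)

/-- The radius of the discs of the central vertex. -/
def rad : ℝ := min C.inner.radius C.outer.radius / 2

/-- The outer radius in the charts about the exceptional orbits. -/
def rstar : ℝ := C.rad / 2

lemma rad_pos : 0 < C.rad := by
  have := lt_min C.inner.radius_pos C.outer.radius_pos
  rw [rad]; linarith

lemma rstar_pos : 0 < C.rstar := by
  have := C.rad_pos
  rw [rstar]; linarith

lemma two_mul_rad_le_inner : 2 * C.rad ≤ C.inner.radius := by
  have := min_le_left C.inner.radius C.outer.radius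
  rw [rad]; linarith

lemma two_mul_rad_le_outer : 2 * C.rad ≤ C.outer.radius := by
  have := min_le_right C.inner.radius C.outer.radius
  rw [rad]; linarith

lemma four_mul_rad_le : 4 * C.rad ≤ C.ρ := by
  have := C.two_mul_rad_le_inner
  have := C.inner.radius_le
  linarith

lemma rad_le : C.rad ≤ 1 / 64 := by
  have := C.four_mul_rad_le
  have := C.ρ_le
  linarith

lemma rstar_lt_one : C.rstar < 1 := by
  have := C.rad_le
  rw [rstar]; linarith

lemma sep' (α β : Option (Fin d)) (h : α ≠ β) :
    3 / 2 * C.rad + 2 * C.rad ≤ ‖centrePt d α - centrePt d β‖ := by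
  have := C.sep α β h
  have := C.four_mul_rad_le
  have := C.rad_pos
  linarith

/-- The radial coordinate of the circle bundle over the disc at a puncture. -/
def level (e : ℕ) (t : ℝ) : ℝ := (C.rstar * ((1 + t) / 2)) ^ e

lemma level_pos (e : ℕ) {t : ℝ} (ht : 0 ≤ t) : 0 < C.level e t := by
  have := C.rstar_pos
  rw [level]; positivity

/-- The radial profile of the blow-up at a puncture. -/
def profile (m N : ℕ) (α : Option (Fin d)) : ℝ → ℝ :=
  blend C.rad (fun x => C.level (endMult m N α) (x / C.rad) / endScale d α) fun x => x

lemma two_le_endScale (hd : 0 < d) (α : Option (Fin d)) : 2 ≤ endScale d α := by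
  have : (1 : ℝ) ≤ d := by exact_mod_cast hd
  cases α <;> simp only [endScale] <;> linarith

lemma endMult_pos {m N : ℕ} (hm : 0 < m) (hN : 0 < N) (α : Option (Fin d)) :
    0 < endMult m N α := by cases α <;> assumption

variable {m N : ℕ} (hd : 0 < d) (hm : 0 < m) (hN : 0 < N)

include hd hm hN

/-- The value at 0 is positive: the puncture is opened to a disc, over which the points of the link
come from the arm only. For 0 < t < 1 the level describes the part shared by the centre and the arm.
-/
lemma isRadialProfile (α : Option (Fin d)) : IsRadialProfile (C.profile m N α)
    (C.level (endMult m N α) 0 / endScale d α) (3 / 2 * C.rad) := by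
  have he := endMult_pos hm hN α
  set e := endMult m N α
  have hK := two_le_endScale hd α
  have hr := C.rad_pos
  have hR := C.rstar_pos
  have := isRadialProfile_blend hr
    (f := fun x => C.level e (x / C.rad) / endScale d α) ?_ ?_ ?_ ?_
  · simpa [profile] using this
  · simp only [level]
    fun_prop
  · intro x hx
    have h1 : HasDerivAt (fun x : ℝ => C.rstar * ((1 + x / C.rad) / 2)) (C.rstar * (1 / C.rad / 2)) x :=
      ((((hasDerivAt_id x).div_const C.rad).const_add 1).div_const 2).const_mul _
    have h2 := (h1.pow e).div_const (endScale d α)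
    refine ⟨_, ?_, h2⟩
    have : (0 : ℝ) < e := by exact_mod_cast he
    have : 0 < endScale d α := by linarith
    positivity
  · have := C.level_pos e (t := 0 / C.rad) (by simp)
    positivity
  · simp only [level]
    have h1 : 3 / 2 * C.rad / C.rad = 3 / 2 := by field_simp
    -- At x = 3/2 · rad the level is (5/8 · rad)^e, and since rad is small its quotient by the scale
    -- is at most rad, as the blending requires.
    have h2 : C.rstar * ((1 + 3 / 2) / 2) = 5 / 8 * C.rad := by rw [rstar]; ring
    rw [h1, h2, div_le_iff₀ (by linarith)]
    have h3 : (5 / 8 * C.rad) ^ e ≤ 5 / 8 * C.rad :=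
      pow_le_of_le_one (by positivity) (by linarith [C.rad_le]) he.ne'
    nlinarith

omit hm hN

lemma inner_centrePt (α : Option (Fin d)) {η : ℂ} (h : ‖η‖ ≤ 4 * C.rad) :
    (2 * C.inner.toFun (centrePt d α + η / endScale d α))⁻¹ = endVal d α η := by
  have hK := two_le_endScale hd α
  have hη : ‖η / (endScale d α : ℂ)‖ ≤ 2 * C.rad := by
    rw [norm_div, Complex.norm_real, Real.norm_of_nonneg (by linarith),
      div_le_iff₀ (by linarith)]
    nlinarith [C.rad_pos]
  cases α with
  | none =>
    have : C.inner.toFun (centrePt d none + η / (endScale d none : ℂ)) = η / 2 := by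
      rw [C.inner.eq_self]
      · simp [centrePt, endScale]
      · intro j
        have h1 := norm_sub_norm_le (centrePt d (some j))
          (centrePt d none + η / (endScale d none : ℂ))
        rw [norm_sub_rev, norm_centrePt_some] at h1
        rw [centrePt, zero_add] at h1 ⊢
        have := C.rad_le
        have := C.ρ_le
        linarith
    rw [this, mul_div_cancel₀ _ two_ne_zero, endVal]
  | some j =>
    rw [C.inner.eq_near j _ (hη.trans C.two_mul_rad_le_inner), endVal]
    have hd0 : (d : ℂ) ≠ 0 := Nat.cast_ne_zero.2 hd.ne'
    have h1 : 2 * (d : ℂ) * -rootPt d j * (η / (endScale d (some j) : ℂ)) = -rootPt d j * η := by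
      simp only [endScale]; push_cast; field_simp
    rw [h1, centrePt]
    have := rootPt_ne_zero j
    have := rootBranch_ne_zero d (-rootPt d j * η)
    field_simp

omit hd

/-- The blow-up of the punctures of the base of the central vertex. -/
def blow (m N : ℕ) : ℂ → ℂ := blowUp (centrePt d) (C.profile m N)

/-- The coordinate `y` on the base of the central vertex. -/
def base (m N : ℕ) (z : ℂ) : ℂ := (2 * C.inner.toFun (C.blow m N z))⁻¹

/-- The function whose direction trivializes the bundle of the central vertex. -/
def phase (z : ℂ) : ℂ :=
  (1 - cutoff (C.outer.toFun z / ((1 / 8 : ℝ) : ℂ))) * C.outer.toFun z ^ d + (2 ^ d)⁻¹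

lemma centrePt_pow (j : Fin d) : centrePt d (some j) ^ d = -(2 ^ d)⁻¹ := by
  rw [centrePt, inv_pow, mul_pow, rootPt_pow, mul_neg_one, inv_neg]

lemma outer_centrePt (j : Fin d) : C.outer.toFun (centrePt d (some j)) = centrePt d (some j) := by
  have := C.outer.eq_near j 0 (by simpa using C.outer.radius_pos.le)
  simpa [rootBranch_zero] using this

lemma inner_zero : C.inner.toFun 0 = 0 := by
  refine C.inner.eq_self 0 fun j => ?_
  rw [zero_sub, norm_neg, norm_centrePt_some]
  linarith [C.ρ_le]

lemma inner_centrePt_some (j : Fin d) :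
    C.inner.toFun (centrePt d (some j)) = centrePt d (some j) := by
  have := C.inner.eq_near j 0 (by simpa using C.inner.radius_pos.le)
  simpa [rootBranch_zero] using this

lemma contDiff_phase : ContDiff ℝ ∞ C.phase := by
  have h1 : ContDiff ℝ ∞ fun z : ℂ => C.outer.toFun z / ((1 / 8 : ℝ) : ℂ) :=
    C.outer.contDiff.div_const _
  have h2 : ContDiff ℝ ∞ fun z : ℂ => ((cutoff (C.outer.toFun z / ((1 / 8 : ℝ) : ℂ)) : ℝ) : ℂ) :=
    Complex.ofRealCLM.contDiff.comp (cutoff.contDiff.comp h1)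
  exact ((contDiff_const.sub h2).mul (C.outer.contDiff.pow d)).add contDiff_const

/-- A zero gives (1 - χ) x^d = -2^(-d), hence |x| ≥ 1/2. There the cutoff χ vanishes, so (2x)^(-1)
is a d-th root of -1 and the point is a puncture. -/
lemma phase_ne_zero (hd : 0 < d) {z : ℂ} (hz : ∀ j, z ≠ centrePt d (some j)) : C.phase z ≠ 0 := by
  intro h0
  set x := C.outer.toFun z with hx
  set χ : ℝ := cutoff (x / ((1 / 8 : ℝ) : ℂ)) with hχ
  have h1 : ((1 - χ : ℝ) : ℂ) * x ^ d = -(2 ^ d)⁻¹ := by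
    have : ((1 - χ : ℝ) : ℂ) * x ^ d + (2 ^ d)⁻¹ = 0 := by
      rw [← h0, phase, Complex.ofReal_sub, Complex.ofReal_one]
    linear_combination this
  have h2 := congrArg norm h1
  rw [norm_mul, Complex.norm_real, norm_pow, norm_neg, norm_inv, norm_pow, Complex.norm_ofNat,
    Real.norm_of_nonneg (by linarith [cutoff.le_one (x := x / ((1 / 8 : ℝ) : ℂ))])] at h2
  have h3 : 1 / 2 ≤ ‖x‖ := by
    by_contra hlt
    push Not at hlt
    have h4 : ‖x‖ ^ d < (1 / 2) ^ d := pow_lt_pow_left₀ hlt (norm_nonneg _) hd.ne'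
    have h5 : (1 - χ) * ‖x‖ ^ d ≤ ‖x‖ ^ d :=
      mul_le_of_le_one_left (by positivity) (by linarith [cutoff.nonneg (x := x / ((1 / 8 : ℝ) : ℂ))])
    rw [one_div, inv_pow] at h4
    linarith
  have hχ0 : χ = 0 := cutoff_of_ge (by norm_num) (by linarith)
  rw [hχ0, sub_zero, Complex.ofReal_one, one_mul] at h1
  have hx0 : x ≠ 0 := by rw [← norm_pos_iff]; linarith
  obtain ⟨j, hj⟩ := exists_rootPt_eq hd (y := (2 * x)⁻¹) (by
    rw [inv_pow, mul_pow, h1, mul_neg, mul_inv_cancel₀ (pow_ne_zero _ two_ne_zero), inv_neg, inv_one])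
  have hxc : x = centrePt d (some j) := by
    rw [centrePt, hj]; field_simp
  rw [hx, ← C.outer_centrePt j] at hxc
  exact hz j (C.outer.bijective.1 hxc)

lemma dir_phase_near_zero {z : ℂ} (hz : ‖z‖ ≤ 1 / 8) : dir (C.phase z) = 1 := by
  have : C.outer.toFun z = z := by
    refine C.outer.eq_self z fun j => ?_
    have h1 := norm_sub_norm_le (centrePt d (some j)) z
    rw [norm_sub_rev, norm_centrePt_some] at h1
    linarith [C.ρ_le]
  rw [phase, this, cutoff_of_le (by norm_num) hz]
  have : (1 - ((1 : ℝ) : ℂ)) * z ^ d + (2 ^ d)⁻¹ = (((2 ^ d)⁻¹ : ℝ) : ℂ) := by push_cast; ring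
  rw [this, dir_ofReal (by positivity)]

/-- Through the outer straightening the phase is exactly 2d · 2^(-d) · (-p_j ζ) near the puncture.
The constant direction -p_j is compensated by the unit D in `rootChart`. -/
lemma dir_phase_near_centre (hd : 0 < d) (j : Fin d) {ζ : ℂ} (hζ : ‖ζ‖ ≤ 2 * C.rad) :
    dir (C.phase (centrePt d (some j) + ζ)) = -rootPt d j * dir ζ := by
  have h1 : C.outer.toFun (centrePt d (some j) + ζ) = _ :=
    C.outer.eq_near j ζ (hζ.trans C.two_mul_rad_le_outer)
  have hd0 : (0 : ℝ) < d := by exact_mod_cast hd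
  set X := 2 * d * -rootPt d j * ζ with hX
  have hX1 : ‖X‖ ≤ 1 / 4 := by
    rw [hX, norm_mul, norm_mul, norm_mul, norm_neg, norm_rootPt, Complex.norm_natCast,
      Complex.norm_ofNat]
    have := C.ρ_le'
    have := C.four_mul_rad_le
    nlinarith
  have hbr : rootBranch d (-X) ^ d = 1 - X := by
    rw [rootBranch_pow hd, sub_eq_add_neg]
    refine Complex.slitPlane_ne_zero (one_add_mem_slitPlane ?_)
    rw [norm_neg]; linarith
  have hpow : C.outer.toFun (centrePt d (some j) + ζ) ^ d = -(2 ^ d)⁻¹ * (1 - X) := by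
    rw [h1, mul_pow, hbr, centrePt_pow]
  have hnorm : 1 / 4 ≤ ‖C.outer.toFun (centrePt d (some j) + ζ)‖ := by
    by_contra hlt
    push Not at hlt
    have h2 : ‖C.outer.toFun (centrePt d (some j) + ζ)‖ ^ d < (1 / 4) ^ d :=
      pow_lt_pow_left₀ hlt (norm_nonneg _) hd.ne'
    have h3 := congrArg norm hpow
    rw [norm_pow, norm_mul, norm_neg, norm_inv, norm_pow, Complex.norm_ofNat] at h3
    have h4 : 3 / 4 ≤ ‖1 - X‖ := by
      have := norm_sub_norm_le 1 X
      rw [norm_one] at this; linarith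
    have h5 : ((1 : ℝ) / 4) ^ d = (2 ^ d)⁻¹ * (1 / 2) ^ d := by
      rw [← inv_pow, ← mul_pow]; norm_num
    have h6 : ((1 : ℝ) / 2) ^ d ≤ 1 / 2 := pow_le_of_le_one (by norm_num) (by norm_num) hd.ne'
    have h7 : (0 : ℝ) < (2 ^ d)⁻¹ := by positivity
    nlinarith
  rw [phase, cutoff_of_ge (by norm_num) (by linarith), hpow]
  have : (1 - ((0 : ℝ) : ℂ)) * (-(2 ^ d)⁻¹ * (1 - X)) + (2 ^ d)⁻¹ =
      ((2 * d * (2 ^ d)⁻¹ : ℝ) : ℂ) * (-rootPt d j * ζ) := by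
    rw [hX]; push_cast; ring
  rw [this, dir_ofReal_mul (by positivity), dir_mul, dir_of_norm_eq_one]
  rw [norm_neg, norm_rootPt]

/-- The leading term z^d has winding number d at infinity; it accounts for the weight -d of the
centre. -/
lemma phase_of_one_le {z : ℂ} (hz : 1 ≤ ‖z‖) : C.phase z = z ^ d + (2 ^ d)⁻¹ := by
  have : C.outer.toFun z = z := by
    refine C.outer.eq_self z fun j => ?_
    have h1 := norm_sub_norm_le z (centrePt d (some j))
    rw [norm_centrePt_some] at h1
    linarith [C.ρ_le]
  rw [phase, this, cutoff_of_ge (by norm_num) (by linarith)]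
  simp

include hd hm hN

lemma blow_near_centre (α : Option (Fin d)) {t : ℝ} (ht : 0 < t) (ht1 : t ≤ 1) {b : ℂ}
    (hb : ‖b‖ = 1) : C.blow m N (centrePt d α + ((t * C.rad : ℝ) : ℂ) * b) =
      centrePt d α + (C.level (endMult m N α) t : ℂ) * b / endScale d α := by
  have hr := C.rad_pos
  have hn : ‖((t * C.rad : ℝ) : ℂ) * b‖ = t * C.rad := by
    rw [norm_mul, hb, Complex.norm_real, Real.norm_of_nonneg (by positivity), mul_one]
  have htr : t * C.rad ≤ C.rad := mul_le_of_le_one_left hr.le ht1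
  rw [blow, blowUp_of_norm_le (C.isRadialProfile hd hm hN) C.sep' α (by rw [hn]; linarith), hn,
    dir_ofReal_mul (by positivity), dir_of_norm_eq_one hb, profile, blend_of_le hr htr,
    mul_div_cancel_right₀ _ hr.ne']
  push_cast
  ring

omit hd hm hN in
lemma level_le {e : ℕ} (he : 0 < e) {t : ℝ} (ht : 0 ≤ t) (ht1 : t ≤ 1) :
    C.level e t ≤ C.rad := by
  have hr := C.rad_pos
  have hR : C.rstar = C.rad / 2 := rfl
  have h1 : C.rstar * ((1 + t) / 2) ≤ C.rad := by rw [hR]; nlinarith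
  have h2 := C.rad_le
  exact (pow_le_of_le_one (by rw [hR]; positivity) (by linarith) he.ne').trans h1

lemma base_near_centre (α : Option (Fin d)) {t : ℝ} (ht : 0 < t) (ht1 : t ≤ 1) {b : ℂ}
    (hb : ‖b‖ = 1) : C.base m N (centrePt d α + ((t * C.rad : ℝ) : ℂ) * b) =
      endVal d α ((C.level (endMult m N α) t : ℂ) * b) := by
  rw [base, C.blow_near_centre hd hm hN α ht ht1 hb, C.inner_centrePt hd]
  have h1 := C.level_pos (endMult m N α) ht.le
  rw [norm_mul, hb, mul_one, Complex.norm_real, Real.norm_of_nonneg h1.le]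
  have := C.level_le (endMult_pos hm hN α) ht.le ht1
  linarith [C.rad_pos]

lemma base_of_one_le {z : ℂ} (hz : 1 ≤ ‖z‖) : C.base m N z = (2 * z)⁻¹ := by
  have h1 : ∀ α, 1 / 2 ≤ ‖z - centrePt d α‖ := fun α => by
    have h1 := norm_sub_norm_le z (centrePt d α)
    linarith [norm_centrePt_le α]
  have h2 : C.blow m N z = z := blowUp_of_forall_ge (C.isRadialProfile hd hm hN) fun α => by
    linarith [h1 α, C.rad_le]
  rw [base, h2, C.inner.eq_self z fun j => by linarith [h1 (some j), C.ρ_le]]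

lemma blow_ne {z : ℂ} (hz : ∀ α, z ≠ centrePt d α) (α : Option (Fin d)) :
    C.blow m N z ≠ centrePt d α := by
  have hP := C.isRadialProfile hd hm hN
  have := lt_norm_blowUp_sub hP (by linarith [C.rad_pos]) C.sep' hz (fun β => (?_ : _ < _)) α
  · rw [← sub_ne_zero, ← norm_pos_iff]
    exact ((hP α).b_nonneg).trans_lt this
  · have := (hP β).lt _ (hP β).s_pos
    rwa [(hP β).eq_self _ le_rfl] at this

lemma base_ne_zero {z : ℂ} (hz : ∀ α, z ≠ centrePt d α) : C.base m N z ≠ 0 := by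
  refine inv_ne_zero (mul_ne_zero two_ne_zero fun h => ?_)
  rw [← C.inner_zero] at h
  exact C.blow_ne hd hm hN hz none (C.inner.bijective.1 h)

lemma one_add_base_pow_ne_zero {z : ℂ} (hz : ∀ α, z ≠ centrePt d α) :
    1 + C.base m N z ^ d ≠ 0 := by
  intro h
  -- A value y with y^d = -1 would place the blown-up point at the puncture of that root, which
  -- `blow_ne` excludes.
  obtain ⟨j, hj⟩ := exists_rootPt_eq hd (y := C.base m N z) (by linear_combination h)
  have : C.inner.toFun (C.blow m N z) = centrePt d (some j) := by
    rw [centrePt, hj, base, mul_inv 2 (_)⁻¹, inv_inv, inv_mul_cancel_left₀ two_ne_zero]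
  rw [← C.inner_centrePt_some] at this
  exact C.blow_ne hd hm hN hz (some j) (C.inner.bijective.1 this)

lemma contDiffAt_base {z : ℂ} (hz : ∀ α, z ≠ centrePt d α) : ContDiffAt ℝ ∞ (C.base m N) z := by
  have h1 : ContDiffAt ℝ ∞ (C.blow m N) z := contDiffAt_blowUp (C.isRadialProfile hd hm hN) hz
  have h2 : ContDiffAt ℝ ∞ (fun z => C.inner.toFun (C.blow m N z)) z :=
    C.inner.contDiff.contDiffAt.comp z h1
  exact (contDiffAt_const.mul h2).inv (fun h => C.base_ne_zero hd hm hN hz (inv_eq_zero.2 h))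

lemma posJacAt_base {z : ℂ} (hz : ∀ α, z ≠ centrePt d α) : PosJacAt (C.base m N) z := by
  have h0 : C.inner.toFun (C.blow m N z) ≠ 0 :=
    right_ne_zero_of_mul (fun h => C.base_ne_zero hd hm hN hz (inv_eq_zero.2 h))
  have h1 : PosJacAt (C.blow m N) z :=
    posJacAt_blowUp (C.isRadialProfile hd hm hN) (by linarith [C.rad_pos]) C.sep' hz
  have h2 : PosJacAt (fun z => C.inner.toFun (C.blow m N z)) z :=
    PosJacAt.comp (F := C.inner.toFun) (C.inner.posJacAt _) h1
  have h3 : HasDerivAt (fun x : ℂ => (2 * x)⁻¹) (-2 / (2 * C.inner.toFun (C.blow m N z)) ^ 2)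
      (C.inner.toFun (C.blow m N z)) := by
    have := ((hasDerivAt_id (C.inner.toFun (C.blow m N z))).const_mul 2).inv
      (mul_ne_zero two_ne_zero h0)
    exact this.congr_deriv (by simp)
  exact PosJacAt.comp (F := fun x => (2 * x)⁻¹) (h3.posJacAt (div_ne_zero (by norm_num)
    (pow_ne_zero _ (mul_ne_zero two_ne_zero h0)))) h2

omit hd hm hN in
lemma eq_of_inv_inner_eq {w w' : ℂ} (h : (2 * C.inner.toFun w)⁻¹ = (2 * C.inner.toFun w')⁻¹) :
    w = w' :=
  C.inner.bijective.1 (mul_left_cancel₀ two_ne_zero (inv_injective h))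

lemma base_injective {z z' : ℂ} (hz : ∀ α, z ≠ centrePt d α) (hz' : ∀ α, z' ≠ centrePt d α)
    (h : C.base m N z = C.base m N z') : z = z' :=
  blowUp_injective (C.isRadialProfile hd hm hN) (by linarith [C.rad_pos]) C.sep' hz hz'
    (C.eq_of_inv_inner_eq h)

/-- A point whose value of `y` is attained near a puncture is near that puncture. -/
lemma exists_of_base_eq {z : ℂ} (hz : ∀ α, z ≠ centrePt d α) (α : Option (Fin d)) {η : ℂ}
    (hη : ‖η‖ < C.level (endMult m N α) 1) (h : C.base m N z = endVal d α η) :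
    ∃ t b, 0 < t ∧ t < 1 ∧ ‖b‖ = 1 ∧ z = centrePt d α + ((t * C.rad : ℝ) : ℂ) * b ∧
      η = (C.level (endMult m N α) t : ℂ) * b := by
  have hP := C.isRadialProfile hd hm hN
  have hr := C.rad_pos
  have hl := C.level_le (endMult_pos hm hN α) zero_le_one le_rfl
  have hK := two_le_endScale hd α
  have hK0 : (endScale d α : ℂ) ≠ 0 := by exact_mod_cast (by linarith : endScale d α ≠ 0)
  rw [base, ← C.inner_centrePt hd α (by linarith)] at h
  have hw := C.eq_of_inv_inner_eq h
  have h0 : 0 < ‖z - centrePt d α‖ := norm_pos_iff.2 (sub_ne_zero.2 (hz α))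
  have hws : ‖C.blow m N z - centrePt d α‖ < C.level (endMult m N α) 1 / endScale d α := by
    rw [hw, add_sub_cancel_left, norm_div, Complex.norm_real, Real.norm_of_nonneg (by linarith)]
    exact div_lt_div_of_pos_right hη (by linarith)
  have hzs : ‖z - centrePt d α‖ < 3 / 2 * C.rad := by
    refine (norm_blowUp_sub_lt_iff hP (by linarith : 3 / 2 * C.rad < 2 * C.rad) C.sep' hz α).1
      (hws.trans_le ?_)
    rw [div_le_iff₀ (by linarith)]
    nlinarith
  have hb := blowUp_of_norm_le hP C.sep' α (ζ := z - centrePt d α) (by linarith)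
  rw [add_sub_cancel] at hb
  have hbn : ‖C.blow m N z - centrePt d α‖ = C.profile m N α ‖z - centrePt d α‖ := by
    rw [blow, hb, add_sub_cancel_left, norm_mul, norm_dir (norm_pos_iff.1 h0), Complex.norm_real,
      Real.norm_of_nonneg ((hP α).pos h0).le, mul_one]
  have hpr : C.profile m N α C.rad = C.level (endMult m N α) 1 / endScale d α := by
    rw [profile, blend_of_le hr le_rfl, div_self hr.ne']
  have hzr : ‖z - centrePt d α‖ < C.rad := by
    rw [hbn, ← hpr] at hws
    exact ((hP α).strictMonoOn.lt_iff_lt (Set.mem_Ioi.2 h0) (Set.mem_Ioi.2 hr)).1 hws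
  have hze : z = centrePt d α +
      ((‖z - centrePt d α‖ / C.rad * C.rad : ℝ) : ℂ) * dir (z - centrePt d α) := by
    rw [div_mul_cancel₀ _ hr.ne', norm_mul_dir, add_sub_cancel]
  have ht0 : 0 < ‖z - centrePt d α‖ / C.rad := div_pos h0 hr
  have ht1 : ‖z - centrePt d α‖ / C.rad < 1 := (div_lt_one hr).2 hzr
  have hbd := norm_dir (norm_pos_iff.1 h0)
  refine ⟨_, _, ht0, ht1, hbd, hze, ?_⟩
  have := C.blow_near_centre hd hm hN α ht0 ht1.le hbd
  rw [← hze, hw] at this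
  have h3 := add_left_cancel this
  field_simp at h3
  exact h3

/-- Each value of `y` is attained, except at the punctures. -/
lemma exists_base_eq_or {y : ℂ} (hy : y ≠ 0) :
    (∃ z, (∀ α, z ≠ centrePt d α) ∧ C.base m N z = y) ∨
      ∃ α η, ‖η‖ ≤ C.level (endMult m N α) 0 ∧ y = endVal d α η := by
  have hP := C.isRadialProfile hd hm hN
  obtain ⟨w, hw⟩ := C.inner.bijective.2 (2 * y)⁻¹
  have hwy : (2 * C.inner.toFun w)⁻¹ = y := by rw [hw]; field_simp
  by_cases h : ∀ α, C.level (endMult m N α) 0 / endScale d α < ‖w - centrePt d α‖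
  · obtain ⟨z, hz, hzw⟩ := exists_blowUp_eq hP (by linarith [C.rad_pos] : 3 / 2 * C.rad < 2 * C.rad)
      C.sep' h
    exact Or.inl ⟨z, hz, by rw [base, blow, hzw, hwy]⟩
  · push Not at h
    obtain ⟨α, hα⟩ := h
    have hK := two_le_endScale hd α
    have hK0 : (endScale d α : ℂ) ≠ 0 := by exact_mod_cast (by linarith : endScale d α ≠ 0)
    have hη : ‖endScale d α * (w - centrePt d α)‖ ≤ C.level (endMult m N α) 0 := by
      rw [norm_mul, Complex.norm_real, Real.norm_of_nonneg (by linarith), mul_comm]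
      exact (le_div_iff₀ (by linarith)).1 hα
    refine Or.inr ⟨α, endScale d α * (w - centrePt d α), hη, ?_⟩
    have hl := C.level_le (endMult_pos hm hN α) le_rfl zero_le_one
    rw [← C.inner_centrePt hd α (by linarith [C.rad_pos]), mul_div_cancel_left₀ _ hK0, add_sub_cancel,
      hwy]

end CentreData

/-! ## Toric coordinates at the vertices -/

/-! ### Monomial maps of the torus with determinant one -/

section Unimodular

variable {p p' q q' : ℕ} (hpq : p * q' = p' * q + 1)

include hpq

/-- The first component of the inverse monomial map, with the negative exponent moved to the other
side; the same holds for the second component below. -/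
lemma unimodular_first (a b : ℂ) :
    a * (a ^ q * b ^ q') ^ p' = (a ^ p * b ^ p') ^ q' := by
  calc a * (a ^ q * b ^ q') ^ p' = a ^ (p' * q + 1) * b ^ (p' * q') := by ring
    _ = (a ^ p * b ^ p') ^ q' := by rw [← hpq]; ring

lemma unimodular_second (a b : ℂ) :
    b * (a ^ p * b ^ p') ^ q = (a ^ q * b ^ q') ^ p := by
  calc b * (a ^ p * b ^ p') ^ q = a ^ (p * q) * b ^ (p' * q + 1) := by ring
    _ = (a ^ q * b ^ q') ^ p := by rw [← hpq]; ring

lemma unimodular_injective {a b a' b' : ℂ} (ha : a ≠ 0) (hb : b ≠ 0)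
    (h1 : a ^ p * b ^ p' = a' ^ p * b' ^ p') (h2 : a ^ q * b ^ q' = a' ^ q * b' ^ q') :
    a = a' ∧ b = b' := by
  have hU : a ^ p * b ^ p' ≠ 0 := mul_ne_zero (pow_ne_zero _ ha) (pow_ne_zero _ hb)
  have hV : a ^ q * b ^ q' ≠ 0 := mul_ne_zero (pow_ne_zero _ ha) (pow_ne_zero _ hb)
  constructor
  · have e1 := unimodular_first hpq a b
    have e2 := unimodular_first hpq a' b'
    rw [← h1, ← h2, ← e1] at e2
    exact (mul_right_cancel₀ (pow_ne_zero _ hV) e2).symm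
  · have e1 := unimodular_second hpq a b
    have e2 := unimodular_second hpq a' b'
    rw [← h1, ← h2, ← e1] at e2
    exact (mul_right_cancel₀ (pow_ne_zero _ hU) e2).symm

lemma exists_unimodular {U V : ℂ} (hU : ‖U‖ = 1) (hV : ‖V‖ = 1) :
    ∃ a b : ℂ, ‖a‖ = 1 ∧ ‖b‖ = 1 ∧ a ^ p * b ^ p' = U ∧ a ^ q * b ^ q' = V := by
  have hU0 : U ≠ 0 := by rw [← norm_ne_zero_iff, hU]; exact one_ne_zero
  have hV0 : V ≠ 0 := by rw [← norm_ne_zero_iff, hV]; exact one_ne_zero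
  refine ⟨U ^ q' / V ^ p', V ^ p / U ^ q, ?_, ?_, ?_, ?_⟩
  · rw [norm_div, norm_pow, norm_pow, hU, hV]; simp
  · rw [norm_div, norm_pow, norm_pow, hU, hV]; simp
  · have : U ^ (q' * p) = U ^ (q * p') * U := by rw [← pow_succ, mul_comm q', hpq, mul_comm p']
    rw [div_pow, div_pow, ← pow_mul, ← pow_mul, ← pow_mul, ← pow_mul, this, mul_comm p' p]
    field_simp
  · have : V ^ (p * q') = V ^ (p' * q) * V := by rw [← pow_succ, hpq]
    rw [div_pow, div_pow, ← pow_mul, ← pow_mul, ← pow_mul, ← pow_mul, this, mul_comm q' q]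
    field_simp

end Unimodular

section ToricCoord

variable {p p' q q' n : ℕ} {R : ℝ → ℝ} {G W s : ℂ}

lemma norm_toricCoord_fst (hG : G ≠ 0) (hW : W ≠ 0) (hs : ‖s‖ = 1) :
    ‖(toricCoord p p' q q' n R G W s).1‖ = 1 := by
  simp [toricCoord, norm_dir hG, norm_dir hW, hs]

lemma norm_toricCoord_snd (hG : G ≠ 0) (hW : W ≠ 0) (hs : ‖s‖ = 1) (hR : 0 ≤ R ‖G‖) :
    ‖(toricCoord p p' q q' n R G W s).2‖ = R ‖G‖ := by
  simp [toricCoord, norm_dir hG, norm_dir hW, hs, abs_of_nonneg hR]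

lemma toricCoord_injective (hpq : p * q' = p' * q + 1) (hR : Set.InjOn R (Set.Ioi 0))
    (hR0 : ∀ x, 0 < x → 0 < R x) {G' W' s' : ℂ} (hG : G ≠ 0) (hW : W ≠ 0) (hs : ‖s‖ = 1)
    (hG' : G' ≠ 0) (hW' : W' ≠ 0) (hs' : ‖s'‖ = 1)
    (h : toricCoord p p' q q' n R G W s = toricCoord p p' q q' n R G' W' s') :
    G = G' ∧ s * dir W ^ n = s' * dir W' ^ n := by
  have hp := hR0 _ (norm_pos_iff.2 hG)
  have hp' := hR0 _ (norm_pos_iff.2 hG')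
  have hn : R ‖G‖ = R ‖G'‖ := by
    rw [← norm_toricCoord_snd (p := p) (p' := p') (q := q) (q' := q') (n := n) hG hW hs hp.le, h,
      norm_toricCoord_snd hG' hW' hs' hp'.le]
  have hn' : ‖G‖ = ‖G'‖ := hR (Set.mem_Ioi.2 (norm_pos_iff.2 hG)) (Set.mem_Ioi.2 (norm_pos_iff.2 hG')) hn
  have h1 := congrArg Prod.fst h
  have h2 := congrArg Prod.snd h
  simp only [toricCoord] at h1 h2
  rw [← hn] at h2
  have hRc : (R ‖G‖ : ℂ) ≠ 0 := by exact_mod_cast hp.ne'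
  have hs0 : s ≠ 0 := by rw [← norm_ne_zero_iff, hs]; exact one_ne_zero
  obtain ⟨e1, e2⟩ := unimodular_injective hpq (dir_ne_zero hG)
    (mul_ne_zero hs0 (pow_ne_zero n (dir_ne_zero hW))) h1 (mul_left_cancel₀ hRc h2)
  refine ⟨?_, e2⟩
  rw [← norm_mul_dir G, hn', e1, norm_mul_dir]

lemma exists_toricCoord_eq (hpq : p * q' = p' * q + 1) {u v : ℂ} (hu : ‖u‖ = 1) (hv : v ≠ 0)
    (hR : ∃ x, 0 < x ∧ R x = ‖v‖) : ∃ G σ : ℂ, G ≠ 0 ∧ ‖σ‖ = 1 ∧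
      ∀ W s, s * dir W ^ n = σ → toricCoord p p' q q' n R G W s = (u, v) := by
  obtain ⟨x, hx, hxv⟩ := hR
  obtain ⟨a, b, ha, hb, h1, h2⟩ := exists_unimodular hpq hu (norm_dir hv)
  have ha0 : a ≠ 0 := by rw [← norm_ne_zero_iff, ha]; exact one_ne_zero
  have hx0 : (x : ℂ) ≠ 0 := by exact_mod_cast hx.ne'
  refine ⟨x * a, b, mul_ne_zero hx0 ha0, hb, fun W s hs => ?_⟩
  have hn : ‖(x : ℂ) * a‖ = x := by rw [norm_mul, ha, Complex.norm_real, Real.norm_of_nonneg hx.le, mul_one]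
  rw [toricCoord, hs, hn, dir_ofReal_mul hx, dir_of_norm_eq_one ha, h1, h2, hxv, norm_mul_dir]

lemma contDiffAt_toricCoord {G W : ℂ → ℂ} {z s : ℂ} (hG : ContDiffAt ℝ ∞ G z) (hG0 : G z ≠ 0)
    (hW : ContDiffAt ℝ ∞ W z) (hW0 : W z ≠ 0) (hR : ContDiffAt ℝ ∞ R ‖G z‖) :
    ContDiffAt ℝ ∞ (fun x : ℂ × ℂ => toricCoord p p' q q' n R (G x.1) (W x.1) x.2) (z, s) := by
  have hG1 : ContDiffAt ℝ ∞ (fun x : ℂ × ℂ => G x.1) (z, s) :=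
    ContDiffAt.comp (z, s) (f := Prod.fst) hG contDiffAt_fst
  have hW1 : ContDiffAt ℝ ∞ (fun x : ℂ × ℂ => W x.1) (z, s) :=
    ContDiffAt.comp (z, s) (f := Prod.fst) hW contDiffAt_fst
  have hA : ContDiffAt ℝ ∞ (fun x : ℂ × ℂ => dir (G x.1)) (z, s) :=
    ContDiffAt.comp (z, s) (f := fun x : ℂ × ℂ => G x.1) (contDiffAt_dir hG0) hG1
  have hB : ContDiffAt ℝ ∞ (fun x : ℂ × ℂ => dir (W x.1)) (z, s) :=
    ContDiffAt.comp (z, s) (f := fun x : ℂ × ℂ => W x.1) (contDiffAt_dir hW0) hW1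
  have hS : ContDiffAt ℝ ∞ (fun x : ℂ × ℂ => x.2 * dir (W x.1) ^ n) (z, s) :=
    contDiffAt_snd.mul (hB.pow n)
  have hN : ContDiffAt ℝ ∞ (fun x : ℂ × ℂ => ‖G x.1‖) (z, s) :=
    ContDiffAt.comp (z, s) (f := fun x : ℂ × ℂ => G x.1) (contDiffAt_norm ℝ hG0) hG1
  have hR1 : ContDiffAt ℝ ∞ (fun x : ℂ × ℂ => R ‖G x.1‖) (z, s) :=
    ContDiffAt.comp (z, s) (f := fun x : ℂ × ℂ => ‖G x.1‖) hR hN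
  exact ((hA.pow p).mul (hS.pow p')).prodMk
    ((Complex.ofRealCLM.contDiff.contDiffAt.comp (z, s) hR1).mul ((hA.pow q).mul (hS.pow q')))

end ToricCoord

/-- The ratio of the radii of consecutive vertices of an arm. -/
def armRatio : ℝ := 1 / (2 * (1 + 1 / (4 * armRadius ^ 2)))

lemma armRatio_pos : 0 < armRatio := by
  have := armRadius_pos
  rw [armRatio]; positivity

lemma armRatio_lt_half : armRatio < 1 / 2 := by
  have := armRadius_pos
  rw [armRatio]
  refine one_div_lt_one_div_of_lt two_pos ?_
  have : 0 < 1 / (4 * armRadius ^ 2) := by positivity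
  linarith

/-- The data of a vertex off the centre: its weight is `-n`, and the torus coordinates are
`a ^ p b ^ p'` and `a ^ q b ^ q'`. -/
structure ToricVertex where
  p : ℕ
  p' : ℕ
  q : ℕ
  q' : ℕ
  n : ℕ
  leaf : Bool
  size : ℝ
  unimodular : p * q' = p' * q + 1
  size_pos : 0 < size
  leaf_p : leaf = true → p = n
  leaf_p' : leaf = true → p' = 1

namespace ToricVertex

variable (τ : ToricVertex)

/-- The punctured base. -/
def IsRegular (z : ℂ) : Prop := z ≠ 0 ∧ (τ.leaf = false → z ≠ Complex.I / 2)

/-- The base coordinate. -/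
def G (z : ℂ) : ℂ := bif τ.leaf then z else armBase z

/-- The function trivializing the bundle. -/
def W (z : ℂ) : ℂ := bif τ.leaf then 1 else armPhase z

/-- The limit of the radius, relative to the size, at the outer end. -/
def lo : ℝ := bif τ.leaf then 0 else armRatio / 2

/-- The slope of the radius at the outer end. -/
def slope : ℝ := bif τ.leaf then armRadius / 4 else armRatio / (8 * armRadius)

/-- The radius. -/
def R (x : ℝ) : ℝ := τ.size * radialProfile armRadius τ.lo τ.slope x

/-- The toric coordinates over the finite part of the base. -/
def inl (z s : ℂ) : ℂ × ℂ := toricCoord τ.p τ.p' τ.q τ.q' τ.n τ.R (τ.G z) (τ.W z) s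

/-- The toric coordinates about infinity. -/
def inr (z s : ℂ) : ℂ × ℂ :=
  bif τ.leaf then (s, ((τ.size * (armRadius / 4) : ℝ) : ℂ) * z * s ^ τ.q')
  else toricCoord τ.p τ.p' τ.q τ.q' τ.n τ.R (z + 2 * Complex.I)⁻¹ (1 - Complex.I / 2 * z) s

lemma slope_pos : 0 < τ.slope := by
  have := armRadius_pos
  have := armRatio_pos
  rw [slope]
  cases τ.leaf <;> simp only [cond_true, cond_false] <;> positivity

lemma lo_nonneg : 0 ≤ τ.lo := by
  have := armRatio_pos
  rw [lo]
  cases τ.leaf <;> simp only [cond_true, cond_false] <;> positivity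

/-- The value of `armRatio` is determined here: armRatio · (1 + 1 / (4 armRadius²)) = 1/2 makes the
bound 1/4 of the radial profile an equality, also at interior vertices. -/
lemma lo_add_slope : τ.lo + τ.slope / armRadius ≤ 1 / 4 := by
  have := armRadius_pos
  rw [lo, slope]
  cases τ.leaf
  · simp only [cond_false]
    have h : armRatio * (1 + 1 / (4 * armRadius ^ 2)) = 1 / 2 := by rw [armRatio]; field_simp
    have h2 : armRatio / 2 + armRatio / (8 * armRadius) / armRadius =
        (armRatio * (1 + 1 / (4 * armRadius ^ 2))) / 2 := by field_simp; ring
    rw [h2, h]; norm_num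
  · simp only [cond_true]
    rw [zero_add, div_div, mul_comm, ← div_div, div_self armRadius_pos.ne']

lemma contDiffAt_R {x : ℝ} (hx : 0 < x) : ContDiffAt ℝ ∞ τ.R x :=
  contDiffAt_const.mul (contDiffAt_radialProfile hx)

lemma hasDerivAt_R {x : ℝ} (hx : 0 < x) : ∃ d, d < 0 ∧ HasDerivAt τ.R d x := by
  obtain ⟨d, hd, h⟩ := radialProfile_hasDerivAt armRadius_pos τ.slope_pos τ.lo_add_slope hx
  exact ⟨_, mul_neg_of_pos_of_neg τ.size_pos hd, h.const_mul _⟩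

lemma strictAntiOn_R : StrictAntiOn τ.R (Set.Ioi 0) := fun _ hx _ hy hxy =>
  mul_lt_mul_of_pos_left
    (strictAntiOn_radialProfile armRadius_pos τ.slope_pos τ.lo_add_slope hx hy hxy) τ.size_pos

lemma R_lt {x : ℝ} (hx : 0 < x) : τ.R x < τ.size := by
  have := mul_lt_mul_of_pos_left
    (radialProfile_lt_one armRadius_pos τ.slope_pos τ.lo_add_slope hx) τ.size_pos
  rwa [mul_one] at this

lemma lt_R {x : ℝ} (hx : 0 < x) : τ.size * τ.lo < τ.R x :=
  mul_lt_mul_of_pos_left (lt_radialProfile armRadius_pos τ.slope_pos τ.lo_add_slope hx) τ.size_pos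

lemma R_pos {x : ℝ} (hx : 0 < x) : 0 < τ.R x :=
  (mul_nonneg τ.size_pos.le τ.lo_nonneg).trans_lt (τ.lt_R hx)

lemma exists_R_eq {y : ℝ} (h1 : τ.size * τ.lo < y) (h2 : y < τ.size) : ∃ x, 0 < x ∧ τ.R x = y := by
  obtain ⟨x, hx, hxy⟩ := exists_radialProfile_eq armRadius_pos τ.slope_pos τ.lo_add_slope
    (y := y / τ.size) (by rw [lt_div_iff₀ τ.size_pos, mul_comm]; exact h1)
    (by rw [div_lt_one τ.size_pos]; exact h2)
  exact ⟨x, hx, by rw [R, hxy, mul_div_cancel₀ _ τ.size_pos.ne']⟩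

lemma R_of_le {x : ℝ} (hx : x ≤ armRadius) : τ.R x = τ.size * (1 - x / (2 * armRadius)) := by
  rw [R, radialProfile_of_le armRadius_pos hx]

lemma R_of_ge {x : ℝ} (hx : 1 / 3 ≤ x) : τ.R x = τ.size * (τ.lo + τ.slope / x) := by
  rw [R, radialProfile_of_ge armRadius_pos]
  linarith [armRadius_le]

variable {τ} {z z' s s' : ℂ}

lemma G_ne_zero (h : τ.IsRegular z) : τ.G z ≠ 0 := by
  rw [G]
  cases hl : τ.leaf
  · exact armBase_ne_zero h.1 (h.2 hl)
  · exact h.1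

lemma W_ne_zero (h : τ.IsRegular z) : τ.W z ≠ 0 := by
  rw [W]
  cases hl : τ.leaf
  · exact armPhase_ne_zero (h.2 hl)
  · exact one_ne_zero

lemma contDiffAt_G (h : τ.IsRegular z) : ContDiffAt ℝ ∞ τ.G z := by
  unfold G
  cases hl : τ.leaf
  · exact contDiffAt_armBase (h.2 hl)
  · exact contDiffAt_id

lemma posJacAt_G (h : τ.IsRegular z) : PosJacAt τ.G z := by
  unfold G
  cases hl : τ.leaf
  · exact posJacAt_armBase (h.2 hl)
  · exact posJacAt_id z

variable (τ) in
lemma contDiff_W : ContDiff ℝ ∞ τ.W := by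
  unfold W
  cases hl : τ.leaf
  · exact contDiff_armPhase
  · exact contDiff_const

lemma contDiffAt_inl (h : τ.IsRegular z) :
    ContDiffAt ℝ ∞ (fun x : ℂ × ℂ => τ.inl x.1 x.2) (z, s) :=
  contDiffAt_toricCoord (contDiffAt_G h) (G_ne_zero h) τ.contDiff_W.contDiffAt (W_ne_zero h)
    (τ.contDiffAt_R (norm_pos_iff.2 (G_ne_zero h)))

lemma one_sub_ne_zero (h : ‖z‖ < 1) : 1 - Complex.I / 2 * z ≠ 0 := by
  intro h0
  have h1 : Complex.I / 2 * z = 1 := by linear_combination -h0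
  have h2 := congrArg norm h1
  rw [norm_mul, norm_I_div_two, norm_one] at h2
  linarith

lemma hasDerivAt_infinity (h : ‖z‖ < 1) :
    HasDerivAt (fun z : ℂ => (z + 2 * Complex.I)⁻¹) (-1 / (z + 2 * Complex.I) ^ 2) z :=
  ((hasDerivAt_id z).add_const (2 * Complex.I)).inv (add_two_I_ne_zero h)

variable (τ) in
lemma contDiffAt_inr (h : ‖z‖ < 1) :
    ContDiffAt ℝ ∞ (fun x : ℂ × ℂ => τ.inr x.1 x.2) (z, s) := by
  unfold inr
  cases hl : τ.leaf
  · have h0 := add_two_I_ne_zero h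
    refine contDiffAt_toricCoord (G := fun z => (z + 2 * Complex.I)⁻¹)
      (W := fun z => 1 - Complex.I / 2 * z) ((contDiffAt_id.add contDiffAt_const).inv h0)
      (inv_ne_zero h0) (contDiffAt_const.sub (contDiffAt_const.mul contDiffAt_id))
      (one_sub_ne_zero h) (τ.contDiffAt_R (norm_pos_iff.2 (inv_ne_zero h0)))
  · exact contDiffAt_snd.prodMk ((contDiffAt_const.mul contDiffAt_fst).mul (contDiffAt_snd.pow _))

lemma det4_inl_pos (h : τ.IsRegular z) (θ : ℝ) {wt : ℕ × ℕ} (hwt : 0 < wt.1) :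
    ∃ g' : ℂ × ℝ →L[ℝ] ℂ × ℂ, HasFDerivAt (fun x : ℂ × ℝ =>
        τ.inl x.1 (Complex.exp (x.2 * Complex.I))) g' (z, θ) ∧
      0 < det4 ((wt.1 : ℂ) * (τ.inl z (Complex.exp (θ * Complex.I))).1,
          (wt.2 : ℂ) * (τ.inl z (Complex.exp (θ * Complex.I))).2)
        (g' (1, 0)) (g' (Complex.I, 0)) (g' (0, 1)) := by
  have hn := norm_pos_iff.2 (G_ne_zero h)
  obtain ⟨d, hd, hR⟩ := τ.hasDerivAt_R hn
  exact toricCoord_det4_pos τ.unimodular (posJacAt_G h) (G_ne_zero h)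
    (τ.contDiff_W.contDiffAt.differentiableAt (by simp)) (W_ne_zero h) hR hd (τ.R_pos hn) θ hwt

variable (τ) in
lemma det4_inr_pos (h : ‖z‖ < 1) (θ : ℝ) {wt : ℕ × ℕ} (hwt : 0 < wt.1) :
    ∃ g' : ℂ × ℝ →L[ℝ] ℂ × ℂ, HasFDerivAt (fun x : ℂ × ℝ =>
        τ.inr x.1 (Complex.exp (x.2 * Complex.I))) g' (z, θ) ∧
      0 < det4 ((wt.1 : ℂ) * (τ.inr z (Complex.exp (θ * Complex.I))).1,
          (wt.2 : ℂ) * (τ.inr z (Complex.exp (θ * Complex.I))).2)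
        (g' (1, 0)) (g' (Complex.I, 0)) (g' (0, 1)) := by
  unfold inr
  cases hl : τ.leaf
  · have h0 := add_two_I_ne_zero h
    have hn := norm_pos_iff.2 (inv_ne_zero h0)
    obtain ⟨d, hd, hR⟩ := τ.hasDerivAt_R hn
    refine toricCoord_det4_pos τ.unimodular (G := fun z => (z + 2 * Complex.I)⁻¹)
      (W := fun z => 1 - Complex.I / 2 * z) ?_ (inv_ne_zero h0) ?_
      (one_sub_ne_zero h) hR hd (τ.R_pos hn) θ hwt
    · exact (hasDerivAt_infinity h).posJacAt (div_ne_zero (by norm_num) (pow_ne_zero _ h0))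
    · exact (differentiableAt_const _).sub ((differentiableAt_const _).mul differentiableAt_id)
  · exact core_det4_pos (mul_pos τ.size_pos (by linarith [armRadius_pos])) τ.q' z θ hwt

lemma norm_inl_fst (h : τ.IsRegular z) (hs : ‖s‖ = 1) : ‖(τ.inl z s).1‖ = 1 :=
  norm_toricCoord_fst (G_ne_zero h) (W_ne_zero h) hs

lemma norm_inl_snd (h : τ.IsRegular z) (hs : ‖s‖ = 1) : ‖(τ.inl z s).2‖ = τ.R ‖τ.G z‖ :=
  norm_toricCoord_snd (G_ne_zero h) (W_ne_zero h) hs (τ.R_pos (norm_pos_iff.2 (G_ne_zero h))).le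

variable (τ) in
lemma norm_inr_fst (h : ‖z‖ < 1) (hs : ‖s‖ = 1) : ‖(τ.inr z s).1‖ = 1 := by
  unfold inr
  cases hl : τ.leaf
  · exact norm_toricCoord_fst (inv_ne_zero (add_two_I_ne_zero h)) (one_sub_ne_zero h) hs
  · exact hs

variable (τ) in
lemma norm_inr_snd_lt (h : ‖z‖ < 1) (hs : ‖s‖ = 1) : ‖(τ.inr z s).2‖ < τ.size := by
  unfold inr
  cases hl : τ.leaf
  · have h0 := norm_pos_iff.2 (inv_ne_zero (add_two_I_ne_zero h))
    simp only [cond_false]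
    rw [norm_toricCoord_snd (inv_ne_zero (add_two_I_ne_zero h)) (one_sub_ne_zero h) hs
      (τ.R_pos h0).le]
    exact τ.R_lt h0
  · simp only [cond_true]
    have := armRadius_pos
    have := armRadius_le
    have := τ.size_pos
    rw [norm_mul, norm_mul, norm_pow, hs, one_pow, mul_one, Complex.norm_real,
      Real.norm_of_nonneg (by positivity)]
    have h1 : armRadius / 4 * ‖z‖ < 1 := by nlinarith [norm_nonneg z]
    rw [mul_assoc]
    exact mul_lt_of_lt_one_right τ.size_pos h1

lemma norm_inl_snd_lt (h : τ.IsRegular z) (hs : ‖s‖ = 1) : ‖(τ.inl z s).2‖ < τ.size := by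
  rw [norm_inl_snd h hs]
  exact τ.R_lt (norm_pos_iff.2 (G_ne_zero h))

lemma lt_norm_inl_snd (h : τ.IsRegular z) (hs : ‖s‖ = 1) : τ.size * τ.lo < ‖(τ.inl z s).2‖ := by
  rw [norm_inl_snd h hs]
  exact τ.lt_R (norm_pos_iff.2 (G_ne_zero h))

lemma norm_inr_zero_snd (hl : τ.leaf = false) (hs : ‖s‖ = 1) :
    ‖(τ.inr 0 s).2‖ = τ.R (1 / 2) := by
  have h : ‖(0 : ℂ)‖ < 1 := by simp
  have h0 := norm_pos_iff.2 (inv_ne_zero (add_two_I_ne_zero h))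
  have hn : ‖((0 : ℂ) + 2 * Complex.I)⁻¹‖ = 1 / 2 := by simp
  rw [inr, hl, cond_false, norm_toricCoord_snd (inv_ne_zero (add_two_I_ne_zero h)) (one_sub_ne_zero h)
    hs (τ.R_pos h0).le, hn]

/-- At an interior vertex, W = z (1 - iz'/2) and the factor z supplies the twist dir z^n. At a leaf
the radius is a constant over ‖z‖, so v becomes a constant times z' s^q', which is smooth over z' =
0. There p = n and p' = 1 make u the new fibre coordinate, and n q' = q + 1 fixes the power of dir z
in v. -/
lemma inl_eq_inr (hz : 1 < ‖z‖) (hzz : z * z' = 1) :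
    τ.inl z s = τ.inr z' (dir z ^ τ.n * s) := by
  have hz0 : z ≠ 0 := by rintro rfl; simp at hzz
  have hdz := dir_ne_zero hz0
  unfold inl inr
  cases hl : τ.leaf
  · have hW : armPhase z = z * (1 - Complex.I / 2 * z') := by
      rw [armPhase_of_ge (by linarith)]; linear_combination Complex.I / 2 * hzz
    simp only [cond_false, G, W, hl]
    rw [armBase_of_one_le hz.le hzz, hW]
    simp only [toricCoord, dir_mul, mul_pow]
    ring_nf
  · have hp := τ.leaf_p hl
    have hp' := τ.leaf_p' hl
    have hu := τ.unimodular
    simp only [cond_true, G, W, hl, toricCoord]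
    have h1 : dir (1 : ℂ) = 1 := dir_of_norm_eq_one (by simp)
    rw [h1, one_pow, mul_one, hp, hp', pow_one]
    refine Prod.ext rfl ?_
    have hR : τ.R ‖z‖ = τ.size * (armRadius / 4) / ‖z‖ := by
      rw [τ.R_of_ge (by linarith), lo, slope, hl, cond_true, cond_true]; ring
    have hz' : z' = (dir z)⁻¹ / ‖z‖ := by
      rw [← norm_mul_dir z] at hzz
      have hn : (‖z‖ : ℂ) ≠ 0 := by exact_mod_cast (norm_pos_iff.2 hz0).ne'
      field_simp
      linear_combination hzz
    have hpow : dir z ^ (τ.n * τ.q') = dir z ^ τ.q * dir z := by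
      rw [← hp, hu, hp', one_mul, pow_succ]
    simp only
    rw [hR, mul_pow, ← pow_mul, hpow, hz']
    push_cast
    field_simp

lemma inl_near_zero {t : ℝ} (ht : 0 < t) (ht1 : t ≤ 1) {σ : ℂ} (hσ : ‖σ‖ = 1) :
    τ.inl (((t * armRadius : ℝ) : ℂ) * σ) s =
      (σ ^ τ.p * s ^ τ.p', ((τ.size * (1 - t / 2) : ℝ) : ℂ) * (σ ^ τ.q * s ^ τ.q')) := by
  have hr := armRadius_pos
  have htr : 0 < t * armRadius := mul_pos ht hr
  have hle : t * armRadius ≤ armRadius := mul_le_of_le_one_left hr.le ht1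
  set ζ := ((t * armRadius : ℝ) : ℂ) * σ with hζ
  have hn : ‖ζ‖ = t * armRadius := by
    rw [hζ, norm_mul, hσ, Complex.norm_real, Real.norm_of_nonneg htr.le, mul_one]
  have hG : τ.G ζ = ζ := by
    rw [G]
    cases τ.leaf
    · exact armBase_near_zero (by rw [hn]; exact hle)
    · rfl
  have hW : τ.W ζ = 1 := by
    rw [W]
    cases τ.leaf
    · exact armPhase_near_zero (by rw [hn]; linarith [armRadius_le])
    · rfl
  have h1 : dir (1 : ℂ) = 1 := dir_of_norm_eq_one (by simp)
  have hd : dir ζ = σ := by rw [hζ, dir_ofReal_mul htr, dir_of_norm_eq_one hσ]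
  rw [inl, toricCoord, hG, hW, h1, one_pow, mul_one, hd, hn, τ.R_of_le hle]
  congr 5
  field_simp

/-- Near i/2 the direction of G is σ⁻¹ and that of W is σ, so the exponents of σ are n p' - p and n
q' - q: one step of the continued fraction. The radius is size · armRatio · (1 + t) / 2, which is
the formula of `inl_near_zero` for the next vertex at the parameter 1 - t. -/
lemma inl_near_center (hl : τ.leaf = false) {P Q : ℕ} (hP : P + τ.p = τ.n * τ.p')
    (hQ : Q + τ.q = τ.n * τ.q') {t : ℝ} (ht : 0 < t) (ht1 : t ≤ 1) {σ : ℂ} (hσ : ‖σ‖ = 1) :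
    τ.inl (Complex.I / 2 + ((t * armRadius : ℝ) : ℂ) * σ) s =
      (s ^ τ.p' * σ ^ P, ((τ.size * armRatio * ((1 + t) / 2) : ℝ) : ℂ) * (s ^ τ.q' * σ ^ Q)) := by
  have hr := armRadius_pos
  have htr : 0 < t * armRadius := mul_pos ht hr
  have hle : t * armRadius ≤ armRadius := mul_le_of_le_one_left hr.le ht1
  have hσ0 : σ ≠ 0 := by rw [← norm_ne_zero_iff, hσ]; exact one_ne_zero
  set ζ := ((t * armRadius : ℝ) : ℂ) * σ with hζ
  have hn : ‖ζ‖ = t * armRadius := by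
    rw [hζ, norm_mul, hσ, Complex.norm_real, Real.norm_of_nonneg htr.le, mul_one]
  have hζ0 : ζ ≠ 0 := by rw [← norm_pos_iff, hn]; exact htr
  have hd : dir ζ = σ := by rw [hζ, dir_ofReal_mul htr, dir_of_norm_eq_one hσ]
  have hG : τ.G (Complex.I / 2 + ζ) = (4 * ζ)⁻¹ := by
    rw [G, hl]; exact armBase_near_center (by rw [hn]; exact hle) hζ0
  have hW : τ.W (Complex.I / 2 + ζ) = ζ := by
    rw [W, hl]; exact armPhase_near_center (by rw [hn]; exact hle)
  have hGn : ‖(4 * ζ)⁻¹‖ = 1 / (4 * (t * armRadius)) := by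
    rw [norm_inv, norm_mul, hn, Complex.norm_ofNat, one_div]
  have hGd : dir (4 * ζ)⁻¹ = σ⁻¹ := by
    have h4 : (4 : ℂ) = ((4 : ℝ) : ℂ) := by norm_num
    rw [dir_inv, h4, dir_ofReal_mul (by norm_num), hd]
  have hge : 1 / 3 ≤ 1 / (4 * (t * armRadius)) :=
    one_div_le_one_div_of_le (by positivity) (by linarith [armRadius_le])
  have hR : τ.R (1 / (4 * (t * armRadius))) = τ.size * armRatio * ((1 + t) / 2) := by
    rw [τ.R_of_ge hge, lo, slope, hl, cond_false, cond_false]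
    field_simp
    ring
  have e1 : σ⁻¹ ^ τ.p * (s * σ ^ τ.n) ^ τ.p' = s ^ τ.p' * σ ^ P := by
    rw [mul_pow, ← pow_mul, ← hP, pow_add, inv_pow]; field_simp
  have e2 : σ⁻¹ ^ τ.q * (s * σ ^ τ.n) ^ τ.q' = s ^ τ.q' * σ ^ Q := by
    rw [mul_pow, ← pow_mul, ← hQ, pow_add, inv_pow]; field_simp
  rw [inl, toricCoord, hG, hW, hd, hGd, hGn, hR, e1, e2]

lemma inl_injective (h : τ.IsRegular z) (h' : τ.IsRegular z') (hs : ‖s‖ = 1) (hs' : ‖s'‖ = 1)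
    (he : τ.inl z s = τ.inl z' s') : z = z' ∧ s = s' := by
  obtain ⟨h1, h2⟩ := toricCoord_injective τ.unimodular τ.strictAntiOn_R.injOn
    (fun x hx => τ.R_pos hx) (G_ne_zero h) (W_ne_zero h) hs (G_ne_zero h') (W_ne_zero h') hs' he
  have hz : z = z' := by
    rw [G, G] at h1
    cases hl : τ.leaf
    · rw [hl] at h1; exact armBase_injective (h.2 hl) (h'.2 hl) h1
    · rw [hl] at h1; exact h1
  refine ⟨hz, ?_⟩
  rw [hz] at h2
  exact mul_right_cancel₀ (pow_ne_zero _ (dir_ne_zero (W_ne_zero h'))) h2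

lemma inl_ne_inr_zero (h : τ.IsRegular z) (hs : ‖s‖ = 1) (hs' : ‖s'‖ = 1) :
    τ.inl z s ≠ τ.inr 0 s' := by
  intro he
  cases hl : τ.leaf
  · have h0 : ‖(0 : ℂ)‖ < 1 := by simp
    rw [inr, hl, cond_false] at he
    obtain ⟨h1, -⟩ := toricCoord_injective τ.unimodular τ.strictAntiOn_R.injOn
      (fun x hx => τ.R_pos hx) (G_ne_zero h) (W_ne_zero h) hs
      (inv_ne_zero (add_two_I_ne_zero h0)) (one_sub_ne_zero h0) hs' he
    rw [G, hl, cond_false, zero_add] at h1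
    exact armBase_ne_inf (h.2 hl) h1
  · have h1 := τ.lt_norm_inl_snd h hs
    rw [he, inr, hl, cond_true, lo, hl, cond_true] at h1
    simp at h1

lemma inr_zero_injective (hs : ‖s‖ = 1) (hs' : ‖s'‖ = 1) (he : τ.inr 0 s = τ.inr 0 s') :
    s = s' := by
  cases hl : τ.leaf
  · have h0 : ‖(0 : ℂ)‖ < 1 := by simp
    rw [inr, inr, hl, cond_false, cond_false] at he
    have h1 := (toricCoord_injective τ.unimodular τ.strictAntiOn_R.injOn
      (fun x hx => τ.R_pos hx) (inv_ne_zero (add_two_I_ne_zero h0)) (one_sub_ne_zero h0) hs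
      (inv_ne_zero (add_two_I_ne_zero h0)) (one_sub_ne_zero h0) hs' he).2
    exact mul_right_cancel₀ (pow_ne_zero _ (dir_ne_zero (one_sub_ne_zero h0))) h1
  · rw [inr, inr, hl, cond_true, cond_true] at he
    exact congrArg Prod.fst he

/-- All values are attained, except for those over the disc of the next vertex. -/
lemma exists_eq {u v : ℂ} (hu : ‖u‖ = 1) (hv : ‖v‖ < τ.size)
    (hlo : τ.leaf = true ∨ τ.size * τ.lo < ‖v‖) :
    (∃ z s, τ.IsRegular z ∧ ‖s‖ = 1 ∧ τ.inl z s = (u, v)) ∨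
      ∃ s, ‖s‖ = 1 ∧ τ.inr 0 s = (u, v) := by
  by_cases hv0 : v = 0
  · have hl : τ.leaf = true := by
      rcases hlo with hl | hl
      · exact hl
      · rw [hv0, norm_zero] at hl
        exact absurd (mul_nonneg τ.size_pos.le τ.lo_nonneg) (not_le.2 hl)
    refine Or.inr ⟨u, hu, ?_⟩
    rw [inr, hl, cond_true, hv0, mul_zero, zero_mul]
  have hlo' : τ.size * τ.lo < ‖v‖ := by
    rcases hlo with hl | hl
    · rw [lo, hl, cond_true, mul_zero]; exact norm_pos_iff.2 hv0
    · exact hl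
  obtain ⟨G₀, σ, hG₀, hσ, hall⟩ := exists_toricCoord_eq (n := τ.n) τ.unimodular hu hv0
    (τ.exists_R_eq hlo' hv)
  have hfib : ∀ W₀ : ℂ, W₀ ≠ 0 → ‖σ / dir W₀ ^ τ.n‖ = 1 ∧ σ / dir W₀ ^ τ.n * dir W₀ ^ τ.n = σ :=
    fun W₀ hW₀ => ⟨by rw [norm_div, norm_pow, norm_dir hW₀, hσ]; simp,
      div_mul_cancel₀ _ (pow_ne_zero _ (dir_ne_zero hW₀))⟩
  cases hl : τ.leaf
  · by_cases hinf : G₀ = (2 * Complex.I)⁻¹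
    · have h0 : ‖(0 : ℂ)‖ < 1 := by simp
      obtain ⟨h1, h2⟩ := hfib _ (one_sub_ne_zero h0)
      refine Or.inr ⟨_, h1, ?_⟩
      rw [inr, hl, cond_false, zero_add, ← hinf]
      exact hall _ _ h2
    · obtain ⟨z, hz0, hz1, hz⟩ := exists_armBase_eq hG₀ hinf
      have hreg : τ.IsRegular z := ⟨hz0, fun _ => hz1⟩
      obtain ⟨h1, h2⟩ := hfib _ (W_ne_zero hreg)
      refine Or.inl ⟨z, _, hreg, h1, ?_⟩
      rw [inl, G, hl, cond_false, hz]
      exact hall _ _ h2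
  · have hreg : τ.IsRegular G₀ := ⟨hG₀, fun h => by rw [hl] at h; cases h⟩
    obtain ⟨h1, h2⟩ := hfib _ (W_ne_zero hreg)
    refine Or.inl ⟨G₀, _, hreg, h1, ?_⟩
    rw [inl, G, hl, cond_true]
    exact hall _ _ h2

/-- Small values of the radius are attained over the disc of the next vertex. -/
lemma exists_near_center (hl : τ.leaf = false) (h : τ.IsRegular z) (hs : ‖s‖ = 1)
    (hv : ‖(τ.inl z s).2‖ < τ.size * armRatio) :
    ∃ (t : ℝ) (σ : ℂ), 0 < t ∧ t < 1 ∧ ‖σ‖ = 1 ∧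
      z = Complex.I / 2 + ((t * armRadius : ℝ) : ℂ) * σ := by
  have hr := armRadius_pos
  have hG0 := G_ne_zero h
  have hGn := norm_pos_iff.2 hG0
  rw [norm_inl_snd h hs] at hv
  have hR : τ.R (1 / (4 * armRadius)) = τ.size * armRatio := by
    rw [τ.R_of_ge (one_div_le_one_div_of_le (by positivity) (by linarith [armRadius_le])), lo, slope,
      hl, cond_false, cond_false]
    field_simp
    ring
  rw [← hR] at hv
  have hlt : 1 / (4 * armRadius) < ‖τ.G z‖ :=
    (τ.strictAntiOn_R.lt_iff_gt (Set.mem_Ioi.2 hGn) (Set.mem_Ioi.2 (by positivity))).1 hv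
  have hGb : τ.G z = armBase z := by rw [G, hl, cond_false]
  rw [hGb] at hlt hG0
  set ζ := (4 * armBase z)⁻¹ with hζ
  have hζ0 : ζ ≠ 0 := inv_ne_zero (mul_ne_zero (by norm_num) hG0)
  have hζn : ‖ζ‖ < armRadius := by
    rw [hζ, norm_inv, norm_mul, Complex.norm_ofNat]
    rw [div_lt_iff₀ (by positivity)] at hlt
    rw [inv_lt_iff_one_lt_mul₀ (by nlinarith [norm_nonneg (armBase z)])]
    linarith
  have hzz : z = Complex.I / 2 + ζ := by
    refine armBase_injective (h.2 hl) (by simpa using hζ0) ?_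
    rw [armBase_near_center hζn.le hζ0, hζ]
    field_simp
  refine ⟨‖ζ‖ / armRadius, dir ζ, div_pos (norm_pos_iff.2 hζ0) hr, (div_lt_one hr).2 hζn,
    norm_dir hζ0, ?_⟩
  rw [div_mul_cancel₀ _ hr.ne', norm_mul_dir, ← hzz]

/-- The point at infinity has ‖G‖ = 1/2, while the disc of the next vertex is reached only for ‖G‖ >
1 / (4 armRadius) ≥ 1/2, and the radius decreases in ‖G‖. So this point is not shared with the next
vertex. -/
lemma le_norm_inr_zero_snd (hl : τ.leaf = false) (hs : ‖s‖ = 1) :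
    τ.size * armRatio ≤ ‖(τ.inr 0 s).2‖ := by
  have hr := armRadius_pos
  rw [norm_inr_zero_snd hl hs, τ.R_of_ge (by norm_num), lo, slope, hl, cond_false, cond_false]
  refine mul_le_mul_of_nonneg_left ?_ τ.size_pos.le
  have h1 : armRatio / (8 * armRadius) / (1 / 2) = armRatio * (1 / (4 * armRadius)) := by
    field_simp; ring
  have h2 : 1 / 2 ≤ 1 / (4 * armRadius) :=
    one_div_le_one_div_of_le (by positivity) (by linarith [armRadius_le])
  have := armRatio_pos
  rw [h1]
  nlinarith

end ToricVertex

/-! ## Compactness of plumbed manifolds -/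

namespace PlumbingGraph.DiscSystem

variable {V : Type} {Γ : PlumbingGraph V} (D : DiscSystem Γ)

lemma le_norm_sub_center {v w : V} (h : Γ.graph.Adj v w) {z : ℂ} (hz : 1 ≤ ‖z‖) :
    D.radius v w ≤ ‖z - D.center v w‖ := by
  have := D.inside v w h
  have := norm_sub_norm_le z (D.center v w)
  linarith

lemma ne_center_of_one_le {v : V} {z : ℂ} (hz : 1 ≤ ‖z‖) : z ∈ D.base (Sum.inl v) := by
  intro w h hzw
  have h1 := D.le_norm_sub_center h hz
  rw [hzw, sub_self, norm_zero] at h1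
  exact absurd (D.radius_pos v w h) (not_lt.2 h1)

lemma norm_edge_sub {v w : V} (h : Γ.graph.Adj v w) {t : ℝ} (ht : 0 ≤ t) {s : ℂ} (hs : ‖s‖ = 1) :
    ‖((t * D.radius v w : ℝ) : ℂ) * s‖ = t * D.radius v w := by
  rw [norm_mul, hs, Complex.norm_real, Real.norm_of_nonneg (mul_nonneg ht (D.radius_pos v w h).le),
    mul_one]

/-- A point of the disc of `w` keeps its distance from the centers of the other discs. -/
lemma le_norm_edge_sub {v w u : V} (h : Γ.graph.Adj v w) (hu : Γ.graph.Adj v u) (hne : u ≠ w)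
    {t : ℝ} (ht : 0 ≤ t) (ht1 : t < 1) {s : ℂ} (hs : ‖s‖ = 1) :
    D.radius v u ≤ ‖D.center v w + ((t * D.radius v w : ℝ) : ℂ) * s - D.center v u‖ := by
  by_contra hlt
  push Not at hlt
  have h1 : D.center v w + ((t * D.radius v w : ℝ) : ℂ) * s ∈
      Metric.ball (D.center v w) (D.radius v w) := by
    rw [mem_ball_iff_norm, add_sub_cancel_left, D.norm_edge_sub h ht hs]
    exact mul_lt_of_lt_one_left (D.radius_pos v w h) ht1
  exact Set.disjoint_left.1 (D.disjoint v u w hu h hne) (mem_ball_iff_norm.2 hlt) h1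

lemma edge_mem_base {v w : V} (h : Γ.graph.Adj v w) {t : ℝ} (ht : 0 < t) (ht1 : t < 1) {s : ℂ}
    (hs : ‖s‖ = 1) : D.center v w + ((t * D.radius v w : ℝ) : ℂ) * s ∈ D.base (Sum.inl v) := by
  intro u hu heq
  by_cases hne : u = w
  · subst hne
    have h1 := D.norm_edge_sub h ht.le hs
    rw [add_eq_left] at heq
    rw [heq, norm_zero] at h1
    exact (mul_pos ht (D.radius_pos v u h)).ne h1
  · have h1 := D.le_norm_edge_sub h hu hne ht.le ht1 hs
    rw [heq, sub_self, norm_zero] at h1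
    exact absurd (D.radius_pos v u hu) (not_lt.2 h1)

lemma chart_infinity {v : V} {z z' : ℂ} (hz : z ∈ D.base (Sum.inl v))
    (hz' : z' ∈ D.base (Sum.inr v)) (h : z * z' = 1) (s : Circle) :
    ∃ s' : Circle, D.chart (Sum.inl v) ⟨z, hz⟩ s = D.chart (Sum.inr v) ⟨z', hz'⟩ s' ∧
      (s' : ℂ) = dir z ^ (-Γ.weight v) * s := by
  have hz0 : z ≠ 0 := left_ne_zero_of_mul_eq_one h
  have hn : ‖dir z ^ (-Γ.weight v) * (s : ℂ)‖ = 1 := by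
    rw [norm_mul, norm_zpow, norm_dir hz0, one_zpow, one_mul, Circle.norm_coe]
  exact ⟨⟨_, mem_sphere_zero_iff_norm.2 hn⟩, Quot.sound (Glue.infinity v _ _ _ _ h rfl), rfl⟩

lemma chart_infinity' {v : V} {z z' : ℂ} (hz : z ∈ D.base (Sum.inl v))
    (hz' : z' ∈ D.base (Sum.inr v)) (h : z * z' = 1) (s' : Circle) :
    ∃ s : Circle, D.chart (Sum.inl v) ⟨z, hz⟩ s = D.chart (Sum.inr v) ⟨z', hz'⟩ s' := by
  have hz0 : z ≠ 0 := left_ne_zero_of_mul_eq_one h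
  have hd := dir_ne_zero hz0
  have hn : ‖dir z ^ (Γ.weight v) * (s' : ℂ)‖ = 1 := by
    rw [norm_mul, norm_zpow, norm_dir hz0, one_zpow, one_mul, Circle.norm_coe]
  refine ⟨⟨_, mem_sphere_zero_iff_norm.2 hn⟩, Quot.sound (Glue.infinity v _ _ _ _ h ?_)⟩
  change (s' : ℂ) = dir z ^ (-Γ.weight v) * (dir z ^ (Γ.weight v) * (s' : ℂ))
  rw [← mul_assoc, ← zpow_add₀ hd, neg_add_cancel, zpow_zero, one_mul]

lemma chart_edge {v w : V} (h : Γ.graph.Adj v w) {t : ℝ} (ht : 0 < t) (ht1 : t < 1) (s s' : Circle) :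
    D.chart (Sum.inl v) ⟨_, D.edge_mem_base h ht ht1 (Circle.norm_coe s')⟩ s =
      D.chart (Sum.inl w) ⟨_, D.edge_mem_base h.symm (t := 1 - t) (by linarith) (by linarith)
        (Circle.norm_coe s)⟩ s' :=
  Quot.sound (Glue.edge v w h _ _ _ _ t ht ht1 rfl rfl)

/-- Every point lies in a finite part of a base or over a point at infinity. -/
lemma exists_reduced (x : D.Boundary) :
    (∃ v z, ∃ hz : z ∈ D.base (Sum.inl v), ∃ s, x = D.chart (Sum.inl v) ⟨z, hz⟩ s) ∨
      ∃ v s, ∃ h0 : (0 : ℂ) ∈ D.base (Sum.inr v), x = D.chart (Sum.inr v) ⟨0, h0⟩ s := by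
  obtain ⟨⟨c, ⟨z, hz⟩, s⟩, rfl⟩ := Quot.exists_rep x
  cases c with
  | inl v => exact Or.inl ⟨v, z, hz, s, rfl⟩
  | inr v =>
    by_cases h0 : z = 0
    · subst h0; exact Or.inr ⟨v, s, hz, rfl⟩
    · have hz1 : ‖z‖ < 1 := mem_ball_zero_iff.1 hz
      have hzi : z⁻¹ ∈ D.base (Sum.inl v) := D.ne_center_of_one_le (by
        rw [norm_inv]; exact (one_le_inv₀ (norm_pos_iff.2 h0)).2 hz1.le)
      obtain ⟨s', hs'⟩ := D.chart_infinity' hzi hz (inv_mul_cancel₀ h0) s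
      exact Or.inl ⟨v, _, hzi, s', hs'.symm⟩

/-- Compact parts of the bases that cover the manifold. -/
def compactBase : V ⊕ V → Set ℂ
  | Sum.inl v => {z | ‖z‖ ≤ 2 ∧ ∀ w, Γ.graph.Adj v w → D.radius v w / 2 ≤ ‖z - D.center v w‖}
  | Sum.inr _ => Metric.closedBall 0 (1 / 2)

lemma isCompact_compactBase (c : V ⊕ V) : IsCompact (D.compactBase c) := by
  cases c with
  | inl v =>
    refine (isCompact_closedBall (0 : ℂ) 2).of_isClosed_subset ?_ fun z hz =>
      mem_closedBall_zero_iff.2 hz.1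
    refine (isClosed_le continuous_norm continuous_const).and ?_
    simp only [Set.ofPred_forall]
    refine isClosed_iInter fun w => isClosed_iInter fun _ =>
      isClosed_le continuous_const (by fun_prop)
  | inr v => exact isCompact_closedBall 0 (1 / 2)

lemma compactBase_subset (c : V ⊕ V) : D.compactBase c ⊆ D.base c := by
  intro z hz
  cases c with
  | inl v =>
    intro w hw h
    have h1 := hz.2 w hw
    rw [h, sub_self, norm_zero] at h1
    linarith [D.radius_pos v w hw]
  | inr v => exact Metric.closedBall_subset_ball (by norm_num) hz

/-- A point in the inner half of a disc goes to the outer half of the partner disc, since an edge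
takes t to 1 - t. A point with ‖z‖ > 2 goes to the chart at infinity. -/
lemma exists_compactBase (x : D.Boundary) :
    ∃ c z s, ∃ hz : z ∈ D.base c, z ∈ D.compactBase c ∧ x = D.chart c ⟨z, hz⟩ s := by
  obtain ⟨v, z, hz, s, rfl⟩ | ⟨v, s, h0, rfl⟩ := D.exists_reduced x
  · by_cases h2 : ‖z‖ ≤ 2
    · by_cases hK : ∀ w, Γ.graph.Adj v w → D.radius v w / 2 ≤ ‖z - D.center v w‖
      · exact ⟨_, z, s, hz, ⟨h2, hK⟩, rfl⟩
      · push Not at hK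
        obtain ⟨w, hw, hlt⟩ := hK
        have hr := D.radius_pos v w hw
        have hr' := D.radius_pos w v hw.symm
        have h0 : z - D.center v w ≠ 0 := sub_ne_zero.2 (hz w hw)
        set t := ‖z - D.center v w‖ / D.radius v w with ht
        have ht0 : 0 < t := div_pos (norm_pos_iff.2 h0) hr
        have ht1 : t < 1 / 2 := by rw [ht, div_lt_iff₀ hr]; linarith
        let s' : Circle := ⟨dir (z - D.center v w), mem_sphere_zero_iff_norm.2 (norm_dir h0)⟩
        have hzt : D.center v w + ((t * D.radius v w : ℝ) : ℂ) * (s' : ℂ) = z := by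
          rw [ht, div_mul_cancel₀ _ hr.ne']
          change _ + _ * dir (z - D.center v w) = z
          rw [norm_mul_dir, add_sub_cancel]
        have he := D.chart_edge hw ht0 (by linarith) s s'
        simp only [hzt] at he
        have hs := Circle.norm_coe s
        have hn := D.norm_edge_sub hw.symm (t := 1 - t) (by linarith) hs
        refine ⟨Sum.inl w, _, _, _, ⟨?_, fun u hu => ?_⟩, he⟩
        · have h3 := norm_add_le (D.center w v) (((1 - t) * D.radius w v : ℝ) * (s : ℂ))
          have := D.inside w v hw.symm
          rw [hn] at h3
          nlinarith
        · by_cases huv : u = v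
          · subst huv
            rw [add_sub_cancel_left, hn]
            nlinarith
          · have := D.le_norm_edge_sub hw.symm hu huv (t := 1 - t) (by linarith) (by linarith) hs
            have := D.radius_pos w u hu
            linarith
    · push Not at h2
      have hz0 : z ≠ 0 := by rw [← norm_pos_iff]; linarith
      have hzi : ‖z⁻¹‖ ≤ 1 / 2 := by
        rw [norm_inv, one_div]; exact inv_anti₀ two_pos h2.le
      obtain ⟨s', hs', -⟩ := D.chart_infinity hz
        (z' := z⁻¹) (mem_ball_zero_iff.2 (by linarith)) (mul_inv_cancel₀ hz0) s
      exact ⟨_, _, _, _, mem_closedBall_zero_iff.2 hzi, hs'⟩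
  · exact ⟨_, 0, s, h0, mem_closedBall_zero_iff.2 (by simp), rfl⟩

lemma continuous_chart (c : V ⊕ V) :
    Continuous fun x : D.base c × Circle => D.chart c x.1 x.2 := by
  have h1 : Continuous fun P : D.Pieces => (Quot.mk D.Glue P : D.Boundary) := continuous_quot_mk
  have h2 : Continuous fun x : D.base c × Circle => (⟨c, x⟩ : D.Pieces) :=
    continuous_sigmaMk (σ := fun c : V ⊕ V => D.base c × Circle)
  exact h1.comp h2

instance [Finite V] : CompactSpace D.Boundary := by
  constructor
  have h : (Set.univ : Set D.Boundary) = ⋃ c, (fun x : D.base c × Circle => D.chart c x.1 x.2) ''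
      ((Subtype.val ⁻¹' D.compactBase c) ×ˢ Set.univ) := by
    refine (Set.eq_univ_of_forall fun x => ?_).symm
    obtain ⟨c, z, s, hz, hK, rfl⟩ := D.exists_compactBase x
    exact Set.mem_iUnion.2 ⟨c, (⟨z, hz⟩, s), ⟨hK, Set.mem_univ _⟩, rfl⟩
  rw [h]
  refine isCompact_iUnion fun c => IsCompact.image ?_ (D.continuous_chart c)
  refine IsCompact.prod ?_ isCompact_univ
  rw [IsInducing.subtypeVal.isCompact_preimage_iff]
  · exact D.isCompact_compactBase c
  · rw [Subtype.range_coe]; exact D.compactBase_subset c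

/-- A recipe for an orientation-preserving diffeomorphism onto a Brieskorn link: compatible smooth
maps `F c (z, s)` of the charts, with positive frames, that are jointly bijective. -/
theorem boundaryIsBrieskorn [Finite V] {a : Fin 3 → ℕ} (F : V ⊕ V → ℂ → ℂ → Fin 3 → ℂ)
    (hF : ∀ c, ∀ z ∈ D.base c, ∀ s : ℂ, ‖s‖ = 1 →
      ContDiffAt ℝ ∞ (fun x : ℂ × ℂ => F c x.1 x.2) (z, s))
    (hmem : ∀ c, ∀ z ∈ D.base c, ∀ s : ℂ, ‖s‖ = 1 → F c z s ∈ brieskornLink a)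
    (hinf : ∀ v (z z' s : ℂ), 1 < ‖z‖ → z * z' = 1 → ‖s‖ = 1 →
      F (Sum.inl v) z s = F (Sum.inr v) z' (dir z ^ (-Γ.weight v) * s))
    (hedge : ∀ v w, Γ.graph.Adj v w → ∀ (t : ℝ) (s s' : ℂ), 0 < t → t < 1 → ‖s‖ = 1 → ‖s'‖ = 1 →
      F (Sum.inl v) (D.center v w + ((t * D.radius v w : ℝ) : ℂ) * s') s =
        F (Sum.inl w) (D.center w v + (((1 - t) * D.radius w v : ℝ) : ℂ) * s) s')
    (hframe : ∀ c, ∀ z ∈ D.base c, ∀ θ : ℝ,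
      IsPositiveFrame a (F c z (Complex.exp (θ * Complex.I)))
        (fderiv ℝ (fun x : ℂ × ℝ => F c x.1 (Complex.exp (x.2 * Complex.I))) (z, θ) (1, 0))
        (fderiv ℝ (fun x : ℂ × ℝ => F c x.1 (Complex.exp (x.2 * Complex.I))) (z, θ) (Complex.I, 0))
        (fderiv ℝ (fun x : ℂ × ℝ => F c x.1 (Complex.exp (x.2 * Complex.I))) (z, θ) (0, 1)))
    (hinj : ∀ P P' : D.Pieces, (∀ v, P.1 = Sum.inr v → (P.2.1 : ℂ) = 0) →
      (∀ v, P'.1 = Sum.inr v → (P'.2.1 : ℂ) = 0) →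
      F P.1 P.2.1 P.2.2 = F P'.1 P'.2.1 P'.2.2 →
        (Quot.mk D.Glue P : D.Boundary) = Quot.mk D.Glue P')
    (hsurj : ∀ x ∈ brieskornLink a, ∃ c, ∃ z ∈ D.base c, ∃ s : ℂ, ‖s‖ = 1 ∧ F c z s = x) :
    Γ.BoundaryIsBrieskorn a := by
  let H₀ : D.Pieces → brieskornLink a := fun P =>
    ⟨F P.1 P.2.1 P.2.2, hmem _ _ P.2.1.2 _ (Circle.norm_coe _)⟩
  have hglue : ∀ P P', D.Glue P P' → H₀ P = H₀ P' := by
    intro P P' h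
    refine Subtype.ext ?_
    induction h with
    | infinity v z z' s s' hz hs =>
      have hz0 : (z : ℂ) ≠ 0 := left_ne_zero_of_mul_eq_one hz
      have hz1 : ‖(z' : ℂ)‖ < 1 := mem_ball_zero_iff.1 z'.2
      have h1 : 1 < ‖(z : ℂ)‖ := by
        have := congrArg norm hz
        rw [norm_mul, norm_one] at this
        nlinarith [norm_pos_iff.2 hz0]
      have := hinf v z z' s h1 hz (Circle.norm_coe s)
      rw [dir, ← hs] at this
      exact this
    | edge v w h z z' s s' t h0 h1 hz hz' =>
      have := hedge v w h t s s' h0 h1 (Circle.norm_coe s) (Circle.norm_coe s')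
      rw [← hz, ← hz'] at this
      exact this
  let H : D.Boundary → brieskornLink a := Quot.lift H₀ hglue
  have hH : ∀ c (z : D.base c) (s : Circle), (H (D.chart c z s) : Fin 3 → ℂ) = F c z s :=
    fun c z s => rfl
  have hcont : Continuous H := by
    refine continuous_quot_lift hglue (continuous_sigma fun c => ?_)
    refine Continuous.subtype_mk (continuous_iff_continuousAt.2 fun x => ?_) _
    have h1 : ContinuousAt (fun x : ℂ × ℂ => F c x.1 x.2) ((x.1 : ℂ), (x.2 : ℂ)) :=
      (hF c x.1 x.1.2 x.2 (Circle.norm_coe _)).continuousAt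
    have h2 : ContinuousAt (fun x : D.base c × Circle => ((x.1 : ℂ), (x.2 : ℂ))) x :=
      Continuous.continuousAt (by fun_prop)
    exact ContinuousAt.comp (f := fun x : D.base c × Circle => ((x.1 : ℂ), (x.2 : ℂ))) h1 h2
  have hbij : Function.Bijective H := by
    constructor
    · intro x y hxy
      have hxy' := congrArg Subtype.val hxy
      obtain ⟨v, z, hz, s, rfl⟩ | ⟨v, s, h0, rfl⟩ := D.exists_reduced x <;>
      obtain ⟨v', z', hz', s', rfl⟩ | ⟨v', s', h0', rfl⟩ := D.exists_reduced y <;>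
      exact hinj _ _ (fun _ h => by first | rfl | cases h) (fun _ h => by first | rfl | cases h) hxy'
    · rintro ⟨x, hx⟩
      obtain ⟨c, z, hz, s, hs, h⟩ := hsurj x hx
      exact ⟨D.chart c ⟨z, hz⟩ ⟨s, mem_sphere_zero_iff_norm.2 hs⟩, Subtype.ext h⟩
  -- The source is compact and the link is Hausdorff, so the continuous bijection is a homeomorphism
  -- and no inverse has to be written down.
  refine ⟨D, Continuous.homeoOfEquivCompactToT2 (f := Equiv.ofBijective H hbij) hcont, fun c => ?_⟩
  refine ⟨fun x => F c x.1 (Complex.exp (x.2 * Complex.I)), ?_, fun z θ => ⟨?_, hframe c z z.2 θ⟩⟩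
  · rintro ⟨z, θ⟩ ⟨hz, -⟩
    have hs : ‖Complex.exp (θ * Complex.I)‖ = 1 := Complex.norm_exp_ofReal_mul_I θ
    have h1 : ContDiff ℝ ∞ fun x : ℂ × ℝ => (x.1, Complex.exp (x.2 * Complex.I)) :=
      contDiff_fst.prodMk ((Complex.ofRealCLM.contDiff.comp contDiff_snd).mul contDiff_const).cexp
    exact (ContDiffAt.comp (z, θ) (hF c z hz _ hs) h1.contDiffAt).contDiffWithinAt
  · have := hH c z (Circle.exp θ)
    rw [Circle.coe_exp] at this
    exact this.symm

end PlumbingGraph.DiscSystem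

/-! ## The star-shaped graph and its discs -/

/-- The star-shaped graph with `d` long arms. -/
def starGraph (d m : ℕ) : PlumbingGraph (StarVertex d (d * m + 7)) where
  graph := SimpleGraph.fromRel (starEdge d (d * m + 7))
  weight
    | Sum.inl _ => -(d : ℤ)
    | Sum.inr (Sum.inl _) => -(m : ℤ)
    | Sum.inr (Sum.inr (_, j)) => if (j : ℕ) = d * m - 2 then -3 else -2

lemma brieskornGraph_eq (k m : ℕ) : brieskornGraph k m = starGraph (2 ^ k) m := by
  unfold brieskornGraph starGraph
  congr 1
  funext v
  rcases v with _ | _ | ⟨_, _⟩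
  · simp
  · rfl
  · rfl

section Adjacency

variable {d l : ℕ}

/-- The neighbour of the central vertex at a puncture. -/
def endVertex : Option (Fin d) → StarVertex d (l + 1)
  | none => Sum.inr (Sum.inl ())
  | some j => Sum.inr (Sum.inr (j, 0))

lemma starEdge_iff {v w : StarVertex d (l + 1)} : starEdge d (l + 1) v w ↔
    (∃ α, v = Sum.inl () ∧ w = endVertex α) ∨
      ∃ (j : Fin d) (i i' : Fin (l + 1)), (i : ℕ) + 1 = (i' : ℕ) ∧ v = Sum.inr (Sum.inr (j, i)) ∧
        w = Sum.inr (Sum.inr (j, i')) := by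
  constructor
  · intro h
    rcases v with _ | _ | ⟨j, i⟩ <;> rcases w with _ | _ | ⟨j', i'⟩ <;> simp only [starEdge] at h
    · exact Or.inl ⟨none, rfl, rfl⟩
    · refine Or.inl ⟨some j', rfl, ?_⟩
      simp only [endVertex]
      congr 3
      exact Fin.ext h
    · obtain ⟨rfl, h⟩ := h
      exact Or.inr ⟨j, i, i', h, rfl, rfl⟩
  · rintro (⟨α, rfl, rfl⟩ | ⟨j, i, i', h, rfl, rfl⟩)
    · cases α <;> simp [endVertex, starEdge]
    · exact ⟨rfl, h⟩

lemma endVertex_ne (α : Option (Fin d)) : (endVertex α : StarVertex d (l + 1)) ≠ Sum.inl () := by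
  cases α <;> simp [endVertex]

/-- The adjacency relation of the star-shaped graph. -/
def StarAdj (v w : StarVertex d (l + 1)) : Prop :=
  (SimpleGraph.fromRel (starEdge d (l + 1))).Adj v w

lemma starAdj_iff {v w : StarVertex d (l + 1)} :
    StarAdj v w ↔ starEdge d (l + 1) v w ∨ starEdge d (l + 1) w v := by
  rw [StarAdj, SimpleGraph.fromRel_adj, and_iff_right_iff_imp]
  rintro h rfl
  rw [or_self, starEdge_iff] at h
  rcases h with ⟨α, h1, h2⟩ | ⟨j, i, i', h, h1, h2⟩
  · exact endVertex_ne α (h2.symm.trans h1)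
  · rw [h1] at h2
    simp only [Sum.inr.injEq, Prod.mk.injEq, true_and] at h2
    rw [h2] at h
    omega

lemma starAdj_centre_iff {w : StarVertex d (l + 1)} :
    StarAdj (Sum.inl ()) w ↔ ∃ α, w = endVertex α := by
  rw [starAdj_iff, starEdge_iff, starEdge_iff]
  constructor
  · rintro ((⟨α, -, h⟩ | ⟨j, i, i', h, h1, -⟩) | (⟨α, -, h⟩ | ⟨j, i, i', h, -, h1⟩))
    · exact ⟨α, h⟩
    · cases h1
    · exact absurd h.symm (endVertex_ne α)
    · cases h1
  · rintro ⟨α, rfl⟩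
    exact Or.inl (Or.inl ⟨α, rfl, rfl⟩)

lemma starAdj_b_iff {w : StarVertex d (l + 1)} :
    StarAdj (Sum.inr (Sum.inl ())) w ↔ w = Sum.inl () := by
  rw [starAdj_iff, starEdge_iff, starEdge_iff]
  constructor
  · rintro ((⟨α, h, -⟩ | ⟨j, i, i', h, h1, -⟩) | (⟨α, h, -⟩ | ⟨j, i, i', h, -, h1⟩))
    · cases h
    · cases h1
    · exact h
    · cases h1
  · rintro rfl
    exact Or.inr (Or.inl ⟨none, rfl, rfl⟩)

lemma starAdj_arm_iff {j : Fin d} {i : Fin (l + 1)} {w : StarVertex d (l + 1)} :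
    StarAdj (Sum.inr (Sum.inr (j, i))) w ↔ ((i : ℕ) = 0 ∧ w = Sum.inl ()) ∨
      ∃ i' : Fin (l + 1), w = Sum.inr (Sum.inr (j, i')) ∧
        ((i' : ℕ) + 1 = i ∨ (i : ℕ) + 1 = i') := by
  rw [starAdj_iff, starEdge_iff, starEdge_iff]
  constructor
  · rintro ((⟨α, h, -⟩ | ⟨j', i', i'', h, h1, h2⟩) | (⟨α, h, h2⟩ | ⟨j', i', i'', h, h2, h1⟩))
    · cases h
    · cases h1; exact Or.inr ⟨_, h2, Or.inr h⟩
    · cases α with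
      | none => cases h2
      | some j' => cases h2; exact Or.inl ⟨rfl, h⟩
    · cases h1; exact Or.inr ⟨_, h2, Or.inl h⟩
  · rintro (⟨h, rfl⟩ | ⟨i', rfl, h | h⟩)
    · refine Or.inr (Or.inl ⟨some j, rfl, ?_⟩)
      simp only [endVertex]
      congr 3
      exact Fin.ext h
    · exact Or.inr (Or.inr ⟨j, i', i, h, rfl, rfl⟩)
    · exact Or.inl (Or.inr ⟨j, i, i', h, rfl, rfl⟩)

end Adjacency

/-- The parameters of the construction. -/
structure StarData where
  d : ℕ
  m : ℕ
  N : ℕ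
  two_le : 2 ≤ d
  m_pos : 0 < m
  succ_N : N + 1 = 10 * (d * m)
  C : CentreData d

/-- The exponents of `x₁` along an arm. -/
def armP (d m N i : ℕ) : ℕ := if i < d * m then N - 10 * i else d * m + 8 - i

/-- The exponents of `x₂` along an arm. -/
def armQ (d m i : ℕ) : ℕ := if i < d * m then d * m - i else 1

/-- The negatives of the weights along an arm. -/
def armN (d m i : ℕ) : ℕ := if i = d * m - 2 then 3 else 2

/-! ### Arithmetic of the continued fraction of N / (N - 10) -/

section Exponents

variable {d m N : ℕ} (hN : N + 1 = 10 * (d * m)) (h2 : 2 ≤ d * m)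

include hN h2

-- The determinant is 1 in each range of indices: before the end of the long decrease it is 10dm - N
-- = 1, at the change of slope it is 9 · 1 - 8 · 1, and afterwards the q are constant while p drops
-- by one.
omit h2 in
lemma armPQ_unimodular {i : ℕ} (hi : i < d * m + 7) :
    armP d m N i * armQ d m (i + 1) = armP d m N (i + 1) * armQ d m i + 1 := by
  unfold armP armQ
  rcases lt_trichotomy (i + 1) (d * m) with h | h | h
  · rw [if_pos (by omega), if_pos h, if_pos h, if_pos (by omega)]
    obtain ⟨e, he⟩ : ∃ e, d * m = i + 1 + (e + 1) := ⟨d * m - i - 2, by omega⟩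
    have e1 : N - 10 * i = 10 * e + 19 := by omega
    have e2 : N - 10 * (i + 1) = 10 * e + 9 := by omega
    have e3 : d * m - (i + 1) = e + 1 := by omega
    have e4 : d * m - i = e + 2 := by omega
    rw [e1, e2, e3, e4]; ring
  · rw [if_pos (by omega), if_neg (by omega), if_neg (by omega), if_pos (by omega)]
    have e1 : N - 10 * i = 9 := by omega
    have e2 : d * m + 8 - (i + 1) = 8 := by omega
    have e3 : d * m - i = 1 := by omega
    rw [e1, e2, e3]
  · rw [if_neg (by omega), if_neg (by omega), if_neg (by omega), if_neg (by omega)]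
    omega

/-- The sequence N, N - 10, ..., 19, 9, 8, ..., 1, 0 is linear except at 9, where its slope changes
from -10 to -1. There 19 + 8 = 3 · 9, which is the single weight -3. The recursion includes the
value 0 behind the last vertex. -/
lemma armP_rec {i : ℕ} (hi : i ≤ d * m + 6) :
    armP d m N (i + 2) + armP d m N i = armN d m i * armP d m N (i + 1) := by
  unfold armP armN
  split_ifs <;> omega

omit hN in
lemma armQ_rec {i : ℕ} (hi : i < d * m + 6) :
    armQ d m (i + 2) + armQ d m i = armN d m i * armQ d m (i + 1) := by
  unfold armQ armN
  split_ifs <;> omega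

end Exponents

namespace StarData

variable (S : StarData)

/-- The length of an arm, minus one. -/
abbrev last : ℕ := S.d * S.m + 6

/-- The vertices of the graph. -/
abbrev Vertex : Type := StarVertex S.d (S.last + 1)

/-- The plumbing graph. -/
def graph : PlumbingGraph S.Vertex := starGraph S.d S.m

lemma d_pos : 0 < S.d := by have := S.two_le; omega

lemma two_le_mul : 2 ≤ S.d * S.m :=
  S.two_le.trans (Nat.le_mul_of_pos_right _ S.m_pos)

lemma N_pos : 0 < S.N := by have := S.succ_N; have := S.two_le_mul; omega

/-- The vertices of the arms. -/
def armVertex (i : ℕ) (hi : i ≤ S.last) : ToricVertex where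
  p := armP S.d S.m S.N i
  p' := armP S.d S.m S.N (i + 1)
  q := armQ S.d S.m i
  q' := armQ S.d S.m (i + 1)
  n := armN S.d S.m i
  leaf := decide (i = S.last)
  size := S.C.rstar * armRatio ^ i
  unimodular := armPQ_unimodular S.succ_N (Nat.lt_succ_of_le hi)
  size_pos := mul_pos S.C.rstar_pos (pow_pos armRatio_pos i)
  -- At the last index dm + 6 the exponents have come down to p = 2 and p' = 1.
  leaf_p h := by
    have h1 : i = S.d * S.m + 6 := of_decide_eq_true h
    have := S.two_le_mul
    unfold armP armN
    rw [if_neg (by omega), if_neg (by omega)]; omega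
  leaf_p' h := by
    have h1 : i = S.d * S.m + 6 := of_decide_eq_true h
    unfold armP
    rw [if_neg (by omega)]; omega

/-- The vertex of weight `-m`. -/
def bVertex : ToricVertex where
  p := S.m
  p' := 1
  q := S.N
  q' := 10 * S.d
  n := S.m
  leaf := true
  size := S.C.rstar
  -- The relation m · 10d = N + 1 is the determinant condition for the vertex of weight -m.
  unimodular := by rw [one_mul, S.succ_N]; ring
  size_pos := S.C.rstar_pos
  leaf_p _ := rfl
  leaf_p' _ := rfl

/-- The toric vertices. -/
def toric : Unit ⊕ (Fin S.d × Fin (S.last + 1)) → ToricVertex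
  | Sum.inl _ => S.bVertex
  | Sum.inr (_, i) => S.armVertex i (Nat.le_of_lt_succ i.2)

lemma weight_toric (u) : S.graph.weight (Sum.inr u) = -((S.toric u).n : ℤ) := by
  rcases u with _ | ⟨j, i⟩
  · rfl
  · simp only [graph, starGraph, toric, armVertex, armN]
    split_ifs <;> rfl

lemma weight_centre : S.graph.weight (Sum.inl ()) = -(S.d : ℤ) := rfl

/-- The centers of the discs. -/
def center : S.Vertex → S.Vertex → ℂ
  | Sum.inl _, Sum.inr (Sum.inl _) => centrePt S.d none
  | Sum.inl _, Sum.inr (Sum.inr (j, _)) => centrePt S.d (some j)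
  | Sum.inr (Sum.inr (_, i)), Sum.inr (Sum.inr (_, i')) => if i < i' then Complex.I / 2 else 0
  | _, _ => 0

/-- The radii of the discs. -/
def radius : S.Vertex → ℝ
  | Sum.inl _ => S.C.rad
  | Sum.inr _ => armRadius

lemma radius_pos (v : S.Vertex) : 0 < S.radius v := by
  cases v
  exacts [S.C.rad_pos, armRadius_pos]

lemma radius_le (v : S.Vertex) : S.radius v ≤ 1 / 16 := by
  cases v
  exacts [S.C.rad_le.trans (by norm_num), armRadius_le]

lemma norm_center_le (v w : S.Vertex) : ‖S.center v w‖ ≤ 1 / 2 := by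
  unfold center
  split
  · exact norm_centrePt_le _
  · exact norm_centrePt_le _
  · split_ifs <;> simp
  · simp

lemma center_endVertex (α : Option (Fin S.d)) :
    S.center (Sum.inl ()) (endVertex α) = centrePt S.d α := by cases α <;> rfl

lemma center_separated {v w w' : S.Vertex} (h : StarAdj v w) (h' : StarAdj v w') (hne : w ≠ w') :
    S.radius v + S.radius v ≤ ‖S.center v w - S.center v w'‖ := by
  rcases v with _ | _ | ⟨j, i⟩
  · obtain ⟨α, rfl⟩ := starAdj_centre_iff.1 h
    obtain ⟨β, rfl⟩ := starAdj_centre_iff.1 h'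
    rw [center_endVertex, center_endVertex]
    have := S.C.sep' α β fun h => hne (by rw [h])
    have := S.C.rad_pos
    simp only [radius]
    linarith
  · exact absurd ((starAdj_b_iff.1 h).trans (starAdj_b_iff.1 h').symm) hne
  · have hr := armRadius_le
    have key : armRadius + armRadius ≤ ‖Complex.I / 2 - 0‖ ∧
        armRadius + armRadius ≤ ‖0 - Complex.I / 2‖ := by
      rw [sub_zero, zero_sub, norm_neg, norm_I_div_two]
      constructor <;> linarith
    have hlt : ∀ {a b : Fin (S.last + 1)}, (a : ℕ) + 1 = b → a < b := fun h =>
      Fin.lt_def.2 (by omega)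
    rcases starAdj_arm_iff.1 h with ⟨h0, rfl⟩ | ⟨a, rfl, ha | ha⟩ <;>
    rcases starAdj_arm_iff.1 h' with ⟨h0', rfl⟩ | ⟨b, rfl, hb | hb⟩
    · exact absurd rfl hne
    · omega
    · simp only [center, if_pos (hlt hb), radius]; exact key.2
    · omega
    · exact absurd (by congr 3; exact Fin.ext (by omega)) hne
    · simp only [center, if_pos (hlt hb), if_neg (hlt ha).not_gt, radius]; exact key.2
    · simp only [center, if_pos (hlt ha), radius]; exact key.1
    · simp only [center, if_pos (hlt ha), if_neg (hlt hb).not_gt, radius]; exact key.1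
    · exact absurd (by congr 3; exact Fin.ext (by omega)) hne

/-- The discs of the plumbing. -/
def discs : S.graph.DiscSystem where
  center := S.center
  radius v _ := S.radius v
  radius_pos v _ _ := S.radius_pos v
  inside v w _ := by linarith [S.norm_center_le v w, S.radius_le v]
  disjoint v w w' h h' hne := Metric.ball_disjoint_ball (by
    rw [dist_eq_norm]; exact S.center_separated h h' hne)

lemma base_centre {z : ℂ} :
    z ∈ S.discs.base (Sum.inl (Sum.inl ())) ↔ ∀ α, z ≠ centrePt S.d α := by
  constructor
  · intro h α
    have := h (endVertex α) (starAdj_centre_iff.2 ⟨α, rfl⟩)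
    rwa [← S.center_endVertex]
  · intro h w hw
    obtain ⟨α, rfl⟩ := starAdj_centre_iff.1 hw
    change z ≠ S.center _ _
    rw [S.center_endVertex]
    exact h α

lemma base_toric {u : Unit ⊕ (Fin S.d × Fin (S.last + 1))} {z : ℂ} :
    z ∈ S.discs.base (Sum.inl (Sum.inr u)) ↔ (S.toric u).IsRegular z := by
  rcases u with _ | ⟨j, i⟩
  · constructor
    · intro h
      exact ⟨h (Sum.inl ()) (starAdj_b_iff.2 rfl), fun h => by cases h⟩
    · rintro ⟨h, -⟩ w hw
      rw [starAdj_b_iff.1 hw]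
      exact h
  · constructor
    · intro h
      constructor
      · by_cases hi : (i : ℕ) = 0
        · exact h (Sum.inl ()) (starAdj_arm_iff.2 (Or.inl ⟨hi, rfl⟩))
        · have : z ≠ S.center (Sum.inr (Sum.inr (j, i))) (Sum.inr (Sum.inr (j, ⟨i - 1, by omega⟩))) :=
            h _ (starAdj_arm_iff.2 (Or.inr ⟨_, rfl, Or.inl (by simp only; omega)⟩))
          rwa [center, if_neg] at this
          rw [Fin.lt_def]; simp only; omega
      · intro hl
        have hi : (i : ℕ) ≠ S.last := of_decide_eq_false hl
        have : z ≠ S.center (Sum.inr (Sum.inr (j, i))) (Sum.inr (Sum.inr (j, ⟨i + 1, by omega⟩))) :=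
          h _ (starAdj_arm_iff.2 (Or.inr ⟨_, rfl, Or.inr rfl⟩))
        rwa [center, if_pos] at this
        rw [Fin.lt_def]; simp only; omega
    · rintro ⟨h0, h1⟩ w hw
      change z ≠ S.center _ _
      rcases starAdj_arm_iff.1 hw with ⟨-, rfl⟩ | ⟨a, rfl, ha | ha⟩
      · exact h0
      · rw [center, if_neg (by rw [Fin.lt_def]; omega)]; exact h0
      · rw [center, if_pos (by rw [Fin.lt_def]; omega)]
        exact h1 (decide_eq_false (by have ha2 : (a : ℕ) < S.last + 1 := a.2; omega))

lemma base_infinity {v : S.Vertex} {z : ℂ} : z ∈ S.discs.base (Sum.inr v) ↔ ‖z‖ < 1 :=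
  mem_ball_zero_iff

end StarData

/-! ## The map of the charts to the link -/

lemma dilate_cone {d m N : ℕ} (τ : ℝ) {x : Fin 3 → ℂ} (hx : ∑ j, x j ^ linkExp d m N j = 0) :
    ∑ j, dilate (linkWeight d m N) τ x j ^ linkExp d m N j = 0 := by
  have : ∀ j, dilate (linkWeight d m N) τ x j ^ linkExp d m N j =
      ((Real.exp ((d * m * N : ℕ) * τ) : ℝ) : ℂ) * x j ^ linkExp d m N j := by
    intro j
    rw [dilate, mul_pow, ← Complex.ofReal_pow, ← Real.exp_nat_mul, ← mul_assoc, ← Nat.cast_mul,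
      mul_comm (linkExp d m N j), linkWeight_mul_linkExp]
  simp only [this]
  rw [← Finset.mul_sum, hx, mul_zero]

lemma ConeChart.contDiffAt_toSphere {a w : Fin 3 → ℕ} {T : ℂ × ℂ → Fin 3 → ℂ}
    {S : (Fin 3 → ℂ) → ℂ × ℂ} {wt : ℕ × ℕ} {Ω : Set (ℂ × ℂ)} (h : ConeChart a w T S wt Ω)
    (hw : ∀ j, 0 < w j) {g : ℂ × ℂ → ℂ × ℂ} {x : ℂ × ℂ} (hg : ContDiffAt ℝ ∞ g x) (hx : g x ∈ Ω) :
    ContDiffAt ℝ ∞ (fun x => toSphere w (T (g x))) x := by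
  have h1 : ContDiffAt ℝ ∞ (fun x => T (g x)) x :=
    ((h.contDiffAt _ hx).restrict_scalars ℝ).comp x hg
  exact (_root_.contDiffAt_toSphere hw (h.ne_zero _ hx)).comp x h1

/-- Points of a chart with the same image in the sphere and the same first absolute value agree. -/
lemma ConeChart.eq_of_toSphere_eq {a w : Fin 3 → ℕ} {T : ℂ × ℂ → Fin 3 → ℂ}
    {S : (Fin 3 → ℂ) → ℂ × ℂ} {wt : ℕ × ℕ} {Ω : Set (ℂ × ℂ)} (h : ConeChart a w T S wt Ω)
    (hΩ : ∀ P ∈ Ω, ∀ τ : ℝ, (((Real.exp (wt.1 * τ) : ℝ) : ℂ) * P.1,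
      ((Real.exp (wt.2 * τ) : ℝ) : ℂ) * P.2) ∈ Ω) {P P' : ℂ × ℂ} (hP : P ∈ Ω) (hP' : P' ∈ Ω)
    (he : toSphere w (T P) = toSphere w (T P'))
    (hn : (0 < wt.1 ∧ ‖P.1‖ = 1 ∧ ‖P'.1‖ = 1) ∨ (0 < wt.2 ∧ ‖P.2‖ = 1 ∧ ‖P'.2‖ = 1)) :
    P = P' := by
  obtain ⟨τ, hτ⟩ := exists_dilate_eq_of_toSphere_eq he
  rw [← h.dilate_eq P' hP' τ] at hτ
  have h1 := congrArg S hτ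
  rw [h.left_inv _ hP, h.left_inv _ (hΩ P' hP' τ)] at h1
  have hexp : ∀ (n : ℕ), 0 < n → ∀ x y : ℂ, x = ((Real.exp (n * τ) : ℝ) : ℂ) * y → ‖x‖ = 1 →
      ‖y‖ = 1 → τ = 0 := by
    intro n hn x y hxy hx hy
    have h2 := congrArg norm hxy
    rw [norm_mul, hx, hy, mul_one, Complex.norm_real, Real.norm_of_nonneg (Real.exp_pos _).le,
      eq_comm, Real.exp_eq_one_iff, mul_eq_zero] at h2
    have h3 : (n : ℝ) ≠ 0 := by exact_mod_cast hn.ne'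
    exact h2.resolve_left h3
  have hτ0 : τ = 0 := by
    rcases hn with ⟨h2, h3, h4⟩ | ⟨h2, h3, h4⟩
    · exact hexp _ h2 _ _ (congrArg Prod.fst h1) h3 h4
    · exact hexp _ h2 _ _ (congrArg Prod.snd h1) h3 h4
  rw [h1, hτ0]
  simp

lemma toSphere_mem_link {d m N : ℕ} (hw : ∀ j, 0 < linkWeight d m N j) {x : Fin 3 → ℂ}
    (hx : ∑ j, x j ^ linkExp d m N j = 0) (h0 : x ≠ 0) :
    toSphere (linkWeight d m N) x ∈ brieskornLink (linkExp d m N) :=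
  ⟨dilate_cone _ hx, sum_norm_sq_toSphere hw h0⟩

/-! ### Functions on the cone that descend to the link -/

section Ratio

variable {d m N : ℕ} {x x' : Fin 3 → ℂ}
  (h : toSphere (linkWeight d m N) x = toSphere (linkWeight d m N) x')

include h

lemma toSphere_eq_zero_iff (j : Fin 3) : x j = 0 ↔ x' j = 0 := by
  obtain ⟨τ, rfl⟩ := exists_dilate_eq_of_toSphere_eq h
  simp [dilate]

/-- `x₀ / x₁ ^ m` is a function on the link. -/
lemma toSphere_ratio : x 0 / x 1 ^ m = x' 0 / x' 1 ^ m := by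
  obtain ⟨τ, rfl⟩ := exists_dilate_eq_of_toSphere_eq h
  rw [dilate_link]
  have ht : ((Real.exp τ : ℝ) : ℂ) ≠ 0 := by exact_mod_cast (Real.exp_pos τ).ne'
  simp only [Matrix.cons_val_zero, Matrix.cons_val_one]
  rw [mul_pow, ← pow_mul, mul_comm N m, mul_div_mul_left _ _ (pow_ne_zero _ ht)]

end Ratio

namespace StarData

variable (S : StarData)

/-- The exponents of the link. -/
abbrev exps : Fin 3 → ℕ := linkExp S.d S.m S.N

/-- The weights of the dilations. -/
abbrev wts : Fin 3 → ℕ := linkWeight S.d S.m S.N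

lemma exps_pos (j : Fin 3) : 0 < S.exps j := linkExp_pos S.d_pos S.m_pos S.N_pos j

lemma wts_pos (j : Fin 3) : 0 < S.wts j := linkWeight_pos S.d_pos S.m_pos S.N_pos j

/-- The index set of the toric vertices. -/
abbrev Arm : Type := Unit ⊕ (Fin S.d × Fin (S.last + 1))

/-- The chart of the cone that belongs to a toric vertex. -/
def chart : S.Arm → ℂ × ℂ → Fin 3 → ℂ
  | Sum.inl _ => multChart S.d S.m S.N
  | Sum.inr (j, _) => rootChart S.d S.m S.N (rootPt S.d j) (-rootPt S.d j)

/-- The inverse of the chart. -/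
def chartInv : S.Arm → (Fin 3 → ℂ) → ℂ × ℂ
  | Sum.inl _ => multCoord S.d S.m
  | Sum.inr (j, _) => rootCoord S.d S.m S.N (-rootPt S.d j)

/-- The weights of the dilations in the chart. -/
def chartWt : S.Arm → ℕ × ℕ
  | Sum.inl _ => (S.m, S.N)
  | Sum.inr _ => (S.N, S.d * S.m)

/-- The base coordinate in the chart. -/
def chartVal : S.Arm → ℂ × ℂ → ℂ
  | Sum.inl _ => fun P => P.2 ^ S.m / P.1 ^ S.N
  | Sum.inr (j, _) => rootBase S.d S.m S.N (-rootPt S.d j)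

/-- The multiplicity of the exceptional orbit. -/
def chartMult : S.Arm → ℕ
  | Sum.inl _ => S.m
  | Sum.inr _ => S.N

/-- The domain of the chart. -/
def chartDom (u : S.Arm) : Set (ℂ × ℂ) := {P | P.1 ≠ 0 ∧ ‖S.chartVal u P‖ < 1}

lemma norm_neg_rootPt {d : ℕ} (j : Fin d) : ‖-rootPt d j‖ = 1 := by rw [norm_neg, norm_rootPt]

lemma coneChart (u : S.Arm) :
    ConeChart S.exps S.wts (S.chart u) (S.chartInv u) (S.chartWt u) (S.chartDom u) := by
  rcases u with _ | ⟨j, i⟩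
  · exact coneChart_multChart S.succ_N S.d_pos
  · exact coneChart_rootChart S.succ_N S.d_pos (rootPt_pow j) (norm_neg_rootPt j) S.two_le_mul

lemma coneChart_centre : ConeChart S.exps S.wts (baseChart S.d S.m S.N) (baseCoord S.m) (0, 1)
    {P | 1 + P.1 ^ S.d ≠ 0 ∧ P.2 ≠ 0} := coneChart_baseChart S.succ_N

lemma chartWt_pos (u : S.Arm) : 0 < (S.chartWt u).1 := by
  cases u
  exacts [S.m_pos, S.N_pos]

lemma chartMult_pos (u : S.Arm) : 0 < S.chartMult u := by
  cases u
  exacts [S.m_pos, S.N_pos]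

lemma norm_chartVal (u : S.Arm) (P : ℂ × ℂ) (hP : ‖P.1‖ = 1) :
    ‖S.chartVal u P‖ = ‖P.2‖ ^ S.chartMult u := by
  rcases u with _ | ⟨j, i⟩
  · simp [chartVal, chartMult, hP]
  · simp [chartVal, chartMult, rootBase, hP, norm_rootPt]

lemma mem_chartDom (u : S.Arm) {P : ℂ × ℂ} (hP : ‖P.1‖ = 1) (hP2 : ‖P.2‖ < 1) :
    P ∈ S.chartDom u := by
  refine ⟨?_, ?_⟩
  · rw [← norm_ne_zero_iff, hP]; exact one_ne_zero
  · rw [S.norm_chartVal u P hP]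
    exact pow_lt_one₀ (norm_nonneg _) hP2 (S.chartMult_pos u).ne'

lemma chartVal_scale (u : S.Arm) (P : ℂ × ℂ) (τ : ℝ) :
    S.chartVal u (((Real.exp ((S.chartWt u).1 * τ) : ℝ) : ℂ) * P.1,
      ((Real.exp ((S.chartWt u).2 * τ) : ℝ) : ℂ) * P.2) = S.chartVal u P := by
  have ht : ((Real.exp τ : ℝ) : ℂ) ≠ 0 := by exact_mod_cast (Real.exp_pos τ).ne'
  rcases u with _ | ⟨j, i⟩
  · simp only [chartVal, chartWt]
    rw [Real.exp_nat_mul, Real.exp_nat_mul, Complex.ofReal_pow, Complex.ofReal_pow, mul_pow, mul_pow,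
      ← pow_mul, ← pow_mul, mul_comm S.m S.N, mul_div_mul_left _ _ (pow_ne_zero _ ht)]
  · simp only [chartVal, chartWt, rootBase]
    rw [Real.exp_nat_mul, Real.exp_nat_mul, Complex.ofReal_pow, Complex.ofReal_pow, mul_pow, mul_pow,
      ← pow_mul, ← pow_mul, mul_comm S.N (S.d * S.m), mul_left_comm,
      mul_div_mul_left _ _ (pow_ne_zero _ ht)]

lemma scale_mem_chartDom (u : S.Arm) (P : ℂ × ℂ) (hP : P ∈ S.chartDom u) (τ : ℝ) :
    (((Real.exp ((S.chartWt u).1 * τ) : ℝ) : ℂ) * P.1,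
      ((Real.exp ((S.chartWt u).2 * τ) : ℝ) : ℂ) * P.2) ∈ S.chartDom u := by
  refine ⟨mul_ne_zero (by exact_mod_cast (Real.exp_pos _).ne') hP.1, ?_⟩
  rw [S.chartVal_scale]
  exact hP.2

/-- The toric coordinate of a point over a chart. -/
def toricPt (u : S.Arm) (P : ℂ × ℂ) : Fin 3 → ℂ := toSphere S.wts (S.chart u P)

/-- The point with base coordinate `y` and fibre coordinate `lam`. -/
def regularPt (P : ℂ × ℂ) : Fin 3 → ℂ := toSphere S.wts (baseChart S.d S.m S.N P)

/-- The map of the charts to the link. -/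
def F : S.Vertex ⊕ S.Vertex → ℂ → ℂ → Fin 3 → ℂ
  | Sum.inl (Sum.inl _), z, s => S.regularPt (S.C.base S.m S.N z, s * dir (S.C.phase z))
  | Sum.inl (Sum.inr u), z, s => S.toricPt u ((S.toric u).inl z s)
  | Sum.inr (Sum.inl _), z, s => S.regularPt (z / 2, s * dir (1 + (z / 2) ^ S.d))
  | Sum.inr (Sum.inr u), z, s => S.toricPt u ((S.toric u).inr z s)

lemma size_le (u : S.Arm) : (S.toric u).size ≤ S.C.rstar := by
  rcases u with _ | ⟨j, i⟩
  · exact le_rfl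
  · exact mul_le_of_le_one_right S.C.rstar_pos.le
      (pow_le_one₀ armRatio_pos.le (by linarith [armRatio_lt_half]))

lemma inl_mem_chartDom (u : S.Arm) {z s : ℂ} (hz : (S.toric u).IsRegular z) (hs : ‖s‖ = 1) :
    (S.toric u).inl z s ∈ S.chartDom u :=
  S.mem_chartDom u (ToricVertex.norm_inl_fst hz hs)
    ((ToricVertex.norm_inl_snd_lt hz hs).trans_le ((S.size_le u).trans S.C.rstar_lt_one.le))

lemma inr_mem_chartDom (u : S.Arm) {z s : ℂ} (hz : ‖z‖ < 1) (hs : ‖s‖ = 1) :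
    (S.toric u).inr z s ∈ S.chartDom u :=
  S.mem_chartDom u ((S.toric u).norm_inr_fst hz hs)
    (((S.toric u).norm_inr_snd_lt hz hs).trans_le ((S.size_le u).trans S.C.rstar_lt_one.le))

variable {S}

lemma norm_half_lt {z : ℂ} (hz : ‖z‖ < 1) : ‖z / 2‖ < 1 := by
  rw [norm_div, Complex.norm_ofNat]; linarith

lemma base_mem {z s : ℂ} (hz : ∀ α, z ≠ centrePt S.d α) (hs : ‖s‖ = 1) :
    (S.C.base S.m S.N z, s * dir (S.C.phase z)) ∈ {P : ℂ × ℂ | 1 + P.1 ^ S.d ≠ 0 ∧ P.2 ≠ 0} := by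
  refine ⟨S.C.one_add_base_pow_ne_zero S.d_pos S.m_pos S.N_pos hz, mul_ne_zero ?_
    (dir_ne_zero (S.C.phase_ne_zero S.d_pos fun j => hz (some j)))⟩
  rw [← norm_ne_zero_iff, hs]; exact one_ne_zero

lemma infinity_mem {z s : ℂ} (hz : ‖z‖ < 1) (hs : ‖s‖ = 1) :
    (z / 2, s * dir (1 + (z / 2) ^ S.d)) ∈ {P : ℂ × ℂ | 1 + P.1 ^ S.d ≠ 0 ∧ P.2 ≠ 0} := by
  have h1 := one_add_pow_ne_zero_of_norm_lt S.d_pos (norm_half_lt hz)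
  refine ⟨h1, mul_ne_zero ?_ (dir_ne_zero h1)⟩
  rw [← norm_ne_zero_iff, hs]; exact one_ne_zero

lemma contDiff_infinity : ContDiff ℝ ∞ fun z : ℂ => 1 + (z / 2) ^ S.d :=
  contDiff_const.add ((contDiff_id.div_const _).pow _)

lemma contDiffAt_fibre {Y W : ℂ → ℂ} {z s : ℂ} (hY : ContDiffAt ℝ ∞ Y z) (hW : ContDiffAt ℝ ∞ W z)
    (hW0 : W z ≠ 0) : ContDiffAt ℝ ∞ (fun x : ℂ × ℂ => (Y x.1, x.2 * dir (W x.1))) (z, s) := by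
  have h1 : ContDiffAt ℝ ∞ (fun x : ℂ × ℂ => Y x.1) (z, s) :=
    ContDiffAt.comp (z, s) (f := Prod.fst) hY contDiffAt_fst
  have h2 : ContDiffAt ℝ ∞ (fun x : ℂ × ℂ => W x.1) (z, s) :=
    ContDiffAt.comp (z, s) (f := Prod.fst) hW contDiffAt_fst
  have h3 : ContDiffAt ℝ ∞ (fun x : ℂ × ℂ => dir (W x.1)) (z, s) :=
    ContDiffAt.comp (z, s) (f := fun x : ℂ × ℂ => W x.1) (contDiffAt_dir hW0) h2
  exact h1.prodMk (contDiffAt_snd.mul h3)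

lemma contDiffAt_F (c : S.Vertex ⊕ S.Vertex) (z : ℂ) (hz : z ∈ S.discs.base c) (s : ℂ)
    (hs : ‖s‖ = 1) : ContDiffAt ℝ ∞ (fun x : ℂ × ℂ => S.F c x.1 x.2) (z, s) := by
  rcases c with (⟨⟩ | u) | (⟨⟩ | u)
  · rw [S.base_centre] at hz
    exact S.coneChart_centre.contDiffAt_toSphere S.wts_pos
      (contDiffAt_fibre (S.C.contDiffAt_base S.d_pos S.m_pos S.N_pos hz)
        S.C.contDiff_phase.contDiffAt (S.C.phase_ne_zero S.d_pos fun j => hz (some j)))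
      (base_mem hz hs)
  · rw [S.base_toric] at hz
    exact (S.coneChart u).contDiffAt_toSphere S.wts_pos (ToricVertex.contDiffAt_inl hz)
      (S.inl_mem_chartDom u hz hs)
  · rw [S.base_infinity] at hz
    exact S.coneChart_centre.contDiffAt_toSphere S.wts_pos
      (contDiffAt_fibre (contDiffAt_id.div_const _) contDiff_infinity.contDiffAt
        (one_add_pow_ne_zero_of_norm_lt S.d_pos (norm_half_lt hz))) (infinity_mem hz hs)
  · rw [S.base_infinity] at hz
    exact (S.coneChart u).contDiffAt_toSphere S.wts_pos ((S.toric u).contDiffAt_inr hz)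
      (S.inr_mem_chartDom u hz hs)

lemma F_mem_link (c : S.Vertex ⊕ S.Vertex) (z : ℂ) (hz : z ∈ S.discs.base c) (s : ℂ)
    (hs : ‖s‖ = 1) : S.F c z s ∈ brieskornLink S.exps := by
  rcases c with (⟨⟩ | u) | (⟨⟩ | u)
  · rw [S.base_centre] at hz
    exact toSphere_mem_link S.wts_pos (S.coneChart_centre.cone _ (base_mem hz hs))
      (S.coneChart_centre.ne_zero _ (base_mem hz hs))
  · rw [S.base_toric] at hz
    have := S.inl_mem_chartDom u hz hs
    exact toSphere_mem_link S.wts_pos ((S.coneChart u).cone _ this) ((S.coneChart u).ne_zero _ this)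
  · rw [S.base_infinity] at hz
    exact toSphere_mem_link S.wts_pos (S.coneChart_centre.cone _ (infinity_mem hz hs))
      (S.coneChart_centre.ne_zero _ (infinity_mem hz hs))
  · rw [S.base_infinity] at hz
    have := S.inr_mem_chartDom u hz hs
    exact toSphere_mem_link S.wts_pos ((S.coneChart u).cone _ this) ((S.coneChart u).ne_zero _ this)

lemma isPositiveFrame_F (c : S.Vertex ⊕ S.Vertex) (z : ℂ) (hz : z ∈ S.discs.base c) (θ : ℝ) :
    IsPositiveFrame S.exps (S.F c z (Complex.exp (θ * Complex.I)))
      (fderiv ℝ (fun x : ℂ × ℝ => S.F c x.1 (Complex.exp (x.2 * Complex.I))) (z, θ) (1, 0))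
      (fderiv ℝ (fun x : ℂ × ℝ => S.F c x.1 (Complex.exp (x.2 * Complex.I))) (z, θ)
        (Complex.I, 0))
      (fderiv ℝ (fun x : ℂ × ℝ => S.F c x.1 (Complex.exp (x.2 * Complex.I))) (z, θ) (0, 1)) := by
  have hs : ‖Complex.exp (θ * Complex.I)‖ = 1 := Complex.norm_exp_ofReal_mul_I θ
  have hM := linkWeight_mul_linkExp S.d S.m S.N
  rcases c with (⟨⟩ | u) | (⟨⟩ | u)
  · rw [S.base_centre] at hz
    obtain ⟨g', hg, hdet⟩ := fibre_det4_pos (S.C.posJacAt_base S.d_pos S.m_pos S.N_pos hz)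
      (S.C.contDiff_phase.contDiffAt.differentiableAt (by simp))
      (S.C.phase_ne_zero S.d_pos fun j => hz (some j)) θ
    exact S.coneChart_centre.isPositiveFrame S.exps_pos S.wts_pos hM
      (g := fun x : ℂ × ℝ => (S.C.base S.m S.N x.1, Complex.exp (x.2 * Complex.I) * dir (S.C.phase x.1)))
      (o := (z, θ)) hg (base_mem hz hs) hdet
  · rw [S.base_toric] at hz
    obtain ⟨g', hg, hdet⟩ := ToricVertex.det4_inl_pos hz θ (S.chartWt_pos u)
    exact (S.coneChart u).isPositiveFrame S.exps_pos S.wts_pos hM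
      (g := fun x : ℂ × ℝ => (S.toric u).inl x.1 (Complex.exp (x.2 * Complex.I)))
      (o := (z, θ)) hg (S.inl_mem_chartDom u hz hs) hdet
  · rw [S.base_infinity] at hz
    obtain ⟨g', hg, hdet⟩ := fibre_det4_pos (Y := fun z => z / 2)
      (((hasDerivAt_id z).div_const 2).posJacAt (by norm_num))
      ((contDiff_infinity (S := S)).contDiffAt.differentiableAt (by simp))
      (one_add_pow_ne_zero_of_norm_lt S.d_pos (norm_half_lt hz)) θ
    exact S.coneChart_centre.isPositiveFrame S.exps_pos S.wts_pos hM
      (g := fun x : ℂ × ℝ => (x.1 / 2, Complex.exp (x.2 * Complex.I) * dir (1 + (x.1 / 2) ^ S.d)))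
      (o := (z, θ)) hg (infinity_mem hz hs) hdet
  · rw [S.base_infinity] at hz
    obtain ⟨g', hg, hdet⟩ := (S.toric u).det4_inr_pos hz θ (S.chartWt_pos u)
    exact (S.coneChart u).isPositiveFrame S.exps_pos S.wts_pos hM
      (g := fun x : ℂ × ℝ => (S.toric u).inr x.1 (Complex.exp (x.2 * Complex.I)))
      (o := (z, θ)) hg (S.inr_mem_chartDom u hz hs) hdet

/-- For the centre, z^d + 2^(-d) = z^d (1 + (z'/2)^d) and y = 1 / (2z) = z'/2, so the direction of
z^d is exactly the twist by the weight -d. -/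
lemma F_infinity (v : S.Vertex) (z z' s : ℂ) (hz : 1 < ‖z‖) (hzz : z * z' = 1) :
    S.F (Sum.inl v) z s = S.F (Sum.inr v) z' (dir z ^ (-S.graph.weight v) * s) := by
  rcases v with ⟨⟩ | u
  · rw [weight_centre, neg_neg, zpow_natCast]
    have hz0 : z ≠ 0 := left_ne_zero_of_mul_eq_one hzz
    have h1 : S.C.phase z = z ^ S.d * (1 + (z' / 2) ^ S.d) := by
      rw [S.C.phase_of_one_le hz.le, mul_add, mul_one, ← mul_pow, mul_div_assoc', hzz, one_div,
        inv_pow]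
    have h2 : S.C.base S.m S.N z = z' / 2 := by
      rw [S.C.base_of_one_le S.d_pos S.m_pos S.N_pos hz.le]
      refine (eq_inv_of_mul_eq_one_left ?_).symm
      linear_combination hzz
    simp only [F]
    rw [h1, h2, dir_mul, dir_pow]
    congr 2
    ring
  · rw [weight_toric, neg_neg, zpow_natCast]
    simp only [F]
    rw [ToricVertex.inl_eq_inr hz hzz]

end StarData

/-! ## Compatibility with the gluing along the edges -/

namespace StarData

variable {S : StarData}

/-- The toric vertex at a puncture of the base of the central vertex. -/
def endArm (S : StarData) : Option (Fin S.d) → S.Arm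
  | none => Sum.inl ()
  | some j => Sum.inr (j, 0)

lemma endVertex_eq (α : Option (Fin S.d)) : endVertex (l := S.last) α = Sum.inr (S.endArm α) := by
  cases α <;> rfl

/-- The puncture to which a toric vertex belongs. -/
def endOf : S.Arm → Option (Fin S.d)
  | Sum.inl _ => none
  | Sum.inr (j, _) => some j

/-- The parameter at the puncture. -/
def endParam : S.Arm → ℂ × ℂ → ℂ
  | Sum.inl _, P => P.2 ^ S.m / P.1 ^ S.N
  | Sum.inr _, P => P.2 ^ S.N / P.1 ^ (S.d * S.m)

lemma norm_endParam (u : S.Arm) {P : ℂ × ℂ} (hP : ‖P.1‖ = 1) :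
    ‖endParam u P‖ = ‖P.2‖ ^ endMult S.m S.N (endOf u) := by
  rcases u with _ | ⟨j, i⟩ <;> simp [endParam, endOf, endMult, hP]

lemma neg_rootPt_ne_zero {d : ℕ} (j : Fin d) : -rootPt d j ≠ 0 := neg_ne_zero.2 (rootPt_ne_zero j)

lemma chart_cone {u : S.Arm} {P : ℂ × ℂ} (hP : P ∈ S.chartDom u) :
    S.chart u P 0 ^ S.d + S.chart u P 1 ^ (S.d * S.m) + S.chart u P 2 ^ S.N = 0 :=
  cone_iff.1 ((S.coneChart u).cone P hP)

lemma chart_arm_one_ne_zero (j : Fin S.d) (i) {P : ℂ × ℂ} (hP : P.1 ≠ 0) :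
    S.chart (Sum.inr (j, i)) P 1 ≠ 0 :=
  mul_ne_zero (pow_ne_zero _ (neg_rootPt_ne_zero j)) hP

lemma chart_b_zero_ne_zero {P : ℂ × ℂ} (hP : P ∈ S.chartDom (Sum.inl ())) :
    S.chart (Sum.inl ()) P 0 ≠ 0 :=
  div_ne_zero (pow_ne_zero _ hP.1)
    (pow_ne_zero _ (neg_ne_zero.2 (one_add_pow_ne_zero_of_norm_lt S.d_pos hP.2)))

lemma chart_ratio (u : S.Arm) {P : ℂ × ℂ} (hP : P ∈ S.chartDom u) (h1 : S.chart u P 1 ≠ 0) :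
    S.chart u P 0 / S.chart u P 1 ^ S.m = endVal S.d (endOf u) (endParam u P) := by
  rcases u with _ | ⟨j, i⟩
  · have := (multChart_functions S.succ_N hP.1 (one_add_pow_ne_zero_of_norm_lt S.d_pos hP.2)).2.1
    simp only [endOf, endVal, endParam]
    rw [← this, inv_div]
    rfl
  · simp only [endOf, endVal, endParam]
    have h2 : (-rootPt S.d j) ^ (S.N - 10) * P.1 ≠ 0 := h1
    have h3 : rootBase S.d S.m S.N (-rootPt S.d j) P =
        -rootPt S.d j * (P.2 ^ S.N / P.1 ^ (S.d * S.m)) := by rw [rootBase, mul_div_assoc]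
    rw [← h3]
    exact mul_div_cancel_right₀ _ (pow_ne_zero _ h2)

/-- A point of the regular part, in terms of the base and fibre coordinates. -/
lemma regularPt_eq {X : Fin 3 → ℂ} (hX : X 0 ^ S.d + X 1 ^ (S.d * S.m) + X 2 ^ S.N = 0)
    (h1 : X 1 ≠ 0) (h2 : X 2 ≠ 0) {y lam : ℂ} {c : ℝ} (hc : 0 < c) (hy : X 0 / X 1 ^ S.m = y)
    (hl : X 2 ^ 10 / X 1 = c * lam) : S.regularPt (y, lam) = toSphere S.wts X := by
  have h3 := (baseChart_baseCoord S.succ_N hX h1 h2).2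
  have h4 : baseCoord S.m X = (y, ((Real.exp (Real.log c) : ℝ) : ℂ) * lam) := by
    rw [baseCoord, hy, hl, Real.exp_log hc]
  rw [h4] at h3
  have h5 := baseChart_dilate (d := S.d) (m := S.m) (N := S.N) (y, lam) (Real.log c)
  simp only at h5
  rw [h3] at h5
  have h6 : baseChart S.d S.m S.N (y, lam) ≠ 0 := by
    intro h0
    rw [h0] at h5
    apply h1
    rw [h5]
    simp [dilate]
  rw [regularPt, h5, toSphere_dilate S.wts_pos h6]

lemma toric_endArm_size (α : Option (Fin S.d)) : (S.toric (S.endArm α)).size = S.C.rstar := by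
  cases α
  · rfl
  · simp [toric, endArm, armVertex]

lemma exists_exponents : ∃ e, S.d * S.m = e + 2 ∧ S.N = 10 * e + 19 := by
  have := S.succ_N
  have := S.two_le_mul
  exact ⟨S.d * S.m - 2, by omega, by omega⟩

lemma armP_zero : armP S.d S.m S.N 0 = S.N := by
  have := S.two_le_mul
  rw [armP, if_pos (by omega)]; omega

lemma armP_one : armP S.d S.m S.N 1 = S.N - 10 := by
  have := S.two_le_mul
  rw [armP, if_pos (by omega)]

lemma armQ_zero : armQ S.d S.m 0 = S.d * S.m := by
  have := S.two_le_mul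
  rw [armQ, if_pos (by omega)]; omega

lemma armQ_one : armQ S.d S.m 1 = S.d * S.m - 1 := by
  have := S.two_le_mul
  rw [armQ, if_pos (by omega)]

lemma ne_zero_of_norm_eq_one {s : ℂ} (hs : ‖s‖ = 1) : s ≠ 0 := by
  rw [← norm_ne_zero_iff, hs]; exact one_ne_zero

/-- With u = s^m s' and v = ρ s^N s'^(10d), the relation 10dm = N + 1 cancels all but one factor:
the base parameter 1 / y = v^m / u^N has direction s', and u^(10d) / v, which is λ, has direction s.
This is the exchange of base and fibre along an edge. -/
lemma edge_b_functions {ρ s s' : ℂ} (hρ : ρ ≠ 0) (hs : s ≠ 0) (hs' : s' ≠ 0) :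
    (ρ * (s ^ S.N * s' ^ (10 * S.d))) ^ S.m / (s ^ S.m * s') ^ S.N = ρ ^ S.m * s' ∧
      (s ^ S.m * s') ^ (10 * S.d) / (ρ * (s ^ S.N * s' ^ (10 * S.d))) = ρ⁻¹ * s := by
  have h1 : 10 * S.d * S.m = S.N + 1 := by rw [S.succ_N]; ring
  have h2 : S.m * (10 * S.d) = S.N + 1 := by rw [S.succ_N]; ring
  constructor
  · rw [mul_pow, mul_pow, mul_pow, ← pow_mul, ← pow_mul, ← pow_mul, h1, pow_succ, mul_comm S.m S.N]
    field_simp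
  · rw [mul_pow, ← pow_mul, h2, pow_succ]
    field_simp

/-- The same exchange at an orbit x₂ = 0. The exponents left over are 10dm - N = 1 for s in λ, 1 for
s' in the base parameter, and 1 for D s' in λ. -/
lemma edge_arm_functions {ρ s s' D : ℂ} (hs : s ≠ 0) (hs' : s' ≠ 0) (hD : D ≠ 0) :
    (ρ * (s ^ (S.d * S.m) * s' ^ (S.d * S.m - 1))) ^ S.N /
        (s ^ S.N * s' ^ (S.N - 10)) ^ (S.d * S.m) = ρ ^ S.N * s' ∧
      (D ^ (S.d * S.m - 1) * (ρ * (s ^ (S.d * S.m) * s' ^ (S.d * S.m - 1)))) ^ 10 /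
        (D ^ (S.N - 10) * (s ^ S.N * s' ^ (S.N - 10))) = ρ ^ 10 * (s * (D * s')) := by
  obtain ⟨e, h1, h2⟩ := S.exists_exponents
  have h3 : e + 2 - 1 = e + 1 := by omega
  have h4 : 10 * e + 19 - 10 = 10 * e + 9 := by omega
  rw [h1, h2, h3, h4]
  constructor
  · rw [div_eq_iff (by positivity)]
    ring
  · rw [div_eq_iff (by positivity)]
    ring

/-- A point of the regular part of the link is determined by y and the direction of λ, so only these
two functions of the toric point have to be compared with the base coordinate and the phase of the
centre. -/
lemma F_edge_centre (α : Option (Fin S.d)) {t : ℝ} (ht : 0 < t) (ht1 : t < 1) {s s' : ℂ}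
    (hs : ‖s‖ = 1) (hs' : ‖s'‖ = 1) :
    S.F (Sum.inl (Sum.inl ())) (centrePt S.d α + ((t * S.C.rad : ℝ) : ℂ) * s') s =
      S.toricPt (S.endArm α)
        ((S.toric (S.endArm α)).inl ((((1 - t) * armRadius : ℝ) : ℂ) * s) s') := by
  have hs0 := ne_zero_of_norm_eq_one hs
  have hs0' := ne_zero_of_norm_eq_one hs'
  have hr := S.C.rad_pos
  have htr : 0 < t * S.C.rad := mul_pos ht hr
  set ρ : ℝ := S.C.rstar * ((1 + t) / 2) with hρ
  have hρ0 : 0 < ρ := mul_pos S.C.rstar_pos (by linarith)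
  have hρc : (ρ : ℂ) ≠ 0 := by exact_mod_cast hρ0.ne'
  have hρ1 : ρ < 1 := by have := S.C.rstar_lt_one; have := S.C.rstar_pos; nlinarith
  -- The reversal of t along the edge makes the two radial coordinates agree.
  have hsize : S.C.rstar * (1 - (1 - t) / 2) = ρ := by rw [hρ]; ring
  have hlev : ∀ e, S.C.level e t = ρ ^ e := fun e => rfl
  have hζd : dir (((t * S.C.rad : ℝ) : ℂ) * s') = s' := by
    rw [dir_ofReal_mul htr, dir_of_norm_eq_one hs']
  have hζn : ‖((t * S.C.rad : ℝ) : ℂ) * s'‖ = t * S.C.rad := by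
    rw [norm_mul, hs', Complex.norm_real, Real.norm_of_nonneg htr.le, mul_one]
  rw [ToricVertex.inl_near_zero (by linarith) (by linarith) hs, toric_endArm_size, hsize]
  simp only [F]
  rw [S.C.base_near_centre S.d_pos S.m_pos S.N_pos α ht ht1.le hs', hlev]
  set P : ℂ × ℂ := (s ^ (S.toric (S.endArm α)).p * s' ^ (S.toric (S.endArm α)).p',
    (ρ : ℂ) * (s ^ (S.toric (S.endArm α)).q * s' ^ (S.toric (S.endArm α)).q')) with hPdef
  have hP1 : ‖P.1‖ = 1 := by simp [hPdef, hs, hs']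
  have hP2n : ‖P.2‖ = ρ := by simp [hPdef, hs, hs', hρ0.le]
  have hP2 : P.2 ≠ 0 := by rw [← norm_pos_iff, hP2n]; exact hρ0
  have hP := S.mem_chartDom (S.endArm α) hP1 (by rw [hP2n]; exact hρ1)
  cases α with
  | none =>
    have hZ := one_add_pow_ne_zero_of_norm_lt S.d_pos hP.2
    have hX1 : S.chart (S.endArm none) P 1 ≠ 0 :=
      div_ne_zero hP2 (pow_ne_zero _ (neg_ne_zero.2 hZ))
    have hX2 : S.chart (S.endArm none) P 2 ≠ 0 :=
      div_ne_zero (pow_ne_zero _ hP.1) (neg_ne_zero.2 hZ)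
    have hPe : P = (s ^ S.m * s' ^ 1, (ρ : ℂ) * (s ^ S.N * s' ^ (10 * S.d))) := rfl
    rw [pow_one] at hPe
    obtain ⟨f1, f2⟩ := S.edge_b_functions hρc hs0 hs0'
    refine regularPt_eq (c := ρ⁻¹) (chart_cone hP) hX1 hX2 (inv_pos.2 hρ0) ?_ ?_
    · rw [chart_ratio _ hP hX1]
      simp only [endArm, endOf, endParam, endMult]
      rw [hPe, f1]
      push_cast
      rfl
    · have h3 := (multChart_functions S.succ_N hP.1 hZ).2.2
      rw [hPe] at h3
      simp only at h3
      rw [f2, ← hPe] at h3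
      have hW : dir (S.C.phase (centrePt S.d none + ((t * S.C.rad : ℝ) : ℂ) * s')) = 1 := by
        refine S.C.dir_phase_near_zero ?_
        rw [centrePt, zero_add, hζn]
        have := S.C.rad_le
        nlinarith
      rw [hW, mul_one]
      push_cast
      exact h3
  | some j =>
    have hD := neg_rootPt_ne_zero j
    have hX1 : S.chart (S.endArm (some j)) P 1 ≠ 0 := chart_arm_one_ne_zero j _ hP.1
    have hX2 : S.chart (S.endArm (some j)) P 2 ≠ 0 := mul_ne_zero (pow_ne_zero _ hD) hP2
    have hPe : P = (s ^ S.N * s' ^ (S.N - 10),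
        (ρ : ℂ) * (s ^ (S.d * S.m) * s' ^ (S.d * S.m - 1))) := by
      have h0 : P = (s ^ armP S.d S.m S.N 0 * s' ^ armP S.d S.m S.N 1,
        (ρ : ℂ) * (s ^ armQ S.d S.m 0 * s' ^ armQ S.d S.m 1)) := rfl
      rwa [armP_zero, armP_one, armQ_zero, armQ_one] at h0
    obtain ⟨f1, f2⟩ := S.edge_arm_functions (ρ := (ρ : ℂ)) hs0 hs0' hD
    refine regularPt_eq (c := ρ ^ 10) (chart_cone hP) hX1 hX2 (pow_pos hρ0 _) ?_ ?_
    · rw [chart_ratio _ hP hX1]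
      simp only [endArm, endOf, endParam, endMult]
      rw [hPe, f1]
      push_cast
      rfl
    · have hW := S.C.dir_phase_near_centre S.d_pos j (ζ := ((t * S.C.rad : ℝ) : ℂ) * s')
        (by rw [hζn]; nlinarith)
      rw [hW, hζd]
      push_cast
      rw [← f2, hPe]
      rfl

/-- All vertices of an arm use the same chart of the cone, so the toric coordinates themselves
agree. This is the recursion for the exponents together with the ratio of consecutive sizes. -/
lemma F_edge_arm (j : Fin S.d) {i i' : Fin (S.last + 1)} (hi : (i : ℕ) + 1 = i') {t : ℝ}
    (ht : 0 < t) (ht1 : t < 1) {s s' : ℂ} (hs : ‖s‖ = 1) (hs' : ‖s'‖ = 1) :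
    (S.toric (Sum.inr (j, i))).inl (Complex.I / 2 + ((t * armRadius : ℝ) : ℂ) * s') s =
      (S.toric (Sum.inr (j, i'))).inl ((((1 - t) * armRadius : ℝ) : ℂ) * s) s' := by
  have hi6 : (i : ℕ) < S.d * S.m + 6 := by
    have : (i' : ℕ) < S.last + 1 := i'.2
    have : S.last = S.d * S.m + 6 := rfl
    omega
  have hl : (S.toric (Sum.inr (j, i))).leaf = false :=
    decide_eq_false (by have : S.last = S.d * S.m + 6 := rfl; omega)
  have hP := armP_rec S.succ_N S.two_le_mul hi6.le
  have hQ := armQ_rec S.two_le_mul hi6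
  rw [ToricVertex.inl_near_center hl (P := armP S.d S.m S.N (i + 2)) (Q := armQ S.d S.m (i + 2))
    hP hQ ht ht1.le hs', ToricVertex.inl_near_zero (by linarith) (by linarith) hs]
  simp only [toric, armVertex, ← hi]
  congr 3
  rw [pow_succ]
  ring

lemma F_edge {v w : S.Vertex} (h : starEdge S.d (S.last + 1) v w) {t : ℝ} (ht : 0 < t) (ht1 : t < 1)
    {s s' : ℂ} (hs : ‖s‖ = 1) (hs' : ‖s'‖ = 1) :
    S.F (Sum.inl v) (S.center v w + ((t * S.radius v : ℝ) : ℂ) * s') s =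
      S.F (Sum.inl w) (S.center w v + (((1 - t) * S.radius w : ℝ) : ℂ) * s) s' := by
  rcases starEdge_iff.1 h with ⟨α, rfl, rfl⟩ | ⟨j, i, i', hi, rfl, rfl⟩
  · have h0 : S.center (endVertex α) (Sum.inl ()) = 0 := by cases α <;> rfl
    rw [center_endVertex, h0, zero_add, endVertex_eq]
    exact F_edge_centre α ht ht1 hs hs'
  · have hlt : i < i' := Fin.lt_def.2 (by omega)
    simp only [center, if_pos hlt, if_neg hlt.not_gt, zero_add, F, radius]
    rw [F_edge_arm j hi ht ht1 hs hs']
    rfl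

lemma F_adj {v w : S.Vertex} (h : S.graph.graph.Adj v w) (t : ℝ) (s s' : ℂ) (ht : 0 < t)
    (ht1 : t < 1) (hs : ‖s‖ = 1) (hs' : ‖s'‖ = 1) :
    S.F (Sum.inl v) (S.center v w + ((t * S.radius v : ℝ) : ℂ) * s') s =
      S.F (Sum.inl w) (S.center w v + (((1 - t) * S.radius w : ℝ) : ℂ) * s) s' := by
  rcases starAdj_iff.1 h with h | h
  · exact F_edge h ht ht1 hs hs'
  · have := F_edge h (t := 1 - t) (by linarith) (by linarith) hs' hs
    rw [sub_sub_cancel] at this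
    exact this.symm

end StarData

/-! ## Injectivity -/

namespace StarData

variable {S : StarData}

/-- `x` is a point over a toric vertex with toric coordinates `e`. -/
def Over (u : S.Arm) (e : ℂ × ℂ) (x : S.discs.Boundary) : Prop :=
  (∃ z, ∃ hz : z ∈ S.discs.base (Sum.inl (Sum.inr u)), ∃ s : Circle,
    x = S.discs.chart (Sum.inl (Sum.inr u)) ⟨z, hz⟩ s ∧ e = (S.toric u).inl z s) ∨
  ∃ h0 : (0 : ℂ) ∈ S.discs.base (Sum.inr (Sum.inr u)), ∃ s : Circle,
    x = S.discs.chart (Sum.inr (Sum.inr u)) ⟨0, h0⟩ s ∧ e = (S.toric u).inr 0 s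

/-! ### Points over the arms -/

namespace Over

variable {u u' : S.Arm} {e e' : ℂ × ℂ} {x x' : S.discs.Boundary}

lemma norm_fst (h : Over u e x) : ‖e.1‖ = 1 := by
  rcases h with ⟨z, hz, s, -, rfl⟩ | ⟨h0, s, -, rfl⟩
  · exact ToricVertex.norm_inl_fst (S.base_toric.1 hz) (Circle.norm_coe s)
  · exact (S.toric u).norm_inr_fst (by simp) (Circle.norm_coe s)

lemma norm_snd_lt (h : Over u e x) : ‖e.2‖ < (S.toric u).size := by
  rcases h with ⟨z, hz, s, -, rfl⟩ | ⟨h0, s, -, rfl⟩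
  · exact ToricVertex.norm_inl_snd_lt (S.base_toric.1 hz) (Circle.norm_coe s)
  · exact (S.toric u).norm_inr_snd_lt (by simp) (Circle.norm_coe s)

lemma norm_snd_lt_rstar (h : Over u e x) : ‖e.2‖ < S.C.rstar :=
  h.norm_snd_lt.trans_le (S.size_le u)

lemma mem_chartDom (h : Over u e x) : e ∈ S.chartDom u :=
  S.mem_chartDom u h.norm_fst (h.norm_snd_lt_rstar.trans S.C.rstar_lt_one)

lemma unique (h : Over u e x) (h' : Over u e x') : x = x' := by
  rcases h with ⟨z, hz, s, rfl, he⟩ | ⟨h0, s, rfl, he⟩ <;>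
  rcases h' with ⟨z', hz', s', rfl, he'⟩ | ⟨h0', s', rfl, he'⟩
  · obtain ⟨rfl, h2⟩ := ToricVertex.inl_injective (S.base_toric.1 hz) (S.base_toric.1 hz')
      (Circle.norm_coe s) (Circle.norm_coe s') (he.symm.trans he')
    rw [Circle.coe_injective h2]
  · exact absurd (he.symm.trans he') (ToricVertex.inl_ne_inr_zero (S.base_toric.1 hz)
      (Circle.norm_coe s) (Circle.norm_coe s'))
  · exact absurd (he'.symm.trans he) (ToricVertex.inl_ne_inr_zero (S.base_toric.1 hz')
      (Circle.norm_coe s') (Circle.norm_coe s))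
  · have := ToricVertex.inr_zero_injective (Circle.norm_coe s) (Circle.norm_coe s')
      (he.symm.trans he')
    rw [Circle.coe_injective this]

/-- A point whose radius is below the size of the next vertex lies in the disc of that vertex, so
the edge gluing presents it as a point there with the same toric coordinates. -/
lemma next {j : Fin S.d} {i i' : Fin (S.last + 1)} (hi : (i : ℕ) + 1 = i')
    (h : Over (Sum.inr (j, i)) e x) (hv : ‖e.2‖ < (S.toric (Sum.inr (j, i'))).size) :
    Over (Sum.inr (j, i')) e x := by
  have hl : (S.toric (Sum.inr (j, i))).leaf = false := decide_eq_false (by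
    have : (i' : ℕ) < S.last + 1 := i'.2
    omega)
  have hsize : (S.toric (Sum.inr (j, i'))).size = (S.toric (Sum.inr (j, i))).size * armRatio := by
    simp only [toric, armVertex, ← hi, pow_succ, mul_assoc]
  rw [hsize] at hv
  have hadj : S.graph.graph.Adj (Sum.inr (Sum.inr (j, i))) (Sum.inr (Sum.inr (j, i'))) :=
    starAdj_arm_iff.2 (Or.inr ⟨i', rfl, Or.inr hi⟩)
  have hlt : i < i' := Fin.lt_def.2 (by omega)
  rcases h with ⟨z, hz, s, rfl, rfl⟩ | ⟨h0, s, rfl, rfl⟩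
  · obtain ⟨t, σ, ht, ht1, hσ, rfl⟩ := ToricVertex.exists_near_center hl (S.base_toric.1 hz)
      (Circle.norm_coe s) hv
    let s' : Circle := ⟨σ, mem_sphere_zero_iff_norm.2 hσ⟩
    have hg := S.discs.chart_edge hadj ht ht1 s s'
    have hc : S.discs.center (Sum.inr (Sum.inr (j, i))) (Sum.inr (Sum.inr (j, i'))) =
        Complex.I / 2 := if_pos hlt
    have hc' : S.discs.center (Sum.inr (Sum.inr (j, i'))) (Sum.inr (Sum.inr (j, i))) = 0 :=
      if_neg hlt.not_gt
    simp only [hc, hc', zero_add] at hg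
    refine Or.inl ⟨_, _, s', hg, ?_⟩
    exact F_edge_arm j hi ht ht1 (Circle.norm_coe s) hσ
  · exact absurd hv (not_lt.2 (ToricVertex.le_norm_inr_zero_snd hl (Circle.norm_coe s)))

lemma size_antitone (j : Fin S.d) {i i' : Fin (S.last + 1)} (h : i ≤ i') :
    (S.toric (Sum.inr (j, i'))).size ≤ (S.toric (Sum.inr (j, i))).size :=
  mul_le_mul_of_nonneg_left (pow_le_pow_of_le_one armRatio_pos.le
    (by linarith [armRatio_lt_half]) h) S.C.rstar_pos.le

lemma descend {j : Fin S.d} (n : ℕ) : ∀ {i i' : Fin (S.last + 1)}, (i : ℕ) + n = i' →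
    Over (Sum.inr (j, i)) e x → ‖e.2‖ < (S.toric (Sum.inr (j, i'))).size →
    Over (Sum.inr (j, i')) e x := by
  induction n with
  | zero =>
    intro i i' hi h _
    obtain rfl : i = i' := Fin.ext hi
    exact h
  | succ n ih =>
    intro i i' hi h hv
    have hi' : (i : ℕ) + 1 < S.last + 1 := by have : (i' : ℕ) < S.last + 1 := i'.2; omega
    have hn : ((⟨i + 1, hi'⟩ : Fin (S.last + 1)) : ℕ) + n = i' := by simp only; omega
    exact ih hn (h.next rfl (hv.trans_le (size_antitone j (Fin.le_def.2 (by omega))))) hv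

/-- If two points of one arm have the same toric coordinates, the point at the inner index can be
moved outwards to the index of the other, where the toric coordinates are injective. -/
lemma arm_unique {j : Fin S.d} {i i' : Fin (S.last + 1)} (h : Over (Sum.inr (j, i)) e x)
    (h' : Over (Sum.inr (j, i')) e x') : x = x' := by
  rcases le_total i i' with hi | hi
  · exact (h.descend (i' - i) (by have := Fin.le_def.1 hi; omega) h'.norm_snd_lt).unique h'
  · exact h.unique (h'.descend (i - i') (by have := Fin.le_def.1 hi; omega) h.norm_snd_lt)

lemma eq_of_toSphere_eq (h : Over u e x) (h' : Over u' e' x') (hu : S.chart u = S.chart u')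
    (hc : S.chartDom u = S.chartDom u') (heq : S.toricPt u e = S.toricPt u' e') : e = e' := by
  have hd := h'.mem_chartDom
  rw [← hc] at hd
  rw [toricPt, toricPt, ← hu] at heq
  exact (S.coneChart u).eq_of_toSphere_eq (S.scale_mem_chartDom u) h.mem_chartDom hd heq
    (Or.inl ⟨S.chartWt_pos u, h.norm_fst, h'.norm_fst⟩)

/-- The values of y separate the two kinds of neighbourhoods: |y| ≥ 2 near x₁ = 0, whereas |y^d| < 2
near an orbit x₂ = 0. -/
lemma not_b_arm {j : Fin S.d} {i : Fin (S.last + 1)} (h : Over (Sum.inl ()) e x)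
    (h' : Over (Sum.inr (j, i)) e' x') :
    S.toricPt (Sum.inl ()) e ≠ S.toricPt (Sum.inr (j, i)) e' := by
  intro heq
  have hP := h.mem_chartDom
  have hP' := h'.mem_chartDom
  have h1' := chart_arm_one_ne_zero (S := S) j i hP'.1
  have h1 : S.chart (Sum.inl ()) e 1 ≠ 0 := fun h0 => h1' ((toSphere_eq_zero_iff heq 1).1 h0)
  have hr := toSphere_ratio heq
  rw [chart_ratio _ hP h1, chart_ratio _ hP' h1'] at hr
  simp only [endOf, endVal] at hr
  have hη := norm_endParam (S := S) (Sum.inl ()) h.norm_fst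
  have hη' := norm_endParam (S := S) (Sum.inr (j, i)) h'.norm_fst
  have hlt := h.norm_snd_lt_rstar
  have hlt' := h'.norm_snd_lt_rstar
  have hR := S.C.rstar_lt_one
  have hR' : S.C.rstar ≤ 1 / 128 := by have := S.C.rad_le; rw [CentreData.rstar]; linarith
  generalize endParam (S := S) (Sum.inl ()) e = η at hr hη
  generalize endParam (S := S) (Sum.inr (j, i)) e' = η' at hr hη'
  have hηlt : ‖η‖ < 1 / 2 := by
    rw [hη]
    have := pow_le_of_le_one (norm_nonneg e.2) (hlt.trans hR).le S.m_pos.ne'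
    simp only [endOf, endMult]
    linarith
  have hηlt' : ‖-rootPt S.d j * η'‖ < 1 := by
    rw [norm_mul, norm_neg_rootPt, one_mul, hη']
    exact pow_lt_one₀ (norm_nonneg _) (hlt'.trans hR) S.N_pos.ne'
  have hpow := congrArg (fun y => ‖y ^ S.d‖) hr
  have hslit := Complex.slitPlane_ne_zero (one_add_mem_slitPlane hηlt')
  rw [mul_pow, rootPt_pow, rootBranch_pow S.d_pos hslit, neg_one_mul, norm_neg, norm_pow,
    norm_inv] at hpow
  have h2 : ‖1 + -rootPt S.d j * η'‖ < 2 := by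
    refine (norm_add_le _ _).trans_lt ?_
    rw [norm_one]; linarith
  have hη0 : η ≠ 0 := by
    intro h0
    rw [h0, inv_zero, eq_comm, mul_eq_zero] at hr
    exact hr.elim (rootPt_ne_zero j) (rootBranch_ne_zero _ _)
  have h3 : 2 ≤ ‖η‖⁻¹ := by
    rw [le_inv_comm₀ two_pos (norm_pos_iff.2 hη0)]
    linarith
  have h4 : ‖η‖⁻¹ ≤ ‖η‖⁻¹ ^ S.d :=
    le_self_pow₀ (by linarith) S.d_pos.ne'
  linarith

/-- On the long arms y^d determines the argument of the root branch, and y then determines the root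
p_j, hence the arm. Within one arm the chart is injective up to dilation, and the condition |u| = 1
removes the dilation. -/
lemma eq_of_toricPt_eq (h : Over u e x) (h' : Over u' e' x')
    (heq : S.toricPt u e = S.toricPt u' e') : x = x' := by
  rcases u with ⟨⟩ | ⟨j, i⟩ <;> rcases u' with ⟨⟩ | ⟨j', i'⟩
  · obtain rfl := h.eq_of_toSphere_eq h' rfl rfl heq
    exact h.unique h'
  · exact absurd heq (h.not_b_arm h')
  · exact absurd heq.symm (h'.not_b_arm h)
  · have hP := h.mem_chartDom
    have hP' := h'.mem_chartDom
    have h1 := chart_arm_one_ne_zero (S := S) j i hP.1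
    have h1' := chart_arm_one_ne_zero (S := S) j' i' hP'.1
    have hr := toSphere_ratio heq
    have hrb : ∀ (j : Fin S.d) (i : Fin (S.last + 1)) (P : ℂ × ℂ),
        P ∈ S.chartDom (Sum.inr (j, i)) →
        S.chart (Sum.inr (j, i)) P 0 / S.chart (Sum.inr (j, i)) P 1 ^ S.m =
          rootPt S.d j * rootBranch S.d (S.chartVal (Sum.inr (j, i)) P) ∧
        1 + (S.chart (Sum.inr (j, i)) P 0 / S.chart (Sum.inr (j, i)) P 1 ^ S.m) ^ S.d =
          -S.chartVal (Sum.inr (j, i)) P := by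
      intro j i P hP
      have h1 := chart_arm_one_ne_zero (S := S) j i hP.1
      have e1 : S.chart (Sum.inr (j, i)) P 0 / S.chart (Sum.inr (j, i)) P 1 ^ S.m =
          rootPt S.d j * rootBranch S.d (S.chartVal (Sum.inr (j, i)) P) :=
        mul_div_cancel_right₀ _ (pow_ne_zero _ h1)
      refine ⟨e1, ?_⟩
      rw [e1, mul_pow, rootPt_pow,
        rootBranch_pow S.d_pos (Complex.slitPlane_ne_zero (one_add_mem_slitPlane hP.2))]
      ring
    obtain ⟨a1, a2⟩ := hrb j i e hP
    obtain ⟨b1, b2⟩ := hrb j' i' e' hP'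
    rw [hr, b2, neg_inj] at a2
    rw [hr, b1, ← a2] at a1
    obtain rfl := rootPt_injective (mul_right_cancel₀ (rootBranch_ne_zero _ _) a1)
    obtain rfl := h.eq_of_toSphere_eq h' rfl rfl heq
    exact h.arm_unique h'

end Over

/-- A point over the regular part whose value of `y` is attained near an exceptional orbit is glued
to a point there. -/
lemma exists_over_of_base_eq {z : ℂ} (hz : z ∈ S.discs.base (Sum.inl (Sum.inl ()))) (s : Circle)
    (α : Option (Fin S.d)) {η : ℂ} (hη : ‖η‖ < S.C.level (endMult S.m S.N α) 1)
    (h : S.C.base S.m S.N z = endVal S.d α η) :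
    ∃ e, Over (S.endArm α) e (S.discs.chart (Sum.inl (Sum.inl ())) ⟨z, hz⟩ s) ∧
      S.F (Sum.inl (Sum.inl ())) z s = S.toricPt (S.endArm α) e := by
  obtain ⟨t, b, ht, ht1, hb, rfl, -⟩ := S.C.exists_of_base_eq S.d_pos S.m_pos S.N_pos
    (S.base_centre.1 hz) α hη h
  let s' : Circle := ⟨b, mem_sphere_zero_iff_norm.2 hb⟩
  have hadj : S.graph.graph.Adj (Sum.inl ()) (Sum.inr (S.endArm α)) :=
    starAdj_centre_iff.2 ⟨α, (endVertex_eq α).symm⟩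
  have hg := S.discs.chart_edge hadj ht ht1 s s'
  have hc : S.discs.center (Sum.inl ()) (Sum.inr (S.endArm α)) = centrePt S.d α := by
    cases α <;> rfl
  have hc' : S.discs.center (Sum.inr (S.endArm α)) (Sum.inl ()) = 0 := by cases α <;> rfl
  simp only [hc, hc', zero_add] at hg
  exact ⟨_, Or.inl ⟨_, _, s', hg, rfl⟩, F_edge_centre α ht ht1 (Circle.norm_coe s) hb⟩

lemma level_one (e : ℕ) : S.C.level e 1 = S.C.rstar ^ e := by
  rw [CentreData.level]; norm_num

lemma Over.norm_endParam_lt {u : S.Arm} {e : ℂ × ℂ} {x : S.discs.Boundary} (h : Over u e x) :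
    ‖endParam u e‖ < S.C.level (endMult S.m S.N (endOf u)) 1 := by
  rw [norm_endParam u h.norm_fst, level_one]
  exact pow_lt_pow_left₀ h.norm_snd_lt_rstar (norm_nonneg _)
    (CentreData.endMult_pos S.m_pos S.N_pos _).ne'

/-- The common value of y is attained near a puncture, so the point over the centre lies in the disc
of that puncture and is glued to a point over the arm. The comparison then takes place between two
points over arms. -/
lemma Over.eq_centre {u : S.Arm} {e : ℂ × ℂ} {x : S.discs.Boundary} (h : Over u e x) {z : ℂ}
    (hz : z ∈ S.discs.base (Sum.inl (Sum.inl ()))) (s : Circle)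
    (heq : S.F (Sum.inl (Sum.inl ())) z s = S.toricPt u e) :
    S.discs.chart (Sum.inl (Sum.inl ())) ⟨z, hz⟩ s = x := by
  have hm := base_mem (S.base_centre.1 hz) (Circle.norm_coe s)
  have hb := baseCoord_baseChart S.succ_N hm.1 hm.2
  have h1 : baseChart S.d S.m S.N (S.C.base S.m S.N z, s * dir (S.C.phase z)) 1 ≠ 0 :=
    div_ne_zero (pow_ne_zero _ hm.2) (pow_ne_zero _ (neg_ne_zero.2 hm.1))
  have h1' : S.chart u e 1 ≠ 0 := fun h0 => h1 ((toSphere_eq_zero_iff heq 1).2 h0)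
  have hr := toSphere_ratio heq
  rw [chart_ratio u h.mem_chartDom h1'] at hr
  have hy : S.C.base S.m S.N z = endVal S.d (endOf u) (endParam u e) :=
    (congrArg Prod.fst hb).symm.trans hr
  obtain ⟨e', hov, hF⟩ := exists_over_of_base_eq hz s (endOf u) h.norm_endParam_lt hy
  exact hov.eq_of_toricPt_eq h (hF.symm.trans heq)

/-- The point at infinity of the central base is y = 0, where x₀ = 0 and x₁ ≠ 0; near the special
orbits x₀ does not vanish. -/
lemma Over.ne_infinity {u : S.Arm} {e : ℂ × ℂ} {x : S.discs.Boundary} (h : Over u e x) {s : ℂ}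
    (hs : ‖s‖ = 1) : S.F (Sum.inr (Sum.inl ())) 0 s ≠ S.toricPt u e := by
  intro heq
  have hm : _ ∈ {P : ℂ × ℂ | 1 + P.1 ^ S.d ≠ 0 ∧ P.2 ≠ 0} := infinity_mem (z := 0) (by simp) hs
  have h1 : baseChart S.d S.m S.N (0 / 2, s * dir (1 + (0 / 2) ^ S.d)) 1 ≠ 0 :=
    div_ne_zero (pow_ne_zero _ hm.2) (pow_ne_zero _ (neg_ne_zero.2 hm.1))
  have h1' : S.chart u e 1 ≠ 0 := fun h0 => h1 ((toSphere_eq_zero_iff heq 1).2 h0)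
  have h0 : baseChart S.d S.m S.N (0 / 2, s * dir (1 + (0 / 2) ^ S.d)) 0 = 0 := by
    simp [baseChart]
  have h0' : S.chart u e 0 = 0 := (toSphere_eq_zero_iff heq 0).1 h0
  rcases u with ⟨⟩ | ⟨j, i⟩
  · exact chart_b_zero_ne_zero h.mem_chartDom h0'
  · have hr := mul_eq_zero.1 h0'
    rcases hr with hr | hr
    · exact (mul_ne_zero (rootPt_ne_zero j) (rootBranch_ne_zero _ _)) hr
    · exact pow_ne_zero _ h1' hr

lemma centre_scale (P : ℂ × ℂ) (hP : P ∈ {P : ℂ × ℂ | 1 + P.1 ^ S.d ≠ 0 ∧ P.2 ≠ 0}) (τ : ℝ) :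
    (((Real.exp (((0, 1) : ℕ × ℕ).1 * τ) : ℝ) : ℂ) * P.1,
      ((Real.exp (((0, 1) : ℕ × ℕ).2 * τ) : ℝ) : ℂ) * P.2) ∈
      {P : ℂ × ℂ | 1 + P.1 ^ S.d ≠ 0 ∧ P.2 ≠ 0} := by
  refine ⟨?_, mul_ne_zero (by exact_mod_cast (Real.exp_pos _).ne') hP.2⟩
  simpa using hP.1

lemma regularPt_injective {P P' : ℂ × ℂ} (hP : P ∈ {P : ℂ × ℂ | 1 + P.1 ^ S.d ≠ 0 ∧ P.2 ≠ 0})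
    (hP' : P' ∈ {P : ℂ × ℂ | 1 + P.1 ^ S.d ≠ 0 ∧ P.2 ≠ 0}) (h1 : ‖P.2‖ = 1) (h1' : ‖P'.2‖ = 1)
    (h : S.regularPt P = S.regularPt P') : P = P' :=
  S.coneChart_centre.eq_of_toSphere_eq centre_scale hP hP' h (Or.inr ⟨one_pos, h1, h1'⟩)

lemma norm_mul_dir_eq_one {s W : ℂ} (hs : ‖s‖ = 1) (hW : W ≠ 0) : ‖s * dir W‖ = 1 := by
  rw [norm_mul, hs, norm_dir hW, one_mul]

/-- The three kinds of points of the plumbed manifold. -/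
lemma piece_cases (P : S.discs.Pieces) (hP : ∀ v, P.1 = Sum.inr v → (P.2.1 : ℂ) = 0) :
    (∃ z, ∃ hz : z ∈ S.discs.base (Sum.inl (Sum.inl ())), ∃ s : Circle,
      P = ⟨Sum.inl (Sum.inl ()), (⟨z, hz⟩, s)⟩) ∨
    (∃ h0 : (0 : ℂ) ∈ S.discs.base (Sum.inr (Sum.inl ())), ∃ s : Circle,
      P = ⟨Sum.inr (Sum.inl ()), (⟨0, h0⟩, s)⟩) ∨
    ∃ u e, Over u e (Quot.mk S.discs.Glue P) ∧ S.F P.1 P.2.1 P.2.2 = S.toricPt u e := by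
  obtain ⟨c, ⟨z, hz⟩, s⟩ := P
  rcases c with (⟨⟩ | u) | (⟨⟩ | u)
  · exact Or.inl ⟨z, hz, s, rfl⟩
  · exact Or.inr (Or.inr ⟨u, _, Or.inl ⟨z, hz, s, rfl, rfl⟩, rfl⟩)
  · have : z = 0 := hP _ rfl
    subst this
    exact Or.inr (Or.inl ⟨hz, s, rfl⟩)
  · have : z = 0 := hP _ rfl
    subst this
    exact Or.inr (Or.inr ⟨u, _, Or.inr ⟨hz, s, rfl, rfl⟩, rfl⟩)

lemma F_injective (P P' : S.discs.Pieces) (hP : ∀ v, P.1 = Sum.inr v → (P.2.1 : ℂ) = 0)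
    (hP' : ∀ v, P'.1 = Sum.inr v → (P'.2.1 : ℂ) = 0)
    (h : S.F P.1 P.2.1 P.2.2 = S.F P'.1 P'.2.1 P'.2.2) :
    (Quot.mk S.discs.Glue P : S.discs.Boundary) = Quot.mk S.discs.Glue P' := by
  have hph : ∀ {z : ℂ}, z ∈ S.discs.base (Sum.inl (Sum.inl ())) → S.C.phase z ≠ 0 := fun hz =>
    S.C.phase_ne_zero S.d_pos fun j => S.base_centre.1 hz (some j)
  have hinf : ∀ s : ℂ, ‖s‖ = 1 → ‖s * dir (1 + (0 / 2) ^ S.d)‖ = 1 := fun s hs =>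
    norm_mul_dir_eq_one hs (one_add_pow_ne_zero_of_norm_lt S.d_pos (by simp))
  have hci : ∀ {z : ℂ} (hz : z ∈ S.discs.base (Sum.inl (Sum.inl ()))) (s s' : Circle),
      S.F (Sum.inl (Sum.inl ())) z s ≠ S.F (Sum.inr (Sum.inl ())) 0 s' := by
    intro z hz s s' heq
    have := regularPt_injective (base_mem (S.base_centre.1 hz) (Circle.norm_coe s))
      (infinity_mem (z := 0) (by simp) (Circle.norm_coe s'))
      (norm_mul_dir_eq_one (Circle.norm_coe s) (hph hz)) (hinf _ (Circle.norm_coe s')) heq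
    have h1 := congrArg Prod.fst this
    simp only [zero_div] at h1
    exact S.C.base_ne_zero S.d_pos S.m_pos S.N_pos (S.base_centre.1 hz) h1
  rcases piece_cases P hP with ⟨z, hz, s, rfl⟩ | ⟨h0, s, rfl⟩ | ⟨u, e, hu, hF⟩ <;>
  rcases piece_cases P' hP' with ⟨z', hz', s', rfl⟩ | ⟨h0', s', rfl⟩ | ⟨u', e', hu', hF'⟩
  · have := regularPt_injective (base_mem (S.base_centre.1 hz) (Circle.norm_coe s))
      (base_mem (S.base_centre.1 hz') (Circle.norm_coe s'))
      (norm_mul_dir_eq_one (Circle.norm_coe s) (hph hz))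
      (norm_mul_dir_eq_one (Circle.norm_coe s') (hph hz')) h
    obtain rfl := S.C.base_injective S.d_pos S.m_pos S.N_pos (S.base_centre.1 hz)
      (S.base_centre.1 hz') (congrArg Prod.fst this)
    have h2 := mul_right_cancel₀ (dir_ne_zero (hph hz)) (congrArg Prod.snd this)
    rw [Circle.coe_injective h2]
  · exact absurd h (hci hz s s')
  · exact hu'.eq_centre hz s (h.trans hF')
  · exact absurd h.symm (hci hz' s' s)
  · have := regularPt_injective (infinity_mem (z := 0) (by simp) (Circle.norm_coe s))
      (infinity_mem (z := 0) (by simp) (Circle.norm_coe s'))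
      (hinf _ (Circle.norm_coe s)) (hinf _ (Circle.norm_coe s')) h
    have h2 := mul_right_cancel₀ (dir_ne_zero (one_add_pow_ne_zero_of_norm_lt S.d_pos (by simp)))
      (congrArg Prod.snd this)
    rw [Circle.coe_injective h2]
  · exact absurd (h.trans hF') (hu'.ne_infinity (Circle.norm_coe s))
  · exact (hu.eq_centre hz' s' (h.symm.trans hF)).symm
  · exact absurd (h.symm.trans hF) (hu.ne_infinity (Circle.norm_coe s'))
  · exact hu.eq_of_toricPt_eq hu' ((hF.symm.trans h).trans hF')

end StarData

/-! ## Surjectivity -/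

lemma multChart_multCoord {d m N : ℕ} (hN : N + 1 = 10 * (d * m)) {X : Fin 3 → ℂ}
    (hX : X 0 ^ d + X 1 ^ (d * m) + X 2 ^ N = 0) (h0 : X 0 ≠ 0) (h2 : X 2 ≠ 0) :
    (multCoord d m X).2 ^ m / (multCoord d m X).1 ^ N = X 1 ^ m / X 0 ∧
      multChart d m N (multCoord d m X) = X := by
  have hZ : (X 2 ^ (10 * m) / X 0) ^ d / X 2 = X 2 ^ N / X 0 ^ d := by
    have e : 10 * m * d = N + 1 := by rw [hN]; ring
    rw [div_pow, ← pow_mul, e, pow_succ]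
    field_simp
  have hN' : N * (10 * m) = 10 * m * N := mul_comm _ _
  have hd' : d * (10 * m) = N + 1 := by rw [hN]; ring
  have hr : (multCoord d m X).2 ^ m / (multCoord d m X).1 ^ N = X 1 ^ m / X 0 := by
    simp only [multCoord]
    rw [hZ, mul_pow, ← pow_mul, div_pow, div_pow, ← pow_mul, ← pow_mul, ← pow_mul, hN', hd',
      pow_succ]
    field_simp
  have hZ' : -(1 + ((multCoord d m X).2 ^ m / (multCoord d m X).1 ^ N) ^ d) =
      (X 2 ^ (10 * m) / X 0) ^ d / X 2 := by
    rw [hr, hZ, div_pow, ← pow_mul, mul_comm m d]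
    field_simp
    linear_combination -hX
  refine ⟨hr, ?_⟩
  have hZ0 : (X 2 ^ (10 * m) / X 0) ^ d / X 2 ≠ 0 :=
    div_ne_zero (pow_ne_zero _ (div_ne_zero (pow_ne_zero _ h2) h0)) h2
  rw [multChart, hZ']
  funext j
  fin_cases j
  · change (X 2 ^ (10 * m) / X 0) ^ N / ((X 2 ^ (10 * m) / X 0) ^ d / X 2) ^ (10 * m) = X 0
    rw [hZ, div_pow, div_pow, ← pow_mul, ← pow_mul, ← pow_mul, hN', hd', pow_succ]
    field_simp
  · change X 1 * ((X 2 ^ (10 * m) / X 0) ^ d / X 2) ^ 10 / _ = X 1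
    exact mul_div_cancel_right₀ _ (pow_ne_zero _ hZ0)
  · change (X 2 ^ (10 * m) / X 0) ^ d / _ = X 2
    rw [div_div_cancel₀ (pow_ne_zero _ (div_ne_zero (pow_ne_zero _ h2) h0))]

lemma rootChart_rootCoord {d m N : ℕ} (hN : N + 1 = 10 * (d * m)) (hd : 0 < d) (hdm : 2 ≤ d * m)
    (j : Fin d) {X : Fin 3 → ℂ} (hX : X 0 ^ d + X 1 ^ (d * m) + X 2 ^ N = 0) (h1 : X 1 ≠ 0)
    {η : ℂ} (hη : ‖η‖ < 1) (hy : X 0 / X 1 ^ m = endVal d (some j) η) :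
    rootBase d m N (-rootPt d j) (rootCoord d m N (-rootPt d j) X) = -rootPt d j * η ∧
      rootChart d m N (rootPt d j) (-rootPt d j) (rootCoord d m N (-rootPt d j) X) = X := by
  have hD : -rootPt d j ≠ 0 := neg_ne_zero.2 (rootPt_ne_zero j)
  have hDn : ‖-rootPt d j‖ = 1 := by rw [norm_neg, norm_rootPt]
  have hP : (rootCoord d m N (-rootPt d j) X).1 ≠ 0 := div_ne_zero h1 (pow_ne_zero _ hD)
  have e1 : (-rootPt d j) ^ (N - 10) * (rootCoord d m N (-rootPt d j) X).1 = X 1 :=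
    mul_div_cancel₀ _ (pow_ne_zero _ hD)
  have e2 : (-rootPt d j) ^ (d * m - 1) * (rootCoord d m N (-rootPt d j) X).2 = X 2 :=
    mul_div_cancel₀ _ (pow_ne_zero _ hD)
  have hslit : 1 + -rootPt d j * η ≠ 0 := Complex.slitPlane_ne_zero (one_add_mem_slitPlane (by
    rwa [norm_mul, hDn, one_mul]))
  have hb : rootBase d m N (-rootPt d j) (rootCoord d m N (-rootPt d j) X) = -rootPt d j * η := by
    rw [← rootChart_base hN hDn hdm hP, e1, e2]
    have h3 := congrArg (· ^ d) hy
    simp only [endVal] at h3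
    rw [mul_pow, rootPt_pow, rootBranch_pow hd hslit, div_pow, ← pow_mul, mul_comm m d] at h3
    have h4 : X 1 ^ (d * m) ≠ 0 := pow_ne_zero _ h1
    rw [div_eq_iff h4] at h3 ⊢
    linear_combination hX - h3
  refine ⟨hb, ?_⟩
  rw [rootChart, hb, e1, e2]
  rw [endVal, div_eq_iff (pow_ne_zero _ h1)] at hy
  rw [← hy]
  funext i
  fin_cases i <;> rfl

namespace StarData

variable {S : StarData}

/-- The point `x` lies in the image of one of the charts. -/
def IsCovered (S : StarData) (x : Fin 3 → ℂ) : Prop :=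
  ∃ c, ∃ z ∈ S.discs.base c, ∃ s : ℂ, ‖s‖ = 1 ∧ S.F c z s = x

lemma isCovered_toricPt {u : S.Arm} {e : ℂ × ℂ} (h1 : ‖e.1‖ = 1) (h2 : ‖e.2‖ < (S.toric u).size)
    (hlo : (S.toric u).leaf = true ∨ (S.toric u).size * (S.toric u).lo < ‖e.2‖) :
    S.IsCovered (S.toricPt u e) := by
  rcases (S.toric u).exists_eq h1 h2 hlo with ⟨z, s, hz, hs, h⟩ | ⟨s, hs, h⟩
  · exact ⟨Sum.inl (Sum.inr u), z, S.base_toric.2 hz, s, hs, congrArg (S.toricPt u) h⟩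
  · exact ⟨Sum.inr (Sum.inr u), 0, S.base_infinity.2 (by simp), s, hs, congrArg (S.toricPt u) h⟩

/-- The shells overlap: the lower limit of the radius at a vertex is half the size of the next one.
A radius that is too small for a vertex is passed outwards, and the last vertex accepts all values
including 0. -/
lemma isCovered_arm {j : Fin S.d} {e : ℂ × ℂ} (h1 : ‖e.1‖ = 1) (n : ℕ) :
    ∀ i : Fin (S.last + 1), (i : ℕ) + n = S.last → ‖e.2‖ < (S.toric (Sum.inr (j, i))).size →
      S.IsCovered (S.toricPt (Sum.inr (j, i)) e) := by
  induction n with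
  | zero =>
    intro i hi h2
    exact isCovered_toricPt h1 h2 (Or.inl (decide_eq_true hi))
  | succ n ih =>
    intro i hi h2
    have hi' : (i : ℕ) + 1 < S.last + 1 := by omega
    by_cases h : (S.toric (Sum.inr (j, i))).size * (S.toric (Sum.inr (j, i))).lo < ‖e.2‖
    · exact isCovered_toricPt h1 h2 (Or.inr h)
    · refine ih ⟨i + 1, hi'⟩ (by simp only; omega) ((not_lt.1 h).trans_lt ?_)
      have hl : (S.toric (Sum.inr (j, i))).leaf = false := decide_eq_false (by omega)
      rw [ToricVertex.lo, hl, cond_false]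
      change S.C.rstar * armRatio ^ (i : ℕ) * (armRatio / 2) < S.C.rstar * armRatio ^ ((i : ℕ) + 1)
      have := mul_pos S.C.rstar_pos (pow_pos armRatio_pos ((i : ℕ) + 1))
      rw [pow_succ] at this ⊢
      linarith

lemma isCovered_endArm (α : Option (Fin S.d)) {e : ℂ × ℂ} (h1 : ‖e.1‖ = 1)
    (h2 : ‖e.2‖ < S.C.rstar) : S.IsCovered (S.toricPt (S.endArm α) e) := by
  rw [← toric_endArm_size α] at h2
  cases α with
  | none => exact isCovered_toricPt h1 h2 (Or.inl rfl)
  | some j => exact isCovered_arm h1 S.last 0 (by simp) h2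

lemma chartMult_endArm (α : Option (Fin S.d)) : S.chartMult (S.endArm α) = endMult S.m S.N α := by
  cases α <;> rfl

lemma isCovered_chart (α : Option (Fin S.d)) {P : ℂ × ℂ} (hP1 : P.1 ≠ 0)
    (hP : ‖S.chartVal (S.endArm α) P‖ ≤ S.C.level (endMult S.m S.N α) 0) :
    S.IsCovered (toSphere S.wts (S.chart (S.endArm α) P)) := by
  have hr := S.C.rstar_pos
  have hr1 := S.C.rstar_lt_one
  have hmult := S.chartMult_pos (S.endArm α)
  rw [CentreData.level, ← chartMult_endArm] at hP
  have hPm : P ∈ S.chartDom (S.endArm α) :=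
    ⟨hP1, hP.trans_lt (pow_lt_one₀ (by linarith) (by linarith) hmult.ne')⟩
  have hw : (0 : ℝ) < (S.chartWt (S.endArm α)).1 := Nat.cast_pos.2 (S.chartWt_pos _)
  -- The dilation normalizes |u| to 1. The base value is then |v| to the multiplicity, so the bound
  -- by the level at 0 becomes |v| ≤ rstar / 2.
  obtain ⟨τ, hτ⟩ : ∃ τ : ℝ, Real.exp ((S.chartWt (S.endArm α)).1 * τ) * ‖P.1‖ = 1 := by
    refine ⟨-Real.log ‖P.1‖ / (S.chartWt (S.endArm α)).1, ?_⟩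
    rw [mul_div_cancel₀ _ hw.ne', Real.exp_neg, Real.exp_log (norm_pos_iff.2 hP1),
      inv_mul_cancel₀ (norm_ne_zero_iff.2 hP1)]
  have hdil := (S.coneChart (S.endArm α)).dilate_eq P hPm τ
  have hval := S.chartVal_scale (S.endArm α) P τ
  generalize hQ : ((((Real.exp ((S.chartWt (S.endArm α)).1 * τ) : ℝ) : ℂ) * P.1,
    ((Real.exp ((S.chartWt (S.endArm α)).2 * τ) : ℝ) : ℂ) * P.2) : ℂ × ℂ) = Q at hdil hval
  have hQ1 : ‖Q.1‖ = 1 := by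
    rw [← hQ, norm_mul, Complex.norm_real, Real.norm_of_nonneg (Real.exp_pos _).le, hτ]
  have hQ2 : ‖Q.2‖ < S.C.rstar := by
    rw [← hval, S.norm_chartVal _ _ hQ1] at hP
    have := le_of_pow_le_pow_left₀ hmult.ne' (by linarith) hP
    linarith
  have := isCovered_endArm α hQ1 hQ2
  rwa [toricPt, hdil, toSphere_dilate S.wts_pos ((S.coneChart _).ne_zero _ hPm)] at this

lemma isCovered_some {X : Fin 3 → ℂ} (hX : X 0 ^ S.d + X 1 ^ (S.d * S.m) + X 2 ^ S.N = 0)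
    (h1 : X 1 ≠ 0) (j : Fin S.d) {η : ℂ} (hη : ‖η‖ ≤ S.C.level S.N 0)
    (hy : X 0 / X 1 ^ S.m = endVal S.d (some j) η) : S.IsCovered (toSphere S.wts X) := by
  have hr := S.C.rstar_pos
  have hr1 := S.C.rstar_lt_one
  have hη1 : ‖η‖ < 1 := hη.trans_lt (pow_lt_one₀ (by linarith) (by linarith) S.N_pos.ne')
  obtain ⟨hb, hc⟩ := rootChart_rootCoord S.succ_N S.d_pos S.two_le_mul j hX h1 hη1 hy
  have := isCovered_chart (S := S) (some j) (P := rootCoord S.d S.m S.N (-rootPt S.d j) X)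
    (div_ne_zero h1 (pow_ne_zero _ (neg_rootPt_ne_zero j))) (by
      simp only [endArm, chartVal, endMult]
      rwa [hb, norm_mul, norm_neg_rootPt, one_mul])
  simp only [endArm, chart] at this
  rwa [hc] at this

lemma isCovered_none {X : Fin 3 → ℂ} (hX : X 0 ^ S.d + X 1 ^ (S.d * S.m) + X 2 ^ S.N = 0)
    (h0 : X 0 ≠ 0) (h2 : X 2 ≠ 0) (hη : ‖X 1 ^ S.m / X 0‖ ≤ S.C.level S.m 0) :
    S.IsCovered (toSphere S.wts X) := by
  obtain ⟨hb, hc⟩ := multChart_multCoord S.succ_N hX h0 h2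
  have := isCovered_chart (S := S) none (P := multCoord S.d S.m X)
    (div_ne_zero (pow_ne_zero _ h2) h0) (by
      simp only [endArm, chartVal, endMult]
      rwa [hb])
  simp only [endArm, chart] at this
  rwa [hc] at this

lemma eq_norm_mul_dir {z : ℂ} (hz : z ≠ 0) : z = (‖z‖ : ℂ) * dir z := by
  rw [dir, mul_div_cancel₀]
  exact_mod_cast norm_ne_zero_iff.2 hz

/-- The value y = 0 belongs to the point at infinity of the central base. Any other y is either
attained on the blown-up base or lies in a disc by which a puncture was replaced, and then the point
is over an arm. -/
lemma isCovered_regular {X : Fin 3 → ℂ} (hX : X 0 ^ S.d + X 1 ^ (S.d * S.m) + X 2 ^ S.N = 0)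
    (h1 : X 1 ≠ 0) (h2 : X 2 ≠ 0) : S.IsCovered (toSphere S.wts X) := by
  have hl0 : X 2 ^ 10 / X 1 ≠ 0 := div_ne_zero (pow_ne_zero _ h2) h1
  have hlpos := norm_pos_iff.2 hl0
  have hl := eq_norm_mul_dir hl0
  have hld := norm_dir hl0
  by_cases hy : X 0 / X 1 ^ S.m = 0
  · refine ⟨Sum.inr (Sum.inl ()), 0, S.base_infinity.2 (by simp), _, hld, ?_⟩
    refine regularPt_eq hX h1 h2 hlpos (by rw [hy, zero_div]) ?_
    rw [zero_div, zero_pow S.d_pos.ne', add_zero]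
    rwa [dir_of_norm_eq_one (norm_one : ‖(1 : ℂ)‖ = 1), mul_one]
  rcases S.C.exists_base_eq_or S.d_pos S.m_pos S.N_pos hy with ⟨z, hz, hzy⟩ | ⟨α, η, hη, hαy⟩
  · have hph := S.C.phase_ne_zero S.d_pos fun j => hz (some j)
    refine ⟨Sum.inl (Sum.inl ()), z, S.base_centre.2 hz,
      dir (X 2 ^ 10 / X 1) / dir (S.C.phase z), ?_, ?_⟩
    · rw [norm_div, hld, norm_dir hph, div_one]
    · refine regularPt_eq hX h1 h2 hlpos hzy.symm ?_
      rwa [div_mul_cancel₀ _ (dir_ne_zero hph)]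
  · cases α with
    | none =>
      have h0 : X 0 ≠ 0 := fun h => hy (by rw [h, zero_div])
      refine isCovered_none hX h0 h2 ?_
      rw [← inv_div, hαy, endVal, inv_inv]
      exact hη
    | some j => exact isCovered_some hX h1 j hη hαy

lemma isCovered_of_mem_link {x : Fin 3 → ℂ} (hx : x ∈ brieskornLink S.exps) : S.IsCovered x := by
  rw [← toSphere_eq_self S.wts_pos hx.2]
  have hX := cone_iff.1 hx.1
  have hdm : S.d * S.m ≠ 0 := by have := S.two_le_mul; omega
  by_cases h2 : x 2 = 0
  · have h1 : x 1 ≠ 0 := by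
      intro h1
      rw [h1, h2, zero_pow hdm, zero_pow S.N_pos.ne', add_zero, add_zero] at hX
      have h0 := eq_zero_of_pow_eq_zero hX
      have := hx.2
      simp [Fin.sum_univ_three, h0, h1, h2] at this
    obtain ⟨j, hj⟩ := exists_rootPt_eq S.d_pos (y := x 0 / x 1 ^ S.m) (by
      rw [div_pow, ← pow_mul, mul_comm S.m, div_eq_iff (pow_ne_zero _ h1)]
      rw [h2, zero_pow S.N_pos.ne'] at hX
      linear_combination hX)
    refine isCovered_some hX h1 j (η := 0) ?_ ?_
    · rw [norm_zero]; exact (S.C.level_pos _ le_rfl).le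
    · rw [← hj, endVal, mul_zero, rootBranch_zero, mul_one]
  by_cases h1 : x 1 = 0
  · have h0 : x 0 ≠ 0 := by
      intro h0
      rw [h0, h1, zero_pow hdm, zero_pow S.d_pos.ne', zero_add, zero_add] at hX
      exact h2 (eq_zero_of_pow_eq_zero hX)
    refine isCovered_none hX h0 h2 ?_
    rw [h1, zero_pow S.m_pos.ne', zero_div, norm_zero]
    exact (S.C.level_pos _ le_rfl).le
  · exact isCovered_regular hX h1 h2

/-- The plumbed manifold is the Brieskorn link. -/
theorem boundaryIsBrieskorn_graph (S : StarData) : S.graph.BoundaryIsBrieskorn S.exps :=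
  S.discs.boundaryIsBrieskorn S.F S.contDiffAt_F S.F_mem_link
    (fun v z z' s hz hzz _ => F_infinity v z z' s hz hzz)
    (fun _ _ h t s s' => F_adj h t s s') S.isPositiveFrame_F F_injective
    fun _ hx => isCovered_of_mem_link hx

end StarData

theorem boundaryIsBrieskorn_brieskornGraph {k m : ℕ} (hk : 0 < k) (hm : 0 < m) :
    (brieskornGraph k m).BoundaryIsBrieskorn ![2 ^ k, 2 ^ k * m, 2 ^ k * (10 * m) - 1] := by
  obtain ⟨C⟩ := nonempty_centreData (d := 2 ^ k) (by positivity)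
  have h2 : 2 ≤ 2 ^ k := le_self_pow₀ one_le_two hk.ne'
  have h3 : 0 < 2 ^ k * m := by positivity
  let S : StarData :=
    { d := 2 ^ k
      m := m
      N := 2 ^ k * (10 * m) - 1
      two_le := h2
      m_pos := hm
      succ_N := by
        have : 2 ^ k * (10 * m) = 10 * (2 ^ k * m) := by ring
        omega
      C := C }
  rw [brieskornGraph_eq]
  exact S.boundaryIsBrieskorn_graph

/-! ## Intersection forms of plumbing graphs -/

namespace PlumbingGraph

variable {V : Type} [Fintype V] (Γ : PlumbingGraph V)

open Classical in
/-- The sum of a function over the neighbours of a vertex. -/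
def nbrSum {R : Type*} [AddCommMonoid R] (y : V → R) (v : V) : R :=
  ∑ w, if Γ.graph.Adj v w then y w else 0

lemma sum_intersectionMatrix_mul {R : Type*} [CommRing R] (y : V → R) (v : V) :
    ∑ w, (Γ.intersectionMatrix v w : R) * y w = Γ.weight v * y v + Γ.nbrSum y v := by
  classical
  have h : ∀ w, (Γ.intersectionMatrix v w : R) * y w =
      (if v = w then Γ.weight v * y v else 0) + if Γ.graph.Adj v w then y w else 0 := by
    intro w
    by_cases hvw : v = w
    · subst hvw
      simp [intersectionMatrix]
    · by_cases ha : Γ.graph.Adj v w <;> simp [intersectionMatrix, hvw, ha]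
  simp_rw [h]
  rw [Finset.sum_add_distrib, Finset.sum_ite_eq, if_pos (Finset.mem_univ v), nbrSum]

omit [Fintype V] in
lemma intersectionMatrix_comm (v w : V) : Γ.intersectionMatrix v w = Γ.intersectionMatrix w v := by
  classical
  unfold intersectionMatrix
  by_cases h : v = w
  · rw [h]
  · rw [if_neg h, if_neg (Ne.symm h), Γ.graph.adj_comm]

lemma inter_eq (x y : V → ℤ) : Γ.inter x y = ∑ v, x v * (Γ.weight v * y v + Γ.nbrSum y v) := by
  refine Finset.sum_congr rfl fun v _ => ?_
  have := Γ.sum_intersectionMatrix_mul y v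
  rw [Int.cast_id] at this
  rw [← this, Finset.mul_sum]
  exact Finset.sum_congr rfl fun w _ => by rw [Int.cast_id, mul_assoc]

lemma inter_single (x : V → ℤ) (v : V) [DecidableEq V] :
    Γ.inter x (Pi.single v 1) = Γ.weight v * x v + Γ.nbrSum x v := by
  have := Γ.sum_intersectionMatrix_mul x v
  rw [Int.cast_id] at this
  rw [← this]
  refine Finset.sum_congr rfl fun u _ => ?_
  rw [Finset.sum_eq_single v]
  · rw [Pi.single_eq_same, mul_one, Int.cast_id, mul_comm, Γ.intersectionMatrix_comm]
  · intro w _ h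
    rw [Pi.single_eq_of_ne h, mul_zero]
  · exact fun h => absurd (Finset.mem_univ v) h

/-- The degree sum formula as a criterion for trees. -/
lemma isTree_of_sum_nbrSum (hc : Γ.graph.Connected)
    (h : ∑ v, Γ.nbrSum (fun _ => 1) v + 2 = 2 * Fintype.card V) : Γ.graph.IsTree := by
  classical
  rw [SimpleGraph.isTree_iff_connected_and_card]
  refine ⟨hc, ?_⟩
  have h1 : ∀ v, Γ.nbrSum (fun _ => 1) v = Γ.graph.degree v := by
    intro v
    rw [nbrSum, Finset.sum_boole, ← SimpleGraph.card_neighborFinset_eq_degree,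
      SimpleGraph.neighborFinset_eq_filter, Nat.cast_id]
  simp_rw [h1] at h
  rw [SimpleGraph.sum_degrees_eq_twice_card_edges, SimpleGraph.edgeFinset_card] at h
  rw [Nat.card_eq_fintype_card, Nat.card_eq_fintype_card]
  omega

open Classical in
/-- The intersection form has odd determinant if its reduction modulo 2 is injective. -/
lemma hasOddDet_of_forall
    (h : ∀ y : V → ZMod 2, (∀ v, (Γ.weight v : ZMod 2) * y v + Γ.nbrSum y v = 0) → y = 0) :
    Γ.HasOddDet := by
  rw [HasOddDet, ← Int.not_even_iff_odd, even_iff_two_dvd]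
  intro hd
  have h2 : ((Γ.intersectionMatrix.det : ℤ) : ZMod 2) = 0 :=
    (ZMod.intCast_zmod_eq_zero_iff_dvd _ 2).2 hd
  rw [Int.cast_det] at h2
  obtain ⟨y, hy0, hy⟩ := Matrix.exists_mulVec_eq_zero_iff.2 h2
  refine hy0 (h y fun v => ?_)
  rw [← Γ.sum_intersectionMatrix_mul]
  exact congrFun hy v

/-- Two spherical Wu classes agree if the intersection form is injective modulo 2. -/
lemma IsSphericalWuClass.unique {Γ : PlumbingGraph V}
    (h : ∀ y : V → ZMod 2, (∀ v, (Γ.weight v : ZMod 2) * y v + Γ.nbrSum y v = 0) → y = 0)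
    {w w' : V → ℤ} (hw : Γ.IsSphericalWuClass w) (hw' : Γ.IsSphericalWuClass w') : w' = w := by
  classical
  have h0 := h (fun v => ((w' v - w v : ℤ) : ZMod 2)) fun v => by
    have h1 := hw.2 v
    have h2 := hw'.2 v
    have e : (Γ.weight v : ZMod 2) * ((w' v - w v : ℤ) : ZMod 2) +
        Γ.nbrSum (fun v => ((w' v - w v : ℤ) : ZMod 2)) v =
        ((Γ.inter w' (Pi.single v 1) - Γ.inter w (Pi.single v 1) : ℤ) : ZMod 2) := by
      rw [inter_single, inter_single]
      have : Γ.nbrSum (fun v => ((w' v - w v : ℤ) : ZMod 2)) v =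
          ((Γ.nbrSum w' v - Γ.nbrSum w v : ℤ) : ZMod 2) := by
        simp only [nbrSum]
        rw [← Finset.sum_sub_distrib, Int.cast_sum]
        refine Finset.sum_congr rfl fun u _ => ?_
        split_ifs <;> simp
      rw [this]
      push_cast
      ring
    rw [e, ZMod.intCast_zmod_eq_zero_iff_dvd]
    have h3 := (h1.trans h2.symm).dvd
    convert h3 using 1
    congr! 3
  funext v
  have h1 := congrFun h0 v
  simp only [Pi.zero_apply] at h1
  rw [ZMod.intCast_zmod_eq_zero_iff_dvd] at h1
  rcases hw.1 v with a | a <;> rcases hw'.1 v with b | b <;> rw [a, b] at h1 ⊢ <;> norm_num at h1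

/-! ### Negative definiteness from a positive vector -/

section NegDef

variable {M : V → V → ℝ} {n : V → ℝ}

/-- Substituting x = n f and using the symmetry of M splits the form into a diagonal part with
coefficients M n and a sum of squares of differences of f. When M n ≤ 0 and the off-diagonal entries
are nonnegative, both contributions are nonpositive. -/
lemma sum_ground_state (hM : ∀ v w, M v w = M w v) (hn : ∀ v, n v ≠ 0) (x : V → ℝ) :
    ∑ v, ∑ w, x v * M v w * x w = ∑ v, (∑ w, M v w * n w) * (x v ^ 2 / n v) -
      (∑ v, ∑ w, M v w * (n v * n w) * (x v / n v - x w / n w) ^ 2) / 2 := by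
  have h1 : ∑ v, (∑ w, M v w * n w) * (x v ^ 2 / n v) =
      ∑ v, ∑ w, M v w * n w * (x v ^ 2 / n v) :=
    Finset.sum_congr rfl fun v _ => Finset.sum_mul _ _ _
  have h2 : ∑ v, ∑ w, M v w * n w * (x v ^ 2 / n v) = ∑ v, ∑ w, M v w * n v * (x w ^ 2 / n w) := by
    rw [Finset.sum_comm]
    exact Finset.sum_congr rfl fun v _ => Finset.sum_congr rfl fun w _ => by rw [hM]
  have h3 : ∑ v, ∑ w, M v w * (n v * n w) * (x v / n v - x w / n w) ^ 2 =
      ∑ v, ∑ w, M v w * n w * (x v ^ 2 / n v) + ∑ v, ∑ w, M v w * n v * (x w ^ 2 / n w) -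
        2 * ∑ v, ∑ w, x v * M v w * x w := by
    rw [Finset.mul_sum, ← Finset.sum_add_distrib, ← Finset.sum_sub_distrib]
    refine Finset.sum_congr rfl fun v _ => ?_
    rw [Finset.mul_sum, ← Finset.sum_add_distrib, ← Finset.sum_sub_distrib]
    refine Finset.sum_congr rfl fun w _ => ?_
    have := hn v
    have := hn w
    field_simp
    ring
  rw [h1, h3, ← h2]
  ring

/-- A positive vector `n` with `M n ≤ 0`, `M n ≠ 0` makes the form negative definite. -/
lemma sum_neg_of_ground_state (hM : ∀ v w, M v w = M w v) (hn : ∀ v, 0 < n v)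
    (hoff : ∀ v w, v ≠ w → 0 ≤ M v w) {G : SimpleGraph V} (hG : G.Connected)
    (hadj : ∀ v w, G.Adj v w → 0 < M v w) (hle : ∀ v, ∑ w, M v w * n w ≤ 0) {c : V}
    (hc : ∑ w, M c w * n w < 0) {x : V → ℝ} (hx : x ≠ 0) :
    ∑ v, ∑ w, x v * M v w * x w < 0 := by
  rw [sum_ground_state hM (fun v => (hn v).ne')]
  have h1 : ∀ v, (∑ w, M v w * n w) * (x v ^ 2 / n v) ≤ 0 := fun v =>
    mul_nonpos_of_nonpos_of_nonneg (hle v) (div_nonneg (sq_nonneg _) (hn v).le)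
  have h2 : ∀ v w, 0 ≤ M v w * (n v * n w) * (x v / n v - x w / n w) ^ 2 := by
    intro v w
    by_cases h : v = w
    · rw [h, sub_self]; simp
    · exact mul_nonneg (mul_nonneg (hoff v w h) (mul_pos (hn v) (hn w)).le) (sq_nonneg _)
  have h1s := Finset.sum_nonpos fun v (_ : v ∈ Finset.univ) => h1 v
  have h2s : ∀ v, 0 ≤ ∑ w, M v w * (n v * n w) * (x v / n v - x w / n w) ^ 2 := fun v =>
    Finset.sum_nonneg fun w _ => h2 v w
  have h2t := Finset.sum_nonneg fun v (_ : v ∈ Finset.univ) => h2s v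
  by_contra hlt
  have h1z : ∑ v, (∑ w, M v w * n w) * (x v ^ 2 / n v) = 0 := by linarith
  have h2z : ∑ v, ∑ w, M v w * (n v * n w) * (x v / n v - x w / n w) ^ 2 = 0 := by linarith
  have hxc : x c / n c = 0 := by
    have := (Finset.sum_eq_zero_iff_of_nonpos fun v _ => h1 v).1 h1z c (Finset.mem_univ c)
    rcases mul_eq_zero.1 this with h | h
    · exact absurd h hc.ne
    · rcases div_eq_zero_iff.1 h with h | h
      · rw [eq_zero_of_pow_eq_zero h, zero_div]
      · exact absurd h (hn c).ne'
  have hstep : ∀ v w, G.Adj v w → x v / n v = x w / n w := by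
    intro v w h
    have h3 := (Finset.sum_eq_zero_iff_of_nonneg fun v _ => h2s v).1 h2z v (Finset.mem_univ v)
    have h4 := (Finset.sum_eq_zero_iff_of_nonneg fun w _ => h2 v w).1 h3 w (Finset.mem_univ w)
    rcases mul_eq_zero.1 h4 with h5 | h5
    · exact absurd h5 (mul_pos (hadj v w h) (mul_pos (hn v) (hn w))).ne'
    · exact sub_eq_zero.1 (eq_zero_of_pow_eq_zero h5)
  -- If the form does not take a negative value, x / n is constant along edges, hence constant on
  -- the connected graph, and it vanishes at the vertex where M n is strictly negative.
  have hwalk : ∀ {v w : V}, G.Walk v w → x v / n v = x w / n w := by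
    intro v w p
    induction p with
    | nil => rfl
    | cons h _ ih => exact (hstep _ _ h).trans ih
  refine hx (funext fun v => ?_)
  obtain ⟨p⟩ := hG.preconnected c v
  exact (div_eq_zero_iff.1 ((hwalk p).symm.trans hxc)).resolve_right (hn v).ne'

end NegDef

/-- The signature of a negative definite intersection form. -/
lemma signature_eq_neg_card
    (h : ∀ x : V → ℝ, x ≠ 0 → ∑ v, ∑ w, x v * (Γ.intersectionMatrix v w : ℝ) * x w < 0) :
    Γ.signature = -(Fintype.card V : ℤ) := by
  classical
  have hneg : ∀ x : V → ℝ, x ≠ 0 →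
      (Γ.intersectionMatrix.map (Int.cast : ℤ → ℝ)).toQuadraticForm' x < 0 := by
    intro x hx
    refine lt_of_eq_of_lt ?_ (h x hx)
    rw [Matrix.toQuadraticForm', LinearMap.BilinMap.toQuadraticMap_apply,
      Matrix.toLinearMap₂'_apply]
    refine Finset.sum_congr rfl fun v _ => Finset.sum_congr rfl fun w _ => ?_
    simp only [Matrix.map_apply, smul_eq_mul]
    ring
  have key : ∀ Q : QuadraticForm ℝ (V → ℝ), (∀ x, x ≠ 0 → Q x < 0) →
      sigPos Q = 0 ∧ sigNeg Q = Fintype.card V := by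
    intro Q hQ
    constructor
    · obtain ⟨W, hW, hp⟩ := exists_finrank_eq_sigPos_and_posDef Q
      rw [← hW]
      have : W = ⊥ := by
        rw [Submodule.eq_bot_iff]
        intro x hx
        by_contra h0
        have h1 := hp ⟨x, hx⟩ fun h => h0 (congrArg Subtype.val h)
        exact (hQ x h0).not_gt h1
      rw [this, finrank_bot]
    · refine le_antisymm ?_ ?_
      · have := sigPos_le_finrank (-Q)
        rwa [Module.finrank_fintype_fun_eq_card] at this
      · have := le_sigNeg_of_negDef Q (V := ⊤) (fun x hx => by
          have h1 := hQ x fun h => hx (Subtype.ext h)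
          exact neg_pos.2 h1)
        rwa [finrank_top, Module.finrank_fintype_fun_eq_card] at this
  obtain ⟨h1, h2⟩ := key _ hneg
  simp only [signature]
  convert congrArg₂ (fun a b : ℕ => (a : ℤ) - b) h1 h2 using 1
  simp

end PlumbingGraph

/-! ## The intersection form of the star-shaped graph -/

namespace PlumbingGraph

variable {d m : ℕ} {R : Type*}

/-- The values along an arm, with the centre in front and zeros behind. -/
def armSeq [Zero R] (y : StarVertex d (d * m + 7) → R) (j : Fin d) : ℕ → R
  | 0 => y (Sum.inl ())
  | t + 1 => if h : t < d * m + 7 then y (Sum.inr (Sum.inr (j, ⟨t, h⟩))) else 0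

lemma armSeq_succ [Zero R] (y : StarVertex d (d * m + 7) → R) (j : Fin d) (i : Fin (d * m + 7)) :
    armSeq y j (i + 1) = y (Sum.inr (Sum.inr (j, i))) := dif_pos i.2

lemma armSeq_of_le [Zero R] (y : StarVertex d (d * m + 7) → R) (j : Fin d) {t : ℕ}
    (ht : d * m + 8 ≤ t) : armSeq y j t = 0 := by
  obtain ⟨t, rfl⟩ : ∃ s, t = s + 1 := ⟨t - 1, by omega⟩
  exact dif_neg (by omega)

lemma sum_fin_ite_val_eq [AddCommMonoid R] {l : ℕ} (f : Fin l → R) (t : ℕ) :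
    (∑ i : Fin l, if (i : ℕ) = t then f i else 0) = if h : t < l then f ⟨t, h⟩ else 0 := by
  split_ifs with h
  · rw [Finset.sum_eq_single ⟨t, h⟩]
    · simp
    · intro i _ hi
      rw [if_neg fun he => hi (Fin.ext he)]
    · simp
  · refine Finset.sum_eq_zero fun i _ => if_neg ?_
    have := i.2
    omega

variable [AddCommMonoid R] (y : StarVertex d (d * m + 7) → R)

lemma nbrSum_centre : (starGraph d m).nbrSum y (Sum.inl ()) =
    y (Sum.inr (Sum.inl ())) + ∑ j, armSeq y j 1 := by
  classical
  have h : ∀ w, (starGraph d m).graph.Adj (Sum.inl ()) w ↔ ∃ α, w = endVertex α :=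
    fun w => starAdj_centre_iff
  have h2 : ∀ j i, (∃ α : Option (Fin d), (Sum.inr (Sum.inr (j, i)) : StarVertex d (d * m + 6 + 1)) =
      endVertex α) ↔ (i : ℕ) = 0 := by
    intro j i
    constructor
    · rintro ⟨_ | j', h⟩
      · cases h
      · cases h; rfl
    · intro h
      exact ⟨some j, by simp only [endVertex]; congr 3; exact Fin.ext h⟩
  simp only [nbrSum, h]
  rw [Fintype.sum_sum_type, Fintype.sum_sum_type, Fintype.sum_prod_type]
  simp only [Finset.univ_unique, Finset.sum_singleton]
  rw [if_neg, if_pos ⟨none, rfl⟩, zero_add]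
  · congr 1
    refine Finset.sum_congr rfl fun j _ => ?_
    simp only [h2]
    exact sum_fin_ite_val_eq _ 0
  · rintro ⟨α, h⟩
    exact endVertex_ne α h.symm

lemma nbrSum_b : (starGraph d m).nbrSum y (Sum.inr (Sum.inl ())) = y (Sum.inl ()) := by
  classical
  have h : ∀ w, (starGraph d m).graph.Adj (Sum.inr (Sum.inl ())) w ↔ w = Sum.inl () :=
    fun w => starAdj_b_iff
  simp only [nbrSum, h]
  rw [Finset.sum_ite_eq', if_pos (Finset.mem_univ _)]

lemma nbrSum_arm (j : Fin d) (i : Fin (d * m + 7)) :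
    (starGraph d m).nbrSum y (Sum.inr (Sum.inr (j, i))) =
      armSeq y j i + armSeq y j (i + 2) := by
  classical
  have h : ∀ w, (starGraph d m).graph.Adj (Sum.inr (Sum.inr (j, i))) w ↔ _ :=
    fun w => starAdj_arm_iff
  have hc : (starGraph d m).graph.Adj (Sum.inr (Sum.inr (j, i))) (Sum.inl ()) ↔ (i : ℕ) = 0 := by
    rw [h]; simp
  have hb : ¬(starGraph d m).graph.Adj (Sum.inr (Sum.inr (j, i))) (Sum.inr (Sum.inl ())) := by
    rw [h]; simp
  have ha : ∀ j' i', (starGraph d m).graph.Adj (Sum.inr (Sum.inr (j, i))) (Sum.inr (Sum.inr (j', i'))) ↔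
      j' = j ∧ ((i' : ℕ) + 1 = i ∨ (i' : ℕ) = i + 1) := by
    intro j' i'
    rw [h]
    constructor
    · rintro (⟨-, h⟩ | ⟨a, h, h'⟩)
      · cases h
      · cases h; exact ⟨rfl, h'.imp_right Eq.symm⟩
    · rintro ⟨rfl, h'⟩
      exact Or.inr ⟨i', rfl, h'.imp_right Eq.symm⟩
  simp only [nbrSum]
  rw [Fintype.sum_sum_type, Fintype.sum_sum_type, Fintype.sum_prod_type]
  simp only [Finset.univ_unique, Finset.sum_singleton, PUnit.default_eq_unit]
  rw [if_neg hb, zero_add, Finset.sum_eq_single j]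
  · have hsplit : ∀ i' : Fin (d * m + 7), (if (starGraph d m).graph.Adj (Sum.inr (Sum.inr (j, i)))
        (Sum.inr (Sum.inr (j, i'))) then y (Sum.inr (Sum.inr (j, i'))) else 0) =
        (if (i' : ℕ) + 1 = i then y (Sum.inr (Sum.inr (j, i'))) else 0) +
          if (i' : ℕ) = i + 1 then y (Sum.inr (Sum.inr (j, i'))) else 0 := by
      intro i'
      simp only [ha, true_and]
      by_cases h1 : (i' : ℕ) + 1 = i
      · rw [if_pos (Or.inl h1), if_pos h1, if_neg (by omega), add_zero]
      · by_cases h2 : (i' : ℕ) = i + 1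
        · rw [if_pos (Or.inr h2), if_neg h1, if_pos h2, zero_add]
        · rw [if_neg (by tauto), if_neg h1, if_neg h2, zero_add]
    simp only [hsplit]
    rw [Finset.sum_add_distrib, sum_fin_ite_val_eq, ← add_assoc]
    congr 1
    obtain ⟨_ | i, hi⟩ := i
    · rw [if_pos (hc.2 rfl), Finset.sum_eq_zero fun i' _ => if_neg (by simp), add_zero]
      rfl
    · rw [if_neg fun h => by simpa using hc.1 h, zero_add]
      simp only [Nat.add_right_cancel_iff]
      exact sum_fin_ite_val_eq _ i
  · intro j' _ hj
    exact Finset.sum_eq_zero fun i' _ => if_neg fun h => hj ((ha j' i').1 h).1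
  · simp

lemma starGraph_connected (d m : ℕ) : (starGraph d m).graph.Connected := by
  have h : ∀ v, (starGraph d m).graph.Reachable (Sum.inl ()) v := by
    rintro (⟨⟩ | ⟨⟩ | ⟨j, i, hi⟩)
    · exact SimpleGraph.Reachable.refl _
    · exact SimpleGraph.Adj.reachable (starAdj_centre_iff (l := d * m + 6).2 ⟨none, rfl⟩)
    · induction i with
      | zero => exact SimpleGraph.Adj.reachable (starAdj_centre_iff (l := d * m + 6).2 ⟨some j, rfl⟩)
      | succ i ih =>
        exact (ih (by omega)).trans (SimpleGraph.Adj.reachable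
          (starAdj_arm_iff (l := d * m + 6).2 (Or.inr ⟨_, rfl, Or.inr rfl⟩)))
  exact (SimpleGraph.connected_iff_exists_forall_reachable _).2 ⟨_, h⟩

lemma card_starVertex (d m : ℕ) :
    Fintype.card (StarVertex d (d * m + 7)) = 2 + d * (d * m + 7) := by
  simp only [Fintype.card_sum, Fintype.card_prod, Fintype.card_fin, Fintype.card_unit]
  ring

lemma starGraph_isTree (d m : ℕ) : (starGraph d m).graph.IsTree := by
  refine isTree_of_sum_nbrSum _ (starGraph_connected d m) ?_
  rw [card_starVertex, Fintype.sum_sum_type, Fintype.sum_sum_type, Fintype.sum_prod_type]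
  simp only [Finset.univ_unique, Finset.sum_singleton, PUnit.default_eq_unit]
  rw [nbrSum_centre, nbrSum_b]
  have h1 : ∀ (j : Fin d) t, t < d * m + 8 →
      armSeq (fun _ : StarVertex d (d * m + 7) => 1) j t = 1 := by
    rintro j (_ | t) ht
    · rfl
    · exact dif_pos (by omega)
  have h2 : ∀ j : Fin d, ∑ i : Fin (d * m + 7),
      (starGraph d m).nbrSum (fun _ => 1) (Sum.inr (Sum.inr (j, i))) = 2 * (d * m + 6) + 1 := by
    intro j
    simp only [nbrSum_arm]
    rw [Fin.sum_univ_castSucc, Finset.sum_congr rfl (g := fun _ => 2)]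
    · rw [h1 _ _ (by simp), armSeq_of_le _ _ (by simp)]
      simp
      ring
    · intro i _
      have := i.2
      rw [h1 _ _ (by simp only [Fin.val_castSucc]; omega),
        h1 _ _ (by simp only [Fin.val_castSucc]; omega)]
  simp only [h2]
  rw [Finset.sum_congr rfl fun j _ => h1 j 1 (by omega)]
  simp
  ring

end PlumbingGraph

namespace PlumbingGraph

variable {d m N : ℕ}

lemma weight_arm (j : Fin d) (i : Fin (d * m + 7)) :
    (starGraph d m).weight (Sum.inr (Sum.inr (j, i))) = -(armN d m i : ℤ) := by
  simp only [starGraph, armN]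
  split_ifs <;> rfl

/-! ### The intersection form modulo 2 -/

section Determinant

variable (hN : N + 1 = 10 * (d * m)) (h2 : 2 ≤ d * m)

include hN h2

/-- A solution of the recursion along an arm is determined by its last value. -/
lemma eq_armP_mul {R : Type*} [CommRing R] {Y : ℕ → R} (hY : Y (d * m + 8) = 0)
    (hrec : ∀ i < d * m + 7, Y i + Y (i + 2) = armN d m i * Y (i + 1)) (s : ℕ) :
    ∀ t, t + s = d * m + 7 → Y t = armP d m N t * Y (d * m + 7) ∧
      Y (t + 1) = armP d m N (t + 1) * Y (d * m + 7) := by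
  induction s with
  | zero =>
    intro t ht
    obtain rfl : t = d * m + 7 := ht
    have e1 : armP d m N (d * m + 7) = 1 := by unfold armP; rw [if_neg (by omega)]; omega
    have e2 : armP d m N (d * m + 7 + 1) = 0 := by unfold armP; rw [if_neg (by omega)]; omega
    rw [e1, e2, hY]
    simp
  | succ s ih =>
    intro t ht
    obtain ⟨h1, h3⟩ := ih (t + 1) (by omega)
    refine ⟨?_, h1⟩
    have h4 := hrec t (by omega)
    have h5 := congrArg (Nat.cast : ℕ → R) (armP_rec hN h2 (i := t) (by omega))
    push_cast at h5
    rw [h1, h3] at h4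
    linear_combination h4 - Y (d * m + 7) * h5

/-- A kernel vector is a multiple of `armP` along each arm. As N and N - 10 are odd, the first
vertex of the arm has the value of the centre, and so has the vertex of weight -m because m is odd.
The equation at the centre is then -d y + y + d y = 0 for its value y, so y = 0. -/
lemma eq_zero_of_mod_two (hm : Odd m) (y : StarVertex d (d * m + 7) → ZMod 2)
    (hy : ∀ v, ((starGraph d m).weight v : ZMod 2) * y v + (starGraph d m).nbrSum y v = 0) :
    y = 0 := by
  have h11 : ∀ a : ZMod 2, a + a = 0 := CharTwo.add_self_eq_zero
  have hP : ∀ j t, t ≤ d * m + 7 → armSeq y j t = armP d m N t * armSeq y j (d * m + 7) := by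
    intro j t ht
    refine (eq_armP_mul hN h2 (armSeq_of_le y j le_rfl) (fun i hi => ?_) (d * m + 7 - t) t
      (by omega)).1
    have := hy (Sum.inr (Sum.inr (j, ⟨i, hi⟩)))
    rw [nbrSum_arm, weight_arm, ← armSeq_succ y] at this
    push_cast at this
    linear_combination this
  have hNodd : ((N : ℕ) : ZMod 2) = 1 := by
    rw [ZMod.natCast_eq_one_iff_odd]
    exact ⟨5 * (d * m) - 1, by omega⟩
  have e0 : armP d m N 0 = N := by unfold armP; rw [if_pos (by omega)]; omega
  have e1 : armP d m N 1 = N - 10 := by unfold armP; rw [if_pos (by omega)]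
  have e1' : ((N - 10 : ℕ) : ZMod 2) = 1 := by
    rw [ZMod.natCast_eq_one_iff_odd]
    exact ⟨5 * (d * m) - 6, by omega⟩
  have h0 : ∀ j, armSeq y j (d * m + 7) = y (Sum.inl ()) := fun j => by
    have := hP j 0 (by omega)
    rw [e0, hNodd, one_mul] at this
    exact this.symm
  have h1 : ∀ j, armSeq y j 1 = y (Sum.inl ()) := fun j => by
    rw [hP j 1 (by omega), e1, e1', one_mul, h0]
  have hmodd : ((m : ℕ) : ZMod 2) = 1 := ZMod.natCast_eq_one_iff_odd.2 hm
  have hb : y (Sum.inr (Sum.inl ())) = y (Sum.inl ()) := by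
    have := hy (Sum.inr (Sum.inl ()))
    rw [nbrSum_b] at this
    change ((-(m : ℤ) : ℤ) : ZMod 2) * _ + _ = 0 at this
    push_cast at this
    rw [hmodd] at this
    linear_combination -this
  have hc : y (Sum.inl ()) = 0 := by
    have := hy (Sum.inl ())
    rw [nbrSum_centre, hb, Finset.sum_congr rfl fun j _ => h1 j] at this
    change ((-(d : ℤ) : ℤ) : ZMod 2) * _ + _ = 0 at this
    simp only [Finset.sum_const, Finset.card_univ, Fintype.card_fin, nsmul_eq_mul] at this
    push_cast at this
    linear_combination this
  funext v
  rcases v with ⟨⟩ | ⟨⟩ | ⟨j, i⟩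
  · exact hc
  · exact hb.trans hc
  · rw [← armSeq_succ y, hP j _ (by have := i.2; omega), h0, hc, mul_zero]
    rfl

end Determinant

/-! ### Signature -/

/-- The multiplicities of the exceptional curves. -/
def multiplicity (d m N : ℕ) : StarVertex d (d * m + 7) → ℝ
  | Sum.inl _ => m * N
  | Sum.inr (Sum.inl _) => N
  | Sum.inr (Sum.inr (_, i)) => m * armP d m N (i + 1)

/-- The vector `multiplicity` consists of the orders of vanishing of x₀ along the exceptional
curves. The rest of the divisor of x₀ is one regular orbit, which meets the centre once; accordingly
the form sends the vector to -1 at the centre and to 0 elsewhere. At the centre this is N + 1 =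
10dm, along the arms the recursion for `armP`. -/
lemma starGraph_signature (hN : N + 1 = 10 * (d * m)) (h2 : 2 ≤ d * m) :
    (starGraph d m).signature = -(2 + d * (d * m + 7)) := by
  classical
  have hm : 0 < m := by rcases Nat.eq_zero_or_pos m with rfl | h <;> omega
  have hN0 : 0 < N := by omega
  have hseq : ∀ (j : Fin d) t, t ≤ d * m + 8 →
      armSeq (multiplicity d m N) j t = m * armP d m N t := by
    rintro j (_ | t) ht
    · have e0 : armP d m N 0 = N := by unfold armP; rw [if_pos (by omega)]; omega
      rw [e0]; rfl
    · rcases Nat.lt_or_ge t (d * m + 7) with h | h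
      · exact dif_pos h
      · obtain rfl : t = d * m + 7 := by omega
        have e : armP d m N (d * m + 7 + 1) = 0 := by unfold armP; rw [if_neg (by omega)]; omega
        rw [e, armSeq_of_le _ _ le_rfl]; simp
  have hc : ∑ w, ((starGraph d m).intersectionMatrix (Sum.inl ()) w : ℝ) * multiplicity d m N w =
      -1 := by
    have e1 : armP d m N 1 = N - 10 := by unfold armP; rw [if_pos (by omega)]
    rw [sum_intersectionMatrix_mul, nbrSum_centre,
      Finset.sum_congr rfl fun j _ => hseq j 1 (by omega), e1, Nat.cast_sub (by omega)]
    change ((-(d : ℤ) : ℤ) : ℝ) * (m * N) + (N + _) = -1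
    have h := congrArg (Nat.cast : ℕ → ℝ) hN
    push_cast at h
    simp only [Finset.sum_const, Finset.card_univ, Fintype.card_fin, nsmul_eq_mul]
    push_cast
    linear_combination h
  have hb : ∑ w, ((starGraph d m).intersectionMatrix (Sum.inr (Sum.inl ())) w : ℝ) *
      multiplicity d m N w = 0 := by
    rw [sum_intersectionMatrix_mul, nbrSum_b]
    change ((-(m : ℤ) : ℤ) : ℝ) * N + m * N = 0
    push_cast
    ring
  have ha : ∀ j i, ∑ w, ((starGraph d m).intersectionMatrix (Sum.inr (Sum.inr (j, i))) w : ℝ) *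
      multiplicity d m N w = 0 := by
    intro j i
    have hi : (i : ℕ) < d * m + 7 := i.2
    rw [sum_intersectionMatrix_mul, nbrSum_arm, weight_arm, hseq j _ (by omega),
      hseq j _ (by omega)]
    have h := congrArg (Nat.cast : ℕ → ℝ) (armP_rec hN h2 (i := i) (by omega))
    push_cast at h
    simp only [multiplicity]
    push_cast
    linear_combination (m : ℝ) * h
  rw [signature_eq_neg_card, card_starVertex]
  · push_cast; ring
  intro x hx
  refine sum_neg_of_ground_state (n := multiplicity d m N) (c := Sum.inl ())
    (fun v w => by rw [intersectionMatrix_comm]) ?_ ?_ (starGraph_connected d m) ?_ ?_ ?_ hx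
  · rintro (_ | _ | ⟨j, i⟩)
    · exact mul_pos (Nat.cast_pos.2 hm) (Nat.cast_pos.2 hN0)
    · exact Nat.cast_pos.2 hN0
    · refine mul_pos (Nat.cast_pos.2 hm) (Nat.cast_pos.2 ?_)
      have := i.2
      unfold armP
      split_ifs <;> omega
  · intro v w h
    simp only [intersectionMatrix, if_neg h]
    split_ifs <;> simp
  · intro v w h
    simp [intersectionMatrix, h, h.ne]
  · rintro (⟨⟩ | ⟨⟩ | ⟨j, i⟩)
    · rw [hc]; norm_num
    · exact hb.le
    · exact (ha j i).le
  · rw [hc]; norm_num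

/-! ### The spherical Wu class -/

/-- The spherical Wu class of the star-shaped graph. -/
def starWu (d m : ℕ) : StarVertex d (d * m + 7) → ℤ
  | Sum.inl _ => 1
  | Sum.inr (Sum.inl _) => 0
  | Sum.inr (Sum.inr (_, i)) => if Odd (i : ℕ) ∧ (i : ℕ) < d * m - 2 then 1 else 0

/-! ### The Wu class and its square -/

section Wu

variable (hd : Even d) (h2 : 2 ≤ d * m)

include hd h2

/-- Counted from the centre at position 0, the class occupies the even positions below dm. The -3 is
at position dm - 1, which is odd because d is even. -/
lemma armSeq_starWu (j : Fin d) (t : ℕ) :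
    armSeq (starWu d m) j t = if Even t ∧ t < d * m then 1 else 0 := by
  obtain ⟨e, he⟩ : Even (d * m) := hd.mul_right m
  rcases t with _ | t
  · rw [if_pos ⟨Even.zero, by omega⟩]; rfl
  · simp only [armSeq, starWu]
    have : (Odd t ∧ t < d * m - 2) ↔ (Even (t + 1) ∧ t + 1 < d * m) := by
      rw [Nat.even_add_one, Nat.not_even_iff_odd]
      refine and_congr_right fun ⟨s, hs⟩ => ?_
      omega
    simp only [this]
    split_ifs <;> omega

lemma starWu_centre : (starGraph d m).weight (Sum.inl ()) * starWu d m (Sum.inl ()) +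
    (starGraph d m).nbrSum (starWu d m) (Sum.inl ()) = -(d : ℤ) := by
  rw [nbrSum_centre, Finset.sum_eq_zero fun j _ => by rw [armSeq_starWu hd h2]; simp]
  change -(d : ℤ) * 1 + (0 + 0) = _
  ring

/-- The -3 vertex is outside the class, and of its neighbours only the inner one is inside (the
centre itself if dm = 2), which gives the odd value 1. Before it the values are 2 outside the class
and -2 inside; behind it the class is empty. -/
lemma starWu_arm (j : Fin d) (i : Fin (d * m + 7)) :
    (starGraph d m).weight (Sum.inr (Sum.inr (j, i))) * starWu d m (Sum.inr (Sum.inr (j, i))) +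
      (starGraph d m).nbrSum (starWu d m) (Sum.inr (Sum.inr (j, i))) =
    if (i : ℕ) = d * m - 2 then 1 else if (i : ℕ) < d * m - 2 then (if Even (i : ℕ) then 2 else -2)
      else 0 := by
  obtain ⟨e, he⟩ : Even (d * m) := hd.mul_right m
  rw [nbrSum_arm, weight_arm, ← armSeq_succ (starWu d m), armSeq_starWu hd h2, armSeq_starWu hd h2,
    armSeq_starWu hd h2, armN]
  generalize (i : ℕ) = i
  rcases Nat.even_or_odd' i with ⟨s, rfl | rfl⟩
  · have e1 : Even (2 * s) := even_two_mul s
    have e2 : ¬Even (2 * s + 1) := by simp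
    have e3 : Even (2 * s + 2) := by simp [parity_simps]
    simp only [e1, e2, e3, true_and, false_and, if_true, if_false]
    split_ifs <;> omega
  · have e1 : ¬Even (2 * s + 1) := by simp
    have e2 : Even (2 * s + 1 + 1) := by simp [parity_simps]
    have e3 : ¬Even (2 * s + 1 + 2) := by simp [parity_simps]
    simp only [e1, e2, e3, true_and, false_and, if_false]
    split_ifs <;> omega

lemma isSphericalWuClass_starWu (hm : Odd m) :
    (starGraph d m).IsSphericalWuClass (starWu d m) := by
  classical
  refine ⟨?_, fun v => ?_⟩
  · rintro (_ | _ | ⟨j, i⟩)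
    · exact Or.inr rfl
    · exact Or.inl rfl
    · simp only [starWu]
      split_ifs <;> simp
  rw [inter_single]
  rcases v with ⟨⟩ | ⟨⟩ | ⟨j, i⟩
  · rw [starWu_centre hd h2]
    exact Int.ModEq.refl _
  · rw [nbrSum_b]
    change -(m : ℤ) * 0 + 1 ≡ -(m : ℤ) [ZMOD 2]
    obtain ⟨s, rfl⟩ := hm
    rw [Int.modEq_iff_dvd]
    exact ⟨-(s : ℤ) - 1, by push_cast; ring⟩
  · rw [starWu_arm hd h2, weight_arm, armN]
    split_ifs <;> decide

/-- Only vertices in the class count: the centre contributes -d, and each arm has (dm - 2) / 2 of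
them, each contributing -2. In total this is -d - d(dm - 2). -/
lemma inter_starWu_self : (starGraph d m).inter (starWu d m) (starWu d m) = d - d ^ 2 * m := by
  rw [inter_eq, Fintype.sum_sum_type, Fintype.sum_sum_type, Fintype.sum_prod_type]
  simp only [Finset.univ_unique, Finset.sum_singleton, PUnit.default_eq_unit]
  rw [starWu_centre hd h2]
  have harm : ∀ j : Fin d, ∑ i : Fin (d * m + 7), starWu d m (Sum.inr (Sum.inr (j, i))) *
      ((starGraph d m).weight (Sum.inr (Sum.inr (j, i))) * starWu d m (Sum.inr (Sum.inr (j, i))) +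
        (starGraph d m).nbrSum (starWu d m) (Sum.inr (Sum.inr (j, i)))) = -(d * m - 2 : ℤ) := by
    intro j
    obtain ⟨e, he⟩ : Even (d * m) := hd.mul_right m
    have hterm : ∀ i : Fin (d * m + 7), starWu d m (Sum.inr (Sum.inr (j, i))) *
        ((starGraph d m).weight (Sum.inr (Sum.inr (j, i))) * starWu d m (Sum.inr (Sum.inr (j, i))) +
          (starGraph d m).nbrSum (starWu d m) (Sum.inr (Sum.inr (j, i)))) =
        (fun i : ℕ => if Odd i ∧ i < d * m - 2 then (-2 : ℤ) else 0) i := by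
      intro i
      rw [starWu_arm hd h2, starWu]
      by_cases h : Odd (i : ℕ) ∧ (i : ℕ) < d * m - 2
      · rw [if_pos h, if_neg h.2.ne, if_pos h.2, if_neg (Nat.not_even_iff_odd.2 h.1), one_mul]
        exact (if_pos h).symm
      · rw [if_neg h, zero_mul]
        exact (if_neg h).symm
    simp only [hterm]
    rw [Fin.sum_univ_eq_sum_range (fun i : ℕ => if Odd i ∧ i < d * m - 2 then (-2 : ℤ) else 0)]
    have hsum : ∀ n, ∑ i ∈ Finset.range n, (if Odd i ∧ i < d * m - 2 then (-2 : ℤ) else 0) =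
        -2 * ((min n (d * m - 2) / 2 : ℕ) : ℤ) := by
      intro n
      induction n with
      | zero => simp
      | succ n ih =>
        rw [Finset.sum_range_succ, ih]
        by_cases h : Odd n ∧ n < d * m - 2
        · rw [if_pos h]
          obtain ⟨⟨s, rfl⟩, h⟩ := h
          omega
        · rw [if_neg h]
          rcases Nat.even_or_odd' n with ⟨s, rfl | rfl⟩
          · omega
          · have : ¬(2 * s + 1 < d * m - 2) := fun h' => h ⟨⟨s, rfl⟩, h'⟩
            omega
    rw [hsum]
    have : ((d * m : ℕ) : ℤ) = d * m := by push_cast; rfl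
    omega
  simp only [harm]
  simp only [starWu, Finset.sum_const, Finset.card_univ, Fintype.card_fin, nsmul_eq_mul]
  ring

end Wu

end PlumbingGraph

end

/-! ### The main theorem -/

theorem mainTheorem11 (k m : ℕ) (hk : 0 < k) (hm : Odd m) :
    IsNeumannSiebenmannInvariant ![2 ^ k, 2 ^ k * m, 2 ^ k * (10 * m) - 1]
      (-(2 ^ k) - 1 / 4) ∧
    (brieskornGraph k m).graph.IsTree ∧
    (brieskornGraph k m).HasOddDet ∧
    (brieskornGraph k m).BoundaryIsBrieskorn ![2 ^ k, 2 ^ k * m, 2 ^ k * (10 * m) - 1] ∧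
    ∃ w, (brieskornGraph k m).IsSphericalWuClass w ∧
      (∀ w', (brieskornGraph k m).IsSphericalWuClass w' → w' = w) ∧
      (brieskornGraph k m).signature = -(2 + 2 ^ k * (2 ^ k * m + 7)) ∧
      (brieskornGraph k m).inter w w = 2 ^ k - 2 ^ (2 * k) * m ∧
      (brieskornGraph k m).muBar w = -(2 ^ k) - 1 / 4 := by
  have hd : Even (2 ^ k) := (Nat.even_pow.2 ⟨even_two, hk.ne'⟩)
  have h2 : 2 ≤ 2 ^ k * m :=
    (le_self_pow₀ one_le_two hk.ne').trans (Nat.le_mul_of_pos_right _ hm.pos)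
  have hN : (10 * (2 ^ k * m) - 1) + 1 = 10 * (2 ^ k * m) := by omega
  have hb := boundaryIsBrieskorn_brieskornGraph hk hm.pos
  rw [brieskornGraph_eq] at hb ⊢
  have ht := PlumbingGraph.starGraph_isTree (2 ^ k) m
  have hinj := PlumbingGraph.eq_zero_of_mod_two hN h2 hm
  have hdet := PlumbingGraph.hasOddDet_of_forall _ hinj
  have hw := PlumbingGraph.isSphericalWuClass_starWu hd h2 hm
  have hsig := PlumbingGraph.starGraph_signature hN h2
  have hww := PlumbingGraph.inter_starWu_self hd h2
  push_cast at hsig hww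
  -- With d = 2^k the terms d²m cancel: -(2 + d²m + 7d) - d + d²m = -2 - 8d.
  have hmu : (starGraph (2 ^ k) m).muBar (PlumbingGraph.starWu (2 ^ k) m) =
      -(2 ^ k) - 1 / 4 := by
    rw [PlumbingGraph.muBar, hsig, hww]
    push_cast
    ring
  refine ⟨⟨_, _, _, ht, hdet, hb, _, hw, hmu.symm⟩, ht, hdet, hb, _, hw,
    fun w' hw' => hw.unique hinj hw', hsig, ?_, hmu⟩
  rw [hww, ← pow_mul, mul_comm k 2]
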